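/- Let $k$ be a field and let $H=(H,\Delta,\varepsilon,\Phi,S,\alpha,\beta)$ be a quasi-Hopf algebra over $k$: $H$ is an associative unital $k$-algebra, $\Delta:H\to H\otimes H$ and $\varepsilon:H\to k$ are algebra maps, $\Phi\in H^{\otimes 3}$ is invertible, $S$ is a (bijective) anti-automorphism of the algebra $H$, $\alpha,\beta\in H$, and, writing $\Delta(h)=h_1\otimes h_2$, $\Phi=X^1\otimes X^2\otimes X^3=Y^1\otimes Y^2\otimes Y^3$, $\Phi^{-1}=x^1\otimes x^2\otimes x^3$ (summation understood), $$(id\otimes\Delta)\Delta(h)=\Phi\,(\Delta\otimes id)\Delta(h)\,\Phi^{-1},\qquad (id\otimes\varepsilon)\Delta(h)=h=(\varepsilon\otimes id)\Delta(h),$$ $$(1\otimes\Phi)(id\otimes\Delta\otimes id)(\Phi)(\Phi\otimes1)=(id\otimes id\otimes\Delta)(\Phi)(\Delta\otimes id\otimes id)(\Phi),\qquad (id\otimes\varepsilon\otimes id)(\Phi)=1\otimes1,$$ $$S(h_1)\alpha h_2=\varepsilon(h)\alpha,\quad h_1\beta S(h_2)=\varepsilon(h)\beta,\quad X^1\beta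 S(X^2)\alpha X^3=1,\quad S(x^1)\alpha x^2\beta S(x^3)=1 .$$ Put $A=(\Phi\otimes1)(\Delta\otimes id\otimes id)(\Phi^{-1})$, $B=(\Delta\otimes id\otimes id)(\Phi)(\Phi^{-1}\otimes1)$, $\gamma=S(A^2)\alpha A^3\otimes S(A^1)\alpha A^4$, $\delta=B^1\beta S(B^4)\otimes B^2\beta S(B^3)$, $\Delta^{\rm op}(h)=h_2\otimes h_1$ and $$f=f^1\otimes f^2=(S\otimes S)(\Delta^{\rm op}(x^1))\,\gamma\,\Delta(x^2\beta S(x^3)),\qquad g=g^1\otimes g^2=\Delta(S(x^1)\alpha x^2)\,\delta\,(S\otimes S)(\Delta^{\rm op}(x^3)).$$ A left Yetter-Drinfeld module over $H$ is a left $H$-module $M$ with a $k$-linear map $\lambda_M:M\to H\otimes M$, $\lambda_M(m)=m_{(-1)}\otimes m_{(0)}$, such that for all $h\in H$, $m\in M$: $\varepsilon(m_{(-1)})m_{(0)}=m$, $\;h_1m_{(-1)}\otimes h_2\cdot m_{(0)}=(h_1\cdot m)_{(-1)}h_2\otimes(h_1\cdot m)_{(0)}$, and $$X^1m_{(-1)}\otimes(X^2\cdot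 m_{(0)})_{(-1)}X^3\otimes(X^2\cdot m_{(0)})_{(0)}=X^1\big((Y^1\cdot m)_{(-1)}\big)_1Y^2\otimes X^2\big((Y^1\cdot m)_{(-1)}\big)_2Y^3\otimes X^3\cdot(Y^1\cdot m)_{(0)}.$$ Let ${}_H^H\mathcal{YD}^{\rm fd}$ be the category of finite-dimensional left Yetter-Drinfeld modules and $H$-linear, $H$-colinear maps. **Theorem.** $g$ is the two-sided inverse of $f$ in $H\otimes H$, and ${}_H^H\mathcal{YD}^{\rm fd}$ is a rigid braided monoidal category, as follows. (i) The tensor product is $M\otimes_kN$ with $h\cdot(m\otimes n)=h_1\cdot m\otimes h_2\cdot n$ and coaction $$\lambda(m\otimes n)=X^1(x^1Y^1\cdot m)_{(-1)}x^2(Y^2\cdot n)_{(-1)}Y^3\otimes X^2\cdot(x^1Y^1\cdot m)_{(0)}\otimes X^3x^3\cdot(Y^2\cdot n)_{(0)};$$ on morphisms it is the tensor product of linear maps. The unit is $k$ with $h\cdot t=\varepsilon(h)t$, $\lambda(t)=1\otimes t$. The associativity constraint is $(u\otimes v)\otimes w\mapsto X^1\cdot u\otimes(X^2\cdot v\otimes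 X^3\cdot w)$, and the unit constraints are the usual ones. The braiding is $c_{M,N}(m\otimes n)=m_{(-1)}\cdot n\otimes m_{(0)}$. (ii) Every object $M$ has a left and a right dual. For any basis $({}_im)_{i=1}^n$ of $M$ with dual basis $({}^im)_{i=1}^n$, a left dual $M^*$ and a right dual ${}^*M$ of $M$ are given by ${\rm Hom}(M,k)$ as a vector space, with the following structures. - $M^*$: $(h\cdot m^*)(m)=m^*(S(h)\cdot m)$ and $$\lambda_{M^*}(m^*)=\sum_i\langle m^*,f^2\cdot(g^1\cdot{}_im)_{(0)}\rangle\,S^{-1}\big(f^1(g^1\cdot{}_im)_{(-1)}g^2\big)\otimes{}^im,$$ with evaluation $M^*\otimes M\to k$, $m^*\otimes m\mapsto m^*(\alpha\cdot m)$, and coevaluation $k\to M\otimes M^*$, $1\mapsto\sum_i\beta\cdot{}_im\otimes{}^im$. - ${}^*M$: $(h\cdot{}^*m)(m)={}^*m(S^{-1}(h)\cdot m)$ and $$\lambda_{{}^*M}({}^*m)=\sum_i\langle{}^*m,S^{-1}(f^1)\cdot(S^{-1}(g^2)\cdot{}_im)_{(0)}\rangle\,g^1S\big((S^{-1}(g^2)\cdot{}_im)_{(-1)}\big)f^2\otimes{}^im,$$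 with evaluation $M\otimes{}^*M\to k$, $m\otimes{}^*m\mapsto{}^*m(S^{-1}(\alpha)\cdot m)$, and coevaluation $k\to{}^*M\otimes M$, $1\mapsto\sum_i{}^im\otimes S^{-1}(\beta)\cdot{}_im$. -/

import Mathlib

open CategoryTheory
open scoped TensorProduct

universe u v

noncomputable section

namespace QuasiHopf

/-! ### Multilinear bookkeeping -/

section Bookkeeping

variable (k : Type u) [Field k]

/-- For representations `ρ` of `A` on `U` and `σ` of `B` on `V`, the action of `A ⊗ B` on
`U ⊗ V`: `(a ⊗ b) · (u ⊗ v) = a · u ⊗ b · v`. -/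
def act2 {k : Type u} [Field k] {A B U V : Type*} [Ring A] [Algebra k A] [Ring B] [Algebra k B]
    [AddCommGroup U] [Module k U] [AddCommGroup V] [Module k V]
    (ρ : A →ₐ[k] Module.End k U) (σ : B →ₐ[k] Module.End k V) :
    A ⊗[k] B →ₐ[k] Module.End k (U ⊗[k] V) :=
  (Module.endTensorEndAlgHom (R := k) (S := k) (A := k)).comp (Algebra.TensorProduct.map ρ σ)

/-- The action of `A ⊗ (B ⊗ C)` on `U ⊗ (V ⊗ W)`:
`(a ⊗ (b ⊗ c)) · (u ⊗ (v ⊗ w)) = a · u ⊗ (b · v ⊗ c · w)`. -/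
def act3 {k : Type u} [Field k] {A B C U V W : Type*} [Ring A] [Algebra k A] [Ring B] [Algebra k B]
    [Ring C] [Algebra k C]
    [AddCommGroup U] [Module k U] [AddCommGroup V] [Module k V] [AddCommGroup W] [Module k W]
    (ρ : A →ₐ[k] Module.End k U) (σ : B →ₐ[k] Module.End k V) (τ : C →ₐ[k] Module.End k W) :
    A ⊗[k] (B ⊗[k] C) →ₐ[k] Module.End k (U ⊗[k] (V ⊗[k] W)) :=
  act2 ρ (act2 σ τ)

/-- An invertible element of an algebra acts by a linear automorphism. -/
def unitAct {k : Type u} [Field k] {A U : Type*} [Ring A] [Algebra k A]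
    [AddCommGroup U] [Module k U] (ρ : A →ₐ[k] Module.End k U) (a : Aˣ) : U ≃ₗ[k] U :=
  LinearMap.GeneralLinearGroup.toLinearEquiv (Units.map (ρ : A →* Module.End k U) a)

variable (H : Type v) [Ring H] [Algebra k H]

/-- The left regular representation of `H`. -/
abbrev reg : H →ₐ[k] Module.End k H := Algebra.lmul k H

variable {k H}

/-- `Δ ⊗ id ⊗ id`. -/
def comulFst (Δ : H →ₐ[k] H ⊗[k] H) :
    H ⊗[k] (H ⊗[k] H) →ₐ[k] H ⊗[k] (H ⊗[k] (H ⊗[k] H)) :=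
  (Algebra.TensorProduct.assoc k k k H H (H ⊗[k] H)).toAlgHom.comp
    (Algebra.TensorProduct.map Δ (AlgHom.id k (H ⊗[k] H)))

/-- `id ⊗ Δ ⊗ id`. -/
def comulSnd (Δ : H →ₐ[k] H ⊗[k] H) :
    H ⊗[k] (H ⊗[k] H) →ₐ[k] H ⊗[k] (H ⊗[k] (H ⊗[k] H)) :=
  Algebra.TensorProduct.map (AlgHom.id k H)
    ((Algebra.TensorProduct.assoc k k k H H H).toAlgHom.comp
      (Algebra.TensorProduct.map Δ (AlgHom.id k H)))

/-- `id ⊗ id ⊗ Δ`. -/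
def comulThd (Δ : H →ₐ[k] H ⊗[k] H) :
    H ⊗[k] (H ⊗[k] H) →ₐ[k] H ⊗[k] (H ⊗[k] (H ⊗[k] H)) :=
  Algebra.TensorProduct.map (AlgHom.id k H) (Algebra.TensorProduct.map (AlgHom.id k H) Δ)

variable (k H)

/-- `x ↦ 1 ⊗ x`. -/
def oneTensor : H ⊗[k] (H ⊗[k] H) →ₐ[k] H ⊗[k] (H ⊗[k] (H ⊗[k] H)) :=
  Algebra.TensorProduct.includeRight

/-- `x ↦ x ⊗ 1`. -/
def tensorOne : H ⊗[k] (H ⊗[k] H) →ₐ[k] H ⊗[k] (H ⊗[k] (H ⊗[k] H)) :=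
  Algebra.TensorProduct.map (AlgHom.id k H)
    (Algebra.TensorProduct.map (AlgHom.id k H) Algebra.TensorProduct.includeLeft)

variable {k H}

/-- `a ⊗ b ↦ S(a) c b`. -/
def mulLeftS (S : H →ₗ[k] H) (c : H) : H ⊗[k] H →ₗ[k] H :=
  LinearMap.mul' k H ∘ₗ TensorProduct.map (LinearMap.mulRight k c ∘ₗ S) LinearMap.id

/-- `a ⊗ b ↦ a c S(b)`. -/
def mulRightS (S : H →ₗ[k] H) (c : H) : H ⊗[k] H →ₗ[k] H :=
  LinearMap.mul' k H ∘ₗ TensorProduct.map (LinearMap.mulRight k c) S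

end Bookkeeping

/-! ### Quasi-bialgebras and quasi-Hopf algebras -/

/-- A quasi-bialgebra `(H, Δ, ε, Φ)` over a field `k`. -/
class QuasiBialgebra (k : Type u) (H : Type v) [Field k] [Ring H] [Algebra k H] where
  /-- the comultiplication `Δ` -/
  comul : H →ₐ[k] H ⊗[k] H
  /-- the counit `ε` -/
  counit : H →ₐ[k] k
  /-- the reassociator `Φ`, an invertible element of `H ⊗ H ⊗ H` -/
  Phi : (H ⊗[k] (H ⊗[k] H))ˣ
  /-- `(id ⊗ Δ)(Δ(h)) = Φ (Δ ⊗ id)(Δ(h)) Φ⁻¹` -/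
  quasi_coassoc : ∀ h : H,
    Algebra.TensorProduct.map (AlgHom.id k H) comul (comul h) =
      (Phi : H ⊗[k] (H ⊗[k] H)) *
        Algebra.TensorProduct.assoc k k k H H H
          (Algebra.TensorProduct.map comul (AlgHom.id k H) (comul h)) *
        ((Phi⁻¹ : (H ⊗[k] (H ⊗[k] H))ˣ) : H ⊗[k] (H ⊗[k] H))
  /-- `(id ⊗ ε)(Δ(h)) = h` -/
  comul_counit : ∀ h : H,
    Algebra.TensorProduct.rid k k H
      (Algebra.TensorProduct.map (AlgHom.id k H) counit (comul h)) = h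
  /-- `(ε ⊗ id)(Δ(h)) = h` -/
  counit_comul : ∀ h : H,
    Algebra.TensorProduct.lid k H
      (Algebra.TensorProduct.map counit (AlgHom.id k H) (comul h)) = h
  /-- `(1 ⊗ Φ)(id ⊗ Δ ⊗ id)(Φ)(Φ ⊗ 1) = (id ⊗ id ⊗ Δ)(Φ)(Δ ⊗ id ⊗ id)(Φ)` -/
  cocycle :
    oneTensor k H Phi * comulSnd comul Phi * tensorOne k H Phi =
      comulThd comul Phi * comulFst comul Phi
  /-- `(id ⊗ ε ⊗ id)(Φ) = 1 ⊗ 1` -/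
  normalized :
    Algebra.TensorProduct.map (AlgHom.id k H)
      ((Algebra.TensorProduct.lid k H).toAlgHom.comp
        (Algebra.TensorProduct.map counit (AlgHom.id k H)))
      (Phi : H ⊗[k] (H ⊗[k] H)) = 1

/-- A quasi-Hopf algebra `(H, Δ, ε, Φ, S, α, β)`, with bijective antipode. -/
class QuasiHopfAlgebra (k : Type u) (H : Type v) [Field k] [Ring H] [Algebra k H]
    extends QuasiBialgebra k H where
  /-- the antipode `S`, an anti-automorphism of the algebra `H` -/
  S : H ≃ₗ[k] H
  S_one : S 1 = 1
  S_mul : ∀ a b : H, S (a * b) = S b * S a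
  alpha : H
  beta : H
  /-- `S(h₁) α h₂ = ε(h) α` -/
  S_alpha : ∀ h : H, mulLeftS S.toLinearMap alpha (comul h) = counit h • alpha
  /-- `h₁ β S(h₂) = ε(h) β` -/
  beta_S : ∀ h : H, mulRightS S.toLinearMap beta (comul h) = counit h • beta
  /-- `X¹ β S(X²) α X³ = 1` for `Φ = X¹ ⊗ X² ⊗ X³` -/
  Phi_S :
    LinearMap.mul' k H (TensorProduct.map (LinearMap.mulRight k beta)
      (mulLeftS S.toLinearMap alpha) (Phi : H ⊗[k] (H ⊗[k] H))) = 1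
  /-- `S(x¹) α x² β S(x³) = 1` for `Φ⁻¹ = x¹ ⊗ x² ⊗ x³` -/
  PhiInv_S :
    LinearMap.mul' k H (TensorProduct.map (LinearMap.mulRight k alpha ∘ₗ S.toLinearMap)
      (mulRightS S.toLinearMap beta)
        ((Phi⁻¹ : (H ⊗[k] (H ⊗[k] H))ˣ) : H ⊗[k] (H ⊗[k] H))) = 1

section Twist

variable (k : Type u) (H : Type v) [Field k] [Ring H] [Algebra k H]

/-- The comultiplication `Δ`. -/
abbrev Dl [QuasiBialgebra k H] : H →ₐ[k] H ⊗[k] H := QuasiBialgebra.comul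

/-- The counit `ε`. -/
abbrev eps [QuasiBialgebra k H] : H →ₐ[k] k := QuasiBialgebra.counit

/-- The reassociator `Φ`. -/
abbrev Ph [QuasiBialgebra k H] : (H ⊗[k] (H ⊗[k] H))ˣ := QuasiBialgebra.Phi

variable [QuasiHopfAlgebra k H]

/-- The antipode `S`. -/
abbrev An : H →ₗ[k] H := (QuasiHopfAlgebra.S (k := k) (H := H)).toLinearMap

/-- The inverse antipode `S⁻¹`. -/
abbrev AnInv : H →ₗ[k] H := (QuasiHopfAlgebra.S (k := k) (H := H)).symm.toLinearMap

/-- `α`. -/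
abbrev al : H := QuasiHopfAlgebra.alpha k

/-- `β`. -/
abbrev be : H := QuasiHopfAlgebra.beta k

theorem AnInv_one : AnInv k H 1 = 1 :=
  (LinearEquiv.symm_apply_eq _).2 (QuasiHopfAlgebra.S_one (k := k)).symm

theorem AnInv_mul (a b : H) : AnInv k H (a * b) = AnInv k H b * AnInv k H a := by
  refine (LinearEquiv.symm_apply_eq _).2 ?_
  rw [QuasiHopfAlgebra.S_mul]
  simp [AnInv]

/-- `h ↦ (S ⊗ S)(Δᵒᵖ(h)) = S(h₂) ⊗ S(h₁)`. -/
def SSop : H →ₗ[k] H ⊗[k] H :=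
  TensorProduct.map (An k H) (An k H) ∘ₗ (TensorProduct.comm k H H).toLinearMap ∘ₗ
    (Dl k H).toLinearMap

/-- `A = (Φ ⊗ 1)(Δ ⊗ id ⊗ id)(Φ⁻¹)`. -/
def elA : H ⊗[k] (H ⊗[k] (H ⊗[k] H)) :=
  tensorOne k H (Ph k H : H ⊗[k] (H ⊗[k] H)) *
    comulFst (Dl k H) (((Ph k H)⁻¹ : (H ⊗[k] (H ⊗[k] H))ˣ) : H ⊗[k] (H ⊗[k] H))

/-- `B = (Δ ⊗ id ⊗ id)(Φ)(Φ⁻¹ ⊗ 1)`. -/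
def elB : H ⊗[k] (H ⊗[k] (H ⊗[k] H)) :=
  comulFst (Dl k H) (Ph k H : H ⊗[k] (H ⊗[k] H)) *
    tensorOne k H (((Ph k H)⁻¹ : (H ⊗[k] (H ⊗[k] H))ˣ) : H ⊗[k] (H ⊗[k] H))

/-- `a ⊗ b ⊗ c ⊗ d ↦ (b ⊗ c) ⊗ (a ⊗ d)`. -/
def regroup : H ⊗[k] (H ⊗[k] (H ⊗[k] H)) →ₗ[k] (H ⊗[k] H) ⊗[k] (H ⊗[k] H) :=
  (TensorProduct.leftComm k H (H ⊗[k] H) H).toLinearMap ∘ₗ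
    TensorProduct.map LinearMap.id (TensorProduct.assoc k H H H).symm.toLinearMap

/-- `a ⊗ b ⊗ c ⊗ d ↦ (a ⊗ d) ⊗ (b ⊗ c)`. -/
def regroup' : H ⊗[k] (H ⊗[k] (H ⊗[k] H)) →ₗ[k] (H ⊗[k] H) ⊗[k] (H ⊗[k] H) :=
  (TensorProduct.comm k (H ⊗[k] H) (H ⊗[k] H)).toLinearMap ∘ₗ regroup k H

/-- `γ = S(A²) α A³ ⊗ S(A¹) α A⁴`. -/
def gam : H ⊗[k] H :=
  TensorProduct.map (mulLeftS (An k H) (al k H)) (mulLeftS (An k H) (al k H))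
    (regroup k H (elA k H))

/-- `δ = B¹ β S(B⁴) ⊗ B² β S(B³)`. -/
def del : H ⊗[k] H :=
  TensorProduct.map (mulRightS (An k H) (be k H)) (mulRightS (An k H) (be k H))
    (regroup' k H (elB k H))

/-- The Drinfeld twist `f = (S ⊗ S)(Δᵒᵖ(x¹)) γ Δ(x² β S(x³))`, where `Φ⁻¹ = x¹ ⊗ x² ⊗ x³`. -/
def drinfeldTwist : H ⊗[k] H :=
  LinearMap.mul' k (H ⊗[k] H)
    (TensorProduct.map (LinearMap.mulRight k (gam k H) ∘ₗ SSop k H)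
      ((Dl k H).toLinearMap ∘ₗ mulRightS (An k H) (be k H))
      (((Ph k H)⁻¹ : (H ⊗[k] (H ⊗[k] H))ˣ) : H ⊗[k] (H ⊗[k] H)))

/-- The element `Δ(S(x¹) α x²) δ (S ⊗ S)(Δᵒᵖ(x³))`, where `Φ⁻¹ = x¹ ⊗ x² ⊗ x³`;
this is `f⁻¹`. -/
def drinfeldTwistInv : H ⊗[k] H :=
  LinearMap.mul' k (H ⊗[k] H)
    (TensorProduct.map
      (LinearMap.mulRight k (del k H) ∘ₗ (Dl k H).toLinearMap ∘ₗ mulLeftS (An k H) (al k H))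
      (SSop k H)
      ((TensorProduct.assoc k H H H).symm
        (((Ph k H)⁻¹ : (H ⊗[k] (H ⊗[k] H))ˣ) : H ⊗[k] (H ⊗[k] H))))

end Twist

/-! ### Yetter-Drinfeld modules -/

section YD

variable (k : Type u) (H : Type v) [Field k] [Ring H] [Algebra k H]

/-- The data underlying a left Yetter-Drinfeld module: a left `H`-module (a `k`-space with an
algebra homomorphism to its endomorphisms) and a linear map `λ : M → H ⊗ M`. -/
structure YDDatum where
  carrier : Type u
  [addCommGroup : AddCommGroup carrier]
  [module : Module k carrier]
  act : H →ₐ[k] Module.End k carrier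
  coact : carrier →ₗ[k] H ⊗[k] carrier

attribute [instance] YDDatum.addCommGroup YDDatum.module

variable {k H}

/-- For `c(m) = m₍₋₁₎ ⊗ m₍₀₎ ∈ A ⊗ M`, the map
`a ⊗ b ↦ (m ↦ (a · m)₍₋₁₎ b ⊗ (a · m)₍₀₎)`. -/
def coactTwist {A M : Type*} [Ring A] [Algebra k A] [AddCommGroup M] [Module k M]
    (ρ : H →ₐ[k] Module.End k M) (c : M →ₗ[k] A ⊗[k] M) :
    H ⊗[k] A →ₗ[k] (M →ₗ[k] A ⊗[k] M) :=
  TensorProduct.lift (LinearMap.mk₂ k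
    (fun a b => (LinearMap.mulRight k b).rTensor M ∘ₗ c ∘ₗ ρ a)
    (by intro a a' b; ext m; simp)
    (by intro t a b; ext m; simp)
    (by
      intro a b b'
      have h : LinearMap.mulRight k (b + b') = LinearMap.mulRight k b + LinearMap.mulRight k b' := by
        ext x; simp [mul_add]
      ext m; simp [h, LinearMap.rTensor_add])
    (by
      intro t a b
      have h : LinearMap.mulRight k (t • b) = t • LinearMap.mulRight k b := by
        ext x; simp
      ext m; simp [h, LinearMap.rTensor_smul]))

/-- `m ⊗ v ↦ m₍₋₁₎ · v ⊗ m₍₀₎`. -/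
def braidLin {M V : Type*} [AddCommGroup M] [Module k M] [AddCommGroup V] [Module k V]
    (c : M →ₗ[k] H ⊗[k] M) (σ : H →ₐ[k] Module.End k V) : M ⊗[k] V →ₗ[k] V ⊗[k] M :=
  TensorProduct.lift (LinearMap.mk₂ k
    (fun m v => (σ.toLinearMap.flip v).rTensor M (c m))
    (by intro m m' v; simp)
    (by intro t m v; simp)
    (by intro m v v'; simp [LinearMap.rTensor_add])
    (by intro t m v; simp [LinearMap.rTensor_smul]))

namespace YDDatum

/-- The axioms of a left Yetter-Drinfeld module over a quasi-bialgebra. -/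
structure IsYD [QuasiBialgebra k H] (M : YDDatum k H) : Prop where
  /-- `X¹ m₍₋₁₎ ⊗ (X² · m₍₀₎)₍₋₁₎ X³ ⊗ (X² · m₍₀₎)₍₀₎
    = X¹ (Y¹ · m)₍₋₁₎₁ Y² ⊗ X² (Y¹ · m)₍₋₁₎₂ Y³ ⊗ X³ · (Y¹ · m)₍₀₎` -/
  coassoc : ∀ m : M.carrier,
    TensorProduct.homTensorHomMap (RingHom.id k) H M.carrier H (H ⊗[k] M.carrier)
      (TensorProduct.map (reg k H).toLinearMap (coactTwist M.act M.coact)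
        (Ph k H : H ⊗[k] (H ⊗[k] H))) (M.coact m) =
    act3 (reg k H) (reg k H) M.act (Ph k H : H ⊗[k] (H ⊗[k] H))
      (TensorProduct.assoc k H H M.carrier
        (coactTwist M.act ((Dl k H).toLinearMap.rTensor M.carrier ∘ₗ M.coact)
          (Ph k H : H ⊗[k] (H ⊗[k] H)) m))
  /-- `ε(m₍₋₁₎) m₍₀₎ = m` -/
  counit : ∀ m : M.carrier,
    TensorProduct.lid k M.carrier ((eps k H).toLinearMap.rTensor M.carrier (M.coact m)) = m
  /-- `h₁ m₍₋₁₎ ⊗ h₂ · m₍₀₎ = (h₁ · m)₍₋₁₎ h₂ ⊗ (h₁ · m)₍₀₎` -/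
  compat : ∀ (h : H) (m : M.carrier),
    act2 (reg k H) M.act (Dl k H h) (M.coact m) = coactTwist M.act M.coact (Dl k H h) m

/-- `H`-linear and `H`-colinear maps. -/
structure IsYDHom (M N : YDDatum k H) (f : M.carrier →ₗ[k] N.carrier) : Prop where
  map_act : ∀ (h : H) (m : M.carrier), f (M.act h m) = N.act h (f m)
  map_coact : ∀ m : M.carrier, N.coact (f m) = f.lTensor H (M.coact m)

theorem IsYDHom.id (M : YDDatum k H) : IsYDHom M M LinearMap.id :=
  ⟨fun _ _ => rfl, fun m => by simp⟩

theorem IsYDHom.comp {M N P : YDDatum k H} {f : M.carrier →ₗ[k] N.carrier}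
    {g : N.carrier →ₗ[k] P.carrier} (hg : IsYDHom N P g) (hf : IsYDHom M N f) :
    IsYDHom M P (g ∘ₗ f) :=
  ⟨fun h m => by simp [hf.map_act, hg.map_act],
    fun m => by simp [hf.map_coact, hg.map_coact, LinearMap.lTensor_comp]⟩

theorem IsYDHom.symm {M N : YDDatum k H} (e : M.carrier ≃ₗ[k] N.carrier)
    (he : IsYDHom M N e.toLinearMap) : IsYDHom N M e.symm.toLinearMap :=
  ⟨fun h n => by
    obtain ⟨m, rfl⟩ := e.surjective n
    have := he.map_act h m
    simp only [LinearEquiv.coe_coe] at this ⊢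
    rw [← this]; simp,
   fun n => by
    obtain ⟨m, rfl⟩ := e.surjective n
    have := he.map_coact m
    simp only [LinearEquiv.coe_coe] at this ⊢
    rw [this, ← LinearMap.comp_apply, ← LinearMap.lTensor_comp]
    simp⟩

/-- The action of `H` on `M ⊗ N`: `h · (m ⊗ n) = h₁ · m ⊗ h₂ · n`. -/
def tensorAct [QuasiBialgebra k H] (M N : YDDatum k H) :
    H →ₐ[k] Module.End k (M.carrier ⊗[k] N.carrier) :=
  (act2 M.act N.act).comp (Dl k H)

/-- The coaction of `H` on `M ⊗ N`: `m ⊗ n` is sent to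
`X¹ (x¹ Y¹ · m)₍₋₁₎ x² (Y² · n)₍₋₁₎ Y³ ⊗ X² · (x¹ Y¹ · m)₍₀₎ ⊗ X³ x³ · (Y² · n)₍₀₎`.
It is the composite of
`m ⊗ n ↦ Y¹ · m ⊗ (Y² · n)₍₋₁₎ Y³ ⊗ (Y² · n)₍₀₎`, the action of `Φ⁻¹` on `M ⊗ (H ⊗ N)`,
`m ⊗ h ⊗ n ↦ m₍₋₁₎ h ⊗ m₍₀₎ ⊗ n`, and the action of `Φ` on `H ⊗ (M ⊗ N)`. -/
def tensorCoact [QuasiBialgebra k H] (M N : YDDatum k H) :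
    M.carrier ⊗[k] N.carrier →ₗ[k] H ⊗[k] (M.carrier ⊗[k] N.carrier) :=
  act3 (reg k H) M.act N.act (Ph k H : H ⊗[k] (H ⊗[k] H)) ∘ₗ
    (TensorProduct.assoc k H M.carrier N.carrier).toLinearMap ∘ₗ
    (braidLin M.coact (reg k H)).rTensor N.carrier ∘ₗ
    (TensorProduct.assoc k M.carrier H N.carrier).symm.toLinearMap ∘ₗ
    act3 M.act (reg k H) N.act
      (((Ph k H)⁻¹ : (H ⊗[k] (H ⊗[k] H))ˣ) : H ⊗[k] (H ⊗[k] H)) ∘ₗ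
    TensorProduct.homTensorHomMap (RingHom.id k) M.carrier N.carrier M.carrier
        (H ⊗[k] N.carrier)
      (TensorProduct.map M.act.toLinearMap (coactTwist N.act N.coact)
        (Ph k H : H ⊗[k] (H ⊗[k] H)))

/-- The tensor product of two Yetter-Drinfeld modules. -/
def tensor [QuasiBialgebra k H] (M N : YDDatum k H) : YDDatum k H where
  carrier := M.carrier ⊗[k] N.carrier
  act := tensorAct M N
  coact := tensorCoact M N

variable (k H) in
/-- The unit object: `k` with `h · t = ε(h) t` and coaction `t ↦ 1 ⊗ t`. -/
def unit [QuasiBialgebra k H] : YDDatum k H where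
  carrier := k
  act := (Algebra.lmul k k).comp (eps k H)
  coact := TensorProduct.mk k H k 1

/-- The associativity constraint `(u ⊗ v) ⊗ w ↦ X¹ · u ⊗ (X² · v ⊗ X³ · w)`. -/
def associator [QuasiBialgebra k H] (U V W : YDDatum k H) :
    ((U.tensor V).tensor W).carrier ≃ₗ[k] (U.tensor (V.tensor W)).carrier :=
  (TensorProduct.assoc k U.carrier V.carrier W.carrier).trans
    (unitAct (act3 U.act V.act W.act) (Ph k H))

/-- The left unit constraint `t ⊗ m ↦ t m`. -/
def leftUnitor [QuasiBialgebra k H] (M : YDDatum k H) :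
    ((unit k H).tensor M).carrier ≃ₗ[k] M.carrier :=
  TensorProduct.lid k M.carrier

/-- The right unit constraint `m ⊗ t ↦ t m`. -/
def rightUnitor [QuasiBialgebra k H] (M : YDDatum k H) :
    (M.tensor (unit k H)).carrier ≃ₗ[k] M.carrier :=
  TensorProduct.rid k M.carrier

end YDDatum

/-- The contragredient action along an anti-endomorphism `σ` of `H`:
`(h · φ)(m) = φ(σ(h) · m)`. -/
def dualAct {M : Type*} [AddCommGroup M] [Module k M] (ρ : H →ₐ[k] Module.End k M)
    (σ : H →ₗ[k] H) (h1 : σ 1 = 1) (hmul : ∀ a b, σ (a * b) = σ b * σ a) :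
    H →ₐ[k] Module.End k (Module.Dual k M) :=
  AlgHom.ofLinearMap
    ((Module.Dual.transpose (R := k) (M := M) (M' := M)) ∘ₗ ρ.toLinearMap ∘ₗ σ)
    (by ext φ m; simp [h1, Module.Dual.transpose_apply])
    (by intro a b; ext φ m; simp [hmul, Module.Dual.transpose_apply])

/-- `(id ⊗ φ) : H ⊗ M → H`, `h ⊗ m ↦ φ(m) h`. -/
def contract {M : Type*} [AddCommGroup M] [Module k M] (φ : Module.Dual k M) :
    H ⊗[k] M →ₗ[k] H :=
  (TensorProduct.rid k H).toLinearMap ∘ₗ φ.lTensor H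

/-- For `ψ(m) = m' ⊗ m'' ∈ H ⊗ M`, the linear map
`M^* → H ⊗ M^*`, `φ ↦ Σᵢ ⟨φ, (mᵢ)''⟩ (mᵢ)' ⊗ mⁱ`, with `(mᵢ)` a basis of `M` and `(mⁱ)`
its dual basis. -/
def dualize {M : Type*} [AddCommGroup M] [Module k M] {n : ℕ} (b : Module.Basis (Fin n) k M)
    (ψ : M →ₗ[k] H ⊗[k] M) : Module.Dual k M →ₗ[k] H ⊗[k] Module.Dual k M where
  toFun φ := ∑ i, contract φ (ψ (b i)) ⊗ₜ[k] b.coord i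
  map_add' φ φ' := by
    simp [contract, LinearMap.lTensor_add, TensorProduct.add_tmul, Finset.sum_add_distrib]
  map_smul' t φ := by
    simp [contract, LinearMap.lTensor_smul, TensorProduct.smul_tmul', Finset.smul_sum]

namespace YDDatum

variable [QuasiHopfAlgebra k H]

/-- `m ↦ S⁻¹(f¹ (g¹ · m)₍₋₁₎ g²) ⊗ f² · (g¹ · m)₍₀₎`. -/
def leftDualMap (M : YDDatum k H) : M.carrier →ₗ[k] H ⊗[k] M.carrier :=
  (AnInv k H).rTensor M.carrier ∘ₗ
    act2 (reg k H) M.act (drinfeldTwist k H) ∘ₗ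
    coactTwist M.act M.coact (drinfeldTwistInv k H)

/-- `M^*`, as `Hom(M, k)` with `(h · φ)(m) = φ(S(h) · m)` and
`φ ↦ Σᵢ ⟨φ, f² · (g¹ · mᵢ)₍₀₎⟩ S⁻¹(f¹ (g¹ · mᵢ)₍₋₁₎ g²) ⊗ mⁱ`. -/
def leftDual (M : YDDatum k H) {n : ℕ} (b : Module.Basis (Fin n) k M.carrier) :
    YDDatum k H where
  carrier := Module.Dual k M.carrier
  act := dualAct M.act (An k H) QuasiHopfAlgebra.S_one QuasiHopfAlgebra.S_mul
  coact := dualize b M.leftDualMap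

/-- `a ⊗ b ↦ (m ↦ a S((S⁻¹(b) · m)₍₋₁₎) ⊗ (S⁻¹(b) · m)₍₀₎)`. -/
def rightDualMapAux (M : YDDatum k H) :
    H ⊗[k] H →ₗ[k] (M.carrier →ₗ[k] H ⊗[k] M.carrier) :=
  TensorProduct.lift (LinearMap.mk₂ k
    (fun a b => (LinearMap.mulLeft k a ∘ₗ An k H).rTensor M.carrier ∘ₗ M.coact ∘ₗ
      M.act (AnInv k H b))
    (by
      intro a a' b
      have h : LinearMap.mulLeft k (a + a') ∘ₗ An k H =
          LinearMap.mulLeft k a ∘ₗ An k H + LinearMap.mulLeft k a' ∘ₗ An k H := by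
        ext x; simp [add_mul]
      ext m; simp only [h, LinearMap.rTensor_add]; simp)
    (by
      intro t a b
      have h : LinearMap.mulLeft k (t • a) ∘ₗ An k H =
          t • (LinearMap.mulLeft k a ∘ₗ An k H) := by
        ext x; simp
      ext m; simp only [h, LinearMap.rTensor_smul]; simp)
    (by intro a b b'; ext m; simp)
    (by intro t a b; ext m; simp))

/-- `m ↦ g¹ S((S⁻¹(g²) · m)₍₋₁₎) f² ⊗ S⁻¹(f¹) · (S⁻¹(g²) · m)₍₀₎`. -/
def rightDualMap (M : YDDatum k H) : M.carrier →ₗ[k] H ⊗[k] M.carrier :=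
  TensorProduct.homTensorHomMap (RingHom.id k) H M.carrier H M.carrier
      (TensorProduct.map (LinearMap.mul k H).flip (M.act.toLinearMap ∘ₗ AnInv k H)
        (TensorProduct.comm k H H (drinfeldTwist k H))) ∘ₗ
    M.rightDualMapAux (drinfeldTwistInv k H)

/-- `^*M`, as `Hom(M, k)` with `(h · φ)(m) = φ(S⁻¹(h) · m)` and
`φ ↦ Σᵢ ⟨φ, S⁻¹(f¹) · (S⁻¹(g²) · mᵢ)₍₀₎⟩ g¹ S((S⁻¹(g²) · mᵢ)₍₋₁₎) f² ⊗ mⁱ`. -/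
def rightDual (M : YDDatum k H) {n : ℕ} (b : Module.Basis (Fin n) k M.carrier) :
    YDDatum k H where
  carrier := Module.Dual k M.carrier
  act := dualAct M.act (AnInv k H) (AnInv_one k H) (AnInv_mul k H)
  coact := dualize b M.rightDualMap

end YDDatum

variable (k H)

/-- A finite dimensional left Yetter-Drinfeld module. -/
structure FdYD [QuasiBialgebra k H] where
  datum : YDDatum k H
  [finite : Module.Finite k datum.carrier]
  isYD : datum.IsYD

attribute [instance] FdYD.finite

variable {k H}

/-- A morphism of Yetter-Drinfeld modules. -/
@[ext]
structure YDHom (M N : YDDatum k H) where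
  toLin : M.carrier →ₗ[k] N.carrier
  isYDHom : YDDatum.IsYDHom M N toLin

section Category

variable [QuasiBialgebra k H]

/-- The category of finite dimensional left Yetter-Drinfeld modules. -/
instance : Category (FdYD k H) where
  Hom M N := YDHom M.datum N.datum
  id M := ⟨LinearMap.id, .id _⟩
  comp f g := ⟨g.toLin ∘ₗ f.toLin, g.isYDHom.comp f.isYDHom⟩

/-- An isomorphism of Yetter-Drinfeld modules from a linear equivalence. -/
def isoMk {M N : FdYD k H} (e : M.datum.carrier ≃ₗ[k] N.datum.carrier)
    (he : YDDatum.IsYDHom M.datum N.datum e.toLinearMap) : M ≅ N where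
  hom := ⟨e.toLinearMap, he⟩
  inv := ⟨e.symm.toLinearMap, YDDatum.IsYDHom.symm e he⟩
  hom_inv_id := YDHom.ext (LinearMap.ext fun x => e.symm_apply_apply x)
  inv_hom_id := YDHom.ext (LinearMap.ext fun x => e.apply_symm_apply x)

variable (k H) in
/-- The tensor product, the unit, and the constraints stay within finite dimensional
Yetter-Drinfeld modules and their morphisms. -/
structure TensorWellDefined : Prop where
  tensor : ∀ M N : FdYD k H, (M.datum.tensor N.datum).IsYD
  unit : (YDDatum.unit k H).IsYD
  tensorHom : ∀ {M M' N N' : FdYD k H} (f : M ⟶ M') (g : N ⟶ N'),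
    YDDatum.IsYDHom (M.datum.tensor N.datum) (M'.datum.tensor N'.datum)
      (TensorProduct.map f.toLin g.toLin)
  associator : ∀ U V W : FdYD k H,
    YDDatum.IsYDHom ((U.datum.tensor V.datum).tensor W.datum)
      (U.datum.tensor (V.datum.tensor W.datum))
      (YDDatum.associator U.datum V.datum W.datum).toLinearMap
  leftUnitor : ∀ M : FdYD k H,
    YDDatum.IsYDHom ((YDDatum.unit k H).tensor M.datum) M.datum M.datum.leftUnitor.toLinearMap
  rightUnitor : ∀ M : FdYD k H,
    YDDatum.IsYDHom (M.datum.tensor (YDDatum.unit k H)) M.datum M.datum.rightUnitor.toLinearMap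

instance (M N : FdYD k H) : Module.Finite k (M.datum.tensor N.datum).carrier :=
  inferInstanceAs (Module.Finite k (M.datum.carrier ⊗[k] N.datum.carrier))

instance : Module.Finite k (YDDatum.unit k H).carrier :=
  inferInstanceAs (Module.Finite k k)

/-- The tensor product, unit object and constraints of the category of finite dimensional left
Yetter-Drinfeld modules. -/
@[reducible]
def fdYDTensor (hw : TensorWellDefined k H) : MonoidalCategoryStruct (FdYD k H) where
  tensorObj M N := ⟨M.datum.tensor N.datum, hw.tensor M N⟩
  whiskerLeft M _ _ g := ⟨TensorProduct.map LinearMap.id g.toLin, hw.tensorHom (𝟙 M) g⟩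
  whiskerRight f N := ⟨TensorProduct.map f.toLin LinearMap.id, hw.tensorHom f (𝟙 N)⟩
  tensorHom f g := ⟨TensorProduct.map f.toLin g.toLin, hw.tensorHom f g⟩
  tensorUnit := ⟨YDDatum.unit k H, hw.unit⟩
  associator U V W := isoMk _ (hw.associator U V W)
  leftUnitor M := isoMk _ (hw.leftUnitor M)
  rightUnitor M := isoMk _ (hw.rightUnitor M)

end Category

/-- The given tensor product, unit object and constraints satisfy the axioms of a monoidal
category. -/
def IsMonoidal {C : Type*} [Category C] (T : MonoidalCategoryStruct C) : Prop :=
  ∃ M : MonoidalCategory C, M.toMonoidalCategoryStruct = T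

/-- The monoidal category with the given tensor product, unit object and constraints. -/
@[reducible]
def IsMonoidal.monoidalCategory {C : Type*} [Category C] {T : MonoidalCategoryStruct C}
    (h : IsMonoidal T) : MonoidalCategory C where
  toMonoidalCategoryStruct := T
  tensorHom_def := by obtain ⟨M, rfl⟩ := h; exact M.tensorHom_def
  id_tensorHom_id := by obtain ⟨M, rfl⟩ := h; exact M.id_tensorHom_id
  tensorHom_comp_tensorHom := by obtain ⟨M, rfl⟩ := h; exact M.tensorHom_comp_tensorHom
  whiskerLeft_id := by obtain ⟨M, rfl⟩ := h; exact M.whiskerLeft_id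
  id_whiskerRight := by obtain ⟨M, rfl⟩ := h; exact M.id_whiskerRight
  associator_naturality := by obtain ⟨M, rfl⟩ := h; exact M.associator_naturality
  leftUnitor_naturality := by obtain ⟨M, rfl⟩ := h; exact M.leftUnitor_naturality
  rightUnitor_naturality := by obtain ⟨M, rfl⟩ := h; exact M.rightUnitor_naturality
  pentagon := by obtain ⟨M, rfl⟩ := h; exact M.pentagon
  triangle := by obtain ⟨M, rfl⟩ := h; exact M.triangle

variable [QuasiHopfAlgebra k H]

instance (M : FdYD k H) {n : ℕ} (b : Module.Basis (Fin n) k M.datum.carrier) :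
    Module.Finite k (M.datum.leftDual b).carrier :=
  inferInstanceAs (Module.Finite k (Module.Dual k M.datum.carrier))

instance (M : FdYD k H) {n : ℕ} (b : Module.Basis (Fin n) k M.datum.carrier) :
    Module.Finite k (M.datum.rightDual b).carrier :=
  inferInstanceAs (Module.Finite k (Module.Dual k M.datum.carrier))

end YD

end QuasiHopf

end

/-!
An algebra map `a : H → A` is called a string of `A`. Strings `a`, `b` with commuting images have a
product `a ⋆ b`, given by `h ↦ a(h₁) b(h₂)`, and three commuting strings carry the invertible element
`ph a b c = a(X¹) b(X²) c(X³)` of `A`. In these terms coassociativity says that `ph a b c` intertwines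
`(a ⋆ b) ⋆ c` with `a ⋆ (b ⋆ c)`, and the cocycle condition becomes `pentagon`. All identities below
are proved for words in such letters in an arbitrary algebra, and are then specialized to iterated
tensor products of `H` and of endomorphism algebras. The axioms for `S`, `α`, `β` enter only through
linear maps such as `a ⊗ b ↦ S(a) α b`, which absorb a string: `Ψ(s(h) T) = ε(h) Ψ(T)` (`AbsL`,
`AbsR`). An absorbed string may be erased from any reassociator in which it occurs, provided that
the letters outside commute with it.

*The Drinfeld twist.* Both `(S ⊗ S) ∘ Δᵒᵖ` with `γ`, `δ` and `Δ ∘ S` with `Δ(α)`, `Δ(β)` are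
antipodes along `Δ : H → H ⊗ H` (`isAntipode_SSop`, `isAntipode_comul`). Two antipodes along the same
map differ by an explicit invertible element, whose inverse is obtained by exchanging their roles
(`IsAntipode.cmp_mul_cmp`). For these two antipodes the element and its inverse are `f` and `g`. Hence
`f` intertwines `Δ ∘ S` with `(S ⊗ S) ∘ Δᵒᵖ` and satisfies `f Δ(α) = γ` and `Δ(β) f⁻¹ = δ`. It is
compatible with `Φ` in the sense of `tw_assoc`, since two ways of nesting three lines `S(x) α y` differ
by reassociators (`twist_assoc_word`).

*Modules as elements.* A coaction on a finite-dimensional module `M` is an element `R` of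
`H ⊗ End M`, and the Yetter-Drinfeld axioms become a commutation rule, a normalization and a hexagon
for `R` (`IsYDElem`, `YDDatum.isYD_iff`). The tensor product is again a Yetter-Drinfeld module, the
associativity constraint is colinear, and the braiding is colinear, because of identities between
words in `R`, `R'` and reassociators (`tensorWord_hex`, `assoc_word`, `braid_word`). The braiding is
injective because `R` has a left inverse when there is an antipode (`IsYDElem.exists_left_inverse`),
and hence bijective by dimension.

*Duals.* The opposite algebra of `End M` acts on the dual space, so the coaction of the left dual is
an element of `H ⊗ (End M)ᵐᵒᵖ`: `S⁻¹` of `R` conjugated by the Drinfeld twist. By `tw_assoc` its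
hexagon is equivalent to that of `R` (`isYDElem_dual_iff`). Evaluation and coevaluation are colinear
because they absorb the words of the coactions on `M^* ⊗ M` and `M ⊗ M^*` (`evalOp_tensorWord`,
`coevalOp_tensorWord`). The right dual is the inverse construction (`dualElem_rightDualElem`), so `M`
is the left dual of `^*M`, and both dualities are instances of `IsDualPair`. The triangle identities of
`IsDualPair.exactPairing` are then `X¹ β S(X²) α X³ = 1` and `S(x¹) α x² β S(x³) = 1`.
-/

noncomputable section

namespace QuasiHopf

-- With the default priorities, the search for ring structures on tensor powers starts with commutative
-- and idempotent semirings.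
attribute [local instance 1100] Ring.toSemiring Algebra.TensorProduct.instSemiring

/-! ### Commuting strings -/

section Placement

variable {k : Type u} [Field k]
variable {X Y Z W A B : Type*} [Semiring X] [Algebra k X] [Semiring Y] [Algebra k Y] [Semiring Z] [Algebra k Z]
  [Semiring W] [Algebra k W] [Semiring A] [Algebra k A] [Semiring B] [Algebra k B]

/-- Two algebra maps into `A` with elementwise commuting images. -/
class Comm (a : X →ₐ[k] A) (b : Y →ₐ[k] A) : Prop where
  comm : ∀ x y, Commute (a x) (b y)

instance (priority := 100) Comm.symm (a : X →ₐ[k] A) (b : Y →ₐ[k] A) [h : Comm a b] : Comm b a :=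
  ⟨fun x y => (h.comm y x).symm⟩

/-- `x ↦ x ⊗ 1`. -/
abbrev iL : X →ₐ[k] X ⊗[k] Y := Algebra.TensorProduct.includeLeft

/-- `y ↦ 1 ⊗ y`. -/
abbrev iR : Y →ₐ[k] X ⊗[k] Y := Algebra.TensorProduct.includeRight

instance : Comm (iL : X →ₐ[k] X ⊗[k] Y) (iR : Y →ₐ[k] X ⊗[k] Y) :=
  ⟨fun x y => by simp [Commute, SemiconjBy]⟩

instance (a : X →ₐ[k] A) (b : Y →ₐ[k] A) (c : Z →ₐ[k] X) [h : Comm a b] : Comm (a.comp c) b :=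
  ⟨fun x y => h.comm (c x) y⟩

instance (a : X →ₐ[k] A) (b : Y →ₐ[k] A) (c : Z →ₐ[k] Y) [h : Comm a b] : Comm a (b.comp c) :=
  ⟨fun x y => h.comm x (c y)⟩

instance (F : A →ₐ[k] B) (a : X →ₐ[k] A) (b : Y →ₐ[k] A) [h : Comm a b] :
    Comm (F.comp a) (F.comp b) :=
  ⟨fun x y => (h.comm x y).map F⟩

/-- The algebra map `x ⊗ y ↦ a(x) b(y)` for commuting `a` and `b`. -/
def pl (a : X →ₐ[k] A) (b : Y →ₐ[k] A) [h : Comm a b] : X ⊗[k] Y →ₐ[k] A :=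
  Algebra.TensorProduct.lift a b h.comm

@[simp] theorem pl_tmul (a : X →ₐ[k] A) (b : Y →ₐ[k] A) [Comm a b] (x : X) (y : Y) :
    pl a b (x ⊗ₜ y) = a x * b y := by
  simp [pl]

instance (a : X →ₐ[k] A) (b : Y →ₐ[k] A) (c : Z →ₐ[k] A) [Comm a b] [h1 : Comm a c]
    [h2 : Comm b c] : Comm (pl a b) c :=
  ⟨fun x z => by
    induction x using TensorProduct.induction_on with
    | zero => simp
    | tmul x y => simpa using (h1.comm x z).mul_left (h2.comm y z)
    | add x y hx hy => simpa using hx.add_left hy⟩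

instance (a : X →ₐ[k] A) (b : Y →ₐ[k] A) (c : Z →ₐ[k] A) [Comm a b] [h1 : Comm c a]
    [h2 : Comm c b] : Comm c (pl a b) :=
  ⟨fun x z => by
    induction z using TensorProduct.induction_on with
    | zero => simp
    | tmul y z => simpa using (h1.comm x y).mul_right (h2.comm x z)
    | add x y hx hy => simpa using hx.add_right hy⟩

theorem comp_pl (F : A →ₐ[k] B) (a : X →ₐ[k] A) (b : Y →ₐ[k] A) [Comm a b] :
    F.comp (pl a b) = pl (F.comp a) (F.comp b) := by
  ext <;> simp

@[simp] theorem map_pl (F : A →ₐ[k] B) (a : X →ₐ[k] A) (b : Y →ₐ[k] A) [Comm a b] (t : X ⊗[k] Y) :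
    F (pl a b t) = pl (F.comp a) (F.comp b) t := by
  rw [← comp_pl]; rfl

@[simp] theorem pl_comp_iL (a : X →ₐ[k] A) (b : Y →ₐ[k] A) [Comm a b] : (pl a b).comp iL = a := by
  ext; simp

@[simp] theorem pl_comp_iR (a : X →ₐ[k] A) (b : Y →ₐ[k] A) [Comm a b] : (pl a b).comp iR = b := by
  ext; simp

@[simp] theorem pl_comp_iL_comp (a : X →ₐ[k] A) (b : Y →ₐ[k] A) [Comm a b] (c : Z →ₐ[k] X) :
    (pl a b).comp (iL.comp c) = a.comp c := by
  rw [← AlgHom.comp_assoc, pl_comp_iL]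

@[simp] theorem pl_comp_iR_comp (a : X →ₐ[k] A) (b : Y →ₐ[k] A) [Comm a b] (c : Z →ₐ[k] Y) :
    (pl a b).comp (iR.comp c) = b.comp c := by
  rw [← AlgHom.comp_assoc, pl_comp_iR]

theorem pl_map (a : X →ₐ[k] A) (b : Y →ₐ[k] A) [Comm a b] (c : Z →ₐ[k] X) (d : W →ₐ[k] Y)
    (t : Z ⊗[k] W) :
    pl a b (Algebra.TensorProduct.map c d t) = pl (a.comp c) (b.comp d) t := by
  induction t using TensorProduct.induction_on with
  | zero => simp
  | tmul x y => simp
  | add x y hx hy => simp [hx, hy]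

theorem pl_iL_iR (t : X ⊗[k] Y) : pl (iL : X →ₐ[k] X ⊗[k] Y) iR t = t := by
  induction t using TensorProduct.induction_on with
  | zero => simp
  | tmul x y => simp
  | add x y hx hy => simp [hx, hy]

theorem pl_comm (a : X →ₐ[k] A) (b : Y →ₐ[k] A) [h : Comm a b] (t : X ⊗[k] Y) :
    pl b a (TensorProduct.comm k X Y t) = pl a b t := by
  induction t using TensorProduct.induction_on with
  | zero => simp
  | tmul x y => simpa using (h.comm x y).symm.eq
  | add x y hx hy => simp [hx, hy]

theorem pl_assoc (a : X →ₐ[k] A) (b : Y →ₐ[k] A) (c : Z →ₐ[k] A) [h : Comm a b] [Comm a c]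
    [Comm b c] (t : (X ⊗[k] Y) ⊗[k] Z) :
    pl a (pl b c) (Algebra.TensorProduct.assoc k k k X Y Z t) = pl (pl a b) c t := by
  have : (pl a (pl b c)).comp (Algebra.TensorProduct.assoc k k k X Y Z).toAlgHom =
      pl (pl a b) c := by
    ext
    · simp
    · simp
    · simp [Algebra.TensorProduct.one_def]
  exact DFunLike.congr_fun this t

end Placement

section Strings

variable {k : Type u} {H : Type v} [Field k] [Ring H] [Algebra k H] [QuasiBialgebra k H]
variable {X Y A B : Type*} [Semiring X] [Algebra k X] [Semiring Y] [Algebra k Y]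
  [Semiring A] [Algebra k A] [Semiring B] [Algebra k B]

/-- The tensor product of two commuting strings: `h ↦ a(h₁) b(h₂)`. -/
def pr (a b : H →ₐ[k] A) [Comm a b] : H →ₐ[k] A := (pl a b).comp (Dl k H)

infixl:75 " ⋆ " => pr

theorem pr_apply (a b : H →ₐ[k] A) [Comm a b] (h : H) : (a ⋆ b) h = pl a b (Dl k H h) := rfl

instance (a b : H →ₐ[k] A) (c : X →ₐ[k] A) [Comm a b] [Comm a c] [Comm b c] : Comm (a ⋆ b) c :=
  inferInstanceAs (Comm ((pl a b).comp (Dl k H)) c)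

instance (a b : H →ₐ[k] A) (c : X →ₐ[k] A) [Comm a b] [Comm c a] [Comm c b] : Comm c (a ⋆ b) :=
  inferInstanceAs (Comm c ((pl a b).comp (Dl k H)))

@[simp] theorem comp_pr (F : A →ₐ[k] B) (a b : H →ₐ[k] A) [Comm a b] :
    F.comp (a ⋆ b) = F.comp a ⋆ F.comp b := by
  rw [pr, ← AlgHom.comp_assoc, comp_pl, pr]

/-- The reassociator `Φ` placed on the strings `a`, `b`, `c`. -/
def ph (a b c : H →ₐ[k] A) [Comm a b] [Comm a c] [Comm b c] : Aˣ :=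
  Units.map ((pl a (pl b c) : H ⊗[k] (H ⊗[k] H) →ₐ[k] A) : H ⊗[k] (H ⊗[k] H) →* A) (Ph k H)

theorem ph_val (a b c : H →ₐ[k] A) [Comm a b] [Comm a c] [Comm b c] :
    (ph a b c : A) = pl a (pl b c) (Ph k H : H ⊗[k] (H ⊗[k] H)) := rfl

theorem ph_inv_val (a b c : H →ₐ[k] A) [Comm a b] [Comm a c] [Comm b c] :
    ((ph a b c)⁻¹ : Aˣ) =
      pl a (pl b c) (((Ph k H)⁻¹ : (H ⊗[k] (H ⊗[k] H))ˣ) : H ⊗[k] (H ⊗[k] H)) := rfl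

theorem map_ph (F : A →ₐ[k] B) (a b c : H →ₐ[k] A) [Comm a b] [Comm a c] [Comm b c] :
    Units.map (F : A →* B) (ph a b c) = ph (F.comp a) (F.comp b) (F.comp c) := by
  ext
  simp [ph_val, comp_pl]

@[simp] theorem map_ph_val (F : A →ₐ[k] B) (a b c : H →ₐ[k] A) [Comm a b] [Comm a c] [Comm b c] :
    F (ph a b c : A) = ph (F.comp a) (F.comp b) (F.comp c) := by
  rw [← map_ph]; rfl

@[simp] theorem map_ph_inv_val (F : A →ₐ[k] B) (a b c : H →ₐ[k] A) [Comm a b] [Comm a c]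
    [Comm b c] : F (((ph a b c)⁻¹ : Aˣ) : A) = ((ph (F.comp a) (F.comp b) (F.comp c))⁻¹ : Bˣ) := by
  rw [← map_ph]; rfl

section Pentagon

variable (a b c d : H →ₐ[k] A) [Comm a b] [Comm a c] [Comm a d] [Comm b c] [Comm b d] [Comm c d]
variable (t : H ⊗[k] (H ⊗[k] H))

theorem pl_oneTensor : pl a (pl b (pl c d)) (oneTensor k H t) = pl b (pl c d) t := by
  simp [oneTensor]

theorem pl_tensorOne : pl a (pl b (pl c d)) (tensorOne k H t) = pl a (pl b c) t := by
  have : (pl a (pl b (pl c d))).comp (tensorOne k H) = pl a (pl b c) := by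
    ext <;> simp [tensorOne]
  exact DFunLike.congr_fun this t

theorem pl_comulFst : pl a (pl b (pl c d)) (comulFst (Dl k H) t) = pl (a ⋆ b) (pl c d) t := by
  have := pl_assoc a b (pl c d)
    (Algebra.TensorProduct.map (Dl k H) (AlgHom.id k (H ⊗[k] H)) t)
  rw [pl_map] at this
  exact this

theorem pl_comulSnd : pl a (pl b (pl c d)) (comulSnd (Dl k H) t) = pl a (pl (b ⋆ c) d) t := by
  simp only [comulSnd, pl_map]
  have : (pl b (pl c d)).comp ((Algebra.TensorProduct.assoc k k k H H H).toAlgHom.comp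
      (Algebra.TensorProduct.map (Dl k H) (AlgHom.id k H))) = pl (b ⋆ c) d := by
    apply AlgHom.ext; intro t
    have := pl_assoc b c d (Algebra.TensorProduct.map (Dl k H) (AlgHom.id k H) t)
    rw [pl_map] at this
    exact this
  simp only [this]; rfl

theorem pl_comulThd : pl a (pl b (pl c d)) (comulThd (Dl k H) t) = pl a (pl b (c ⋆ d)) t := by
  simp only [comulThd, pl_map]
  have : (pl b (pl c d)).comp (Algebra.TensorProduct.map (AlgHom.id k H) (Dl k H)) =
      pl b (c ⋆ d) := by
    apply AlgHom.ext; intro t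
    exact pl_map _ _ _ _ t
  simp only [this]; rfl

/-- The pentagon for four commuting strings. -/
theorem pentagon : ph b c d * ph a (b ⋆ c) d * ph a b c = ph a b (c ⋆ d) * ph (a ⋆ b) c d := by
  have := congrArg (pl a (pl b (pl c d))) (QuasiBialgebra.cocycle (k := k) (H := H))
  rw [map_mul, map_mul, map_mul, pl_oneTensor, pl_comulSnd, pl_tensorOne, pl_comulThd,
    pl_comulFst] at this
  exact Units.ext this

end Pentagon

theorem coassoc (a b c : H →ₐ[k] A) [Comm a b] [Comm a c] [Comm b c] (h : H) :
    (a ⋆ (b ⋆ c)) h * ph a b c = ph a b c * (a ⋆ b ⋆ c) h := by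
  have := congrArg (pl a (pl b c)) (QuasiBialgebra.quasi_coassoc (k := k) (H := H) h)
  rw [map_mul, map_mul, pl_map, pl_assoc, pl_map] at this
  have h2 : (a ⋆ (b ⋆ c)) h = ph a b c * (a ⋆ b ⋆ c) h * ((ph a b c)⁻¹ : Aˣ) := this
  rw [h2]; simp

theorem coassoc_inv (a b c : H →ₐ[k] A) [Comm a b] [Comm a c] [Comm b c] (h : H) :
    (a ⋆ b ⋆ c) h * ((ph a b c)⁻¹ : Aˣ) = ((ph a b c)⁻¹ : Aˣ) * (a ⋆ (b ⋆ c)) h := by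
  rw [Units.mul_inv_eq_iff_eq_mul, mul_assoc, coassoc, Units.inv_mul_cancel_left]

/-- The string `h ↦ ε(h) 1`. -/
def eta : H →ₐ[k] A := (Algebra.ofId k A).comp (eps k H)

theorem eta_apply (h : H) : (eta : H →ₐ[k] A) h = algebraMap k A (eps k H h) := rfl

instance (a : X →ₐ[k] A) : Comm (eta : H →ₐ[k] A) a :=
  ⟨fun _ _ => Algebra.commutes _ _⟩

@[simp] theorem comp_eta (F : A →ₐ[k] B) : F.comp (eta : H →ₐ[k] A) = eta := by
  ext h; simp [eta_apply]

@[simp] theorem pr_eta (a : H →ₐ[k] A) : a ⋆ (eta : H →ₐ[k] A) = a := by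
  ext h
  conv_rhs => rw [← QuasiBialgebra.comul_counit (k := k) h]
  rw [pr_apply]
  generalize Dl k H h = t
  induction t using TensorProduct.induction_on with
  | zero => simp
  | tmul x y => simp [eta_apply, Algebra.smul_def, ← Algebra.commutes]
  | add x y hx hy => simp [hx, hy]

@[simp] theorem eta_pr (a : H →ₐ[k] A) : (eta : H →ₐ[k] A) ⋆ a = a := by
  ext h
  conv_rhs => rw [← QuasiBialgebra.counit_comul (k := k) h]
  rw [pr_apply]
  generalize Dl k H h = t
  induction t using TensorProduct.induction_on with
  | zero => simp
  | tmul x y => simp [eta_apply, Algebra.smul_def]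
  | add x y hx hy => simp [hx, hy]

@[simp] theorem ph_mid_eta (a b : H →ₐ[k] A) [Comm a b] : ph a (eta : H →ₐ[k] A) b = 1 := by
  ext
  rw [ph_val, Units.val_one, ← map_one (pl a b),
    ← QuasiBialgebra.normalized (k := k) (H := H), pl_map]
  have : b.comp ((Algebra.TensorProduct.lid k H).toAlgHom.comp
    (Algebra.TensorProduct.map (eps k H) (AlgHom.id k H))) = pl eta b := by
    apply AlgHom.ext; intro t
    induction t using TensorProduct.induction_on with
    | zero => simp
    | tmul x y => simp [eta_apply, Algebra.smul_def]
    | add x y hx hy => simp only [map_add, hx, hy]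
  have key : ∀ (c d : H ⊗[k] H →ₐ[k] A) [Comm a c] [Comm a d], c = d → ∀ t, pl a c t = pl a d t := by
    intro c d _ _ h t; subst h; rfl
  exact (key _ _ this _).symm

@[simp] theorem ph_fst_eta (a b : H →ₐ[k] A) [Comm a b] : ph (eta : H →ₐ[k] A) a b = 1 := by
  have := pentagon (k := k) (H := H) (eta : H →ₐ[k] A) (eta : H →ₐ[k] A) a b
  simpa using this

@[simp] theorem ph_snd_eta (a b : H →ₐ[k] A) [Comm a b] : ph a b (eta : H →ₐ[k] A) = 1 := by
  have := pentagon (k := k) (H := H) a b (eta : H →ₐ[k] A) (eta : H →ₐ[k] A)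
  simpa using this

/-! ### Naturality of the reassociator -/

theorem commute_ph {a b c : H →ₐ[k] A} {d : X →ₐ[k] A} [Comm a b] [Comm a c] [Comm b c]
    [Comm a d] [Comm b d] [Comm c d] (x : X) : Commute (ph a b c : A) (d x) :=
  Comm.comm (a := pl a (pl b c)) (b := d) _ _

theorem commute_ph_inv {a b c : H →ₐ[k] A} {d : X →ₐ[k] A} [Comm a b] [Comm a c] [Comm b c]
    [Comm a d] [Comm b d] [Comm c d] (x : X) : Commute (((ph a b c)⁻¹ : Aˣ) : A) (d x) :=
  Comm.comm (a := pl a (pl b c)) (b := d) _ _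

/-- An element intertwining two strings also intertwines their products with a string it commutes
with. -/
theorem intertwine_pr_left {s s' a : H →ₐ[k] A} [Comm s a] [Comm s' a] {z : A}
    (hs : ∀ h, z * s h = s' h * z) (ha : ∀ h, Commute z (a h)) (h : H) :
    z * (s ⋆ a) h = (s' ⋆ a) h * z := by
  rw [pr_apply, pr_apply]
  generalize Dl k H h = t
  induction t using TensorProduct.induction_on with
  | zero => simp
  | tmul x y => simp only [pl_tmul]; rw [← mul_assoc, hs, mul_assoc, (ha y).eq, mul_assoc]
  | add x y hx hy => simp [mul_add, add_mul, hx, hy]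

theorem intertwine_pr_right {s s' a : H →ₐ[k] A} [Comm a s] [Comm a s'] {z : A}
    (hs : ∀ h, z * s h = s' h * z) (ha : ∀ h, Commute z (a h)) (h : H) :
    z * (a ⋆ s) h = (a ⋆ s') h * z := by
  rw [pr_apply, pr_apply]
  generalize Dl k H h = t
  induction t using TensorProduct.induction_on with
  | zero => simp
  | tmul x y => simp only [pl_tmul]; rw [← mul_assoc, (ha x).eq, mul_assoc, hs, mul_assoc]
  | add x y hx hy => simp [mul_add, add_mul, hx, hy]

theorem intertwine_pl {W : Type*} [Semiring W] [Algebra k W] {s s' : X →ₐ[k] A} {a a' : W →ₐ[k] A}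
    [Comm s a] [Comm s' a'] {z : A}
    (hs : ∀ h, z * s h = s' h * z) (ha : ∀ h, z * a h = a' h * z) (t : X ⊗[k] W) :
    z * pl s a t = pl s' a' t * z := by
  induction t using TensorProduct.induction_on with
  | zero => simp
  | tmul x y => simp only [pl_tmul]; rw [← mul_assoc, hs, mul_assoc, ha, mul_assoc]
  | add x y hx hy => simp [mul_add, add_mul, hx, hy]

/-- An element intertwining strings intertwines the reassociators placed on them. -/
theorem intertwine_ph {a b c a' b' c' : H →ₐ[k] A} [Comm a b] [Comm a c] [Comm b c]
    [Comm a' b'] [Comm a' c'] [Comm b' c'] {z : A} (ha : ∀ h, z * a h = a' h * z)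
    (hb : ∀ h, z * b h = b' h * z) (hc : ∀ h, z * c h = c' h * z) :
    z * ph a b c = ph a' b' c' * z :=
  intertwine_pl ha (intertwine_pl hb hc) _

theorem intertwine_ph_inv {a b c a' b' c' : H →ₐ[k] A} [Comm a b] [Comm a c] [Comm b c]
    [Comm a' b'] [Comm a' c'] [Comm b' c'] {z : A} (ha : ∀ h, z * a h = a' h * z)
    (hb : ∀ h, z * b h = b' h * z) (hc : ∀ h, z * c h = c' h * z) :
    z * ((ph a b c)⁻¹ : Aˣ) = ((ph a' b' c')⁻¹ : Aˣ) * z :=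
  intertwine_pl ha (intertwine_pl hb hc) _

end Strings

/-! ### Absorption -/

section Absorption

variable {k : Type u} {H : Type v} [Field k] [Ring H] [Algebra k H] [QuasiBialgebra k H]
variable {A M : Type*} [Semiring A] [Algebra k A] [AddCommMonoid M] [Module k M]

/-- `Ψ` absorbs the string `s` on the left: `Ψ(s(h) T) = ε(h) Ψ(T)`. -/
def AbsL (Ψ : A →ₗ[k] M) (s : H →ₐ[k] A) : Prop := ∀ h T, Ψ (s h * T) = eps k H h • Ψ T

/-- `Ψ` absorbs the string `s` on the right: `Ψ(T s(h)) = ε(h) Ψ(T)`. -/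
def AbsR (Ψ : A →ₗ[k] M) (s : H →ₐ[k] A) : Prop := ∀ h T, Ψ (T * s h) = eps k H h • Ψ T

/-- `Ψ` absorbs the string `s` between the words `L` and `T`. -/
def Abs (Ψ : A →ₗ[k] M) (s : H →ₐ[k] A) (L T : A) : Prop :=
  ∀ (h : H) (c : A), (∀ x, Commute (s x) c) → Ψ (L * (s h * c) * T) = eps k H h • Ψ (L * c * T)

variable {Ψ : A →ₗ[k] M} {s : H →ₐ[k] A} {L T : A}

theorem AbsL.abs (hs : AbsL Ψ s) (hL : ∀ h, Commute L (s h)) : Abs Ψ s L T := fun h c _ => by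
  rw [← mul_assoc L, (hL h).eq, mul_assoc, mul_assoc, hs, mul_assoc]

theorem AbsR.abs (hs : AbsR Ψ s) (hT : ∀ h, Commute T (s h)) : Abs Ψ s L T := fun h c hc => by
  rw [(hc h).eq, ← mul_assoc L, mul_assoc, ← (hT h).eq, ← mul_assoc, hs]

/-- An absorbed string may be replaced by the trivial string in any word `s(h) c` whose other
letters commute with `s`. -/
theorem Abs.pl {C : Type*} [Semiring C] [Algebra k C] (hs : Abs Ψ s L T) (c : C →ₐ[k] A)
    [hc : Comm s c] (t : H ⊗[k] C) : Ψ (L * pl s c t * T) = Ψ (L * pl eta c t * T) := by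
  induction t using TensorProduct.induction_on with
  | zero => simp
  | tmul x y =>
    rw [pl_tmul, hs _ _ (fun x => hc.comm _ _), pl_tmul, eta_apply, ← Algebra.smul_def]
    simp
  | add x y hx hy => simp only [map_add, mul_add, add_mul, hx, hy]

variable (s) in
/-- The centralizer of a string. -/
abbrev cen : Subalgebra k A := Subalgebra.centralizer k (Set.range s)

instance : Comm s (cen s).val :=
  ⟨fun x y => (Subalgebra.mem_centralizer_iff k).1 y.2 _ ⟨x, rfl⟩⟩

/-- A string commuting with `s`, as a string in the centralizer of `s`. -/
def toCen (s a : H →ₐ[k] A) [h : Comm a s] : H →ₐ[k] cen s :=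
  a.codRestrict _ fun x => (Subalgebra.mem_centralizer_iff k).2 (by
    rintro _ ⟨y, rfl⟩; exact (h.comm x y).symm.eq)

@[simp] theorem val_comp_toCen (a : H →ₐ[k] A) [h : Comm a s] : (cen s).val.comp (toCen s a) = a :=
  rfl

instance (a b : H →ₐ[k] A) [Comm a s] [Comm b s] [h : Comm a b] : Comm (toCen s a) (toCen s b) :=
  ⟨fun x y => Subtype.ext (h.comm x y).eq⟩

section Words

variable {a b c : H →ₐ[k] A} [Comm a s] [Comm b s] [Comm c s]
  [Comm a b] [Comm a c] [Comm b c]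

/-- An absorbed string can be erased from `Φ` placed on products of strings, since these come from
`H ⊗ C`, where `C` is the centralizer of the absorbed string. -/
theorem Abs.word (hs : Abs Ψ s L T) (x y z : H →ₐ[k] H ⊗[k] cen s) [Comm x y] [Comm x z] [Comm y z] :
    Ψ (L * ph ((QuasiHopf.pl s (cen s).val).comp x) ((QuasiHopf.pl s (cen s).val).comp y)
        ((QuasiHopf.pl s (cen s).val).comp z) * T) =
      Ψ (L * ph ((QuasiHopf.pl eta (cen s).val).comp x) ((QuasiHopf.pl eta (cen s).val).comp y)
        ((QuasiHopf.pl eta (cen s).val).comp z) * T) ∧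
    Ψ (L * ((ph ((QuasiHopf.pl s (cen s).val).comp x) ((QuasiHopf.pl s (cen s).val).comp y)
        ((QuasiHopf.pl s (cen s).val).comp z))⁻¹ : Aˣ) * T) =
      Ψ (L * ((ph ((QuasiHopf.pl eta (cen s).val).comp x) ((QuasiHopf.pl eta (cen s).val).comp y)
        ((QuasiHopf.pl eta (cen s).val).comp z))⁻¹ : Aˣ) * T) := by
  constructor
  · rw [← map_ph_val, ← map_ph_val, hs.pl]
  · rw [← map_ph_inv_val, ← map_ph_inv_val, hs.pl]

theorem Abs.ph_fst (hs : Abs Ψ s L T) :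
    Ψ (L * ph s b c * T) = Ψ (L * T) ∧ Ψ (L * ((ph s b c)⁻¹ : Aˣ) * T) = Ψ (L * T) := by
  simpa using hs.word iL (iR.comp (toCen s b)) (iR.comp (toCen s c))

theorem Abs.ph_snd (hs : Abs Ψ s L T) :
    Ψ (L * ph a s c * T) = Ψ (L * T) ∧ Ψ (L * ((ph a s c)⁻¹ : Aˣ) * T) = Ψ (L * T) := by
  simpa using hs.word (iR.comp (toCen s a)) iL (iR.comp (toCen s c))

theorem Abs.ph_thd (hs : Abs Ψ s L T) :
    Ψ (L * ph a b s * T) = Ψ (L * T) ∧ Ψ (L * ((ph a b s)⁻¹ : Aˣ) * T) = Ψ (L * T) := by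
  simpa using hs.word (iR.comp (toCen s a)) (iR.comp (toCen s b)) iL

variable {d : H →ₐ[k] A} [Comm d s] [Comm a d] [Comm b d] [Comm c d]

theorem Abs.ph_fst_right (hs : Abs Ψ s L T) :
    Ψ (L * ph (a ⋆ s) b c * T) = Ψ (L * ph a b c * T) ∧
    Ψ (L * ((ph (a ⋆ s) b c)⁻¹ : Aˣ) * T) = Ψ (L * ((ph a b c)⁻¹ : Aˣ) * T) := by
  simpa using hs.word (iR.comp (toCen s a) ⋆ iL) (iR.comp (toCen s b)) (iR.comp (toCen s c))

theorem Abs.ph_fst_left (hs : Abs Ψ s L T) :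
    Ψ (L * ph (s ⋆ a) b c * T) = Ψ (L * ph a b c * T) ∧
    Ψ (L * ((ph (s ⋆ a) b c)⁻¹ : Aˣ) * T) = Ψ (L * ((ph a b c)⁻¹ : Aˣ) * T) := by
  simpa using hs.word (iL ⋆ iR.comp (toCen s a)) (iR.comp (toCen s b)) (iR.comp (toCen s c))

theorem Abs.ph_snd_right (hs : Abs Ψ s L T) :
    Ψ (L * ph a (b ⋆ s) c * T) = Ψ (L * ph a b c * T) ∧
    Ψ (L * ((ph a (b ⋆ s) c)⁻¹ : Aˣ) * T) = Ψ (L * ((ph a b c)⁻¹ : Aˣ) * T) := by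
  simpa using hs.word (iR.comp (toCen s a)) (iR.comp (toCen s b) ⋆ iL) (iR.comp (toCen s c))

theorem Abs.ph_thd_right (hs : Abs Ψ s L T) :
    Ψ (L * ph a b (c ⋆ s) * T) = Ψ (L * ph a b c * T) ∧
    Ψ (L * ((ph a b (c ⋆ s))⁻¹ : Aˣ) * T) = Ψ (L * ((ph a b c)⁻¹ : Aˣ) * T) := by
  simpa using hs.word (iR.comp (toCen s a)) (iR.comp (toCen s b)) (iR.comp (toCen s c) ⋆ iL)

theorem Abs.ph_thd_left (hs : Abs Ψ s L T) :
    Ψ (L * ph a b (s ⋆ c) * T) = Ψ (L * ph a b c * T) ∧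
    Ψ (L * ((ph a b (s ⋆ c))⁻¹ : Aˣ) * T) = Ψ (L * ((ph a b c)⁻¹ : Aˣ) * T) := by
  simpa using hs.word (iR.comp (toCen s a)) (iR.comp (toCen s b)) (iL ⋆ iR.comp (toCen s c))

theorem Abs.pr_right (hs : Abs Ψ s L T) (h : H) :
    Ψ (L * (a ⋆ s) h * T) = Ψ (L * a h * T) := by
  simpa [← AlgHom.comp_apply] using hs.pl (cen s).val ((iR.comp (toCen s a) ⋆ iL) h)

theorem Abs.pr_left (hs : Abs Ψ s L T) (h : H) :
    Ψ (L * (s ⋆ a) h * T) = Ψ (L * a h * T) := by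
  simpa [← AlgHom.comp_apply] using hs.pl (cen s).val ((iL ⋆ iR.comp (toCen s a)) h)

theorem Abs.pr_right_left (hs : Abs Ψ s L T) (h : H) :
    Ψ (L * (a ⋆ s ⋆ b) h * T) = Ψ (L * (a ⋆ b) h * T) := by
  simpa [← AlgHom.comp_apply] using
    hs.pl (cen s).val ((iR.comp (toCen s a) ⋆ iL ⋆ iR.comp (toCen s b)) h)

end Words

end Absorption

/-! ### Erasing absorbed strings -/

section AntipodeWords

variable {k : Type u} {H : Type v} [Field k] [Ring H] [Algebra k H] [QuasiBialgebra k H]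
variable {A M : Type*} [Semiring A] [Algebra k A] [AddCommMonoid M] [Module k M]
variable {p q r t : H →ₐ[k] A} [Comm p q] [Comm p r] [Comm p t] [Comm q r] [Comm q t] [Comm r t]
variable {Ψ : A →ₗ[k] M}

/-- Since `Φ⁻¹` intertwines the two bracketings of `h₁ ⊗ h₂ ⊗ h₃` and two of the three factors are
absorbed on either side, a letter on the last strand moves to the first. -/
theorem ph_inv_slide (hL : AbsL Ψ (p ⋆ q)) (hR : AbsR Ψ (q ⋆ r)) (h : H) :
    Ψ (r h * ((ph p q r)⁻¹ : Aˣ)) = Ψ (((ph p q r)⁻¹ : Aˣ) * p h) := by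
  have h1 := (hL.abs (L := 1) (T := (((ph p q r)⁻¹ : Aˣ) : A)) fun _ => Commute.one_left _).pr_left
    (a := r) h
  have h2 := (hR.abs (L := (((ph p q r)⁻¹ : Aˣ) : A)) (T := 1) fun _ => Commute.one_left _).pr_right
    (a := p) h
  rw [one_mul, one_mul, coassoc_inv] at h1
  rw [mul_one, mul_one] at h2
  rw [← h1, h2]

/-- In the pentagon for four strings with adjacent pairs absorbed in alternation, all reassociators
except the two extreme ones are erased. -/
theorem ph_eq_ph_inv_of_left (hL : AbsL Ψ (p ⋆ q)) (hR : AbsR Ψ (q ⋆ r)) (hL' : AbsL Ψ (r ⋆ t)) :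
    Ψ (ph q r t) = Ψ ((ph p q r)⁻¹ : Aˣ) := by
  have pent : (ph q r t * ph p (q ⋆ r) t : A) =
      ph p q (r ⋆ t) * (ph (p ⋆ q) r t * ((ph p q r)⁻¹ : Aˣ)) := by
    rw [← mul_assoc, ← Units.val_mul, ← Units.val_mul, ← pentagon]; simp
  calc Ψ (ph q r t) = Ψ (ph q r t * ph p (q ⋆ r) t * 1) := by
        rw [((hR.abs fun _ => Commute.one_left _).ph_snd).1, mul_one]
    _ = Ψ (1 * ph p q (r ⋆ t) * (ph (p ⋆ q) r t * ((ph p q r)⁻¹ : Aˣ))) := by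
        rw [mul_one, one_mul, pent]
    _ = Ψ (1 * ph (p ⋆ q) r t * ((ph p q r)⁻¹ : Aˣ)) := by
        rw [((hL'.abs fun _ => Commute.one_left _).ph_thd).1, one_mul, one_mul]
    _ = Ψ ((ph p q r)⁻¹ : Aˣ) := by
        rw [((hL.abs fun _ => Commute.one_left _).ph_fst).1, one_mul]

theorem ph_eq_ph_inv_of_right (hR : AbsR Ψ (p ⋆ q)) (hL : AbsL Ψ (q ⋆ r)) (hR' : AbsR Ψ (r ⋆ t)) :
    Ψ (ph p q r) = Ψ ((ph q r t)⁻¹ : Aˣ) := by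
  have pent : (ph p (q ⋆ r) t * ph p q r : A) =
      ((ph q r t)⁻¹ : Aˣ) * ph p q (r ⋆ t) * ph (p ⋆ q) r t := by
    rw [mul_assoc, ← Units.val_mul (ph p q (r ⋆ t)), ← pentagon]; simp [mul_assoc]
  calc Ψ (ph p q r) = Ψ (1 * ph p (q ⋆ r) t * ph p q r) := by
        rw [((hL.abs fun _ => Commute.one_left _).ph_snd).1, one_mul]
    _ = Ψ (((ph q r t)⁻¹ : Aˣ) * ph p q (r ⋆ t) * ph (p ⋆ q) r t * 1) := by
        rw [mul_one, one_mul, pent]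
    _ = Ψ (((ph q r t)⁻¹ : Aˣ) * ph p q (r ⋆ t) * 1) := by
        rw [((hR.abs fun _ => Commute.one_left _).ph_fst).1]
    _ = Ψ ((ph q r t)⁻¹ : Aˣ) := by
        rw [((hR'.abs fun _ => Commute.one_left _).ph_thd).1, mul_one]

end AntipodeWords

/-! ### Lines: products of beads read along a strand -/

section Lines

variable {k : Type u} {H : Type v} [Field k] [Ring H] [Algebra k H] [QuasiBialgebra k H]
variable {X Y Z B M N : Type*} [Semiring X] [Algebra k X] [Semiring Y] [Algebra k Y] [Semiring Z] [Algebra k Z]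
  [Semiring B] [Algebra k B] [AddCommMonoid M] [Module k M] [AddCommMonoid N] [Module k N]

/-- `x ⊗ y ↦ f(x) g(y)`. -/
def ln {X Y : Type*} [AddCommMonoid X] [Module k X] [AddCommMonoid Y] [Module k Y]
    (f : X →ₗ[k] B) (g : Y →ₗ[k] B) : X ⊗[k] Y →ₗ[k] B :=
  LinearMap.mul' k B ∘ₗ TensorProduct.map f g

@[simp] theorem ln_tmul {X Y : Type*} [AddCommMonoid X] [Module k X] [AddCommMonoid Y] [Module k Y]
    (f : X →ₗ[k] B) (g : Y →ₗ[k] B) (x : X) (y : Y) :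
    ln f g (x ⊗ₜ y) = f x * g y := rfl

/-- `x ↦ f(x) b`. -/
abbrev rm {X : Type*} [AddCommMonoid X] [Module k X] (f : X →ₗ[k] B) (b : B) : X →ₗ[k] B := LinearMap.mulRight k b ∘ₗ f

theorem AbsL.ln_snd {g : Y →ₗ[k] B} {s : H →ₐ[k] Y} (hs : AbsL g s) (f : X →ₗ[k] B) :
    AbsL (ln f g) (iR.comp s) := fun h T => by
  induction T using TensorProduct.induction_on with
  | zero => simp
  | tmul x y => simp [hs h y]
  | add x y hx hy => simp only [mul_add, map_add, hx, hy, smul_add]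

theorem AbsR.ln_snd {g : Y →ₗ[k] B} {s : H →ₐ[k] Y} (hs : AbsR g s) (f : X →ₗ[k] B) :
    AbsR (ln f g) (iR.comp s) := fun h T => by
  induction T using TensorProduct.induction_on with
  | zero => simp
  | tmul x y => simp [hs h y]
  | add x y hx hy => simp only [add_mul, map_add, hx, hy, smul_add]

theorem ln_rm {X Y : Type*} [AddCommMonoid X] [Module k X] [AddCommMonoid Y] [Module k Y]
    (f : X →ₗ[k] B) (g : Y →ₗ[k] B) (b : B) (t : X ⊗[k] Y) :
    ln f (rm g b) t = ln f g t * b := by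
  induction t using TensorProduct.induction_on with
  | zero => rw [map_zero, map_zero, zero_mul]
  | add x y hx hy => rw [map_add, map_add, hx, hy, add_mul]
  | tmul x y => simp [mul_assoc]

theorem AbsL.rm {f : X →ₗ[k] B} {g : Y →ₗ[k] B} {s : H →ₐ[k] X ⊗[k] Y} (hs : AbsL (ln f g) s)
    (b : B) : AbsL (ln f (rm g b)) s := fun h T => by
  rw [ln_rm, hs, ln_rm, smul_mul_assoc]

theorem AbsR.rm {f : X →ₗ[k] B} {g : Y →ₗ[k] B} {s : H →ₐ[k] X ⊗[k] Y} (hs : AbsR (ln f g) s)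
    (b : B) : AbsR (ln f (rm g b)) s := fun h T => by
  rw [ln_rm, hs, ln_rm, smul_mul_assoc]

theorem ln_assoc (f : X →ₗ[k] B) (g : Y →ₗ[k] B) (r : Z →ₗ[k] B) (t : (X ⊗[k] Y) ⊗[k] Z) :
    ln f (ln g r) (Algebra.TensorProduct.assoc k k k X Y Z t) = ln (ln f g) r t := by
  induction t using TensorProduct.induction_on with
  | zero => simp
  | add x y hx hy => simp only [map_add, hx, hy]
  | tmul x z =>
    induction x using TensorProduct.induction_on with
    | zero => simp
    | add x y hx hy => simp only [map_add, TensorProduct.add_tmul, hx, hy]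
    | tmul x y => simp [mul_assoc]

theorem iL_pr_iR_apply (h : H) : ((iL : H →ₐ[k] H ⊗[k] H) ⋆ iR) h = Dl k H h := by
  rw [pr_apply, pl_iL_iR]

theorem assoc_pr (h : H) :
    ((iL : H →ₐ[k] H ⊗[k] (H ⊗[k] Z)) ⋆ iR.comp iL) h =
      Algebra.TensorProduct.assoc k k k H H Z (((iL : H →ₐ[k] H ⊗[k] H) ⋆ iR) h ⊗ₜ 1) := by
  rw [iL_pr_iR_apply, pr_apply]
  generalize Dl k H h = t
  induction t using TensorProduct.induction_on with
  | zero => simp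
  | add x y hx hy => simp only [map_add, TensorProduct.add_tmul, hx, hy]
  | tmul x y => simp

theorem AbsL.ln_fst {f g : H →ₗ[k] B} (hs : AbsL (ln f g) (iL ⋆ iR)) (r : Z →ₗ[k] B) :
    AbsL (ln f (ln g r)) (iL ⋆ iR.comp iL) := fun h T => by
  obtain ⟨T, rfl⟩ := (Algebra.TensorProduct.assoc k k k H H Z).surjective T
  rw [assoc_pr, ← map_mul, ln_assoc, ln_assoc]
  induction T using TensorProduct.induction_on with
  | zero => simp
  | add x y hx hy => simp only [mul_add, map_add, hx, hy, smul_add]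
  | tmul x z => simp [hs h x]

theorem AbsR.ln_fst {f g : H →ₗ[k] B} (hs : AbsR (ln f g) (iL ⋆ iR)) (r : Z →ₗ[k] B) :
    AbsR (ln f (ln g r)) (iL ⋆ iR.comp iL) := fun h T => by
  obtain ⟨T, rfl⟩ := (Algebra.TensorProduct.assoc k k k H H Z).surjective T
  rw [assoc_pr, ← map_mul, ln_assoc, ln_assoc]
  induction T using TensorProduct.induction_on with
  | zero => simp
  | add x y hx hy => simp only [add_mul, map_add, hx, hy, smul_add]
  | tmul x z => simp [hs h x]

theorem AbsL.map_fst {f : X →ₗ[k] M} {s : H →ₐ[k] X} (hs : AbsL f s) (g : Y →ₗ[k] N) :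
    AbsL (TensorProduct.map f g) (iL.comp s) := fun h T => by
  induction T using TensorProduct.induction_on with
  | zero => simp
  | add x y hx hy => simp only [mul_add, map_add, hx, hy, smul_add]
  | tmul x z => simp [hs h x, TensorProduct.smul_tmul']

theorem AbsR.map_fst {f : X →ₗ[k] M} {s : H →ₐ[k] X} (hs : AbsR f s) (g : Y →ₗ[k] N) :
    AbsR (TensorProduct.map f g) (iL.comp s) := fun h T => by
  induction T using TensorProduct.induction_on with
  | zero => simp
  | add x y hx hy => simp only [add_mul, map_add, hx, hy, smul_add]
  | tmul x z => simp [hs h x, TensorProduct.smul_tmul']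

theorem AbsL.map_snd {g : Y →ₗ[k] N} {s : H →ₐ[k] Y} (hs : AbsL g s) (f : X →ₗ[k] M) :
    AbsL (TensorProduct.map f g) (iR.comp s) := fun h T => by
  induction T using TensorProduct.induction_on with
  | zero => simp
  | add x y hx hy => simp only [mul_add, map_add, hx, hy, smul_add]
  | tmul x z => simp [hs h z]

theorem AbsR.map_snd {g : Y →ₗ[k] N} {s : H →ₐ[k] Y} (hs : AbsR g s) (f : X →ₗ[k] M) :
    AbsR (TensorProduct.map f g) (iR.comp s) := fun h T => by
  induction T using TensorProduct.induction_on with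
  | zero => simp
  | add x y hx hy => simp only [add_mul, map_add, hx, hy, smul_add]
  | tmul x z => simp [hs h z]

end Lines

/-! ### Antipodes along an algebra map and their uniqueness -/

section Antipode

variable {k : Type u} {H : Type v} [Field k] [Ring H] [Algebra k H] [QuasiBialgebra k H]
variable {B : Type*} [Semiring B] [Algebra k B]

/-- An antipode `(s, a, b)` of `H` along an algebra map `j : H → B`. For `j = id` these are the
axioms of a quasi-Hopf algebra (without bijectivity of the antipode). -/
structure IsAntipode (j : H →ₐ[k] B) (s : H →ₗ[k] B) (a b : B) : Prop where
  one : s 1 = 1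
  mul : ∀ x y, s (x * y) = s y * s x
  left : ∀ h, ln (rm s a) j.toLinearMap (Dl k H h) = eps k H h • a
  right : ∀ h, ln (rm j.toLinearMap b) s (Dl k H h) = eps k H h • b
  phi : ln (rm j.toLinearMap b) (ln (rm s a) j.toLinearMap) (Ph k H : H ⊗[k] (H ⊗[k] H)) = 1
  phi_inv : ln (rm s a) (ln (rm j.toLinearMap b) s)
    (((Ph k H)⁻¹ : (H ⊗[k] (H ⊗[k] H))ˣ) : H ⊗[k] (H ⊗[k] H)) = 1

namespace IsAntipode

variable {j : H →ₐ[k] B} {s s' : H →ₗ[k] B} {a a' b b' : B}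

theorem absL (hs : IsAntipode j s a b) : AbsL (ln (rm s a) j.toLinearMap) (iL ⋆ iR) := fun h T => by
  rw [iL_pr_iR_apply]
  induction T using TensorProduct.induction_on with
  | zero => simp
  | add x y hx hy => simp only [mul_add, map_add, hx, hy, smul_add]
  | tmul x y =>
    have : ∀ t : H ⊗[k] H, ln (rm s a) j.toLinearMap (t * x ⊗ₜ y) =
        s x * ln (rm s a) j.toLinearMap t * j y := fun t => by
      induction t using TensorProduct.induction_on with
      | zero => simp
      | add x y hx hy => simp only [add_mul, mul_add, map_add, hx, hy]
      | tmul z w => simp [hs.mul, mul_assoc]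
    rw [this, hs.left]; simp

theorem absR (hs : IsAntipode j s a b) : AbsR (ln (rm j.toLinearMap b) s) (iL ⋆ iR) := fun h T => by
  rw [iL_pr_iR_apply]
  induction T using TensorProduct.induction_on with
  | zero => simp
  | add x y hx hy => simp only [add_mul, map_add, hx, hy, smul_add]
  | tmul x y =>
    have : ∀ t : H ⊗[k] H, ln (rm j.toLinearMap b) s (x ⊗ₜ y * t) =
        j x * ln (rm j.toLinearMap b) s t * s y := fun t => by
      induction t using TensorProduct.induction_on with
      | zero => simp
      | add x y hx hy => simp only [add_mul, mul_add, map_add, hx, hy]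
      | tmul z w => simp [hs.mul, mul_assoc]
    rw [this, hs.right]; simp

end IsAntipode

/-- `s(x¹) a j(x²) b s'(x³)`, where `Φ⁻¹ = x¹ ⊗ x² ⊗ x³`: the element comparing two antipodes. -/
def cmp (j : H →ₐ[k] B) (s : H →ₗ[k] B) (a b : B) (s' : H →ₗ[k] B) : B :=
  ln (rm s a) (ln (rm j.toLinearMap b) s')
    (((Ph k H)⁻¹ : (H ⊗[k] (H ⊗[k] H))ˣ) : H ⊗[k] (H ⊗[k] H))

namespace IsAntipode

variable {j : H →ₐ[k] B} {s s' : H →ₗ[k] B} {a a' b b' : B}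

theorem ph_std_val : (ph (iL : H →ₐ[k] H ⊗[k] (H ⊗[k] H)) (iR.comp iL) (iR.comp iR) :
    H ⊗[k] (H ⊗[k] H)) = Ph k H := by
  have : pl (iL : H →ₐ[k] H ⊗[k] (H ⊗[k] H)) (pl (iR.comp iL) (iR.comp iR)) =
      AlgHom.id k (H ⊗[k] (H ⊗[k] H)) := by
    ext <;> simp
  rw [ph_val, this]; rfl

theorem ph_std : ph (iL : H →ₐ[k] H ⊗[k] (H ⊗[k] H)) (iR.comp iL) (iR.comp iR) = Ph k H :=
  Units.ext ph_std_val

/-- The comparison element intertwines the antipodes. -/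
theorem cmp_mul (hs : IsAntipode j s a b) (hs' : IsAntipode j s' a' b') (h : H) :
    cmp j s a b' s' * s' h = s h * cmp j s a b' s' := by
  set Ψ := ln (rm s a) (ln (rm j.toLinearMap b') s')
  have hL : AbsL Ψ (iL ⋆ iR.comp iL) := (hs.absL.rm b').ln_fst s'
  have hR : AbsR Ψ (iR.comp iL ⋆ iR.comp iR) := by
    simpa using hs'.absR.ln_snd (rm s a)
  have h1 : ∀ T, Ψ (T * (iL : H →ₐ[k] H ⊗[k] (H ⊗[k] H)) h) = s h * Ψ T := fun T => by
    induction T using TensorProduct.induction_on with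
    | zero => simp
    | add x y hx hy => simp only [add_mul, mul_add, map_add, hx, hy]
    | tmul z w => simp [Ψ, hs.mul, mul_assoc]
  have h3 : ∀ T, Ψ ((iR.comp iR : H →ₐ[k] H ⊗[k] (H ⊗[k] H)) h * T) = Ψ T * s' h := fun T => by
    induction T using TensorProduct.induction_on with
    | zero => simp
    | add x y hx hy => simp only [add_mul, mul_add, map_add, hx, hy]
    | tmul z w =>
      induction w using TensorProduct.induction_on with
      | zero => simp
      | add x y hx hy => simp only [add_mul, mul_add, map_add, hx, hy, TensorProduct.tmul_add]
      | tmul x y => simp [Ψ, hs'.mul, mul_assoc]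
  have e : cmp j s a b' s' = Ψ ((Ph k H)⁻¹ : (H ⊗[k] (H ⊗[k] H))ˣ) := rfl
  rw [e, ← h1, ← h3, ← ph_std]
  exact ph_inv_slide hL hR h

/-- The pentagon on the four strings of `S(x¹) a x² b' S'(x³) a' y`, with the absorption properties of
both antipodes, gives `u a' = a`. -/
theorem cmp_mul_left (hs : IsAntipode j s a b) (hs' : IsAntipode j s' a' b') :
    cmp j s a b' s' * a' = a := by
  let p : H →ₐ[k] H ⊗[k] (H ⊗[k] (H ⊗[k] H)) := iL
  let q : H →ₐ[k] H ⊗[k] (H ⊗[k] (H ⊗[k] H)) := iR.comp iL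
  let r : H →ₐ[k] H ⊗[k] (H ⊗[k] (H ⊗[k] H)) := iR.comp (iR.comp iL)
  let t : H →ₐ[k] H ⊗[k] (H ⊗[k] (H ⊗[k] H)) := iR.comp (iR.comp iR)
  let Ψ : H ⊗[k] (H ⊗[k] (H ⊗[k] H)) →ₗ[k] B := ln (rm s a) (ln (rm j.toLinearMap b') (ln (rm s' a') j.toLinearMap))
  have hL : AbsL Ψ (p ⋆ q) := by
    simpa [p, q] using (hs.absL.rm b').ln_fst (ln (rm s' a') j.toLinearMap)
  have hR : AbsR Ψ (q ⋆ r) := by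
    simpa [p, q, r] using ((hs'.absR.rm a').ln_fst j.toLinearMap).ln_snd (rm s a)
  have hL' : AbsL Ψ (r ⋆ t) := by
    simpa [r, t] using (hs'.absL.ln_snd (rm j.toLinearMap b')).ln_snd (rm s a)
  have e1 : Ψ (ph q r t) = a := by
    have : (ph q r t : H ⊗[k] (H ⊗[k] (H ⊗[k] H))) = (1 : H) ⊗ₜ (Ph k H : H ⊗[k] (H ⊗[k] H)) := by
      rw [← ph_std_val]
      change ((ph (iR.comp iL) (iR.comp (iR.comp iL)) (iR.comp (iR.comp iR)) :
        (H ⊗[k] (H ⊗[k] (H ⊗[k] H)))ˣ) : H ⊗[k] (H ⊗[k] (H ⊗[k] H))) =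
        iR (ph (iL : H →ₐ[k] H ⊗[k] (H ⊗[k] H)) (iR.comp iL) (iR.comp iR) : H ⊗[k] (H ⊗[k] H))
      rw [map_ph_val]
    rw [this]; simp [Ψ, hs.one, hs'.phi]
  have e2 : Ψ ((ph p q r)⁻¹ : (H ⊗[k] (H ⊗[k] (H ⊗[k] H)))ˣ) = cmp j s a b' s' * a' := by
    have : pl p (pl q r) = Algebra.TensorProduct.map (AlgHom.id k H)
        (Algebra.TensorProduct.map (AlgHom.id k H) iL) := by
      ext <;> simp [p, q, r]
    rw [ph_inv_val, this, cmp]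
    generalize (((Ph k H)⁻¹ : (H ⊗[k] (H ⊗[k] H))ˣ) : H ⊗[k] (H ⊗[k] H)) = z
    induction z using TensorProduct.induction_on with
    | zero => simp
    | add x y hx hy => simp only [add_mul, map_add, hx, hy]
    | tmul x w =>
      induction w using TensorProduct.induction_on with
      | zero => simp
      | add x y hx hy => simp only [add_mul, map_add, hx, hy, TensorProduct.tmul_add]
      | tmul y z => simp [Ψ, mul_assoc]
  rw [← e2, ← ph_eq_ph_inv_of_left hL hR hL', e1]

/-- Mirror image of `cmp_mul_left`. -/
theorem mul_cmp_right (hs : IsAntipode j s a b) (hs' : IsAntipode j s' a' b') :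
    b * cmp j s a b' s' = b' := by
  let p : H →ₐ[k] H ⊗[k] (H ⊗[k] (H ⊗[k] H)) := iL
  let q : H →ₐ[k] H ⊗[k] (H ⊗[k] (H ⊗[k] H)) := iR.comp iL
  let r : H →ₐ[k] H ⊗[k] (H ⊗[k] (H ⊗[k] H)) := iR.comp (iR.comp iL)
  let t : H →ₐ[k] H ⊗[k] (H ⊗[k] (H ⊗[k] H)) := iR.comp (iR.comp iR)
  let Ψ : H ⊗[k] (H ⊗[k] (H ⊗[k] H)) →ₗ[k] B := ln (rm j.toLinearMap b) (ln (rm s a) (ln (rm j.toLinearMap b') s'))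
  have hR : AbsR Ψ (p ⋆ q) := by
    simpa [p, q] using (hs.absR.rm a).ln_fst (ln (rm j.toLinearMap b') s')
  have hL : AbsL Ψ (q ⋆ r) := by
    simpa [q, r] using ((hs.absL.rm b').ln_fst s').ln_snd (rm j.toLinearMap b)
  have hR' : AbsR Ψ (r ⋆ t) := by
    simpa [r, t] using (hs'.absR.ln_snd (rm s a)).ln_snd (rm j.toLinearMap b)
  have e1 : Ψ ((ph q r t)⁻¹ : (H ⊗[k] (H ⊗[k] (H ⊗[k] H)))ˣ) = b * cmp j s a b' s' := by
    have : (((ph q r t)⁻¹ : (H ⊗[k] (H ⊗[k] (H ⊗[k] H)))ˣ) : H ⊗[k] (H ⊗[k] (H ⊗[k] H))) =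
        (1 : H) ⊗ₜ (((Ph k H)⁻¹ : (H ⊗[k] (H ⊗[k] H))ˣ) : H ⊗[k] (H ⊗[k] H)) := by
      rw [← ph_std]
      change (((ph (iR.comp iL) (iR.comp (iR.comp iL)) (iR.comp (iR.comp iR)))⁻¹ : (H ⊗[k] (H ⊗[k] (H ⊗[k] H)))ˣ) : H ⊗[k] (H ⊗[k] (H ⊗[k] H))) =
        iR (((ph (iL : H →ₐ[k] H ⊗[k] (H ⊗[k] H)) (iR.comp iL) (iR.comp iR))⁻¹ :
          (H ⊗[k] (H ⊗[k] H))ˣ) : H ⊗[k] (H ⊗[k] H))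
      rw [map_ph_inv_val]
    rw [this]; simp [Ψ, cmp]
  have e2 : Ψ (ph p q r) = b' := by
    have h2 : pl p (pl q r) = Algebra.TensorProduct.map (AlgHom.id k H)
        (Algebra.TensorProduct.map (AlgHom.id k H) iL) := by
      ext <;> simp [p, q, r]
    have h3 : ∀ z, Ψ (Algebra.TensorProduct.map (AlgHom.id k H)
        (Algebra.TensorProduct.map (AlgHom.id k H) iL) z) =
        ln (rm j.toLinearMap b) (ln (rm s a) j.toLinearMap) z * b' := fun z => by
      induction z using TensorProduct.induction_on with
      | zero => simp
      | add x y hx hy => simp only [add_mul, map_add, hx, hy]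
      | tmul x w =>
        induction w using TensorProduct.induction_on with
        | zero => simp
        | add x y hx hy => simp only [add_mul, map_add, hx, hy, TensorProduct.tmul_add]
        | tmul y z => simp [Ψ, mul_assoc, hs'.one]
    rw [ph_val, h2, h3, hs.phi, one_mul]
  rw [← e1, ← ph_eq_ph_inv_of_right hR hL hR', e2]

/-- An element intertwining the antipodes `s'` and `s` and taking `a'` to `a` is the comparison
element. -/
theorem eq_cmp (hs' : IsAntipode j s' a' b') {w : B}
    (hw : ∀ h, w * s' h = s h * w) (ha : w * a' = a) : w = cmp j s a b' s' := by
  have key : ∀ z : H ⊗[k] (H ⊗[k] H), w * ln (rm s' a') (ln (rm j.toLinearMap b') s') z =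
      ln (rm s a) (ln (rm j.toLinearMap b') s') z := fun z => by
    induction z using TensorProduct.induction_on with
    | zero => simp
    | add x y hx hy => simp only [mul_add, map_add, hx, hy]
    | tmul x y =>
      simp only [ln_tmul, LinearMap.comp_apply, LinearMap.mulRight_apply]
      rw [← mul_assoc, ← mul_assoc, hw, mul_assoc (s x), ha]
  rw [cmp, ← key, hs'.phi_inv, mul_one]

theorem cmp_mul_cmp (hs : IsAntipode j s a b) (hs' : IsAntipode j s' a' b') :
    cmp j s a b' s' * cmp j s' a' b s = 1 := by
  have key : ∀ z : H ⊗[k] (H ⊗[k] H),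
      cmp j s a b' s' * ln (rm s' a') (ln (rm j.toLinearMap b) s) z =
      ln (rm s a) (ln (rm j.toLinearMap b) s) z := fun z => by
    induction z using TensorProduct.induction_on with
    | zero => simp
    | add x y hx hy => simp only [mul_add, map_add, hx, hy]
    | tmul x y =>
      simp only [ln_tmul, LinearMap.comp_apply, LinearMap.mulRight_apply]
      rw [← mul_assoc, ← mul_assoc, hs.cmp_mul hs', mul_assoc (s x), hs.cmp_mul_left hs']
  conv_lhs => rw [cmp.eq_def j s' a' b s, key]
  exact hs.phi_inv

end IsAntipode

end Antipode

/-! ### Words for the Drinfeld twist -/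

section TwistWords

variable {k : Type u} {H : Type v} [Field k] [Ring H] [Algebra k H] [QuasiBialgebra k H]
variable {A M : Type*} [Semiring A] [Algebra k A] [AddCommMonoid M] [Module k M]
variable {Ψ : A →ₗ[k] M}

/-- The element `A = (Φ ⊗ 1)(Δ ⊗ id ⊗ id)(Φ⁻¹)` placed on four strings. -/
def wA (p q r s : H →ₐ[k] A) [Comm p q] [Comm p r] [Comm p s] [Comm q r] [Comm q s] [Comm r s] :
    Aˣ := ph p q r * (ph (p ⋆ q) r s)⁻¹

/-- The element `B = (Δ ⊗ id ⊗ id)(Φ)(Φ⁻¹ ⊗ 1)` placed on four strings. -/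
def wB (p q r s : H →ₐ[k] A) [Comm p q] [Comm p r] [Comm p s] [Comm q r] [Comm q s] [Comm r s] :
    Aˣ := ph (p ⋆ q) r s * (ph p q r)⁻¹

variable {a b c d e f : H →ₐ[k] A} [Comm a b] [Comm a c] [Comm a d] [Comm a e] [Comm a f]
  [Comm b c] [Comm b d] [Comm b e] [Comm b f] [Comm c d] [Comm c e] [Comm c f]
  [Comm d e] [Comm d f] [Comm e f]

/-- Conjugating by `A` brings the strings `b ⋆ c` next to each other, where they are absorbed, and
then `a ⋆ d`. This is the word behind `(S ⊗ S)(Δᵒᵖ(h₁)) γ Δ(h₂) = ε(h) γ`. -/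
theorem wA_absorb (h1 : AbsL Ψ (b ⋆ c)) (h2 : AbsL Ψ (a ⋆ d)) (h : H) :
    Ψ (wA a b c d * ((a ⋆ b) ⋆ (c ⋆ d)) h) = eps k H h • Ψ (wA a b c d) := by
  have e1 : (wA a b c d : A) * ((a ⋆ b) ⋆ (c ⋆ d)) h = (a ⋆ (b ⋆ c) ⋆ d) h * wA a b c d := by
    have e2 : (ph a b c : A) * ((a ⋆ b ⋆ c) ⋆ d) h = (a ⋆ (b ⋆ c) ⋆ d) h * ph a b c :=
      intertwine_pr_left (fun h => (coassoc a b c h).symm) (fun _ => commute_ph _) h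
    rw [wA, Units.val_mul, mul_assoc, ← coassoc_inv, ← mul_assoc, e2, mul_assoc]
  have e3 := (h1.abs (L := 1) (T := (wA a b c d : A)) fun _ => Commute.one_left _).pr_right_left
    (a := a) (b := d) h
  rw [one_mul, one_mul] at e3
  rw [e1, e3, h2]

/-- The word behind `Δ(h₁) δ (S ⊗ S)(Δᵒᵖ(h₂)) = ε(h) δ`. -/
theorem wB_absorb (h1 : AbsR Ψ (b ⋆ c)) (h2 : AbsR Ψ (a ⋆ d)) (h : H) :
    Ψ (((a ⋆ b) ⋆ (c ⋆ d)) h * wB a b c d) = eps k H h • Ψ (wB a b c d) := by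
  have e1 : ((a ⋆ b) ⋆ (c ⋆ d)) h * (wB a b c d : A) = wB a b c d * (a ⋆ (b ⋆ c) ⋆ d) h := by
    have e2 : (((ph a b c)⁻¹ : Aˣ) : A) * (a ⋆ (b ⋆ c) ⋆ d) h =
        (a ⋆ b ⋆ c ⋆ d) h * ((ph a b c)⁻¹ : Aˣ) :=
      intertwine_pr_left (fun h => (coassoc_inv a b c h).symm) (fun _ => commute_ph_inv _) h
    rw [wB, Units.val_mul, ← mul_assoc, coassoc, mul_assoc, ← e2, mul_assoc]
  have e3 := (h1.abs (L := (wB a b c d : A)) (T := 1) fun _ => Commute.one_left _).pr_right_left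
    (a := a) (b := d) h
  rw [mul_one, mul_one] at e3
  rw [e1, e3, h2]

theorem commute_units {a b c a' b' c' : H →ₐ[k] A} [Comm a b] [Comm a c] [Comm b c]
    [Comm a' b'] [Comm a' c'] [Comm b' c'] [Comm a a'] [Comm a b'] [Comm a c'] [Comm b a']
    [Comm b b'] [Comm b c'] [Comm c a'] [Comm c b'] [Comm c c'] :
    Commute (ph a b c) (ph a' b' c') :=
  Units.ext (commute_ph (d := pl a' (pl b' c')) _).eq

/-- The word behind `Δ(X¹) δ (S ⊗ S)(Δᵒᵖ(X²)) γ Δ(X³) = 1`: six strings in two nested zigzags, which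
the pentagon and absorption separate into one copy of `Φ` on each zigzag. -/
theorem zigzag_word (l1 : AbsL Ψ (d ⋆ e)) (l2 : AbsL Ψ (c ⋆ f)) (r1 : AbsR Ψ (b ⋆ c))
    (r2 : AbsR Ψ (a ⋆ d)) :
    Ψ ((wA c d e f * ph (a ⋆ b) (c ⋆ d) (e ⋆ f) * wB a b c d : Aˣ) : A) =
      Ψ ((ph b c f * ph a d e : Aˣ) : A) := by
  -- `e1`, `e2`, `e4`, `e5` are pentagons solved for one factor and `e3` is naturality; between them the
  -- absorbed products of strings are erased from the factors that contain them.
  have e1 : wA c d e f * ph (a ⋆ b) (c ⋆ d) (e ⋆ f) * wB a b c d =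
      wA c d e f * (ph c d (e ⋆ f))⁻¹ * ph (a ⋆ b) c (d ⋆ (e ⋆ f)) * (ph a b c)⁻¹ *
        ph (a ⋆ (b ⋆ c)) d (e ⋆ f) * 1 := by
    have h1 : (ph a b c)⁻¹ * ph (a ⋆ (b ⋆ c)) d (e ⋆ f) = ph (a ⋆ b ⋆ c) d (e ⋆ f) * (ph a b c)⁻¹ :=
      Units.ext (intertwine_ph (fun h => (coassoc_inv a b c h).symm) (fun _ => commute_ph_inv _)
        (fun _ => commute_ph_inv _))
    have h2 := pentagon (a ⋆ b) c d (e ⋆ f)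
    rw [mul_one, mul_assoc _ (ph a b c)⁻¹, h1, wB]
    have h3 : ph (a ⋆ b) (c ⋆ d) (e ⋆ f) * ph (a ⋆ b) c d =
        (ph c d (e ⋆ f))⁻¹ * (ph (a ⋆ b) c (d ⋆ (e ⋆ f)) * ph (a ⋆ b ⋆ c) d (e ⋆ f)) := by
      rw [← h2]; group
    rw [mul_assoc, ← mul_assoc (ph (a ⋆ b) (c ⋆ d) (e ⋆ f)), h3]
    simp only [mul_assoc]
  have e2 : wA c d e f * (ph c d (e ⋆ f))⁻¹ = (ph c (d ⋆ e) f)⁻¹ * (ph d e f)⁻¹ := by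
    have := pentagon c d e f
    have h3 : ph c d (e ⋆ f) = ph d e f * ph c (d ⋆ e) f * ph c d e * (ph (c ⋆ d) e f)⁻¹ := by
      rw [this]; group
    rw [wA, h3]; group
  have e3 : (ph d e f)⁻¹ * ph (a ⋆ b) c (d ⋆ (e ⋆ f)) = ph (a ⋆ b) c (d ⋆ e ⋆ f) * (ph d e f)⁻¹ :=
    Units.ext (intertwine_ph (fun _ => commute_ph_inv _) (fun _ => commute_ph_inv _)
      (fun h => (coassoc_inv d e f h).symm))
  have e4 : ph (a ⋆ b) c f * (ph a b c)⁻¹ = (ph a b (c ⋆ f))⁻¹ * ph b c f * ph a (b ⋆ c) f := by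
    have h3 := pentagon a b c f
    have h4 : ph (a ⋆ b) c f = (ph a b (c ⋆ f))⁻¹ * (ph b c f * ph a (b ⋆ c) f * ph a b c) := by
      rw [h3]; group
    rw [h4]; group
  have e5 : (ph d e f)⁻¹ * ph a d (e ⋆ f) = ph a (d ⋆ e) f * ph a d e * (ph (a ⋆ d) e f)⁻¹ := by
    have h3 := pentagon a d e f
    have h4 : ph a d (e ⋆ f) = ph d e f * ph a (d ⋆ e) f * ph a d e * (ph (a ⋆ d) e f)⁻¹ := by
      rw [h3]; group
    rw [h4]; group
  have c1 : (ph d e f)⁻¹ * (ph a b c)⁻¹ = (ph a b c)⁻¹ * (ph d e f)⁻¹ :=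
    (commute_units.inv_inv).eq
  rw [e1]
  calc _ = Ψ (((wA c d e f * (ph c d (e ⋆ f))⁻¹ * ph (a ⋆ b) c (d ⋆ (e ⋆ f)) * (ph a b c)⁻¹ : Aˣ) :
            A) * ph a d (e ⋆ f) * 1) := by
        rw [← (r1.abs fun _ => Commute.one_left _).ph_fst_right.1]; simp [mul_assoc]
    _ = Ψ (1 * ((ph c (d ⋆ e) f)⁻¹ : Aˣ) * ((ph (a ⋆ b) c (d ⋆ e ⋆ f) * (ph d e f)⁻¹ *
          (ph a b c)⁻¹ * ph a d (e ⋆ f) : Aˣ) : A)) := by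
        rw [e2, mul_assoc (ph c (d ⋆ e) f)⁻¹, e3]; simp [mul_assoc]
    _ = Ψ (1 * ph (a ⋆ b) c (d ⋆ e ⋆ f) * (((ph d e f)⁻¹ *
          (ph a b c)⁻¹ * ph a d (e ⋆ f) : Aˣ) : A)) := by
        rw [(l1.abs fun _ => Commute.one_left _).ph_snd.2]; simp [mul_assoc]
    _ = Ψ (1 * ph (a ⋆ b) c f * (((ph d e f)⁻¹ * (ph a b c)⁻¹ * ph a d (e ⋆ f) : Aˣ) : A)) := by
        rw [(l1.abs fun _ => Commute.one_left _).ph_thd_left.1]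
    _ = Ψ (1 * ((ph a b (c ⋆ f))⁻¹ : Aˣ) * ((ph b c f * ph a (b ⋆ c) f *
          (ph a (d ⋆ e) f * ph a d e * (ph (a ⋆ d) e f)⁻¹) : Aˣ) : A)) := by
        rw [one_mul, one_mul, ← Units.val_mul, ← Units.val_mul, c1, mul_assoc (ph a b c)⁻¹, e5,
          ← mul_assoc (ph (a ⋆ b) c f), e4]
        simp only [mul_assoc]
    _ = Ψ (((ph b c f * ph a (b ⋆ c) f * (ph a (d ⋆ e) f * ph a d e) : Aˣ) : A) *
          ((ph (a ⋆ d) e f)⁻¹ : Aˣ) * 1) := by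
        rw [(l2.abs fun _ => Commute.one_left _).ph_thd.2]; simp [mul_assoc]
    _ = Ψ ((ph b c f * ph a (b ⋆ c) f : Aˣ) * ph a (d ⋆ e) f * (ph a d e : A)) := by
        rw [(r2.abs fun _ => Commute.one_left _).ph_fst.2]; simp [mul_assoc]
    _ = Ψ (ph b c f * ph a (b ⋆ c) f * (ph a d e : A)) := by
        rw [(l1.abs fun _ => by simpa using (commute_ph _).mul_left (commute_ph _)).ph_snd.1]; simp
    _ = _ := by
        rw [(r1.abs fun _ => commute_ph _).ph_snd.1]; simp

/-- The word behind `(S ⊗ S)(Δᵒᵖ(x¹)) γ Δ(x²) δ (S ⊗ S)(Δᵒᵖ(x³)) = 1`, where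
`Φ⁻¹ = x¹ ⊗ x² ⊗ x³`. -/
theorem zigzag_inv_word (l1 : AbsL Ψ (b ⋆ c)) (l2 : AbsL Ψ (a ⋆ d)) (r1 : AbsR Ψ (d ⋆ e))
    (r2 : AbsR Ψ (c ⋆ f)) :
    Ψ ((wA a b c d * (ph (a ⋆ b) (c ⋆ d) (e ⋆ f))⁻¹ * wB c d e f : Aˣ) : A) =
      Ψ (((ph a d e)⁻¹ * (ph b c f)⁻¹ : Aˣ) : A) := by
  have e1 : (ph (a ⋆ b) c d)⁻¹ * (ph (a ⋆ b) (c ⋆ d) (e ⋆ f))⁻¹ =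
      (ph (a ⋆ b ⋆ c) d (e ⋆ f))⁻¹ * (ph (a ⋆ b) c (d ⋆ (e ⋆ f)))⁻¹ * ph c d (e ⋆ f) := by
    have h := pentagon (a ⋆ b) c d (e ⋆ f)
    have h1 : ph (a ⋆ b ⋆ c) d (e ⋆ f) = (ph (a ⋆ b) c (d ⋆ (e ⋆ f)))⁻¹ *
      (ph c d (e ⋆ f) * ph (a ⋆ b) (c ⋆ d) (e ⋆ f) * ph (a ⋆ b) c d) := by rw [h]; group
    rw [h1]; group
  have e2 : ph c d (e ⋆ f) * ph (c ⋆ d) e f * (ph c d e)⁻¹ = ph d e f * ph c (d ⋆ e) f := by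
    rw [← pentagon]; group
  have e3 : ph a b c * (ph (a ⋆ b ⋆ c) d (e ⋆ f))⁻¹ = (ph (a ⋆ (b ⋆ c)) d (e ⋆ f))⁻¹ * ph a b c :=
    Units.ext (intertwine_ph_inv (fun h => (coassoc a b c h).symm) (fun _ => commute_ph _)
      (fun _ => commute_ph _))
  have e4 : (ph (a ⋆ b) c (d ⋆ (e ⋆ f)))⁻¹ * ph d e f = ph d e f * (ph (a ⋆ b) c (d ⋆ e ⋆ f))⁻¹ :=
    Units.ext (intertwine_ph_inv (fun _ => commute_ph _) (fun _ => commute_ph _)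
      (fun h => (coassoc d e f h).symm)).symm
  have e5 : ph a b c * (ph (a ⋆ b) c f)⁻¹ = (ph a (b ⋆ c) f)⁻¹ * (ph b c f)⁻¹ * ph a b (c ⋆ f) := by
    have h := pentagon a b c f
    have h1 : ph (a ⋆ b) c f = (ph a b (c ⋆ f))⁻¹ * (ph b c f * ph a (b ⋆ c) f * ph a b c) := by
      rw [h]; group
    rw [h1]; group
  have e6 : (ph a d (e ⋆ f))⁻¹ * ph d e f = ph (a ⋆ d) e f * (ph a d e)⁻¹ * (ph a (d ⋆ e) f)⁻¹ := by
    have h := pentagon a d e f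
    have h1 : ph a d (e ⋆ f) = ph d e f * ph a (d ⋆ e) f * ph a d e * (ph (a ⋆ d) e f)⁻¹ := by
      rw [h]; group
    rw [h1]; group
  have c1 : ph a b c * ph d e f = ph d e f * ph a b c := commute_units.eq
  calc _ = Ψ (1 * ((ph (a ⋆ (b ⋆ c)) d (e ⋆ f))⁻¹ : Aˣ) * ((ph a b c *
          (ph (a ⋆ b) c (d ⋆ (e ⋆ f)))⁻¹ * ph d e f * ph c (d ⋆ e) f : Aˣ) : A)) := by
        rw [one_mul, ← Units.val_mul]
        congr 2
        rw [wA, wB, mul_assoc (ph a b c), e1, mul_assoc _ (ph d e f), ← e2]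
        simp only [← mul_assoc]; rw [← e3]
    _ = Ψ (((((ph a d (e ⋆ f))⁻¹ * ph a b c * (ph (a ⋆ b) c (d ⋆ (e ⋆ f)))⁻¹ * ph d e f : Aˣ) : A) *
          ph c (d ⋆ e) f * 1)) := by
        rw [(l1.abs fun _ => Commute.one_left _).ph_fst_right.2]; simp [mul_assoc]
    _ = Ψ ((((ph a d (e ⋆ f))⁻¹ * ph a b c * ph d e f : Aˣ) : A) *
          ((ph (a ⋆ b) c (d ⋆ e ⋆ f))⁻¹ : Aˣ) * 1) := by
        rw [(r1.abs fun _ => Commute.one_left _).ph_snd.1, mul_one, mul_one, mul_assoc _ _ (ph d e f),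
          e4, ← Units.val_mul]
        simp only [mul_assoc]
    _ = Ψ ((((ph a d (e ⋆ f))⁻¹ * ph a b c * ph d e f : Aˣ) : A) *
          ((ph (a ⋆ b) c f)⁻¹ : Aˣ) * 1) := by
        rw [(r1.abs fun _ => Commute.one_left _).ph_thd_left.2]
    _ = Ψ (((ph (a ⋆ d) e f * (ph a d e)⁻¹ * (ph a (d ⋆ e) f)⁻¹ * (ph a (b ⋆ c) f)⁻¹ * (ph b c f)⁻¹ :
          Aˣ) : A) * ph a b (c ⋆ f) * 1) := by
        rw [mul_one, mul_one, ← Units.val_mul, ← Units.val_mul]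
        congr 2
        rw [mul_assoc _ (ph a b c), c1, ← mul_assoc, e6, mul_assoc _ (ph a b c), e5]
        simp only [mul_assoc]
    _ = Ψ (1 * ph (a ⋆ d) e f * (((ph a d e)⁻¹ * (ph a (d ⋆ e) f)⁻¹ * (ph a (b ⋆ c) f)⁻¹ *
          (ph b c f)⁻¹ : Aˣ) : A)) := by
        rw [(r2.abs fun _ => Commute.one_left _).ph_thd.1]; simp [mul_assoc]
    _ = Ψ ((((ph a d e)⁻¹ * (ph a (d ⋆ e) f)⁻¹ : Aˣ) : A) * ((ph a (b ⋆ c) f)⁻¹ : Aˣ) *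
          ((ph b c f)⁻¹ : Aˣ)) := by
        rw [(l2.abs fun _ => Commute.one_left _).ph_fst.1]; simp [mul_assoc]
    _ = Ψ ((((ph a d e)⁻¹ : Aˣ) : A) * ((ph a (d ⋆ e) f)⁻¹ : Aˣ) * ((ph b c f)⁻¹ : Aˣ)) := by
        rw [(l1.abs fun _ => by
          simpa using (commute_ph_inv _).mul_left (commute_ph_inv _)).ph_snd.2]; simp
    _ = _ := by
        rw [(r1.abs fun _ => commute_ph_inv _).ph_snd.2]; simp

end TwistWords

/-! ### The Drinfeld twist -/

section Induction

variable {k : Type*} [Field k] {X Y Z W : Type*} [AddCommMonoid X] [Module k X] [AddCommMonoid Y]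
  [Module k Y] [AddCommMonoid Z] [Module k Z] [AddCommMonoid W] [Module k W]

@[elab_as_elim]
theorem tensor3_induction {P : X ⊗[k] (Y ⊗[k] Z) → Prop} (t : X ⊗[k] (Y ⊗[k] Z)) (zero : P 0)
    (tmul : ∀ x y z, P (x ⊗ₜ (y ⊗ₜ z))) (add : ∀ s t, P s → P t → P (s + t)) : P t := by
  induction t using TensorProduct.induction_on with
  | zero => exact zero
  | add x y hx hy => exact add _ _ hx hy
  | tmul x y =>
    induction y using TensorProduct.induction_on with
    | zero => simpa using zero
    | add y z hy hz => simpa [TensorProduct.tmul_add] using add _ _ hy hz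
    | tmul y z => exact tmul x y z

@[elab_as_elim]
theorem tensor22_induction {P : (X ⊗[k] Y) ⊗[k] (Z ⊗[k] W) → Prop}
    (t : (X ⊗[k] Y) ⊗[k] (Z ⊗[k] W)) (zero : P 0)
    (tmul : ∀ x y z w, P ((x ⊗ₜ y) ⊗ₜ (z ⊗ₜ w))) (add : ∀ s t, P s → P t → P (s + t)) : P t := by
  induction t using tensor3_induction with
  | zero => exact zero
  | add x y hx hy => exact add _ _ hx hy
  | tmul x z w =>
    induction x using TensorProduct.induction_on with
    | zero => simpa using zero
    | add y z hy hz => simpa [TensorProduct.add_tmul] using add _ _ hy hz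
    | tmul y z => exact tmul _ _ _ _

@[elab_as_elim]
theorem tensor4_induction {P : X ⊗[k] (Y ⊗[k] (Z ⊗[k] W)) → Prop}
    (t : X ⊗[k] (Y ⊗[k] (Z ⊗[k] W))) (zero : P 0)
    (tmul : ∀ x y z w, P (x ⊗ₜ (y ⊗ₜ (z ⊗ₜ w)))) (add : ∀ s t, P s → P t → P (s + t)) : P t := by
  induction t using tensor3_induction with
  | zero => exact zero
  | add x y hx hy => exact add _ _ hx hy
  | tmul x y z =>
    induction z using TensorProduct.induction_on with
    | zero => simpa using zero
    | add y z hy hz => simpa [TensorProduct.tmul_add] using add _ _ hy hz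
    | tmul y z => exact tmul _ _ _ _

end Induction

section Twist

variable {k : Type u} {H : Type v} [Field k] [Ring H] [Algebra k H]

theorem IsAntipode.comp [QuasiBialgebra k H] {B C : Type*} [Semiring B] [Algebra k B] [Semiring C]
    [Algebra k C] {j : H →ₐ[k] B} {s : H →ₗ[k] B} {a b : B} (hs : IsAntipode j s a b)
    (F : B →ₐ[k] C) : IsAntipode (F.comp j) (F.toLinearMap ∘ₗ s) (F a) (F b) := by
  have h2 : ∀ t, ln (rm (F.toLinearMap ∘ₗ s) (F a)) (F.comp j).toLinearMap t =
      F (ln (rm s a) j.toLinearMap t) := fun t => by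
    induction t using TensorProduct.induction_on with
    | zero => simp
    | add x y hx hy => simp only [map_add, hx, hy]
    | tmul x y => simp
  have h2' : ∀ t, ln (rm (F.comp j).toLinearMap (F b)) (F.toLinearMap ∘ₗ s) t =
      F (ln (rm j.toLinearMap b) s t) := fun t => by
    induction t using TensorProduct.induction_on with
    | zero => simp
    | add x y hx hy => simp only [map_add, hx, hy]
    | tmul x y => simp
  have h3 : ∀ t, ln (rm (F.comp j).toLinearMap (F b))
      (ln (rm (F.toLinearMap ∘ₗ s) (F a)) (F.comp j).toLinearMap) t =
      F (ln (rm j.toLinearMap b) (ln (rm s a) j.toLinearMap) t) := fun t => by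
    induction t using tensor3_induction with
    | zero => simp
    | add x y hx hy => simp only [map_add, hx, hy]
    | tmul x y z => simp
  have h3' : ∀ t, ln (rm (F.toLinearMap ∘ₗ s) (F a))
      (ln (rm (F.comp j).toLinearMap (F b)) (F.toLinearMap ∘ₗ s)) t =
      F (ln (rm s a) (ln (rm j.toLinearMap b) s) t) := fun t => by
    induction t using tensor3_induction with
    | zero => simp
    | add x y hx hy => simp only [map_add, hx, hy]
    | tmul x y z => simp
  constructor
  · simp [hs.one]
  · intro x y; simp [hs.mul]
  · intro h; rw [h2, hs.left, map_smul]
  · intro h; rw [h2', hs.right, map_smul]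
  · rw [h3, hs.phi, map_one]
  · rw [h3', hs.phi_inv, map_one]

variable [QuasiHopfAlgebra k H]

variable (k H) in
/-- `a ⊗ b ↦ S(a) α b`. -/
abbrev lineA : H ⊗[k] H →ₗ[k] H := ln (rm (An k H) (al k H)) (AlgHom.id k H).toLinearMap

variable (k H) in
/-- `a ⊗ b ↦ a β S(b)`. -/
abbrev lineB : H ⊗[k] H →ₗ[k] H := ln (rm (AlgHom.id k H).toLinearMap (be k H)) (An k H)

variable (k H) in
/-- `a ⊗ b ⊗ c ↦ S(a) α b β S(c)`. -/
abbrev lineAB : H ⊗[k] (H ⊗[k] H) →ₗ[k] H :=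
  ln (rm (An k H) (al k H)) (ln (rm (AlgHom.id k H).toLinearMap (be k H)) (An k H))

variable (k H) in
/-- `a ⊗ b ⊗ c ↦ a β S(b) α c`. -/
abbrev lineBA : H ⊗[k] (H ⊗[k] H) →ₗ[k] H :=
  ln (rm (AlgHom.id k H).toLinearMap (be k H)) (ln (rm (An k H) (al k H)) (AlgHom.id k H).toLinearMap)

variable (k H) in
theorem isAntipode_id : IsAntipode (AlgHom.id k H) (An k H) (al k H) (be k H) where
  one := QuasiHopfAlgebra.S_one
  mul := QuasiHopfAlgebra.S_mul
  left := QuasiHopfAlgebra.S_alpha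
  right := QuasiHopfAlgebra.beta_S
  phi := QuasiHopfAlgebra.Phi_S
  phi_inv := QuasiHopfAlgebra.PhiInv_S

theorem An_one : An k H 1 = 1 := QuasiHopfAlgebra.S_one

theorem An_mul (x y : H) : An k H (x * y) = An k H y * An k H x := QuasiHopfAlgebra.S_mul x y

theorem lineA_absL : AbsL (lineA k H) (iL ⋆ iR) := (isAntipode_id k H).absL

theorem lineB_absR : AbsR (lineB k H) (iL ⋆ iR) := (isAntipode_id k H).absR

theorem lineAB_absL : AbsL (lineAB k H) (iL ⋆ iR.comp iL) :=
  ((isAntipode_id k H).absL.rm _).ln_fst _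

theorem lineAB_absR : AbsR (lineAB k H) (iR.comp iL ⋆ iR.comp iR) := by
  have h := (isAntipode_id k H).absR.ln_snd (rm (An k H) (al k H))
  rw [comp_pr] at h; exact h

theorem lineBA_absR : AbsR (lineBA k H) (iL ⋆ iR.comp iL) :=
  ((isAntipode_id k H).absR.rm _).ln_fst _

theorem lineBA_absL : AbsL (lineBA k H) (iR.comp iL ⋆ iR.comp iR) := by
  have h := (isAntipode_id k H).absL.ln_snd (rm (AlgHom.id k H).toLinearMap (be k H))
  rw [comp_pr] at h; exact h

/-- `γ` is obtained from the word `A` by closing its two inner and its two outer strings to lines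
`S(a) α b`. -/
theorem gam_eq : gam k H = TensorProduct.map (lineA k H) (lineA k H)
    (wA (iR.comp iL) (iL.comp iL) (iL.comp iR) (iR.comp iR) : ((H ⊗[k] H) ⊗[k] (H ⊗[k] H))ˣ) := by
  have h : ∀ t, regroup k H t =
      pl (iR.comp iL) (pl (iL.comp iL) (pl (iL.comp iR) (iR.comp iR))) t := fun t => by
    induction t using tensor4_induction with
    | zero => simp
    | add x y hx hy => simp only [map_add, hx, hy]
    | tmul x y z w => simp [regroup]
  rw [gam, h, elA, map_mul, pl_tensorOne, pl_comulFst]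
  rfl

/-- `δ` is obtained from the word `B` by closing its outer and its inner strings to lines
`a β S(b)`. -/
theorem del_eq : del k H = TensorProduct.map (lineB k H) (lineB k H)
    (wB (iL.comp iL) (iR.comp iL) (iR.comp iR) (iL.comp iR) : ((H ⊗[k] H) ⊗[k] (H ⊗[k] H))ˣ) := by
  have h : ∀ t, regroup' k H t =
      pl (iL.comp iL) (pl (iR.comp iL) (pl (iR.comp iR) (iL.comp iR))) t := fun t => by
    induction t using tensor4_induction with
    | zero => simp
    | add x y hx hy => simp only [map_add, hx, hy]
    | tmul x y z w => simp [regroup', regroup]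
  rw [del, h, elB, map_mul, pl_tensorOne, pl_comulFst]
  rfl

theorem SSop_mul (x y : H) : SSop k H (x * y) = SSop k H y * SSop k H x := by
  simp only [SSop, LinearMap.comp_apply, AlgHom.toLinearMap_apply, map_mul]
  generalize Dl k H x = s
  generalize Dl k H y = t
  induction s using TensorProduct.induction_on with
  | zero => simp
  | add x y hx hy => simp only [map_add, hx, hy, add_mul, mul_add]
  | tmul a b =>
    induction t using TensorProduct.induction_on with
    | zero => simp
    | add x y hx hy => simp only [map_add, hx, hy, add_mul, mul_add]
    | tmul c d => simp [An_mul]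

theorem SSop_one : SSop k H 1 = 1 := by
  simp [SSop, Algebra.TensorProduct.one_def, QuasiHopfAlgebra.S_one]

end Twist

/-! ### The antipode along the comultiplication -/

section TwistAntipode

variable {k : Type u} {H : Type v} [Field k] [Ring H] [Algebra k H]

theorem map_wA_val [QuasiBialgebra k H] {A B : Type*} [Semiring A] [Algebra k A] [Semiring B]
    [Algebra k B] (F : A →ₐ[k] B) (p q r s : H →ₐ[k] A) [Comm p q] [Comm p r] [Comm p s] [Comm q r]
    [Comm q s] [Comm r s] :
    F (wA p q r s : A) = wA (F.comp p) (F.comp q) (F.comp r) (F.comp s) := by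
  simp [wA]

theorem map_wB_val [QuasiBialgebra k H] {A B : Type*} [Semiring A] [Algebra k A] [Semiring B]
    [Algebra k B] (F : A →ₐ[k] B) (p q r s : H →ₐ[k] A) [Comm p q] [Comm p r] [Comm p s] [Comm q r]
    [Comm q s] [Comm r s] :
    F (wB p q r s : A) = wB (F.comp p) (F.comp q) (F.comp r) (F.comp s) := by
  simp [wB]

variable [QuasiHopfAlgebra k H]

variable (k H) in
/-- `a ⊗ b ↦ S(b) ⊗ S(a)`. -/
def flipS : H ⊗[k] H →ₗ[k] H ⊗[k] H :=
  TensorProduct.map (An k H) (An k H) ∘ₗ (TensorProduct.comm k H H).toLinearMap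

@[simp] theorem flipS_tmul (x y : H) : flipS k H (x ⊗ₜ y) = An k H y ⊗ₜ An k H x := rfl

theorem SSop_apply (h : H) : SSop k H h = flipS k H (Dl k H h) := rfl

/-- Multiplication around a pair of lines is multiplication of the word by beads on its strings. -/
theorem flipS_lineA (s t : H ⊗[k] H) (W : (H ⊗[k] H) ⊗[k] (H ⊗[k] H)) :
    flipS k H s * TensorProduct.map (lineA k H) (lineA k H) W * t =
      TensorProduct.map (lineA k H) (lineA k H)
        (W * (pl (iR.comp iL) (iL.comp iL) s * pl (iL.comp iR) (iR.comp iR) t)) := by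
  induction W using tensor22_induction with
  | zero => simp
  | add x y hx hy => simp only [map_add, add_mul, mul_add, hx, hy]
  | tmul a b c d =>
    induction s using TensorProduct.induction_on with
    | zero => simp
    | add x y hx hy => simp only [map_add, add_mul, mul_add, hx, hy]
    | tmul x y =>
      induction t using TensorProduct.induction_on with
      | zero => simp
      | add x y hx hy => simp only [map_add, mul_add, hx, hy]
      | tmul z w => simp [QuasiHopfAlgebra.S_mul, mul_assoc]

theorem flipS_lineB (s t : H ⊗[k] H) (W : (H ⊗[k] H) ⊗[k] (H ⊗[k] H)) :
    s * TensorProduct.map (lineB k H) (lineB k H) W * flipS k H t =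
      TensorProduct.map (lineB k H) (lineB k H)
        (pl (iL.comp iL) (iR.comp iL) s * pl (iR.comp iR) (iL.comp iR) t * W) := by
  induction W using tensor22_induction with
  | zero => simp
  | add x y hx hy => simp only [map_add, add_mul, mul_add, hx, hy]
  | tmul a b c d =>
    induction s using TensorProduct.induction_on with
    | zero => simp
    | add x y hx hy => simp only [map_add, add_mul, hx, hy]
    | tmul x y =>
      induction t using TensorProduct.induction_on with
      | zero => simp
      | add x y hx hy => simp only [map_add, add_mul, mul_add, hx, hy]
      | tmul z w => simp [An_mul, mul_assoc]

theorem SSop_gam (h : H) : ln (rm (SSop k H) (gam k H)) (Dl k H).toLinearMap (Dl k H h) =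
    eps k H h • gam k H := by
  have key : ∀ t, ln (rm (SSop k H) (gam k H)) (Dl k H).toLinearMap t =
      TensorProduct.map (lineA k H) (lineA k H)
        ((wA (iR.comp iL) (iL.comp iL) (iL.comp iR) (iR.comp iR) : ((H ⊗[k] H) ⊗[k] (H ⊗[k] H))ˣ) *
          pl ((iR.comp iL) ⋆ (iL.comp iL)) ((iL.comp iR) ⋆ (iR.comp iR)) t) := fun t => by
    induction t using TensorProduct.induction_on with
    | zero => simp
    | add x y hx hy => simp only [map_add, mul_add, hx, hy]
    | tmul x y =>
      rw [pl_tmul, pr_apply, pr_apply, ← flipS_lineA, ← gam_eq]; rfl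
  rw [key, ← pr_apply, wA_absorb, gam_eq]
  · have h := (lineA_absL (k := k) (H := H)).map_fst (lineA k H)
    rw [comp_pr] at h; exact h
  · have h := (lineA_absL (k := k) (H := H)).map_snd (lineA k H)
    rw [comp_pr] at h; exact h

theorem del_SSop (h : H) : ln (rm (Dl k H).toLinearMap (del k H)) (SSop k H) (Dl k H h) =
    eps k H h • del k H := by
  have key : ∀ t, ln (rm (Dl k H).toLinearMap (del k H)) (SSop k H) t =
      TensorProduct.map (lineB k H) (lineB k H)
        (pl ((iL.comp iL) ⋆ (iR.comp iL)) ((iR.comp iR) ⋆ (iL.comp iR)) t *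
        (wB (iL.comp iL) (iR.comp iL) (iR.comp iR) (iL.comp iR) :
          ((H ⊗[k] H) ⊗[k] (H ⊗[k] H))ˣ)) := fun t => by
    induction t using TensorProduct.induction_on with
    | zero => simp
    | add x y hx hy => simp only [map_add, add_mul, hx, hy]
    | tmul x y =>
      rw [pl_tmul, pr_apply, pr_apply, ← flipS_lineB, ← del_eq]; rfl
  rw [key, ← pr_apply, wB_absorb, del_eq]
  · have h := (lineB_absR (k := k) (H := H)).map_snd (lineB k H)
    rw [comp_pr] at h; exact h
  · have h := (lineB_absR (k := k) (H := H)).map_fst (lineB k H)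
    rw [comp_pr] at h; exact h

section Zigzag

variable (k H)

/-- The first bead of a three-bead line. -/
abbrev i1 : H →ₐ[k] H ⊗[k] (H ⊗[k] H) := iL
/-- The middle bead of a three-bead line. -/
abbrev i2 : H →ₐ[k] H ⊗[k] (H ⊗[k] H) := iR.comp iL
/-- The last bead of a three-bead line. -/
abbrev i3 : H →ₐ[k] H ⊗[k] (H ⊗[k] H) := iR.comp iR

end Zigzag

/-- A bead of the first of two three-bead lines. -/
abbrev fst3 : H ⊗[k] (H ⊗[k] H) →ₐ[k] (H ⊗[k] (H ⊗[k] H)) ⊗[k] (H ⊗[k] (H ⊗[k] H)) := iL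
/-- A bead of the second of two three-bead lines. -/
abbrev snd3 : H ⊗[k] (H ⊗[k] H) →ₐ[k] (H ⊗[k] (H ⊗[k] H)) ⊗[k] (H ⊗[k] (H ⊗[k] H)) := iR

theorem iR_mul_iL {X Y : Type*} [Semiring X] [Algebra k X] [Semiring Y] [Algebra k Y] (x : X)
    (y : Y) : (iR y : X ⊗[k] Y) * (iL x : X ⊗[k] Y) = x ⊗ₜ y := by
  simp

section WordExt

variable {A R : Type*} [Semiring A] [Algebra k A] [Semiring R] [Algebra k R] {Ψ : A →ₗ[k] R}
  {σ τ υ : H ⊗[k] H →ₗ[k] R} {f g : (H ⊗[k] H) ⊗[k] (H ⊗[k] H) →ₗ[k] R}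
  {σ' τ' υ' : H ⊗[k] H →ₗ[k] A} {f' g' : (H ⊗[k] H) ⊗[k] (H ⊗[k] H) →ₗ[k] A}

/-- Multilinear expressions in words agree if they agree on pure tensors. All algebras are abstract
here; the lemma is applied to concrete iterated tensor products. -/
theorem word_ext (key : ∀ x y z w z' w' a b c d a' b' c' d' : H,
      σ (x ⊗ₜ y) * f ((a' ⊗ₜ b') ⊗ₜ (c' ⊗ₜ d')) *
        (τ (z ⊗ₜ w) * g ((a ⊗ₜ b) ⊗ₜ (c ⊗ₜ d)) * υ (z' ⊗ₜ w')) =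
      Ψ (g' ((a ⊗ₜ b) ⊗ₜ (c ⊗ₜ d)) * (σ' (x ⊗ₜ y) * (τ' (z ⊗ₜ w) * υ' (z' ⊗ₜ w'))) *
        f' ((a' ⊗ₜ b') ⊗ₜ (c' ⊗ₜ d'))))
    (s t u : H ⊗[k] H) (V W : (H ⊗[k] H) ⊗[k] (H ⊗[k] H)) :
    σ s * f V * (τ t * g W * υ u) = Ψ (g' W * (σ' s * (τ' t * υ' u)) * f' V) := by
  induction W using tensor22_induction with
  | zero => simp only [map_zero, zero_mul, mul_zero]
  | add x y hx hy => simp only [map_add, add_mul, mul_add, hx, hy]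
  | tmul a b c d =>
  induction V using tensor22_induction with
  | zero => simp only [map_zero, zero_mul, mul_zero]
  | add x y hx hy => simp only [map_add, add_mul, mul_add, hx, hy]
  | tmul a' b' c' d' =>
  induction s using TensorProduct.induction_on with
  | zero => simp only [map_zero, zero_mul, mul_zero]
  | add x y hx hy => simp only [map_add, add_mul, mul_add, hx, hy]
  | tmul x y =>
  induction t using TensorProduct.induction_on with
  | zero => simp only [map_zero, zero_mul, mul_zero]
  | add x y hx hy => simp only [map_add, add_mul, mul_add, hx, hy]
  | tmul z w =>
  induction u using TensorProduct.induction_on with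
  | zero => simp only [map_zero, zero_mul, mul_zero]
  | add x y hx hy => simp only [map_add, add_mul, mul_add, hx, hy]
  | tmul z' w' => exact key ..

theorem word_ext' (key : ∀ x y z w z' w' a b c d a' b' c' d' : H,
      σ (x ⊗ₜ y) * f ((a' ⊗ₜ b') ⊗ₜ (c' ⊗ₜ d')) *
        (τ (z ⊗ₜ w) * g ((a ⊗ₜ b) ⊗ₜ (c ⊗ₜ d)) * υ (z' ⊗ₜ w')) =
      Ψ (f' ((a' ⊗ₜ b') ⊗ₜ (c' ⊗ₜ d')) * (σ' (x ⊗ₜ y) * (τ' (z ⊗ₜ w) * υ' (z' ⊗ₜ w'))) *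
        g' ((a ⊗ₜ b) ⊗ₜ (c ⊗ₜ d))))
    (s t u : H ⊗[k] H) (V W : (H ⊗[k] H) ⊗[k] (H ⊗[k] H)) :
    σ s * f V * (τ t * g W * υ u) = Ψ (f' V * (σ' s * (τ' t * υ' u)) * g' W) := by
  induction W using tensor22_induction with
  | zero => simp only [map_zero, zero_mul, mul_zero]
  | add x y hx hy => simp only [map_add, add_mul, mul_add, hx, hy]
  | tmul a b c d =>
  induction V using tensor22_induction with
  | zero => simp only [map_zero, zero_mul, mul_zero]
  | add x y hx hy => simp only [map_add, add_mul, mul_add, hx, hy]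
  | tmul a' b' c' d' =>
  induction s using TensorProduct.induction_on with
  | zero => simp only [map_zero, zero_mul, mul_zero]
  | add x y hx hy => simp only [map_add, add_mul, mul_add, hx, hy]
  | tmul x y =>
  induction t using TensorProduct.induction_on with
  | zero => simp only [map_zero, zero_mul, mul_zero]
  | add x y hx hy => simp only [map_add, add_mul, mul_add, hx, hy]
  | tmul z w =>
  induction u using TensorProduct.induction_on with
  | zero => simp only [map_zero, zero_mul, mul_zero]
  | add x y hx hy => simp only [map_add, add_mul, mul_add, hx, hy]
  | tmul z' w' => exact key ..

theorem word3_ext {F : H ⊗[k] (H ⊗[k] H) →ₗ[k] R} {p q r : H →ₐ[k] A} [Comm p q] [Comm p r]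
    [Comm q r] {L T : A} (key : ∀ x y z, F (x ⊗ₜ (y ⊗ₜ z)) = Ψ (L * (p x * (q y * r z)) * T))
    (z : H ⊗[k] (H ⊗[k] H)) : F z = Ψ (L * pl p (pl q r) z * T) := by
  induction z using tensor3_induction with
  | zero => simp only [map_zero, mul_zero, zero_mul]
  | add x y hx hy => simp only [map_add, mul_add, add_mul, hx, hy]
  | tmul x y z => rw [key, pl_tmul, pl_tmul]

/-- `zigzag_word` for an expression `F` that becomes the zigzag word on pure tensors. -/
theorem zigzag_word_ext {F : H ⊗[k] (H ⊗[k] H) →ₗ[k] R} {a b c d e f : H →ₐ[k] A} [Comm a b]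
    [Comm a c] [Comm a d] [Comm a e] [Comm a f] [Comm b c] [Comm b d] [Comm b e] [Comm b f]
    [Comm c d] [Comm c e] [Comm c f] [Comm d e] [Comm d f] [Comm e f]
    (key : ∀ x y z, F (x ⊗ₜ (y ⊗ₜ z)) =
      Ψ (wA c d e f * ((a ⋆ b) x * ((c ⋆ d) y * (e ⋆ f) z)) * wB a b c d))
    (l1 : AbsL Ψ (d ⋆ e)) (l2 : AbsL Ψ (c ⋆ f)) (r1 : AbsR Ψ (b ⋆ c)) (r2 : AbsR Ψ (a ⋆ d)) :
    F (Ph k H : H ⊗[k] (H ⊗[k] H)) = Ψ (ph b c f * ph a d e) := by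
  rw [word3_ext key, ← ph_val, ← Units.val_mul, ← Units.val_mul, zigzag_word l1 l2 r1 r2,
    Units.val_mul]

/-- `zigzag_inv_word` for an expression `F` that becomes the inverse zigzag word on pure tensors. -/
theorem zigzag_inv_word_ext {F : H ⊗[k] (H ⊗[k] H) →ₗ[k] R} {a b c d e f : H →ₐ[k] A} [Comm a b]
    [Comm a c] [Comm a d] [Comm a e] [Comm a f] [Comm b c] [Comm b d] [Comm b e] [Comm b f]
    [Comm c d] [Comm c e] [Comm c f] [Comm d e] [Comm d f] [Comm e f]
    (key : ∀ x y z, F (x ⊗ₜ (y ⊗ₜ z)) =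
      Ψ (wA a b c d * ((a ⋆ b) x * ((c ⋆ d) y * (e ⋆ f) z)) * wB c d e f))
    (l1 : AbsL Ψ (b ⋆ c)) (l2 : AbsL Ψ (a ⋆ d)) (r1 : AbsR Ψ (d ⋆ e)) (r2 : AbsR Ψ (c ⋆ f)) :
    F (((Ph k H)⁻¹ : (H ⊗[k] (H ⊗[k] H))ˣ) : H ⊗[k] (H ⊗[k] H)) =
      Ψ (((ph a d e)⁻¹ : Aˣ) * ((ph b c f)⁻¹ : Aˣ)) := by
  rw [word3_ext key, ← ph_inv_val, ← Units.val_mul, ← Units.val_mul, zigzag_inv_word l1 l2 r1 r2,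
    Units.val_mul]

end WordExt

/-- A product of two pairs of lines, rewritten as one pair of three-bead lines `a β S(b) α c`. -/
theorem lineBA_word (s t u : H ⊗[k] H) (V W : (H ⊗[k] H) ⊗[k] (H ⊗[k] H)) :
    s * TensorProduct.map (lineB k H) (lineB k H) V *
      (flipS k H t * TensorProduct.map (lineA k H) (lineA k H) W * u) =
    TensorProduct.map (lineBA k H) (lineBA k H)
      (pl (pl (fst3.comp (i2 k H)) (fst3.comp (i3 k H)))
          (pl (snd3.comp (i2 k H)) (snd3.comp (i3 k H))) W *
        (pl (fst3.comp (i1 k H)) (snd3.comp (i1 k H)) s *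
          (pl (snd3.comp (i2 k H)) (fst3.comp (i2 k H)) t *
            pl (fst3.comp (i3 k H)) (snd3.comp (i3 k H)) u)) *
        pl (pl (fst3.comp (i1 k H)) (fst3.comp (i2 k H)))
          (pl (snd3.comp (i1 k H)) (snd3.comp (i2 k H))) V) := by
  refine word_ext (R := H ⊗[k] H) (σ := LinearMap.id) (τ := flipS k H) (υ := LinearMap.id)
    (f := TensorProduct.map (lineB k H) (lineB k H))
    (g := TensorProduct.map (lineA k H) (lineA k H))
    (σ' := (pl (fst3.comp (i1 k H)) (snd3.comp (i1 k H))).toLinearMap)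
    (τ' := (pl (snd3.comp (i2 k H)) (fst3.comp (i2 k H))).toLinearMap)
    (υ' := (pl (fst3.comp (i3 k H)) (snd3.comp (i3 k H))).toLinearMap)
    (f' := (pl (pl (fst3.comp (i1 k H)) (fst3.comp (i2 k H)))
          (pl (snd3.comp (i1 k H)) (snd3.comp (i2 k H)))).toLinearMap)
    (g' := (pl (pl (fst3.comp (i2 k H)) (fst3.comp (i3 k H)))
          (pl (snd3.comp (i2 k H)) (snd3.comp (i3 k H)))).toLinearMap) ?_ s t u V W
  intros
  simp [QuasiHopfAlgebra.S_mul, mul_assoc]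

/-- A product of two pairs of lines, rewritten as one pair of three-bead lines `S(a) α b β S(c)`. -/
theorem lineAB_word (s t u : H ⊗[k] H) (W V : (H ⊗[k] H) ⊗[k] (H ⊗[k] H)) :
    flipS k H s * TensorProduct.map (lineA k H) (lineA k H) W *
      (t * TensorProduct.map (lineB k H) (lineB k H) V * flipS k H u) =
    TensorProduct.map (lineAB k H) (lineAB k H)
      (pl (pl (fst3.comp (i1 k H)) (fst3.comp (i2 k H)))
          (pl (snd3.comp (i1 k H)) (snd3.comp (i2 k H))) W *
        (pl (snd3.comp (i1 k H)) (fst3.comp (i1 k H)) s *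
          (pl (fst3.comp (i2 k H)) (snd3.comp (i2 k H)) t *
            pl (snd3.comp (i3 k H)) (fst3.comp (i3 k H)) u)) *
        pl (pl (fst3.comp (i2 k H)) (fst3.comp (i3 k H)))
          (pl (snd3.comp (i2 k H)) (snd3.comp (i3 k H))) V) := by
  refine word_ext' (R := H ⊗[k] H) (σ := flipS k H) (τ := LinearMap.id) (υ := flipS k H)
    (f := TensorProduct.map (lineA k H) (lineA k H))
    (g := TensorProduct.map (lineB k H) (lineB k H))
    (σ' := (pl (snd3.comp (i1 k H)) (fst3.comp (i1 k H))).toLinearMap)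
    (τ' := (pl (fst3.comp (i2 k H)) (snd3.comp (i2 k H))).toLinearMap)
    (υ' := (pl (snd3.comp (i3 k H)) (fst3.comp (i3 k H))).toLinearMap)
    (f' := (pl (pl (fst3.comp (i1 k H)) (fst3.comp (i2 k H)))
          (pl (snd3.comp (i1 k H)) (snd3.comp (i2 k H)))).toLinearMap)
    (g' := (pl (pl (fst3.comp (i2 k H)) (fst3.comp (i3 k H)))
          (pl (snd3.comp (i2 k H)) (snd3.comp (i3 k H)))).toLinearMap) ?_ s t u W V
  intros
  simp [An_mul, QuasiHopfAlgebra.S_mul, mul_assoc]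

/-- `Δ(X¹) δ (S ⊗ S)(Δᵒᵖ(X²)) γ Δ(X³) = 1`. -/
theorem comulSSop_phi : ln (rm (Dl k H).toLinearMap (del k H))
    (ln (rm (SSop k H) (gam k H)) (Dl k H).toLinearMap) (Ph k H : H ⊗[k] (H ⊗[k] H)) = 1 := by
  refine (zigzag_word_ext (Ψ := TensorProduct.map (lineBA k H) (lineBA k H)) (a := fst3.comp (i1 k H)) (b := snd3.comp (i1 k H))
    (c := snd3.comp (i2 k H)) (d := fst3.comp (i2 k H)) (e := fst3.comp (i3 k H)) (f := snd3.comp (i3 k H)) ?_ ?_ ?_ ?_ ?_).trans ?_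
  · intro x y z
    rw [pr_apply, pr_apply, pr_apply]
    have h := lineBA_word (Dl k H x) (Dl k H y) (Dl k H z)
      (wB (iL.comp iL) (iR.comp iL) (iR.comp iR) (iL.comp iR) : ((H ⊗[k] H) ⊗[k] (H ⊗[k] H))ˣ)
      (wA (iR.comp iL) (iL.comp iL) (iL.comp iR) (iR.comp iR) : ((H ⊗[k] H) ⊗[k] (H ⊗[k] H))ˣ)
    rw [← gam_eq, ← del_eq, map_wA_val, map_wB_val] at h
    simp only [pl_comp_iL_comp, pl_comp_iR_comp, pl_comp_iL, pl_comp_iR] at h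
    exact h
  rotate_left 4
  · have e1 : ((ph (fst3.comp (i1 k H)) (fst3.comp (i2 k H)) (fst3.comp (i3 k H)) :
        ((H ⊗[k] (H ⊗[k] H)) ⊗[k] (H ⊗[k] (H ⊗[k] H)))ˣ) : _) =
        fst3 (Ph k H : H ⊗[k] (H ⊗[k] H)) := by
      rw [← map_ph_val, IsAntipode.ph_std_val]
    have e2 : ((ph (snd3.comp (i1 k H)) (snd3.comp (i2 k H)) (snd3.comp (i3 k H)) :
        ((H ⊗[k] (H ⊗[k] H)) ⊗[k] (H ⊗[k] (H ⊗[k] H)))ˣ) : _) =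
        snd3 (Ph k H : H ⊗[k] (H ⊗[k] H)) := by
      rw [← map_ph_val, IsAntipode.ph_std_val]
    rw [e1, e2]
    rw [iR_mul_iL, TensorProduct.map_tmul]
    exact congrArg₂ _ (isAntipode_id k H).phi (isAntipode_id k H).phi
  · have h := (lineBA_absL (k := k) (H := H)).map_fst (lineBA k H)
    rw [comp_pr] at h; exact h
  · have h := (lineBA_absL (k := k) (H := H)).map_snd (lineBA k H)
    rw [comp_pr] at h; exact h
  · have h := (lineBA_absR (k := k) (H := H)).map_snd (lineBA k H)
    rw [comp_pr] at h; exact h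
  · have h := (lineBA_absR (k := k) (H := H)).map_fst (lineBA k H)
    rw [comp_pr] at h; exact h

/-- `(S ⊗ S)(Δᵒᵖ(x¹)) γ Δ(x²) δ (S ⊗ S)(Δᵒᵖ(x³)) = 1`. -/
theorem comulSSop_phi_inv : ln (rm (SSop k H) (gam k H))
    (ln (rm (Dl k H).toLinearMap (del k H)) (SSop k H))
      (((Ph k H)⁻¹ : (H ⊗[k] (H ⊗[k] H))ˣ) : H ⊗[k] (H ⊗[k] H)) = 1 := by
  refine (zigzag_inv_word_ext (Ψ := TensorProduct.map (lineAB k H) (lineAB k H)) (a := snd3.comp (i1 k H)) (b := fst3.comp (i1 k H))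
    (c := fst3.comp (i2 k H)) (d := snd3.comp (i2 k H)) (e := snd3.comp (i3 k H)) (f := fst3.comp (i3 k H)) ?_ ?_ ?_ ?_ ?_).trans ?_
  · intro x y z
    rw [pr_apply, pr_apply, pr_apply]
    have h := lineAB_word (Dl k H x) (Dl k H y) (Dl k H z)
      (wA (iR.comp iL) (iL.comp iL) (iL.comp iR) (iR.comp iR) : ((H ⊗[k] H) ⊗[k] (H ⊗[k] H))ˣ)
      (wB (iL.comp iL) (iR.comp iL) (iR.comp iR) (iL.comp iR) : ((H ⊗[k] H) ⊗[k] (H ⊗[k] H))ˣ)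
    rw [← gam_eq, ← del_eq, map_wA_val, map_wB_val] at h
    simp only [pl_comp_iL_comp, pl_comp_iR_comp, pl_comp_iL, pl_comp_iR] at h
    exact h
  rotate_left 4
  · have e1 : (((ph (fst3.comp (i1 k H)) (fst3.comp (i2 k H)) (fst3.comp (i3 k H)))⁻¹ :
        ((H ⊗[k] (H ⊗[k] H)) ⊗[k] (H ⊗[k] (H ⊗[k] H)))ˣ) : _) =
        fst3 (((Ph k H)⁻¹ : (H ⊗[k] (H ⊗[k] H))ˣ) : H ⊗[k] (H ⊗[k] H)) := by
      rw [← map_ph_inv_val, IsAntipode.ph_std]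
    have e2 : (((ph (snd3.comp (i1 k H)) (snd3.comp (i2 k H)) (snd3.comp (i3 k H)))⁻¹ :
        ((H ⊗[k] (H ⊗[k] H)) ⊗[k] (H ⊗[k] (H ⊗[k] H)))ˣ) : _) =
        snd3 (((Ph k H)⁻¹ : (H ⊗[k] (H ⊗[k] H))ˣ) : H ⊗[k] (H ⊗[k] H)) := by
      rw [← map_ph_inv_val, IsAntipode.ph_std]
    rw [e1, e2]
    rw [iR_mul_iL, TensorProduct.map_tmul]
    exact congrArg₂ _ (isAntipode_id k H).phi_inv (isAntipode_id k H).phi_inv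
  · have h := (lineAB_absL (k := k) (H := H)).map_fst (lineAB k H)
    rw [comp_pr] at h; exact h
  · have h := (lineAB_absL (k := k) (H := H)).map_snd (lineAB k H)
    rw [comp_pr] at h; exact h
  · have h := (lineAB_absR (k := k) (H := H)).map_snd (lineAB k H)
    rw [comp_pr] at h; exact h
  · have h := (lineAB_absR (k := k) (H := H)).map_fst (lineAB k H)
    rw [comp_pr] at h; exact h

/-- `h ↦ S(h₂) ⊗ S(h₁)` is an antipode along the comultiplication, with `γ` and `δ` in the place of
`α` and `β`. -/
theorem isAntipode_SSop : IsAntipode (Dl k H) (SSop k H) (gam k H) (del k H) where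
  one := SSop_one
  mul := SSop_mul
  left := SSop_gam
  right := del_SSop
  phi := comulSSop_phi
  phi_inv := comulSSop_phi_inv

/-- The image of the antipode under `Δ` is another antipode along `Δ`. -/
theorem isAntipode_comul : IsAntipode (Dl k H) ((Dl k H).toLinearMap ∘ₗ An k H)
    (Dl k H (al k H)) (Dl k H (be k H)) := by
  simpa using (isAntipode_id k H).comp (Dl k H)

/-- The Drinfeld twist compares the two antipodes along `Δ`. -/
theorem drinfeldTwist_eq : drinfeldTwist k H =
    cmp (Dl k H) (SSop k H) (gam k H) (Dl k H (be k H)) ((Dl k H).toLinearMap ∘ₗ An k H) := by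
  rw [drinfeldTwist, cmp]
  generalize (((Ph k H)⁻¹ : (H ⊗[k] (H ⊗[k] H))ˣ) : H ⊗[k] (H ⊗[k] H)) = z
  induction z using tensor3_induction with
  | zero => simp only [map_zero]
  | add x y hx hy => simp only [map_add, hx, hy]
  | tmul x y z => simp [mulRightS]

theorem drinfeldTwistInv_eq : drinfeldTwistInv k H =
    cmp (Dl k H) ((Dl k H).toLinearMap ∘ₗ An k H) (Dl k H (al k H)) (del k H) (SSop k H) := by
  rw [drinfeldTwistInv, cmp]
  generalize (((Ph k H)⁻¹ : (H ⊗[k] (H ⊗[k] H))ˣ) : H ⊗[k] (H ⊗[k] H)) = z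
  induction z using tensor3_induction with
  | zero => simp only [map_zero]
  | add x y hx hy => simp only [map_add, hx, hy]
  | tmul x y z => simp [mulLeftS, mul_assoc]

theorem drinfeldTwist_mul_inv : drinfeldTwist k H * drinfeldTwistInv k H = 1 := by
  rw [drinfeldTwist_eq, drinfeldTwistInv_eq, isAntipode_SSop.cmp_mul_cmp isAntipode_comul]

theorem drinfeldTwistInv_mul : drinfeldTwistInv k H * drinfeldTwist k H = 1 := by
  rw [drinfeldTwist_eq, drinfeldTwistInv_eq, isAntipode_comul.cmp_mul_cmp isAntipode_SSop]

theorem drinfeldTwist_comul_S (h : H) :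
    drinfeldTwist k H * Dl k H (An k H h) = SSop k H h * drinfeldTwist k H := by
  rw [drinfeldTwist_eq]; exact isAntipode_SSop.cmp_mul isAntipode_comul h

theorem drinfeldTwist_comul_al : drinfeldTwist k H * Dl k H (al k H) = gam k H := by
  rw [drinfeldTwist_eq]; exact isAntipode_SSop.cmp_mul_left isAntipode_comul

theorem comul_be_drinfeldTwistInv : Dl k H (be k H) * drinfeldTwistInv k H = del k H := by
  rw [drinfeldTwistInv_eq]; exact isAntipode_comul.mul_cmp_right isAntipode_SSop

end TwistAntipode

/-! ### The Drinfeld twist and the reassociator -/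

section TwistAssocWord

variable {k : Type u} {H : Type v} [Field k] [Ring H] [Algebra k H] [QuasiBialgebra k H]
variable {A M : Type*} [Semiring A] [Algebra k A] [AddCommMonoid M] [Module k M]
variable {Ψ : A →ₗ[k] M}
variable {c' b' a' a b c : H →ₐ[k] A} [Comm c' b'] [Comm c' a'] [Comm c' a] [Comm c' b] [Comm c' c]
  [Comm b' a'] [Comm b' a] [Comm b' b] [Comm b' c] [Comm a' a] [Comm a' b] [Comm a' c]
  [Comm a b] [Comm a c] [Comm b c]

/-- With `a' ⋆ a` absorbed, the two ways of nesting three lines `c' ... c`, `b' ... b`, `a' ... a`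
differ by `Φ` on the outgoing strings `a`, `b`, `c` and `Φ` on the incoming ones. -/
theorem twist_assoc_word (l : AbsL Ψ (a' ⋆ a)) :
    Ψ ((wA c' b' b c * wA (c' ⋆ b') a' a (b ⋆ c) * ph a b c : Aˣ) : A) =
      Ψ ((wA b' a' a b * wA c' (b' ⋆ a') (a ⋆ b) c * ph c' b' a' : Aˣ) : A) := by
  have p1 : (ph (c' ⋆ b' ⋆ a') a (b ⋆ c))⁻¹ * ph a b c = ph (c' ⋆ b' ⋆ a' ⋆ a) b c *
      (ph (c' ⋆ b' ⋆ a') a b)⁻¹ * (ph (c' ⋆ b' ⋆ a') (a ⋆ b) c)⁻¹ := by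
    have h := pentagon (c' ⋆ b' ⋆ a') a b c
    have h2 : ph (c' ⋆ b' ⋆ a' ⋆ a) b c = (ph (c' ⋆ b' ⋆ a') a (b ⋆ c))⁻¹ *
      (ph a b c * ph (c' ⋆ b' ⋆ a') (a ⋆ b) c * ph (c' ⋆ b' ⋆ a') a b) := by rw [h]; group
    rw [h2]; group
  have p2 : ph (c' ⋆ b') a' a * ph (c' ⋆ b' ⋆ a' ⋆ a) b c =
      ph (c' ⋆ b' ⋆ (a' ⋆ a)) b c * ph (c' ⋆ b') a' a :=
    Units.ext (intertwine_ph (fun h => (coassoc (c' ⋆ b') a' a h).symm) (fun _ => commute_ph _)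
      (fun _ => commute_ph _))
  have p3 : (ph (c' ⋆ (b' ⋆ a')) (a ⋆ b) c)⁻¹ * ph c' b' a' =
      ph c' b' a' * (ph (c' ⋆ b' ⋆ a') (a ⋆ b) c)⁻¹ :=
    Units.ext (intertwine_ph_inv (fun h => (coassoc c' b' a' h).symm) (fun _ => commute_ph _)
      (fun _ => commute_ph _)).symm
  have p4 : (ph (c' ⋆ (b' ⋆ a')) a b)⁻¹ * ph c' b' a' =
      ph c' b' a' * (ph (c' ⋆ b' ⋆ a') a b)⁻¹ :=
    Units.ext (intertwine_ph_inv (fun h => (coassoc c' b' a' h).symm) (fun _ => commute_ph _)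
      (fun _ => commute_ph _)).symm
  have p5 : (ph (b' ⋆ a') a b)⁻¹ * ph c' (b' ⋆ a') (a ⋆ b) =
      ph c' (b' ⋆ a' ⋆ a) b * ph c' (b' ⋆ a') a * (ph (c' ⋆ (b' ⋆ a')) a b)⁻¹ := by
    have h := pentagon c' (b' ⋆ a') a b
    have h2 : ph c' (b' ⋆ a') (a ⋆ b) = (ph (b' ⋆ a') a b * ph c' (b' ⋆ a' ⋆ a) b *
      ph c' (b' ⋆ a') a) * (ph (c' ⋆ (b' ⋆ a')) a b)⁻¹ := by rw [h]; group
    rw [h2]; group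
  have p6 : ph b' a' a * ph c' (b' ⋆ a' ⋆ a) b = ph c' (b' ⋆ (a' ⋆ a)) b * ph b' a' a :=
    Units.ext (intertwine_ph (fun _ => commute_ph _) (fun h => (coassoc b' a' a h).symm)
      (fun _ => commute_ph _))
  have p7 := pentagon c' b' a' a
  -- Both words end in the same three factors `T`; in front of them only factors remain in which
  -- `a' ⋆ a` can be erased.
  have hl : wA c' b' b c * wA (c' ⋆ b') a' a (b ⋆ c) * ph a b c =
      ph c' b' b * (ph (c' ⋆ b') b c)⁻¹ * ph (c' ⋆ b' ⋆ (a' ⋆ a)) b c * (ph (c' ⋆ b') a' a *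
        (ph (c' ⋆ b' ⋆ a') a b)⁻¹ * (ph (c' ⋆ b' ⋆ a') (a ⋆ b) c)⁻¹) := by
    rw [wA, wA, mul_assoc, mul_assoc (ph (c' ⋆ b') a' a), p1, ← mul_assoc (ph (c' ⋆ b') a' a),
      ← mul_assoc (ph (c' ⋆ b') a' a), p2]
    group
  have hr : wA b' a' a b * wA c' (b' ⋆ a') (a ⋆ b) c * ph c' b' a' =
      ph c' (b' ⋆ (a' ⋆ a)) b * ph c' b' (a' ⋆ a) * (ph (c' ⋆ b') a' a *
        (ph (c' ⋆ b' ⋆ a') a b)⁻¹ * (ph (c' ⋆ b' ⋆ a') (a ⋆ b) c)⁻¹) := by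
    calc _ = ph b' a' a * ((ph (b' ⋆ a') a b)⁻¹ * ph c' (b' ⋆ a') (a ⋆ b)) *
          ((ph (c' ⋆ (b' ⋆ a')) (a ⋆ b) c)⁻¹ * ph c' b' a') := by
          rw [wA, wA]; group
      _ = (ph b' a' a * ph c' (b' ⋆ a' ⋆ a) b) * ph c' (b' ⋆ a') a *
          ((ph (c' ⋆ (b' ⋆ a')) a b)⁻¹ * ph c' b' a') * (ph (c' ⋆ b' ⋆ a') (a ⋆ b) c)⁻¹ := by
          rw [p3, p5]; group
      _ = ph c' (b' ⋆ (a' ⋆ a)) b * (ph b' a' a * ph c' (b' ⋆ a') a * ph c' b' a') *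
          ((ph (c' ⋆ b' ⋆ a') a b)⁻¹ * (ph (c' ⋆ b' ⋆ a') (a ⋆ b) c)⁻¹) := by
          rw [p4, p6]; group
      _ = _ := by rw [p7]; group
  rw [hl, hr]
  generalize ph (c' ⋆ b') a' a * (ph (c' ⋆ b' ⋆ a') a b)⁻¹ * (ph (c' ⋆ b' ⋆ a') (a ⋆ b) c)⁻¹ = T
  have c1 : ∀ h, Commute ((ph c' b' b * (ph (c' ⋆ b') b c)⁻¹ : Aˣ) : A) ((a' ⋆ a) h) := fun h => by
    rw [Units.val_mul]; exact (commute_ph _).mul_left (commute_ph_inv _)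
  calc _ = Ψ (((ph c' b' b * (ph (c' ⋆ b') b c)⁻¹ : Aˣ) : A) * ph (c' ⋆ b' ⋆ (a' ⋆ a)) b c * T) := by
        simp
    _ = Ψ (((ph c' b' b * (ph (c' ⋆ b') b c)⁻¹ : Aˣ) : A) * ph (c' ⋆ b') b c * T) :=
        (l.abs c1).ph_fst_right.1
    _ = Ψ (ph c' b' b * (T : A)) := by simp
    _ = Ψ (ph c' b' b * ph c' b' (a' ⋆ a) * (T : A)) :=
        ((l.abs fun _ => commute_ph _).ph_thd.1).symm
    _ = Ψ (1 * ph c' b' b * (ph c' b' (a' ⋆ a) * T : A)) := by simp [mul_assoc]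
    _ = Ψ (1 * ph c' (b' ⋆ (a' ⋆ a)) b * (ph c' b' (a' ⋆ a) * T : A)) :=
        ((l.abs fun _ => Commute.one_left _).ph_snd_right.1).symm
    _ = _ := by simp [mul_assoc]

end TwistAssocWord

section Bar

variable {k : Type u} {H : Type v} [Field k] [Ring H] [Algebra k H] [QuasiHopfAlgebra k H]
variable {A B : Type*} [Semiring A] [Algebra k A] [Semiring B] [Algebra k B]

/-- The string `h ↦ p(S(h))` into the opposite algebra. -/
def bar (p : H →ₐ[k] A) : H →ₐ[k] Aᵐᵒᵖ :=
  AlgHom.ofLinearMap ((MulOpposite.opLinearEquiv k).toLinearMap ∘ₗ p.toLinearMap ∘ₗ An k H)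
    (by simp [QuasiHopfAlgebra.S_one]) (by intro x y; simp [QuasiHopfAlgebra.S_mul])

theorem bar_apply (p : H →ₐ[k] A) (h : H) : bar p h = MulOpposite.op (p (An k H h)) := rfl

instance (p q : H →ₐ[k] A) [hpq : Comm p q] : Comm (bar p) (bar q) :=
  ⟨fun x y => (hpq.comm (An k H x) (An k H y)).op⟩

theorem pl_bar (p q : H →ₐ[k] A) [Comm p q] (t : H ⊗[k] H) :
    pl (bar q) (bar p) t = MulOpposite.op (pl p q (flipS k H t)) := by
  induction t using TensorProduct.induction_on with
  | zero => simp
  | add x y hx hy => simp only [map_add, hx, hy, MulOpposite.op_add]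
  | tmul x y => rw [pl_tmul, bar_apply, bar_apply, flipS_tmul, pl_tmul, MulOpposite.op_mul]

/-- The Drinfeld twist `f` placed on two strings. -/
def tw (p q : H →ₐ[k] A) [Comm p q] : Aˣ where
  val := pl p q (drinfeldTwist k H)
  inv := pl p q (drinfeldTwistInv k H)
  val_inv := by rw [← map_mul, drinfeldTwist_mul_inv, map_one]
  inv_val := by rw [← map_mul, drinfeldTwistInv_mul, map_one]

theorem tw_val (p q : H →ₐ[k] A) [Comm p q] : (tw p q : A) = pl p q (drinfeldTwist k H) := rfl

theorem tw_inv_val (p q : H →ₐ[k] A) [Comm p q] :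
    ((tw p q)⁻¹ : Aˣ) = pl p q (drinfeldTwistInv k H) := rfl

@[simp] theorem map_tw_val (F : A →ₐ[k] B) (p q : H →ₐ[k] A) [Comm p q] :
    F (tw p q : A) = tw (F.comp p) (F.comp q) := by
  rw [tw_val, tw_val, map_pl]

/-- `f` conjugates `(p ⋆ q) ∘ S` into the product of `q ∘ S` and `p ∘ S`. -/
theorem tw_mul_pr (p q : H →ₐ[k] A) [Comm p q] (h : H) :
    tw p q * (p ⋆ q) (An k H h) = ((bar q ⋆ bar p) h).unop * tw p q := by
  rw [pr_apply, tw_val, ← map_mul, drinfeldTwist_comul_S, map_mul, pr_apply, pl_bar, SSop_apply]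
  rfl

/-- `f Δ(α) = γ` placed on two strings. -/
theorem tw_mul_pr_al (p q : H →ₐ[k] A) [Comm p q] :
    tw p q * (p ⋆ q) (al k H) = pl p q (gam k H) := by
  rw [pr_apply, tw_val, ← map_mul, drinfeldTwist_comul_al]

/-- The reassociator `p(S(X³)) q(S(X²)) r(S(X¹))`. -/
def xi (p q r : H →ₐ[k] A) [Comm p q] [Comm p r] [Comm q r] : Aˣ :=
  (Units.opEquiv (ph (bar r) (bar q) (bar p))).unop

theorem op_xi (p q r : H →ₐ[k] A) [Comm p q] [Comm p r] [Comm q r] :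
    MulOpposite.op (xi p q r : A) = ph (bar r) (bar q) (bar p) := rfl

end Bar

section TwistAssoc

variable {k : Type u} {H : Type v} [Field k] [Ring H] [Algebra k H] [QuasiHopfAlgebra k H]

section Six

variable (k H)

/-- The algebra of three lines with two beads each. -/
abbrev Six := (H ⊗[k] H) ⊗[k] ((H ⊗[k] H) ⊗[k] (H ⊗[k] H))

/-- The first bead of the first line. -/
abbrev sa' : H →ₐ[k] Six k H := iL.comp iL
/-- The second bead of the first line. -/
abbrev sa : H →ₐ[k] Six k H := iL.comp iR
/-- The first bead of the second line. -/
abbrev sb' : H →ₐ[k] Six k H := iR.comp (iL.comp iL)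
/-- The second bead of the second line. -/
abbrev sb : H →ₐ[k] Six k H := iR.comp (iL.comp iR)
/-- The first bead of the third line. -/
abbrev sc' : H →ₐ[k] Six k H := iR.comp (iR.comp iL)
/-- The second bead of the third line. -/
abbrev sc : H →ₐ[k] Six k H := iR.comp (iR.comp iR)

end Six

variable {A : Type*} [Semiring A] [Algebra k A]
variable (p q r : H →ₐ[k] A) [Comm p q] [Comm p r] [Comm q r]

/-- `(a' ⊗ a) ⊗ (b' ⊗ b) ⊗ (c' ⊗ c) ↦ p(S(a') α a) q(S(b') α b) r(S(c') α c)`. -/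
def lineAAA : Six k H →ₗ[k] A :=
  ln (p.toLinearMap ∘ₗ lineA k H) (ln (q.toLinearMap ∘ₗ lineA k H) (r.toLinearMap ∘ₗ lineA k H))

theorem linear22_ext {T Y : Type*} [Semiring T] [Algebra k T]
    [Semiring Y] [Algebra k Y]
    {f : (H ⊗[k] H) ⊗[k] (H ⊗[k] H) →ₗ[k] Y} {g : (H ⊗[k] H) ⊗[k] (H ⊗[k] H) →ₗ[k] T} {w : T} {z : Y}
    {Ψ : T →ₗ[k] Y} (key : ∀ a b c d, z * f ((a ⊗ₜ b) ⊗ₜ (c ⊗ₜ d)) =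
      Ψ (w * g ((a ⊗ₜ b) ⊗ₜ (c ⊗ₜ d)))) (V : (H ⊗[k] H) ⊗[k] (H ⊗[k] H)) :
    z * f V = Ψ (w * g V) := by
  induction V using tensor22_induction with
  | zero => simp only [map_zero, mul_zero]
  | add x y hx hy => simp only [map_add, mul_add, hx, hy]
  | tmul a b c d => exact key a b c d

theorem lineAAA_iL_iR (x : H ⊗[k] H) (y : (H ⊗[k] H) ⊗[k] (H ⊗[k] H)) :
    lineAAA p q r (x ⊗ₜ y) =
      p (lineA k H x) * pl q r (TensorProduct.map (lineA k H) (lineA k H) y) := by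
  induction y using TensorProduct.induction_on with
  | zero => simp
  | add x y hx hy => simp only [map_add, TensorProduct.tmul_add, mul_add, hx, hy]
  | tmul y z => simp [lineAAA]

theorem lineAAA_pl (y : (H ⊗[k] H) ⊗[k] (H ⊗[k] H)) (z : H ⊗[k] H) :
    lineAAA p q r (pl iL (iR.comp iL) y * (iR.comp iR : H ⊗[k] H →ₐ[k] Six k H) z) =
      pl p q (TensorProduct.map (lineA k H) (lineA k H) y) * r (lineA k H z) := by
  induction y using TensorProduct.induction_on with
  | zero => simp
  | add x y hx hy => simp only [map_add, add_mul, hx, hy]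
  | tmul x y => simp [lineAAA, mul_assoc]

end TwistAssoc

section Ext

variable {k : Type u} {H : Type v} [Field k] [Ring H] [Algebra k H] [QuasiBialgebra k H]
  {X Y T B M N : Type*} [Semiring X] [Algebra k X] [Semiring Y] [Algebra k Y]
  [Semiring T] [Algebra k T] [Semiring B] [Algebra k B] [AddCommMonoid M] [Module k M]
  [AddCommMonoid N] [Module k N]

theorem AbsL.comp {f : X →ₗ[k] M} {s : H →ₐ[k] X} (hs : AbsL f s) (g : M →ₗ[k] N) :
    AbsL (g ∘ₗ f) s := fun h T => by
  rw [LinearMap.comp_apply, hs, map_smul]; rfl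

theorem AbsL.ln_fst' {f : X →ₗ[k] B} {s : H →ₐ[k] X} (hs : AbsL f s) (g : Y →ₗ[k] B) :
    AbsL (ln f g) (iL.comp s) := fun h T => by
  induction T using TensorProduct.induction_on with
  | zero => simp
  | tmul x y => simp [hs h x]
  | add x y hx hy => simp only [mul_add, map_add, hx, hy, smul_add]

variable {f : Six k H →ₗ[k] B} {Ψ : T →ₗ[k] B} {ι : Six k H →ₗ[k] T}
  {u : H ⊗[k] (H ⊗[k] H) →ₗ[k] B} {v : H ⊗[k] (H ⊗[k] H) →ₗ[k] T}

theorem mul_six_ext (key : ∀ a b c a' b' c' x y z : H,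
      u (x ⊗ₜ (y ⊗ₜ z)) * f ((a' ⊗ₜ a) ⊗ₜ ((b' ⊗ₜ b) ⊗ₜ (c' ⊗ₜ c))) =
      Ψ (ι ((a' ⊗ₜ a) ⊗ₜ ((b' ⊗ₜ b) ⊗ₜ (c' ⊗ₜ c))) * v (x ⊗ₜ (y ⊗ₜ z))))
    (w : Six k H) (z : H ⊗[k] (H ⊗[k] H)) : u z * f w = Ψ (ι w * v z) := by
  induction w using TensorProduct.induction_on with
  | zero => simp only [map_zero, zero_mul, mul_zero]
  | add x y hx hy => simp only [map_add, mul_add, add_mul, hx, hy]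
  | tmul s w =>
  induction s using TensorProduct.induction_on with
  | zero => simp only [TensorProduct.zero_tmul, map_zero, zero_mul, mul_zero]
  | add x y hx hy => simp only [TensorProduct.add_tmul, map_add, mul_add, add_mul, hx, hy]
  | tmul a' a =>
  induction w using tensor22_induction with
  | zero => simp only [TensorProduct.tmul_zero, map_zero, zero_mul, mul_zero]
  | add x y hx hy => simp only [TensorProduct.tmul_add, map_add, mul_add, add_mul, hx, hy]
  | tmul b' b c' c =>
  induction z using tensor3_induction with
  | zero => simp only [map_zero, zero_mul, mul_zero]
  | add x y hx hy => simp only [map_add, mul_add, add_mul, hx, hy]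
  | tmul x y z => exact key ..

theorem six_mul_ext (key : ∀ a b c a' b' c' x y z : H,
      f ((a' ⊗ₜ a) ⊗ₜ ((b' ⊗ₜ b) ⊗ₜ (c' ⊗ₜ c))) * u (x ⊗ₜ (y ⊗ₜ z)) =
      Ψ (ι ((a' ⊗ₜ a) ⊗ₜ ((b' ⊗ₜ b) ⊗ₜ (c' ⊗ₜ c))) * v (x ⊗ₜ (y ⊗ₜ z))))
    (w : Six k H) (z : H ⊗[k] (H ⊗[k] H)) : f w * u z = Ψ (ι w * v z) := by
  induction w using TensorProduct.induction_on with
  | zero => simp only [map_zero, zero_mul]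
  | add x y hx hy => simp only [map_add, add_mul, hx, hy]
  | tmul s w =>
  induction s using TensorProduct.induction_on with
  | zero => simp only [TensorProduct.zero_tmul, map_zero, zero_mul]
  | add x y hx hy => simp only [TensorProduct.add_tmul, map_add, add_mul, hx, hy]
  | tmul a' a =>
  induction w using tensor22_induction with
  | zero => simp only [TensorProduct.tmul_zero, map_zero, zero_mul]
  | add x y hx hy => simp only [TensorProduct.tmul_add, map_add, add_mul, hx, hy]
  | tmul b' b c' c =>
  induction z using tensor3_induction with
  | zero => simp only [map_zero, mul_zero]
  | add x y hx hy => simp only [map_add, mul_add, hx, hy]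
  | tmul x y z => exact key ..

end Ext

section Ext2

variable {k : Type*} [Field k] {X Y A : Type*} [Semiring X] [Algebra k X] [Semiring Y] [Algebra k Y]
  [Semiring A] [Algebra k A]

theorem iR_mul_iL_mul (x : X) (w c d : Y) :
    (iR w : X ⊗[k] Y) * (iL x * (iR c * iR d)) = x ⊗ₜ (w * (c * d)) := by
  simp

theorem map_mul_mul (F : X →ₐ[k] A) (w c d : X) (z : A) :
    F w * (F c * F d * z) = F (w * (c * d)) * z := by
  simp [mul_assoc]

end Ext2

section Four

variable (k : Type u) (H : Type v) [Field k] [Ring H] [Algebra k H]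

/-- The first string of `(H ⊗ H) ⊗ (H ⊗ H)`. -/
abbrev q1 : H →ₐ[k] (H ⊗[k] H) ⊗[k] (H ⊗[k] H) := iL.comp iL
/-- The second string of `(H ⊗ H) ⊗ (H ⊗ H)`. -/
abbrev q2 : H →ₐ[k] (H ⊗[k] H) ⊗[k] (H ⊗[k] H) := iL.comp iR
/-- The third string of `(H ⊗ H) ⊗ (H ⊗ H)`. -/
abbrev q3 : H →ₐ[k] (H ⊗[k] H) ⊗[k] (H ⊗[k] H) := iR.comp iL
/-- The fourth string of `(H ⊗ H) ⊗ (H ⊗ H)`. -/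
abbrev q4 : H →ₐ[k] (H ⊗[k] H) ⊗[k] (H ⊗[k] H) := iR.comp iR

end Four

section TwistAssoc

variable {k : Type u} {H : Type v} [Field k] [Ring H] [Algebra k H] [QuasiHopfAlgebra k H]
variable {A : Type*} [Semiring A] [Algebra k A]
variable (p q r : H →ₐ[k] A) [Comm p q] [Comm p r] [Comm q r]

theorem lineAAA_absL : AbsL (lineAAA p q r) (sa' k H ⋆ sa k H) := by
  have h0 := ((lineA_absL (k := k) (H := H)).comp p.toLinearMap).ln_fst'
    (ln (q.toLinearMap ∘ₗ lineA k H) (r.toLinearMap ∘ₗ lineA k H))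
  rw [comp_pr] at h0; exact h0

theorem lineAAA_mul (T : Six k H) (z : H ⊗[k] (H ⊗[k] H)) :
    lineAAA p q r T * pl p (pl q r) z =
      lineAAA p q r (T * pl (sa k H) (pl (sb k H) (sc k H)) z) := by
  have key : ∀ a b c a' b' c' x y z : H,
      lineAAA p q r ((a' ⊗ₜ a) ⊗ₜ ((b' ⊗ₜ b) ⊗ₜ (c' ⊗ₜ c))) * pl p (pl q r) (x ⊗ₜ (y ⊗ₜ z)) =
      lineAAA p q r ((a' ⊗ₜ a) ⊗ₜ ((b' ⊗ₜ b) ⊗ₜ (c' ⊗ₜ c)) *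
        pl (sa k H) (pl (sb k H) (sc k H)) (x ⊗ₜ (y ⊗ₜ z))) := by
    intro a b c a' b' c' x y z
    have c1 : ∀ x, Commute (r x) (p x) := fun x => Comm.comm _ _
    simp only [lineAAA, pl_tmul, ln_tmul, LinearMap.comp_apply, AlgHom.comp_apply,
      Algebra.TensorProduct.includeLeft_apply, Algebra.TensorProduct.includeRight_apply,
      Algebra.TensorProduct.tmul_mul_tmul, one_mul, mul_one, AlgHom.toLinearMap_apply,
      LinearMap.mulRight_apply, AlgHom.coe_id, id, ← mul_assoc, map_mul]
    have e1 := (Comm.comm (a := p) (b := r) x (An k H c' * al k H * c)).eq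
    have e2 := (Comm.comm (a := p) (b := q) x (An k H b' * al k H * b)).eq
    have e3 := (Comm.comm (a := q) (b := r) y (An k H c' * al k H * c)).eq
    simp only [map_mul] at e1 e2 e3
    simp only [mul_assoc] at e1 e2 e3 ⊢
    have e1' : ∀ t, r (An k H c') * (r (al k H) * (r c * (p x * t))) =
        p x * (r (An k H c') * (r (al k H) * (r c * t))) := fun t => by
      have := congrArg (· * t) e1.symm; simpa [mul_assoc] using this
    have e2' : ∀ t, q (An k H b') * (q (al k H) * (q b * (p x * t))) =
        p x * (q (An k H b') * (q (al k H) * (q b * t))) := fun t => by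
      have := congrArg (· * t) e2.symm; simpa [mul_assoc] using this
    have e3' : ∀ t, r (An k H c') * (r (al k H) * (r c * (q y * t))) =
        q y * (r (An k H c') * (r (al k H) * (r c * t))) := fun t => by
      have := congrArg (· * t) e3.symm; simpa [mul_assoc] using this
    rw [e1', e2', e3']
  refine six_mul_ext (T := Six k H) (Ψ := lineAAA p q r) (f := lineAAA p q r) (ι := LinearMap.id)
    (u := (pl p (pl q r)).toLinearMap)
    (v := (pl (sa k H) (pl (sb k H) (sc k H))).toLinearMap) (fun a b c a' b' c' x y z => ?_) T z
  exact key ..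

theorem unop_mul_lineAAA (T : Six k H) (z : H ⊗[k] (H ⊗[k] H)) :
    (pl (bar r) (pl (bar q) (bar p)) z).unop * lineAAA p q r T =
      lineAAA p q r (T * pl (sc' k H) (pl (sb' k H) (sa' k H)) z) := by
  have key : ∀ a b c a' b' c' x y z : H,
      (pl (bar r) (pl (bar q) (bar p)) (x ⊗ₜ (y ⊗ₜ z))).unop *
        lineAAA p q r ((a' ⊗ₜ a) ⊗ₜ ((b' ⊗ₜ b) ⊗ₜ (c' ⊗ₜ c))) =
      lineAAA p q r ((a' ⊗ₜ a) ⊗ₜ ((b' ⊗ₜ b) ⊗ₜ (c' ⊗ₜ c)) *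
        pl (sc' k H) (pl (sb' k H) (sa' k H)) (x ⊗ₜ (y ⊗ₜ z))) := by
    intro a b c a' b' c' x y z
    simp only [lineAAA, pl_tmul, ln_tmul, LinearMap.comp_apply, AlgHom.comp_apply,
      Algebra.TensorProduct.includeLeft_apply, Algebra.TensorProduct.includeRight_apply,
      Algebra.TensorProduct.tmul_mul_tmul, one_mul, mul_one, AlgHom.toLinearMap_apply,
      LinearMap.mulRight_apply, AlgHom.coe_id, id, bar_apply, MulOpposite.unop_mul,
      MulOpposite.unop_op, An_mul, map_mul]
    have e1 := (Comm.comm (a := p) (b := q) (An k H a' * al k H * a) (An k H y)).eq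
    have e2 := (Comm.comm (a := p) (b := r) (An k H a' * al k H * a) (An k H x)).eq
    have e3 := (Comm.comm (a := q) (b := r) (An k H b' * al k H * b) (An k H x)).eq
    simp only [map_mul] at e1 e2 e3
    simp only [mul_assoc] at e1 e2 e3 ⊢
    have e1' : ∀ t, p (An k H a') * (p (al k H) * (p a * (q (An k H y) * t))) =
        q (An k H y) * (p (An k H a') * (p (al k H) * (p a * t))) := fun t => by
      have := congrArg (· * t) e1; simpa [mul_assoc] using this
    have e2' : ∀ t, p (An k H a') * (p (al k H) * (p a * (r (An k H x) * t))) =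
        r (An k H x) * (p (An k H a') * (p (al k H) * (p a * t))) := fun t => by
      have := congrArg (· * t) e2; simpa [mul_assoc] using this
    have e3' : ∀ t, q (An k H b') * (q (al k H) * (q b * (r (An k H x) * t))) =
        r (An k H x) * (q (An k H b') * (q (al k H) * (q b * t))) := fun t => by
      have := congrArg (· * t) e3; simpa [mul_assoc] using this
    rw [e1', e3', e2']
  refine mul_six_ext (T := Six k H) (Ψ := lineAAA p q r) (f := lineAAA p q r) (ι := LinearMap.id)
    (u := (MulOpposite.opLinearEquiv k).symm.toLinearMap ∘ₗ (pl (bar r) (pl (bar q) (bar p))).toLinearMap)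
    (v := (pl (sc' k H) (pl (sb' k H) (sa' k H))).toLinearMap) (fun a b c a' b' c' x y z => ?_) T z
  exact key ..

theorem SSop_al_comul (p q : H →ₐ[k] A) [Comm p q] (x y : H) :
    tw p q * (p ⋆ q) (An k H x * al k H * y) = pl p q
      (TensorProduct.map (lineA k H) (lineA k H)
        ((wA (q3 k H) (q1 k H) (q2 k H) (q4 k H) : (H ⊗[k] H) ⊗[k] (H ⊗[k] H)) *
          ((q3 k H ⋆ q1 k H) x * (q2 k H ⋆ q4 k H) y))) := by
  have h := flipS_lineA (Dl k H x) (Dl k H y)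
    (wA (q3 k H) (q1 k H) (q2 k H) (q4 k H) : ((H ⊗[k] H) ⊗[k] (H ⊗[k] H))ˣ)
  rw [← gam_eq] at h
  refine Eq.trans ?_ (congrArg (pl p q) h)
  rw [map_mul, map_mul, ← mul_assoc, ← mul_assoc, tw_mul_pr, map_mul, map_mul,
    mul_assoc (MulOpposite.unop _), tw_mul_pr_al, pr_apply, pr_apply, pl_bar]
  rfl

/-- `(1 ⊗ f)(id ⊗ Δ)(γ)` as a word closed to three lines. -/
theorem tw_mul_gam_right :
    (tw q r * pl p (q ⋆ r) (gam k H) : A) = lineAAA p q r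
      (((wA (sc' k H) (sb' k H) (sb k H) (sc k H) : (Six k H)ˣ) : Six k H) *
        (wA (sc' k H ⋆ sb' k H) (sa' k H) (sa k H) (sb k H ⋆ sc k H) : (Six k H)ˣ)) := by
  have h := linear22_ext (z := (tw q r : A)) (Ψ := lineAAA p q r)
    (f := (pl p (q ⋆ r)).toLinearMap ∘ₗ TensorProduct.map (lineA k H) (lineA k H))
    (w := ((wA (sc' k H) (sb' k H) (sb k H) (sc k H) : (Six k H)ˣ) : Six k H))
    (g := (pl (pl (sa' k H) (sa k H)) (pl (sc' k H ⋆ sb' k H) (sb k H ⋆ sc k H))).toLinearMap)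
    (fun a b c d => by
      have e : ((wA (sc' k H) (sb' k H) (sb k H) (sc k H) : (Six k H)ˣ) : Six k H) =
          iR ((wA (q3 k H) (q1 k H) (q2 k H) (q4 k H) :
            ((H ⊗[k] H) ⊗[k] (H ⊗[k] H))ˣ) : (H ⊗[k] H) ⊗[k] (H ⊗[k] H)) := by
        rw [map_wA_val]
      have e2 : (sc' k H ⋆ sb' k H) = iR.comp (q3 k H ⋆ q1 k H) := by rw [comp_pr]
      have e3 : (sb k H ⋆ sc k H) = iR.comp (q2 k H ⋆ q4 k H) := by rw [comp_pr]
      have e4 : pl (sa' k H) (sa k H) (a ⊗ₜ b) = iL (a ⊗ₜ b : H ⊗[k] H) := by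
        rw [pl_tmul, AlgHom.comp_apply, AlgHom.comp_apply, ← map_mul]; simp
      have h1 := SSop_al_comul q r c d
      simp only [LinearMap.comp_apply, AlgHom.toLinearMap_apply, TensorProduct.map_tmul, pl_tmul,
        ln_tmul, LinearMap.mulRight_apply, AlgHom.coe_id, id]
      have h2 : ∀ x, (tw q r : A) * p x = p x * tw q r := fun x =>
        (Comm.comm (a := pl q r) (b := p) _ x).eq
      rw [← mul_assoc, h2, mul_assoc, h1]
      rw [← pl_tmul (sa' k H) (sa k H), e, e2, e3, e4, AlgHom.comp_apply, AlgHom.comp_apply,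
        iR_mul_iL_mul, lineAAA_iL_iR]
      simp [mul_assoc])
    ((wA (q3 k H) (q1 k H) (q2 k H) (q4 k H) : ((H ⊗[k] H) ⊗[k] (H ⊗[k] H))ˣ))
  rw [LinearMap.comp_apply, ← gam_eq, AlgHom.toLinearMap_apply, AlgHom.toLinearMap_apply,
    map_wA_val] at h
  simp only [pl_comp_iL_comp, pl_comp_iR_comp, pl_comp_iL, pl_comp_iR] at h
  exact h

/-- `(f ⊗ 1)(Δ ⊗ id)(γ)` as a word closed to three lines. -/
theorem tw_mul_gam_left :
    (tw p q * pl (p ⋆ q) r (gam k H) : A) = lineAAA p q r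
      (((wA (sb' k H) (sa' k H) (sa k H) (sb k H) : (Six k H)ˣ) : Six k H) *
        (wA (sc' k H) (sb' k H ⋆ sa' k H) (sa k H ⋆ sb k H) (sc k H) : (Six k H)ˣ)) := by
  have h := linear22_ext (z := (tw p q : A)) (Ψ := lineAAA p q r)
    (f := (pl (p ⋆ q) r).toLinearMap ∘ₗ TensorProduct.map (lineA k H) (lineA k H))
    (w := ((wA (sb' k H) (sa' k H) (sa k H) (sb k H) : (Six k H)ˣ) : Six k H))
    (g := (pl (pl (sb' k H ⋆ sa' k H) (sa k H ⋆ sb k H)) (pl (sc' k H) (sc k H))).toLinearMap)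
    (fun a b c d => by
      have e : ((wA (sb' k H) (sa' k H) (sa k H) (sb k H) : (Six k H)ˣ) : Six k H) =
          pl iL (iR.comp iL) ((wA (q3 k H) (q1 k H) (q2 k H) (q4 k H) :
            ((H ⊗[k] H) ⊗[k] (H ⊗[k] H))ˣ) : (H ⊗[k] H) ⊗[k] (H ⊗[k] H)) := by
        rw [map_wA_val]
        simp only [pl_comp_iL_comp, pl_comp_iR_comp]
        rfl
      have e2 : (sb' k H ⋆ sa' k H) =
          (pl iL (iR.comp iL) : _ →ₐ[k] Six k H).comp (q3 k H ⋆ q1 k H) := by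
        rw [comp_pr]
        simp only [pl_comp_iL_comp, pl_comp_iR_comp]
        rfl
      have e3 : (sa k H ⋆ sb k H) =
          (pl iL (iR.comp iL) : _ →ₐ[k] Six k H).comp (q2 k H ⋆ q4 k H) := by
        rw [comp_pr]
        simp only [pl_comp_iL_comp, pl_comp_iR_comp]
        rfl
      have e4 : pl (sc' k H) (sc k H) (c ⊗ₜ d) =
          (iR.comp iR : H ⊗[k] H →ₐ[k] Six k H) (c ⊗ₜ d : H ⊗[k] H) := by
        rw [pl_tmul]
        change (iR.comp iR : H ⊗[k] H →ₐ[k] Six k H) (iL c) *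
          (iR.comp iR : H ⊗[k] H →ₐ[k] Six k H) (iR d) = _
        rw [← map_mul]; simp
      have h1 := SSop_al_comul p q a b
      simp only [LinearMap.comp_apply, AlgHom.toLinearMap_apply, TensorProduct.map_tmul, pl_tmul,
        ln_tmul, LinearMap.mulRight_apply, AlgHom.coe_id, id]
      rw [← mul_assoc, h1]
      rw [← pl_tmul (sc' k H) (sc k H), e, e2, e3, e4, AlgHom.comp_apply, AlgHom.comp_apply,
        map_mul_mul, lineAAA_pl]
      simp [mul_assoc])
    ((wA (q3 k H) (q1 k H) (q2 k H) (q4 k H) : ((H ⊗[k] H) ⊗[k] (H ⊗[k] H))ˣ))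
  rw [LinearMap.comp_apply, ← gam_eq, AlgHom.toLinearMap_apply, AlgHom.toLinearMap_apply,
    map_wA_val] at h
  simp only [pl_comp_iL_comp, pl_comp_iR_comp, pl_comp_iL, pl_comp_iR] at h
  exact h

theorem Xi_mul_lineAAA (T : Six k H) :
    (xi p q r : A) * lineAAA p q r T =
      lineAAA p q r (T * (ph (sc' k H) (sb' k H) (sa' k H) : (Six k H)ˣ)) :=
  unop_mul_lineAAA p q r T _

theorem lineAAA_mul_ph (T : Six k H) :
    lineAAA p q r T * ph p q r =
      lineAAA p q r (T * (ph (sa k H) (sb k H) (sc k H) : (Six k H)ˣ)) :=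
  lineAAA_mul p q r T _

theorem lineAAA_word (T : Six k H → A) (hT : T = lineAAA p q r) :
    T (((wA (sc' k H) (sb' k H) (sb k H) (sc k H) : (Six k H)ˣ) : Six k H) *
        (wA (sc' k H ⋆ sb' k H) (sa' k H) (sa k H) (sb k H ⋆ sc k H) : (Six k H)ˣ) *
        (ph (sa k H) (sb k H) (sc k H) : (Six k H)ˣ)) =
    T (((wA (sb' k H) (sa' k H) (sa k H) (sb k H) : (Six k H)ˣ) : Six k H) *
        (wA (sc' k H) (sb' k H ⋆ sa' k H) (sa k H ⋆ sb k H) (sc k H) : (Six k H)ˣ) *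
        (ph (sc' k H) (sb' k H) (sa' k H) : (Six k H)ˣ)) := by
  subst hT
  exact twist_assoc_word (lineAAA_absL p q r)

/-- The Drinfeld twist carries the reassociator `Φ` to its image `S(X³) ⊗ S(X²) ⊗ S(X¹)` under the
antipode. -/
theorem tw_assoc : tw q r * tw p (q ⋆ r) * ph p q r = xi p q r * (tw p q * tw (p ⋆ q) r) := by
  have hs' := (isAntipode_id k H).comp (p ⋆ q ⋆ r)
  let s : H →ₗ[k] A := (MulOpposite.opLinearEquiv k).symm.toLinearMap ∘ₗ
    (bar r ⋆ bar q ⋆ bar p).toLinearMap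
  have hs : ∀ h, s h = ((bar r ⋆ bar q ⋆ bar p) h).unop := fun _ => rfl
  have i1 : ∀ h, (tw q r * tw p (q ⋆ r) * ph p q r : A) * (p ⋆ q ⋆ r) (An k H h) =
      s h * (tw q r * tw p (q ⋆ r) * ph p q r) := fun h => by
    have e1 : ∀ t : H ⊗[k] H, (tw q r : A) * (pl (bar (q ⋆ r)) (bar p) t).unop =
        (pl (bar r ⋆ bar q) (bar p) t).unop * tw q r := fun t => by
      induction t using TensorProduct.induction_on with
      | zero => simp
      | add x y hx hy => simp only [map_add, MulOpposite.unop_add, mul_add, add_mul, hx, hy]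
      | tmul x y =>
        rw [pl_tmul, pl_tmul, MulOpposite.unop_mul, MulOpposite.unop_mul, bar_apply, bar_apply,
          MulOpposite.unop_op, MulOpposite.unop_op, mul_assoc, ← tw_mul_pr, ← mul_assoc,
          ← mul_assoc]
        congr 1
        exact (Comm.comm (a := pl q r) (b := p) _ _).eq
    rw [mul_assoc, ← coassoc, ← mul_assoc, mul_assoc (tw q r : A), tw_mul_pr, ← mul_assoc,
      pr_apply, e1, hs, pr_apply]
    simp only [mul_assoc]
  have i2 : ∀ h, (xi p q r * (tw p q * tw (p ⋆ q) r) : A) * (p ⋆ q ⋆ r) (An k H h) =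
      s h * (xi p q r * (tw p q * tw (p ⋆ q) r)) := fun h => by
    have e1 : ∀ t : H ⊗[k] H, (tw p q : A) * (pl (bar r) (bar (p ⋆ q)) t).unop =
        (pl (bar r) (bar q ⋆ bar p) t).unop * tw p q := fun t => by
      induction t using TensorProduct.induction_on with
      | zero => simp
      | add x y hx hy => simp only [map_add, MulOpposite.unop_add, mul_add, add_mul, hx, hy]
      | tmul x y =>
        rw [pl_tmul, pl_tmul, MulOpposite.unop_mul, MulOpposite.unop_mul, bar_apply, bar_apply,
          MulOpposite.unop_op, MulOpposite.unop_op, ← mul_assoc, tw_mul_pr, mul_assoc, mul_assoc]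
        congr 1
        exact (Comm.comm (a := pl p q) (b := r) _ _).eq
    have e2 : (xi p q r : A) * ((bar r ⋆ (bar q ⋆ bar p)) h).unop = s h * xi p q r := by
      have := coassoc (bar r) (bar q) (bar p) h
      rw [← op_xi] at this
      exact congrArg MulOpposite.unop this
    rw [mul_assoc, mul_assoc, tw_mul_pr, ← mul_assoc (tw p q : A), pr_apply, e1, mul_assoc,
      ← pr_apply, ← mul_assoc, e2, mul_assoc]
  have a1 : (tw q r * tw p (q ⋆ r) * ph p q r : A) * (p ⋆ q ⋆ r) (al k H) =
      (xi p q r * (tw p q * tw (p ⋆ q) r)) * (p ⋆ q ⋆ r) (al k H) := by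
    rw [mul_assoc, ← coassoc, ← mul_assoc, mul_assoc (tw q r : A), tw_mul_pr_al, tw_mul_gam_right,
      lineAAA_mul_ph, lineAAA_word p q r _ rfl, mul_assoc, mul_assoc, tw_mul_pr_al,
      tw_mul_gam_left, Xi_mul_lineAAA]
  ext
  exact (hs'.eq_cmp (s := s) i1 a1).trans (hs'.eq_cmp (s := s) i2 rfl).symm

end TwistAssoc

/-! ### Counits -/

section Counit

variable {k : Type u} {H : Type v} [Field k] [Ring H] [Algebra k H] [QuasiHopfAlgebra k H]
variable {A : Type*} [Semiring A] [Algebra k A]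

/-- Apply `ε` to `X¹ β S(X²) α X³ = 1`. -/
theorem counit_al_mul_counit_be : eps k H (al k H) * eps k H (be k H) = 1 := by
  have h1 := congrArg (eps k H) (isAntipode_id k H).phi
  have key : ∀ z : H ⊗[k] (H ⊗[k] H),
      eps k H (ln (rm (AlgHom.id k H).toLinearMap (be k H))
        (ln (rm (An k H) (al k H)) (AlgHom.id k H).toLinearMap) z) =
      eps k H (al k H) * eps k H (be k H) *
        eps k H (An k H (pl (eta : H →ₐ[k] H) (pl (AlgHom.id k H) eta) z)) := fun z => by
    induction z using tensor3_induction with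
    | zero => simp
    | add x y hx hy => simp only [map_add, mul_add, hx, hy]
    | tmul x y z =>
      simp only [ln_tmul, pl_tmul, eta_apply, LinearMap.comp_apply, LinearMap.mulRight_apply,
        ← Algebra.commutes (eps k H z), ← Algebra.smul_def, map_smul, map_mul, smul_eq_mul,
        AlgHom.toLinearMap_apply, AlgHom.coe_id, id]
      ring
  have h2 : pl (eta : H →ₐ[k] H) (pl (AlgHom.id k H) eta) (Ph k H : H ⊗[k] (H ⊗[k] H)) = 1 := by
    rw [← ph_val, ph_fst_eta, Units.val_one]
  rw [key, h2, An_one, map_one, mul_one] at h1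
  exact h1

theorem counit_S (h : H) : eps k H (An k H h) = eps k H h := by
  have h1 := congrArg (eps k H) ((isAntipode_id k H).left h)
  have key : ∀ z : H ⊗[k] H,
      eps k H (ln (rm (An k H) (al k H)) (AlgHom.id k H).toLinearMap z) =
      eps k H (al k H) * eps k H (An k H (pl (AlgHom.id k H) eta z)) := fun z => by
    induction z using TensorProduct.induction_on with
    | zero => simp
    | add x y hx hy => simp only [map_add, mul_add, hx, hy]
    | tmul x y =>
      simp only [ln_tmul, pl_tmul, eta_apply, LinearMap.comp_apply, LinearMap.mulRight_apply,
        ← Algebra.commutes (eps k H y), ← Algebra.smul_def, map_smul, map_mul, smul_eq_mul,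
        AlgHom.toLinearMap_apply, AlgHom.coe_id, id]
      ring
  rw [key, ← pr_apply, pr_eta, map_smul, smul_eq_mul, mul_comm (eps k H h)] at h1
  exact mul_left_cancel₀ (left_ne_zero_of_mul_eq_one counit_al_mul_counit_be) h1

theorem counit_S' (h : H) : eps k H (QuasiHopfAlgebra.S (k := k) h) = eps k H h := counit_S h

theorem bar_eta : bar (eta : H →ₐ[k] A) = eta := by
  ext h
  rw [bar_apply, eta_apply, eta_apply, counit_S]; rfl

theorem bar_pr_eta (p : H →ₐ[k] A) : (bar p ⋆ bar (eta : H →ₐ[k] A)) = bar p := by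
  simp only [bar_eta, pr_eta]

theorem bar_eta_pr (p : H →ₐ[k] A) : (bar (eta : H →ₐ[k] A) ⋆ bar p) = bar p := by
  simp only [bar_eta, eta_pr]

theorem pl_eta_gam (p : H →ₐ[k] A) : pl eta p (gam k H) = eps k H (al k H) • p (al k H) := by
  have key : ∀ V : (H ⊗[k] H) ⊗[k] (H ⊗[k] H),
      pl eta p (TensorProduct.map (lineA k H) (lineA k H) V) =
      eps k H (al k H) • p (lineA k H (pl (pl eta eta) (pl iL iR) V)) := fun V => by
    induction V using tensor22_induction with
    | zero => simp
    | add x y hx hy => simp only [map_add, smul_add, hx, hy]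
    | tmul a b c d =>
      simp only [TensorProduct.map_tmul, pl_tmul, eta_apply, ← map_mul, ← Algebra.smul_def,
        map_smul, smul_smul]
      simp [counit_S']
      ring_nf
  rw [gam_eq, key, map_wA_val]
  simp [wA, Algebra.TensorProduct.one_def, QuasiHopfAlgebra.S_one]

theorem pl_gam_eta (p : H →ₐ[k] A) : pl p eta (gam k H) = eps k H (al k H) • p (al k H) := by
  have key : ∀ V : (H ⊗[k] H) ⊗[k] (H ⊗[k] H),
      pl p eta (TensorProduct.map (lineA k H) (lineA k H) V) =
      eps k H (al k H) • p (lineA k H (pl (pl iL iR) (pl eta eta) V)) := fun V => by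
    induction V using tensor22_induction with
    | zero => simp
    | add x y hx hy => simp only [map_add, smul_add, hx, hy]
    | tmul a b c d =>
      rw [TensorProduct.map_tmul, pl_tmul, eta_apply, ← Algebra.commutes, ← Algebra.smul_def,
        pl_tmul, pl_tmul (eta : H →ₐ[k] H ⊗[k] H) eta, eta_apply, eta_apply, ← map_mul (algebraMap k _),
        ← Algebra.commutes, ← Algebra.smul_def]
      simp only [map_smul, smul_smul]
      simp [counit_S']
      ring_nf
  rw [gam_eq, key, map_wA_val]
  simp [wA, Algebra.TensorProduct.one_def, QuasiHopfAlgebra.S_one]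

/-- An element that commutes with the antipode string and acts on `α` as the scalar `ε(α)` is that
scalar, because `S(x¹) α x² β S(x³) = 1`. -/
theorem eq_counit_al {p : H →ₐ[k] A} {w : A} (hw : ∀ h, w * p (An k H h) = p (An k H h) * w)
    (ha : w * p (al k H) = eps k H (al k H) • p (al k H)) :
    w = algebraMap k A (eps k H (al k H)) := by
  have hs := (isAntipode_id k H).comp p
  have e1 := hs.eq_cmp (w := w) (s := p.toLinearMap ∘ₗ An k H) hw ha
  have e2 := hs.eq_cmp (w := algebraMap k A (eps k H (al k H))) (s := p.toLinearMap ∘ₗ An k H)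
    (fun h => Algebra.commutes _ _) (Algebra.smul_def _ _).symm
  rw [e1, e2]

/-- `(ε ⊗ id)(f) = ε(α)`; the twist is counital only up to this scalar. -/
theorem tw_eta_left (p : H →ₐ[k] A) :
    (tw eta p : A) = algebraMap k A (eps k H (al k H)) := by
  refine eq_counit_al (p := p) (fun h => ?_) ?_
  · have := tw_mul_pr eta p h
    rwa [eta_pr, bar_pr_eta] at this
  · have := tw_mul_pr_al eta p
    rwa [eta_pr, pl_eta_gam] at this

theorem tw_eta_right (p : H →ₐ[k] A) :
    (tw p eta : A) = algebraMap k A (eps k H (al k H)) := by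
  refine eq_counit_al (p := p) (fun h => ?_) ?_
  · have := tw_mul_pr p eta h
    rwa [pr_eta, bar_eta_pr] at this
  · have := tw_mul_pr_al p eta
    rwa [pr_eta, pl_gam_eta] at this

end Counit

/-! ### Yetter-Drinfeld modules as elements -/

section Elem

variable {k : Type u} {H : Type v} [Field k] [Ring H] [Algebra k H]
variable {E E' A : Type*} [Semiring E] [Algebra k E] [Semiring E'] [Algebra k E'] [Semiring A]
  [Algebra k A]

/-- The coassociativity axiom of a Yetter-Drinfeld module, on strings `a`, `b` and `e`:
`R(b) Φ(a, m, b) R(a) = Φ(a, b, m) R(a ⋆ b) Φ(m, a, b)` with `m = e ρ`. -/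
def HexAt [QuasiBialgebra k H] (ρ : H →ₐ[k] E) (R : H ⊗[k] E) (a b : H →ₐ[k] A) (e : E →ₐ[k] A)
    [Comm a b] [Comm a e] [Comm b e] : Prop :=
  pl b e R * ph a (e.comp ρ) b * pl a e R =
    ph a b (e.comp ρ) * pl (a ⋆ b) e R * ph (e.comp ρ) a b

/-- The Yetter-Drinfeld axioms for a representation `ρ : H → E` and an element `R ∈ H ⊗ E`,
which stands for the coaction `m ↦ R (1 ⊗ m)` if `E` is an algebra of endomorphisms. -/
structure IsYDElem [QuasiBialgebra k H] (ρ : H →ₐ[k] E) (R : H ⊗[k] E) : Prop where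
  hex' : HexAt ρ R (iL : H →ₐ[k] H ⊗[k] (H ⊗[k] E)) (iR.comp iL) (iR.comp iR)
  compat' : ∀ h, (iL ⋆ iR.comp ρ) h * R = R * (iR.comp ρ ⋆ iL) h
  counit' : pl eta (AlgHom.id k E) R = 1

namespace IsYDElem

section Bialgebra

variable [QuasiBialgebra k H] {ρ : H →ₐ[k] E} {R : H ⊗[k] E}

section General

variable (a b : H →ₐ[k] A) (e : E →ₐ[k] A) [Comm a b] [Comm a e] [Comm b e]

theorem hex (hR : IsYDElem ρ R) :
    pl b e R * ph a (e.comp ρ) b * pl a e R =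
      ph a b (e.comp ρ) * pl (a ⋆ b) e R * ph (e.comp ρ) a b := by
  have h := congrArg (pl a (pl b e)) hR.hex'
  simp only [AlgHom.comp_assoc] at h
  rw [map_mul, map_mul, map_mul, map_mul] at h
  simpa using h

theorem compat (hR : IsYDElem ρ R) (h : H) :
    (a ⋆ e.comp ρ) h * pl a e R = pl a e R * (e.comp ρ ⋆ a) h := by
  have h := congrArg (pl a e) (hR.compat' h)
  simpa [← AlgHom.comp_apply] using h

theorem counit (hR : IsYDElem ρ R) : pl eta e R = 1 := by
  have h := congrArg e hR.counit'
  simpa using h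

end General

theorem map (hR : IsYDElem ρ R) (F : E →ₐ[k] E') :
    IsYDElem (F.comp ρ) (Algebra.TensorProduct.map (AlgHom.id k H) F R) where
  hex' := by
    rw [HexAt, pl_map, pl_map, pl_map]
    exact hR.hex iL (iR.comp iL) (iR.comp (iR.comp F))
  compat' h := by
    have h := hR.compat iL (iR.comp F : E →ₐ[k] H ⊗[k] E') h
    have e : ∀ t, Algebra.TensorProduct.map (AlgHom.id k H) F t = pl iL (iR.comp F) t := fun t => by
      rw [← pl_iL_iR (Algebra.TensorProduct.map (AlgHom.id k H) F t), pl_map]; rfl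
    rw [e]
    exact h
  counit' := by
    rw [pl_map]
    exact hR.counit F

end Bialgebra

end IsYDElem

section Dual

variable [QuasiHopfAlgebra k H]

/-- The element `R` placed on `p` and `e` and twisted by the Drinfeld twist:
`f(p, e ρ) R(p, e) f(e ρ, p)⁻¹`. -/
def twElem (ρ : H →ₐ[k] E) (R : H ⊗[k] E) (p : H →ₐ[k] A) (e : E →ₐ[k] A) [Comm p e] : A :=
  tw p (e.comp ρ) * pl p e R * ((tw (e.comp ρ) p)⁻¹ : Aˣ)

/-- The element of `H ⊗ Eᵐᵒᵖ` describing the coaction of the left dual: `(S⁻¹ ⊗ op)` of the twisted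
element. The opposite algebra acts on the dual space by transposes. -/
def dualElem (ρ : H →ₐ[k] E) (R : H ⊗[k] E) : H ⊗[k] Eᵐᵒᵖ :=
  TensorProduct.map (AnInv k H) (MulOpposite.opLinearEquiv k).toLinearMap (twElem ρ R iL iR)

/-- A string viewed as a string of opposite algebras. -/
abbrev opS (e : E →ₐ[k] A) : Eᵐᵒᵖ →ₐ[k] Aᵐᵒᵖ := AlgHom.op e

instance (p : H →ₐ[k] A) (e : E →ₐ[k] A) [hp : Comm p e] : Comm (bar p) (opS e) :=
  ⟨fun x y => (hp.comm (An k H x) y.unop).op⟩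

theorem opS_comp_bar (e : E →ₐ[k] A) (ρ : H →ₐ[k] E) : (opS e).comp (bar ρ) = bar (e.comp ρ) := rfl

theorem map_twElem {ρ : H →ₐ[k] E} {R : H ⊗[k] E} (p : H →ₐ[k] A) (e : E →ₐ[k] A) [Comm p e] :
    pl p e (twElem ρ R iL iR) = twElem ρ R p e := by
  have h : ∀ (a b : H →ₐ[k] H ⊗[k] E) [Comm a b], pl p e (((tw a b)⁻¹ : (H ⊗[k] E)ˣ) : H ⊗[k] E) =
      ((tw ((pl p e).comp a) ((pl p e).comp b))⁻¹ : Aˣ) := fun a b _ => by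
    rw [tw_inv_val, tw_inv_val, map_pl]
  rw [twElem, map_mul, map_mul, h, map_tw_val, map_pl, twElem]
  simp

theorem pl_dualElem {ρ : H →ₐ[k] E} {R : H ⊗[k] E} (p : H →ₐ[k] A) (e : E →ₐ[k] A) [Comm p e] :
    pl (bar p) (opS e) (dualElem ρ R) = MulOpposite.op (twElem ρ R p e) := by
  have h : ∀ t : H ⊗[k] E, pl (bar p) (opS e) (TensorProduct.map (AnInv k H)
      (MulOpposite.opLinearEquiv k).toLinearMap t) = MulOpposite.op (pl p e t) := fun t => by
    induction t using TensorProduct.induction_on with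
    | zero => simp
    | add x y hx hy => simp only [map_add, hx, hy, MulOpposite.op_add]
    | tmul x y =>
      rw [TensorProduct.map_tmul, pl_tmul, pl_tmul, MulOpposite.op_mul, bar_apply]
      have : An k H (AnInv k H x) = x := QuasiHopfAlgebra.S.apply_symm_apply x
      rw [this]
      have hc := (Comm.comm (a := p) (b := e) x y).op.eq
      exact hc
  rw [dualElem, h, map_twElem]

/-- The dual element on a product of strings, where the Drinfeld twist relates `Δ ∘ S` to
`(S ⊗ S) ∘ Δᵒᵖ`. -/
theorem pl_bar_pr {ρ : H →ₐ[k] E} {R : H ⊗[k] E} (p q : H →ₐ[k] A) (e : E →ₐ[k] A) [Comm p e]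
    [Comm q e] [Comm q p] : (pl (bar p ⋆ bar q) (opS e) (dualElem ρ R)).unop =
      tw q p * twElem ρ R (q ⋆ p) e * ((tw q p)⁻¹ : Aˣ) := by
  rw [Units.eq_mul_inv_iff_mul_eq]
  have h := intertwine_pl (z := MulOpposite.op (tw q p : A)) (s := bar p ⋆ bar q)
    (s' := bar (q ⋆ p)) (a := opS e) (a' := opS e) (fun h => by
      rw [bar_apply, ← MulOpposite.op_mul, tw_mul_pr, MulOpposite.op_mul, MulOpposite.op_unop])
    (fun y => by
      have := (Comm.comm (a := pl q p) (b := e) (drinfeldTwist k H) y.unop).symm.op.eq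
      exact this.symm) (dualElem ρ R)
  rw [pl_dualElem] at h
  exact congrArg MulOpposite.unop h

variable {ρ : H →ₐ[k] E} {R : H ⊗[k] E} (p q : H →ₐ[k] A) (e : E →ₐ[k] A) [Comm p e]
    [Comm q e] [Comm p q]

/-- `tw_assoc` solved for the image of `Φ` under the antipode. -/
theorem xi_eq (p q r : H →ₐ[k] A) [Comm p q] [Comm p r] [Comm q r] :
    xi p q r = tw q r * tw p (q ⋆ r) * ph p q r * (tw (p ⋆ q) r)⁻¹ * (tw p q)⁻¹ := by
  rw [tw_assoc]; group

theorem dual_compat_iff (h : H) :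
    (bar p ⋆ (opS e).comp (bar ρ)) h * pl (bar p) (opS e) (dualElem ρ R) =
      pl (bar p) (opS e) (dualElem ρ R) * ((opS e).comp (bar ρ) ⋆ bar p) h ↔
    (p ⋆ e.comp ρ) (An k H h) * pl p e R = pl p e R * (e.comp ρ ⋆ p) (An k H h) := by
  have e1 : (bar p ⋆ (opS e).comp (bar ρ)) h * pl (bar p) (opS e) (dualElem ρ R) =
      MulOpposite.op (tw p (e.comp ρ) * (pl p e R * (e.comp ρ ⋆ p) (An k H h)) *
        ((tw (e.comp ρ) p)⁻¹ : Aˣ)) := by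
    have h1 : (bar p ⋆ bar (e.comp ρ)) h = MulOpposite.op (tw (e.comp ρ) p *
        (e.comp ρ ⋆ p) (An k H h) * ((tw (e.comp ρ) p)⁻¹ : Aˣ)) := by
      rw [tw_mul_pr]; simp
    rw [pl_dualElem]
    simp only [opS_comp_bar]
    rw [h1, ← MulOpposite.op_mul, twElem]
    simp [mul_assoc]
  have e2 : pl (bar p) (opS e) (dualElem ρ R) * ((opS e).comp (bar ρ) ⋆ bar p) h =
      MulOpposite.op (tw p (e.comp ρ) * ((p ⋆ e.comp ρ) (An k H h) * pl p e R) *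
        ((tw (e.comp ρ) p)⁻¹ : Aˣ)) := by
    have h1 : (bar (e.comp ρ) ⋆ bar p) h = MulOpposite.op (tw p (e.comp ρ) *
        (p ⋆ e.comp ρ) (An k H h) * ((tw p (e.comp ρ))⁻¹ : Aˣ)) := by
      rw [tw_mul_pr]; simp
    rw [pl_dualElem]
    simp only [opS_comp_bar]
    rw [h1, ← MulOpposite.op_mul, twElem]
    simp [mul_assoc]
  rw [e1, e2, MulOpposite.op_inj, Units.mul_left_inj, Units.mul_right_inj]
  exact eq_comm

/-- The coassociativity of the dual is that of the module, up to factors which `tw_assoc` cancels. -/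
theorem dual_hex_iff (hc : ∀ (p : H →ₐ[k] A) [Comm p e] (h),
      (p ⋆ e.comp ρ) h * pl p e R = pl p e R * (e.comp ρ ⋆ p) h) :
    (pl (bar q) (opS e) (dualElem ρ R) * ph (bar p) ((opS e).comp (bar ρ)) (bar q) *
        pl (bar p) (opS e) (dualElem ρ R) =
      ph (bar p) (bar q) ((opS e).comp (bar ρ)) * pl (bar p ⋆ bar q) (opS e) (dualElem ρ R) *
        ph ((opS e).comp (bar ρ)) (bar p) (bar q)) ↔
    pl p e R * ph q (e.comp ρ) p * pl q e R =
      ph q p (e.comp ρ) * pl (q ⋆ p) e R * ph (e.comp ρ) q p := by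
  -- Both sides are the opposites of the two sides of the hexagon of `R`, multiplied by the same twists
  -- on the left and on the right.
  have e1 : pl (bar q) (opS e) (dualElem ρ R) * ph (bar p) ((opS e).comp (bar ρ)) (bar q) *
        pl (bar p) (opS e) (dualElem ρ R) =
      MulOpposite.op (((tw p (e.comp ρ) * tw q (p ⋆ (e.comp ρ)) : Aˣ) : A) *
        (pl p e R * ph q (e.comp ρ) p * pl q e R) * (((tw ((e.comp ρ) ⋆ q) p)⁻¹ * (tw (e.comp ρ) q)⁻¹ : Aˣ) : A)) := by
    have c1 : (pl p e R : A) * tw q ((e.comp ρ) ⋆ p) = tw q (p ⋆ (e.comp ρ)) * pl p e R :=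
      intertwine_pl (fun h => (Comm.comm (a := pl p e) (b := q) R h).eq)
        (fun h => (hc p h).symm) _
    have c2 : (pl q e R : A) * ((tw ((e.comp ρ) ⋆ q) p)⁻¹ : Aˣ) = ((tw (q ⋆ (e.comp ρ)) p)⁻¹ : Aˣ) * pl q e R :=
      intertwine_pl (fun h => (hc q h).symm)
        (fun h => (Comm.comm (a := pl q e) (b := p) R h).eq) _
    rw [pl_dualElem, pl_dualElem]
    simp only [opS_comp_bar]
    rw [← op_xi, ← MulOpposite.op_mul, ← MulOpposite.op_mul]
    congr 1
    rw [xi_eq, twElem, twElem]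
    simp only [Units.val_mul, mul_assoc, Units.inv_mul_cancel_left]
    rw [← mul_assoc (pl p e R : A) (tw q ((e.comp ρ) ⋆ p) : A), c1, ← mul_assoc (pl q e R : A), c2]
    simp only [mul_assoc]
  have e2 : ph (bar p) (bar q) ((opS e).comp (bar ρ)) * pl (bar p ⋆ bar q) (opS e) (dualElem ρ R) *
        ph ((opS e).comp (bar ρ)) (bar p) (bar q) =
      MulOpposite.op (((tw p (e.comp ρ) * tw q (p ⋆ (e.comp ρ)) : Aˣ) : A) *
        (ph q p (e.comp ρ) * pl (q ⋆ p) e R * ph (e.comp ρ) q p) * (((tw ((e.comp ρ) ⋆ q) p)⁻¹ * (tw (e.comp ρ) q)⁻¹ : Aˣ) : A)) := by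
    apply MulOpposite.unop_injective
    rw [MulOpposite.unop_mul, MulOpposite.unop_mul, pl_bar_pr]
    simp only [opS_comp_bar]
    rw [← op_xi, ← op_xi, MulOpposite.unop_op, MulOpposite.unop_op, MulOpposite.unop_op, xi_eq,
      xi_eq, twElem]
    simp only [Units.val_mul, mul_assoc, Units.inv_mul_cancel_left]
  rw [e1, e2, MulOpposite.op_inj, Units.mul_left_inj, Units.mul_right_inj]

theorem dual_counit_iff :
    pl eta (opS e) (dualElem ρ R) = 1 ↔ pl eta e R = 1 := by
  have h : pl (bar (eta : H →ₐ[k] A)) (opS e) (dualElem ρ R) = MulOpposite.op (pl eta e R) := by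
    rw [pl_dualElem, twElem, tw_eta_left, Algebra.commutes, ← tw_eta_right (e.comp ρ), mul_assoc,
      Units.mul_inv, mul_one]
  have h2 : ∀ (s : H →ₐ[k] Aᵐᵒᵖ) [Comm s (opS e)], s = eta → pl s (opS e) (dualElem ρ R) =
    pl eta (opS e) (dualElem ρ R) := fun s _ hs => by subst hs; rfl
  rw [← h2 _ bar_eta, h, ← MulOpposite.op_one, MulOpposite.op_inj]

end Dual

end Elem

section DualElem

variable {k : Type u} {H : Type v} [Field k] [Ring H] [Algebra k H] [QuasiHopfAlgebra k H]
variable {E A : Type*} [Semiring E] [Algebra k E] [Semiring A] [Algebra k A]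
variable {ρ : H →ₐ[k] E} {R : H ⊗[k] E}

theorem HexAt.of_injective {B : Type*} [Semiring B] [Algebra k B] {a b : H →ₐ[k] A} {e : E →ₐ[k] A}
    [Comm a b] [Comm a e] [Comm b e] {G : A →ₐ[k] B} (hG : Function.Injective G)
    (h : HexAt ρ R (G.comp a) (G.comp b) (G.comp e)) : HexAt ρ R a b e := by
  apply hG
  simp only [map_mul, map_ph_val, map_pl, comp_pr]
  exact h

theorem hexAt_congr {a b a' b' : H →ₐ[k] A} {e e' : E →ₐ[k] A}
    [Comm a b] [Comm a e] [Comm b e] [Comm a' b'] [Comm a' e'] [Comm b' e']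
    (h : HexAt ρ R a b e) (ha : a = a') (hb : b = b') (he : e = e') : HexAt ρ R a' b' e' := by
  subst ha hb he; exact h

/-- The map `h ⊗ x ↦ S(h) ⊗ x` is injective because `S` is bijective; it reflects identities of words. -/
theorem bar_opS_injective2 : Function.Injective
    (pl (bar (iL : H →ₐ[k] H ⊗[k] E)) (opS (iR : E →ₐ[k] H ⊗[k] E))) := by
  have h : ∀ t, pl (bar (iL : H →ₐ[k] H ⊗[k] E)) (opS (iR : E →ₐ[k] H ⊗[k] E)) t =
      MulOpposite.op (TensorProduct.congr (QuasiHopfAlgebra.S (k := k) (H := H))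
        (MulOpposite.opLinearEquiv k).symm t) := fun t => by
    induction t using TensorProduct.induction_on with
    | zero => simp
    | add x y hx hy => simp only [map_add, hx, hy, MulOpposite.op_add]
    | tmul x y =>
      rw [pl_tmul, bar_apply, TensorProduct.congr_tmul]
      apply MulOpposite.unop_injective
      simp
  intro x y hxy
  rw [h, h] at hxy
  exact (LinearEquiv.injective _) (MulOpposite.op_injective hxy)

theorem bar_opS_injective3 : Function.Injective
    (pl (bar (iL : H →ₐ[k] H ⊗[k] (H ⊗[k] E))) (pl (bar (iR.comp iL : H →ₐ[k] H ⊗[k] (H ⊗[k] E)))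
      (opS (iR.comp iR : E →ₐ[k] H ⊗[k] (H ⊗[k] E))))) := by
  have h : ∀ t, pl (bar (iL : H →ₐ[k] H ⊗[k] (H ⊗[k] E)))
      (pl (bar (iR.comp iL : H →ₐ[k] H ⊗[k] (H ⊗[k] E)))
        (opS (iR.comp iR : E →ₐ[k] H ⊗[k] (H ⊗[k] E)))) t =
      MulOpposite.op (TensorProduct.congr (QuasiHopfAlgebra.S (k := k) (H := H))
        (TensorProduct.congr (QuasiHopfAlgebra.S (k := k) (H := H))
          (MulOpposite.opLinearEquiv k).symm) t) := fun t => by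
    induction t using tensor3_induction with
    | zero => simp
    | add x y hx hy => simp only [map_add, hx, hy, MulOpposite.op_add]
    | tmul x y z =>
      rw [pl_tmul, pl_tmul, bar_apply, bar_apply, TensorProduct.congr_tmul,
        TensorProduct.congr_tmul]
      apply MulOpposite.unop_injective
      simp
  intro x y hxy
  rw [h, h] at hxy
  exact (LinearEquiv.injective _) (MulOpposite.op_injective hxy)

/-- The left dual satisfies the Yetter-Drinfeld axioms if and only if the module does. -/
theorem isYDElem_dual_iff : IsYDElem (bar ρ) (dualElem ρ R) ↔ IsYDElem ρ R := by
  constructor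
  · intro h
    have hc : ∀ h, (iL ⋆ iR.comp ρ) h * R = R * (iR.comp ρ ⋆ iL) h := fun x => by
      have h1 := (dual_compat_iff (ρ := ρ) (R := R) (iL : H →ₐ[k] H ⊗[k] E) iR (AnInv k H x)).1
        (h.compat _ _ _)
      have h2 : An k H (AnInv k H x) = x := QuasiHopfAlgebra.S.apply_symm_apply x
      rwa [h2, pl_iL_iR] at h1
    refine ⟨?_, hc, ?_⟩
    · refine (dual_hex_iff _ _ _ ?_).1 (h.hex (bar (iR.comp iL)) (bar iL) (opS (iR.comp iR)))
      intro p _ x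
      have h3 := congrArg (pl p (iR.comp iR : E →ₐ[k] H ⊗[k] (H ⊗[k] E))) (hc x)
      simpa [← AlgHom.comp_apply, AlgHom.comp_assoc] using h3
    · exact (dual_counit_iff _).1 (h.counit _)
  · intro h
    refine ⟨?_, ?_, ?_⟩
    · refine HexAt.of_injective bar_opS_injective3 (hexAt_congr
        (a := bar (iL : H →ₐ[k] H ⊗[k] (H ⊗[k] E))) (b := bar (iR.comp iL))
        (e := opS (iR.comp iR)) ?_ ?_ ?_ ?_)
      · exact (dual_hex_iff _ _ _ fun p _ x => h.compat p _ x).2 (h.hex _ _ _)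
      · simp
      · simp
      · simp
    · intro x
      apply bar_opS_injective2
      have h1 := (dual_compat_iff (ρ := ρ) (R := R) (iL : H →ₐ[k] H ⊗[k] E) iR x).2
        (h.compat _ _ _)
      rw [map_mul, map_mul, ← AlgHom.comp_apply, ← AlgHom.comp_apply, comp_pr, comp_pr]
      simpa using h1
    · have h1 := (dual_counit_iff (ρ := ρ) (R := R) (AlgHom.id k E)).2 (h.counit _)
      exact h1

end DualElem

/-! ### Coactions as elements of `H ⊗ End M` -/

section Coact

variable {k : Type u} {H : Type v} [Field k] [Ring H] [Algebra k H]
variable {M : Type*} [AddCommGroup M] [Module k M]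

section Act

variable {A B C U V W : Type*} [Ring A] [Algebra k A] [Ring B] [Algebra k B] [Ring C] [Algebra k C]
  [AddCommGroup U] [Module k U] [AddCommGroup V] [Module k V] [AddCommGroup W] [Module k W]

@[simp] theorem act2_tmul (ρ : A →ₐ[k] Module.End k U) (σ : B →ₐ[k] Module.End k V) (a : A) (b : B)
    (x : U) (y : V) : act2 ρ σ (a ⊗ₜ b) (x ⊗ₜ y) = ρ a x ⊗ₜ σ b y := by
  simp only [act2, AlgHom.comp_apply, Algebra.TensorProduct.map_tmul]
  rfl

@[simp] theorem act3_tmul (ρ : A →ₐ[k] Module.End k U) (σ : B →ₐ[k] Module.End k V)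
    (τ : C →ₐ[k] Module.End k W) (a : A) (b : B) (c : C) (x : U) (y : V) (z : W) :
    act3 ρ σ τ (a ⊗ₜ (b ⊗ₜ c)) (x ⊗ₜ (y ⊗ₜ z)) = ρ a x ⊗ₜ (σ b y ⊗ₜ τ c z) := by
  simp [act3]

end Act

@[simp] theorem coactTwist_tmul {A : Type*} [Ring A] [Algebra k A] (ρ : H →ₐ[k] Module.End k M)
    (c : M →ₗ[k] A ⊗[k] M) (a : H) (b : A) (m : M) :
    coactTwist ρ c (a ⊗ₜ b) m = (LinearMap.mulRight k b).rTensor M (c (ρ a m)) := rfl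

@[simp] theorem braidLin_tmul {V : Type*} [AddCommGroup V] [Module k V]
    (c : M →ₗ[k] H ⊗[k] M) (σ : H →ₐ[k] Module.End k V) (m : M) (v : V) :
    braidLin c σ (m ⊗ₜ v) = (σ.toLinearMap.flip v).rTensor M (c m) := rfl

/-- The map `m ↦ R (1 ⊗ m)` for `R ∈ H ⊗ End M`. -/
def coactOf (R : H ⊗[k] Module.End k M) : M →ₗ[k] H ⊗[k] M :=
  act2 (reg k H) (AlgHom.id k _) R ∘ₗ TensorProduct.mk k H M 1

theorem coactOf_apply (R : H ⊗[k] Module.End k M) (m : M) :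
    coactOf R m = act2 (reg k H) (AlgHom.id k _) R (1 ⊗ₜ m) := rfl

@[simp] theorem coactOf_tmul (h : H) (f : Module.End k M) (m : M) :
    coactOf (h ⊗ₜ f) m = h ⊗ₜ f m := by
  simp [coactOf_apply]

@[simp] theorem coactOf_zero : coactOf (0 : H ⊗[k] Module.End k M) = 0 := by
  ext; simp [coactOf_apply]

@[simp] theorem coactOf_add (R R' : H ⊗[k] Module.End k M) :
    coactOf (R + R') = coactOf R + coactOf R' := by
  ext; simp [coactOf_apply]

theorem coactOf_eq (R : H ⊗[k] Module.End k M) :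
    coactOf R = TensorProduct.lTensorHomToHomLTensor (RingHom.id k) M H M R := by
  ext m
  induction R using TensorProduct.induction_on with
  | zero => simp
  | add x y hx hy => simp [hx, hy]
  | tmul x y => simp

theorem coactOf_injective [Module.Finite k M] : Function.Injective (coactOf : H ⊗[k] Module.End k M → _) := by
  intro R R' h
  rw [coactOf_eq, coactOf_eq, ← lTensorHomEquivHomLTensor_apply,
    ← lTensorHomEquivHomLTensor_apply] at h
  exact (LinearEquiv.injective _) h

theorem exists_coactOf [Module.Finite k M] (c : M →ₗ[k] H ⊗[k] M) : ∃ R, coactOf R = c := by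
  obtain ⟨R, rfl⟩ := (lTensorHomEquivHomLTensor k M H M).surjective c
  exact ⟨R, by rw [coactOf_eq, ← lTensorHomEquivHomLTensor_apply]⟩

/-- The representation of `H ⊗ (H ⊗ End M)` on `H ⊗ (H ⊗ M)`. -/
abbrev rep3 : H ⊗[k] (H ⊗[k] Module.End k M) →ₐ[k] Module.End k (H ⊗[k] (H ⊗[k] M)) :=
  act3 (reg k H) (reg k H) (AlgHom.id k _)

theorem rep3_injective [Module.Finite k M] {X Y : H ⊗[k] (H ⊗[k] Module.End k M)}
    (h : ∀ m : M, rep3 X (1 ⊗ₜ (1 ⊗ₜ m)) = rep3 Y (1 ⊗ₜ (1 ⊗ₜ m))) : X = Y := by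
  let F := (lTensorHomEquivHomLTensor k M H M).lTensor H ≪≫ₗ
    lTensorHomEquivHomLTensor k M H (H ⊗[k] M)
  have hF : ∀ (X : H ⊗[k] (H ⊗[k] Module.End k M)) (m : M), F X m = rep3 X (1 ⊗ₜ (1 ⊗ₜ m)) := by
    intro X m
    induction X using tensor3_induction with
    | zero => simp
    | add x y hx hy => simp only [map_add, LinearMap.add_apply, hx, hy]
    | tmul x y z =>
      simp [F, lTensorHomEquivHomLTensor_apply]
  apply F.injective
  ext m
  rw [hF, hF, h]

theorem act2_reg_comp (ρ : H →ₐ[k] Module.End k M) (t : H ⊗[k] H) :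
    act2 (reg k H) (AlgHom.id k (Module.End k M)) (pl iL (iR.comp ρ) t) =
      act2 (reg k H) ρ t := by
  induction t using TensorProduct.induction_on with
  | zero => simp only [map_zero]
  | add x y hx hy => simp only [map_add, hx, hy]
  | tmul x y => ext; simp

theorem coactOf_pl_mul (ρ : H →ₐ[k] Module.End k M) (t : H ⊗[k] H) (R : H ⊗[k] Module.End k M)
    (m : M) : coactOf (pl iL (iR.comp ρ) t * R) m = act2 (reg k H) ρ t (coactOf R m) := by
  rw [coactOf_apply, map_mul, Module.End.mul_apply, act2_reg_comp, coactOf_apply]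

theorem coactOf_mul_pl (ρ : H →ₐ[k] Module.End k M) (t : H ⊗[k] H) (R : H ⊗[k] Module.End k M)
    (m : M) : coactOf (R * pl (iR.comp ρ) iL t) m = coactTwist ρ (coactOf R) t m := by
  rw [coactOf_apply, map_mul, Module.End.mul_apply]
  induction t using TensorProduct.induction_on with
  | zero => simp
  | add x y hx hy => simp only [map_add, LinearMap.add_apply, hx, hy]
  | tmul x y =>
    rw [coactTwist_tmul]
    induction R using TensorProduct.induction_on with
    | zero => simp
    | add x y hx hy => simp only [map_add, LinearMap.add_apply, coactOf_add, hx, hy]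
    | tmul z w => simp

theorem rep3_left (ρ : H →ₐ[k] Module.End k M) (z : H ⊗[k] (H ⊗[k] H))
    (R R' : H ⊗[k] Module.End k M) (m : M) :
    rep3 (pl (iR.comp iL) (iR.comp iR) R * (pl iL (pl (iR.comp (iR.comp ρ)) (iR.comp iL)) z *
      pl iL (iR.comp iR) R')) ((1 : H) ⊗ₜ (1 ⊗ₜ m)) =
    TensorProduct.homTensorHomMap (RingHom.id k) H M H (H ⊗[k] M)
      (TensorProduct.map (reg k H).toLinearMap (coactTwist ρ (coactOf R)) z) (coactOf R' m) := by
  rw [map_mul, map_mul, Module.End.mul_apply, Module.End.mul_apply]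
  induction R' using TensorProduct.induction_on with
  | zero => simp
  | add x y hx hy => simp only [map_add, LinearMap.add_apply, coactOf_add, hx, hy]
  | tmul h f =>
  induction z using tensor3_induction with
  | zero => simp
  | add x y hx hy => simp only [map_add, LinearMap.add_apply, hx, hy]
  | tmul a b c =>
  induction R using TensorProduct.induction_on with
  | zero => simp
  | add x y hx hy =>
    simp only [map_add, LinearMap.add_apply, hx, hy]
    simp [TensorProduct.tmul_add]
  | tmul h' f' => simp

theorem rep3_right [QuasiBialgebra k H] (ρ : H →ₐ[k] Module.End k M) (z z' : H ⊗[k] (H ⊗[k] H))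
    (R : H ⊗[k] Module.End k M) (m : M) :
    rep3 (pl iL (pl (iR.comp iL) (iR.comp (iR.comp ρ))) z * (pl (iL ⋆ (iR.comp iL)) (iR.comp iR) R *
      pl (iR.comp (iR.comp ρ)) (pl iL (iR.comp iL)) z')) ((1 : H) ⊗ₜ (1 ⊗ₜ m)) =
    act3 (reg k H) (reg k H) ρ z (TensorProduct.assoc k H H M
      (coactTwist ρ ((Dl k H).toLinearMap.rTensor M ∘ₗ coactOf R) z' m)) := by
  have e1 : rep3 (pl iL (pl (iR.comp iL) (iR.comp (iR.comp ρ))) z) =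
      act3 (reg k H) (reg k H) ρ z := by
    induction z using tensor3_induction with
    | zero => simp only [map_zero]
    | add x y hx hy => simp only [map_add, hx, hy]
    | tmul x y => ext; simp
  rw [map_mul, map_mul, Module.End.mul_apply, Module.End.mul_apply, e1]
  congr 1
  induction z' using TensorProduct.induction_on with
  | zero => simp
  | add x y hx hy => simp only [map_add, LinearMap.add_apply, hx, hy]
  | tmul a t =>
  rw [coactTwist_tmul, LinearMap.comp_apply]
  induction R using TensorProduct.induction_on with
  | zero => simp
  | add x y hx hy => simp only [map_add, LinearMap.add_apply, coactOf_add, hx, hy]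
  | tmul h f =>
  rw [pl_tmul, pl_tmul, pr_apply]
  rw [map_mul, map_mul, Module.End.mul_apply, Module.End.mul_apply, coactOf_tmul,
    LinearMap.rTensor_tmul, LinearMap.rTensor_tmul, AlgHom.toLinearMap_apply]
  generalize Dl k H h = s
  induction s using TensorProduct.induction_on with
  | zero => simp
  | add x y hx hy => simp only [map_add, LinearMap.add_apply, TensorProduct.add_tmul, hx, hy]
  | tmul x y =>
  induction t using TensorProduct.induction_on with
  | zero => simp
  | add x y hx hy =>
    simp only [map_add, LinearMap.add_apply, hx, hy]
    simp [mul_add, TensorProduct.add_tmul]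
  | tmul z w => simp

theorem counit_coactOf [QuasiBialgebra k H] (R : H ⊗[k] Module.End k M) (m : M) :
    TensorProduct.lid k M ((eps k H).toLinearMap.rTensor M (coactOf R m)) =
      pl eta (AlgHom.id k (Module.End k M)) R m := by
  induction R using TensorProduct.induction_on with
  | zero => simp
  | add x y hx hy => simp only [map_add, LinearMap.add_apply, coactOf_add, hx, hy]
  | tmul h f => simp [eta_apply]

/-- The Yetter-Drinfeld axioms for a finite dimensional module in terms of the element of
`H ⊗ End M`. -/
theorem isYD_iff [QuasiBialgebra k H] (M : YDDatum k H) [Module.Finite k M.carrier]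
    {R : H ⊗[k] Module.End k M.carrier} (hR : M.coact = coactOf R) :
    M.IsYD ↔ IsYDElem M.act R := by
  constructor
  · intro h
    refine ⟨?_, ?_, ?_⟩
    · apply rep3_injective
      intro m
      have h1 := h.coassoc m
      rw [hR, ← rep3_left, ← rep3_right] at h1
      rw [← mul_assoc, ← mul_assoc] at h1
      exact h1
    · intro x
      apply coactOf_injective
      ext m
      have h1 := h.compat x m
      rw [hR, ← coactOf_mul_pl, ← coactOf_pl_mul] at h1
      exact h1
    · ext m
      have h1 := h.counit m
      rw [hR, counit_coactOf] at h1
      exact h1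
  · intro h
    refine ⟨?_, ?_, ?_⟩
    · intro m
      rw [hR, ← rep3_left, ← rep3_right, ← mul_assoc, ← mul_assoc]
      have := h.hex'
      exact congrArg (fun X => rep3 X ((1 : H) ⊗ₜ (1 ⊗ₜ m))) this
    · intro m
      rw [hR, counit_coactOf, h.counit']
      rfl
    · intro x m
      rw [hR, ← coactOf_mul_pl, ← coactOf_pl_mul]
      exact congrArg (fun X => coactOf X m) (h.compat' x)

end Coact

/-! ### Tensor products of Yetter-Drinfeld modules -/

section Monoid

variable {G : Type*} [Monoid G]

theorem mul_mul_of_eq {a b c : G} (h : a * b = c) (z : G) : a * (b * z) = c * z := by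
  rw [← mul_assoc, h]

theorem mul_mul_mul_of_eq {a b c d : G} (h : a * b * c = d) (z : G) :
    a * (b * (c * z)) = d * z := by
  rw [← mul_assoc, ← mul_assoc, h]

end Monoid

section Pentagon

variable {k : Type u} {H : Type v} [Field k] [Ring H] [Algebra k H] [QuasiBialgebra k H]
variable {A : Type*} [Semiring A] [Algebra k A]
variable (a b c d : H →ₐ[k] A) [Comm a b] [Comm a c] [Comm a d] [Comm b c] [Comm b d] [Comm c d]

theorem pentagon_val :
    (ph b c d * ph a (b ⋆ c) d * ph a b c : A) = ph a b (c ⋆ d) * ph (a ⋆ b) c d := by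
  have := congrArg Units.val (pentagon a b c d)
  exact this

/-- Forms of the pentagon used to rewrite words from left to right. -/
theorem ph_inv_mul_ph : (((ph b c d)⁻¹ : Aˣ) : A) * ph a b (c ⋆ d) =
    ph a (b ⋆ c) d * ph a b c * ((ph (a ⋆ b) c d)⁻¹ : Aˣ) := by
  have : (ph b c d)⁻¹ * ph a b (c ⋆ d) = ph a (b ⋆ c) d * ph a b c * (ph (a ⋆ b) c d)⁻¹ := by
    rw [inv_mul_eq_iff_eq_mul, ← mul_assoc, ← mul_assoc, pentagon, mul_inv_cancel_right]
  exact congrArg Units.val this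

theorem ph_mul_ph_inv : (ph (a ⋆ b) c d : A) * ((ph a b c)⁻¹ : Aˣ) =
    ((ph a b (c ⋆ d))⁻¹ : Aˣ) * ph b c d * ph a (b ⋆ c) d := by
  have : ph (a ⋆ b) c d * (ph a b c)⁻¹ = (ph a b (c ⋆ d))⁻¹ * ph b c d * ph a (b ⋆ c) d := by
    rw [mul_inv_eq_iff_eq_mul, mul_assoc, mul_assoc, eq_inv_mul_iff_mul_eq, ← mul_assoc, pentagon]
  exact congrArg Units.val this

theorem ph_mul_ph_inv_mul_ph_inv_mul_ph : (ph a b c : A) * ((ph (a ⋆ b) c d)⁻¹ : Aˣ) *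
    ((ph a b (c ⋆ d))⁻¹ : Aˣ) * ph b c d = ((ph a (b ⋆ c) d)⁻¹ : Aˣ) := by
  have : ph a b c * (ph (a ⋆ b) c d)⁻¹ * (ph a b (c ⋆ d))⁻¹ * ph b c d = (ph a (b ⋆ c) d)⁻¹ := by
    rw [mul_assoc (ph a b c), ← mul_inv_rev, ← pentagon]
    simp [mul_assoc]
  exact congrArg Units.val this

end Pentagon

section Slide

variable {k : Type u} {H : Type v} [Field k] [Ring H] [Algebra k H] [QuasiBialgebra k H]
variable {E A : Type*} [Semiring E] [Algebra k E] [Semiring A] [Algebra k A]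
variable {ρ : H →ₐ[k] E} {R : H ⊗[k] E}

namespace IsYDElem

variable (hR : IsYDElem ρ R) (a : H →ₐ[k] A) (e : E →ₐ[k] A) [Comm a e]
  (c d : H →ₐ[k] A) [Comm a c] [Comm a d] [Comm c e] [Comm d e] [Comm c d]

include hR

theorem slide (h : H) : pl a e R * (e.comp ρ ⋆ a) h = (a ⋆ e.comp ρ) h * pl a e R :=
  (hR.compat a e h).symm

theorem slide_fst : pl a e R * ph (e.comp ρ ⋆ a) c d = ph (a ⋆ e.comp ρ) c d * pl a e R :=
  intertwine_ph (hR.slide a e) (fun _ => Comm.comm (a := pl a e) (b := c) _ _)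
    (fun _ => Comm.comm (a := pl a e) (b := d) _ _)

theorem slide_mid : pl a e R * ph c (e.comp ρ ⋆ a) d = ph c (a ⋆ e.comp ρ) d * pl a e R :=
  intertwine_ph (fun _ => Comm.comm (a := pl a e) (b := c) _ _) (hR.slide a e)
    (fun _ => Comm.comm (a := pl a e) (b := d) _ _)

theorem slide_snd : pl a e R * ph c d (e.comp ρ ⋆ a) = ph c d (a ⋆ e.comp ρ) * pl a e R :=
  intertwine_ph (fun _ => Comm.comm (a := pl a e) (b := c) _ _)
    (fun _ => Comm.comm (a := pl a e) (b := d) _ _) (hR.slide a e)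

theorem slide_fst_inv : pl a e R * ((ph (e.comp ρ ⋆ a) c d)⁻¹ : Aˣ) =
    ((ph (a ⋆ e.comp ρ) c d)⁻¹ : Aˣ) * pl a e R :=
  intertwine_ph_inv (hR.slide a e) (fun _ => Comm.comm (a := pl a e) (b := c) _ _)
    (fun _ => Comm.comm (a := pl a e) (b := d) _ _)

theorem slide_snd_inv : pl a e R * ((ph c d (e.comp ρ ⋆ a))⁻¹ : Aˣ) =
    ((ph c d (a ⋆ e.comp ρ))⁻¹ : Aˣ) * pl a e R :=
  intertwine_ph_inv (fun _ => Comm.comm (a := pl a e) (b := c) _ _)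
    (fun _ => Comm.comm (a := pl a e) (b := d) _ _) (hR.slide a e)

end IsYDElem

end Slide

section Tensor

variable {k : Type u} {H : Type v} [Field k] [Ring H] [Algebra k H] [QuasiBialgebra k H]
variable {E E' A B : Type*} [Semiring E] [Algebra k E] [Semiring E'] [Algebra k E']
  [Semiring A] [Algebra k A] [Semiring B] [Algebra k B]
variable {ρ : H →ₐ[k] E} {R : H ⊗[k] E} {σ : H →ₐ[k] E'} {R' : H ⊗[k] E'}

/-- The word `Φ(a, m, n) R(a, e) Φ(m, a, n)⁻¹ R'(a, e') Φ(m, n, a)` of the coaction of a tensor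
product, where `m = e ρ` and `n = e' σ`. -/
def tensorWord (ρ : H →ₐ[k] E) (R : H ⊗[k] E) (σ : H →ₐ[k] E') (R' : H ⊗[k] E')
    (a : H →ₐ[k] A) (e : E →ₐ[k] A) (e' : E' →ₐ[k] A) [Comm a e] [Comm a e'] [Comm e e'] : A :=
  ph a (e.comp ρ) (e'.comp σ) * pl a e R * ((ph (e.comp ρ) a (e'.comp σ))⁻¹ : Aˣ) * pl a e' R' *
    ph (e.comp ρ) (e'.comp σ) a

section Words

variable (a b : H →ₐ[k] A) (e : E →ₐ[k] A) (e' : E' →ₐ[k] A) [Comm a b] [Comm a e] [Comm a e']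
  [Comm b e] [Comm b e'] [Comm e e']

/-- The hexagon for the tensor product: the pentagon, naturality of `Φ` along the intertwiners `R`
and `R'`, and the hexagons for `R` and `R'`. -/
theorem tensorWord_hex (hR : IsYDElem ρ R) (hR' : IsYDElem σ R') :
    tensorWord ρ R σ R' b e e' * ph a (e.comp ρ ⋆ e'.comp σ) b * tensorWord ρ R σ R' a e e' =
      ph a b (e.comp ρ ⋆ e'.comp σ) * tensorWord ρ R σ R' (a ⋆ b) e e' *
        ph (e.comp ρ ⋆ e'.comp σ) a b := by
  have hc : ∀ z, pl b e' R' * (pl a e R * z) = pl a e R * (pl b e' R' * z) := fun z =>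
    mul_mul_of_eq (Comm.comm (a := pl b e') (b := pl a e) R' R) z |>.trans (mul_assoc _ _ _)
  simp only [tensorWord, mul_assoc]
  rw [mul_mul_mul_of_eq (pentagon_val a (e.comp ρ) (e'.comp σ) b)]
  simp only [mul_assoc]
  rw [mul_mul_of_eq (hR'.slide_snd b e' a (e.comp ρ))]
  simp only [mul_assoc]
  rw [mul_mul_of_eq
    (hR.slide_fst a e (e'.comp σ) b).symm]
  simp only [mul_assoc]
  rw [hc, mul_mul_of_eq (ph_inv_mul_ph a (e.comp ρ) b (e'.comp σ))]
  simp only [mul_assoc]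
  rw [mul_mul_of_eq (hR.slide_mid b e a (e'.comp σ))]
  simp only [mul_assoc]
  rw [mul_mul_of_eq
    (hR.slide_fst_inv a e b (e'.comp σ)).symm]
  simp only [mul_assoc]
  rw [mul_mul_mul_of_eq (hR.hex a b e)]
  simp only [mul_assoc]
  rw [mul_mul_mul_of_eq (pentagon_val a b (e.comp ρ) (e'.comp σ))]
  simp only [mul_assoc]
  rw [mul_mul_of_eq (ph_mul_ph_inv (e.comp ρ) a (e'.comp σ) b)]
  simp only [mul_assoc]
  rw [mul_mul_of_eq (hR'.slide_snd_inv b e' (e.comp ρ) a)]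
  simp only [mul_assoc]
  rw [mul_mul_of_eq (hR'.slide_mid a e' (e.comp ρ) b).symm]
  simp only [mul_assoc]
  rw [mul_mul_mul_of_eq (hR'.hex a b e')]
  simp only [mul_assoc]
  rw [← mul_assoc (ph (e'.comp σ) a b : A), pentagon_val (e.comp ρ) (e'.comp σ) a b]
  rw [← ph_mul_ph_inv_mul_ph_inv_mul_ph (e.comp ρ) a b (e'.comp σ)]
  simp only [mul_assoc]

theorem tensorWord_compat (hR : IsYDElem ρ R) (hR' : IsYDElem σ R') (h : H) :
    (a ⋆ (e.comp ρ ⋆ e'.comp σ)) h * tensorWord ρ R σ R' a e e' =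
      tensorWord ρ R σ R' a e e' * ((e.comp ρ ⋆ e'.comp σ) ⋆ a) h := by
  simp only [tensorWord, mul_assoc]
  rw [mul_mul_of_eq (coassoc a (e.comp ρ) (e'.comp σ) h), ← coassoc (e.comp ρ) (e'.comp σ) a h]
  simp only [mul_assoc]
  rw [mul_mul_of_eq (intertwine_pr_left (a := e'.comp σ) (hR.slide a e)
    (fun _ => Comm.comm (a := pl a e) (b := e'.comp σ) _ _) h).symm]
  simp only [mul_assoc]
  rw [mul_mul_of_eq (coassoc_inv (e.comp ρ) a (e'.comp σ) h)]
  simp only [mul_assoc]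
  rw [mul_mul_of_eq (intertwine_pr_right (a := e.comp ρ) (hR'.slide a e')
    (fun _ => Comm.comm (a := pl a e') (b := e.comp ρ) _ _) h).symm]
  simp only [mul_assoc]

theorem tensorWord_eta (hR : IsYDElem ρ R) (hR' : IsYDElem σ R') :
    tensorWord ρ R σ R' eta e e' = 1 := by
  simp only [tensorWord, hR.counit e, hR'.counit e', ph_fst_eta, ph_mid_eta, ph_snd_eta,
    inv_one, Units.val_one, mul_one]

theorem map_tensorWord (F : A →ₐ[k] B) :
    F (tensorWord ρ R σ R' a e e') = tensorWord ρ R σ R' (F.comp a) (F.comp e) (F.comp e') := by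
  simp only [tensorWord, map_mul, map_ph_val, map_ph_inv_val, map_pl, AlgHom.comp_assoc]

end Words

/-- The element of `H ⊗ (E ⊗ E')` describing the coaction of a tensor product. -/
def tensorElem (ρ : H →ₐ[k] E) (R : H ⊗[k] E) (σ : H →ₐ[k] E') (R' : H ⊗[k] E') :
    H ⊗[k] (E ⊗[k] E') :=
  tensorWord ρ R σ R' iL (iR.comp iL) (iR.comp iR)

theorem pl_tensorElem (a : H →ₐ[k] A) (e : E ⊗[k] E' →ₐ[k] A) [Comm a e] :
    pl a e (tensorElem ρ R σ R') = tensorWord ρ R σ R' a (e.comp iL) (e.comp iR) := by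
  rw [tensorElem, map_tensorWord]
  simp

theorem tensorElem_hexAt (hR : IsYDElem ρ R) (hR' : IsYDElem σ R') (a b : H →ₐ[k] A)
    (e : E ⊗[k] E' →ₐ[k] A) [Comm a b] [Comm a e] [Comm b e] :
    HexAt (iL.comp ρ ⋆ iR.comp σ) (tensorElem ρ R σ R') a b e := by
  rw [HexAt, pl_tensorElem, pl_tensorElem, pl_tensorElem]
  simp only [comp_pr, ← AlgHom.comp_assoc]
  exact tensorWord_hex _ _ _ _ hR hR'

theorem tensorElem_compat (hR : IsYDElem ρ R) (hR' : IsYDElem σ R') (a : H →ₐ[k] A)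
    (e : E ⊗[k] E' →ₐ[k] A) [Comm a e] (h : H) :
    (a ⋆ e.comp (iL.comp ρ ⋆ iR.comp σ)) h * pl a e (tensorElem ρ R σ R') =
      pl a e (tensorElem ρ R σ R') * (e.comp (iL.comp ρ ⋆ iR.comp σ) ⋆ a) h := by
  rw [pl_tensorElem]
  simp only [comp_pr, ← AlgHom.comp_assoc]
  exact tensorWord_compat _ _ _ hR hR' h

theorem IsYDElem.tensor (hR : IsYDElem ρ R) (hR' : IsYDElem σ R') :
    IsYDElem (iL.comp ρ ⋆ iR.comp σ) (tensorElem ρ R σ R') where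
  hex' := tensorElem_hexAt hR hR' _ _ _
  compat' h := by
    have := tensorElem_compat hR hR' iL iR h
    rwa [pl_iL_iR] at this
  counit' := by
    rw [pl_tensorElem]
    exact tensorWord_eta _ _ hR hR'

end Tensor

/-! ### Coactions on tensor products as words -/

section Rep

variable {k : Type u} {H : Type v} [Field k] [Ring H] [Algebra k H]
variable {M N X Y : Type*} [AddCommGroup M] [Module k M] [AddCommGroup N] [Module k N]
  [AddCommGroup X] [Module k X] [AddCommGroup Y] [Module k Y]

variable (k M N) in
/-- `f ↦ f ⊗ id`. -/
def sL : Module.End k M →ₐ[k] Module.End k (M ⊗[k] N) :=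
  (Module.endTensorEndAlgHom (R := k) (S := k) (A := k)).comp iL

variable (k M N) in
/-- `f ↦ id ⊗ f`. -/
def sR : Module.End k N →ₐ[k] Module.End k (M ⊗[k] N) :=
  (Module.endTensorEndAlgHom (R := k) (S := k) (A := k)).comp iR

@[simp] theorem sL_tmul (f : Module.End k M) (m : M) (n : N) :
    sL k M N f (m ⊗ₜ n) = f m ⊗ₜ n := by
  change Module.endTensorEndAlgHom (R := k) (S := k) (A := k) (f ⊗ₜ 1) (m ⊗ₜ n) = _
  rfl

@[simp] theorem sR_tmul (f : Module.End k N) (m : M) (n : N) :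
    sR k M N f (m ⊗ₜ n) = m ⊗ₜ f n := by
  change Module.endTensorEndAlgHom (R := k) (S := k) (A := k) (1 ⊗ₜ f) (m ⊗ₜ n) = _
  rfl

instance : Comm (sL k M N) (sR k M N) :=
  inferInstanceAs (Comm (AlgHom.comp _ _) (AlgHom.comp _ _))

theorem coactOf_mul_iR (R : H ⊗[k] Module.End k M) (P : Module.End k M) (m : M) :
    coactOf (R * iR P) m = coactOf R (P m) := by
  rw [coactOf_apply, coactOf_apply, map_mul, Module.End.mul_apply]
  simp

theorem coactOf_iR_mul (R : H ⊗[k] Module.End k M) (P : Module.End k M) (m : M) :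
    coactOf (iR P * R) m = P.lTensor H (coactOf R m) := by
  rw [coactOf_apply, coactOf_apply, map_mul, Module.End.mul_apply]
  congr 1
  ext <;> simp

theorem coactOf_conj (e : X ≃ₗ[k] Y) (R : H ⊗[k] Module.End k X) (x : X) :
    coactOf (pl iL (iR.comp (e.conjAlgEquiv k : Module.End k X →ₐ[k] Module.End k Y)) R) (e x) =
      e.toLinearMap.lTensor H (coactOf R x) := by
  induction R using TensorProduct.induction_on with
  | zero => simp
  | add x y hx hy => simp only [map_add, coactOf_add, LinearMap.add_apply, hx, hy]
  | tmul h f => simp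

/-- A linear map is colinear if a corresponding identity of words holds. -/
theorem colinear_of_word (e : X ≃ₗ[k] Y) (P : Module.End k Y) {R : H ⊗[k] Module.End k X}
    {R' : H ⊗[k] Module.End k Y}
    (h : R' * iR P = iR P * pl iL (iR.comp (e.conjAlgEquiv k : _ →ₐ[k] Module.End k Y)) R) (x : X) :
    coactOf R' (P (e x)) = (P ∘ₗ e.toLinearMap).lTensor H (coactOf R x) := by
  rw [← coactOf_mul_iR, h, coactOf_iR_mul, coactOf_conj, LinearMap.lTensor_comp]
  rfl

variable (ρ : H →ₐ[k] Module.End k M) (σ : H →ₐ[k] Module.End k N)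

variable (H M N) in
/-- The exchange of the first two factors. -/
abbrev swap12 : H ⊗[k] (M ⊗[k] N) ≃ₗ[k] M ⊗[k] (H ⊗[k] N) := TensorProduct.leftComm k H M N

/-- The representation of `H ⊗ End (M ⊗ N)` on `H ⊗ (M ⊗ N)`. -/
abbrev repT : H ⊗[k] Module.End k (M ⊗[k] N) →ₐ[k] Module.End k (H ⊗[k] (M ⊗[k] N)) :=
  act2 (reg k H) (AlgHom.id k _)

theorem repT_word (t : H ⊗[k] (H ⊗[k] H)) :
    repT (pl iL (pl ((iR.comp (sL k M N)).comp ρ) ((iR.comp (sR k M N)).comp σ)) t) =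
      act3 (reg k H) ρ σ t := by
  induction t using tensor3_induction with
  | zero => simp only [map_zero]
  | add x y hx hy => simp only [map_add, hx, hy]
  | tmul x y z => ext; simp

theorem swap12_repT_word (t : H ⊗[k] (H ⊗[k] H)) (v : H ⊗[k] (M ⊗[k] N)) :
    swap12 H M N (repT (pl ((iR.comp (sL k M N)).comp ρ) (pl iL ((iR.comp (sR k M N)).comp σ)) t) v) =
      act3 ρ (reg k H) σ t (swap12 H M N v) := by
  induction t using tensor3_induction with
  | zero => simp
  | add x y hx hy => simp only [map_add, LinearMap.add_apply, hx, hy]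
  | tmul x y z =>
    induction v using tensor3_induction with
    | zero => simp
    | add x y hx hy => simp only [map_add, hx, hy]
    | tmul a b c => simp

theorem repT_sL (R : H ⊗[k] Module.End k M) (v : H ⊗[k] (M ⊗[k] N)) :
    repT (pl iL (iR.comp (sL k M N)) R) v =
      TensorProduct.assoc k H M N ((braidLin (coactOf R) (reg k H)).rTensor N
        ((TensorProduct.assoc k M H N).symm (swap12 H M N v))) := by
  induction v using tensor3_induction with
  | zero => simp
  | add x y hx hy => simp only [map_add, hx, hy]
  | tmul a b c =>
    induction R using TensorProduct.induction_on with
    | zero => simp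
    | add x y hx hy =>
      simp only [map_add, coactOf_add, LinearMap.add_apply, hx, hy]
      simp [TensorProduct.add_tmul]
    | tmul h f => simp

theorem swap12_repT_sR (R : H ⊗[k] Module.End k N) (t : H ⊗[k] (H ⊗[k] H)) (v : M ⊗[k] N) :
    swap12 H M N (repT (pl iL (iR.comp (sR k M N)) R *
      pl ((iR.comp (sL k M N)).comp ρ) (pl ((iR.comp (sR k M N)).comp σ) iL) t) (1 ⊗ₜ v)) =
      TensorProduct.homTensorHomMap (RingHom.id k) M N M (H ⊗[k] N)
        (TensorProduct.map ρ.toLinearMap (coactTwist σ (coactOf R)) t) v := by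
  rw [map_mul, Module.End.mul_apply]
  induction t using tensor3_induction with
  | zero => simp
  | add x y hx hy => simp only [map_add, LinearMap.add_apply, hx, hy]
  | tmul x y z =>
    induction v using TensorProduct.induction_on with
    | zero => simp
    | add x y hx hy => simp only [map_add, TensorProduct.tmul_add, hx, hy]
    | tmul b c =>
      induction R using TensorProduct.induction_on with
      | zero => simp
      | add x y hx hy =>
        simp only [map_add, coactOf_add, LinearMap.add_apply, hx, hy]
        simp [TensorProduct.tmul_add]
      | tmul h f => simp

end Rep

section Datum

variable {k : Type u} {H : Type v} [Field k] [Ring H] [Algebra k H]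

/-- The coaction of a finite dimensional Yetter-Drinfeld datum as an element of `H ⊗ End M`. -/
def YDDatum.elem (M : YDDatum k H) [Module.Finite k M.carrier] : H ⊗[k] Module.End k M.carrier :=
  (exists_coactOf M.coact).choose

theorem YDDatum.coact_eq (M : YDDatum k H) [Module.Finite k M.carrier] :
    M.coact = coactOf M.elem :=
  (exists_coactOf M.coact).choose_spec.symm

variable [QuasiBialgebra k H]

theorem YDDatum.isYDElem {M : YDDatum k H} [Module.Finite k M.carrier] (hM : M.IsYD) :
    IsYDElem M.act M.elem :=
  (isYD_iff M M.coact_eq).1 hM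

variable (M N : YDDatum k H)

theorem YDDatum.tensorAct_eq :
    tensorAct M N = (sL k M.carrier N.carrier).comp M.act ⋆ (sR k M.carrier N.carrier).comp N.act := by
  ext h : 1
  change act2 M.act N.act (Dl k H h) = _
  rw [pr_apply]
  generalize Dl k H h = t
  induction t using TensorProduct.induction_on with
  | zero => simp only [map_zero]
  | add x y hx hy => simp only [map_add, hx, hy]
  | tmul x y => ext; simp

theorem YDDatum.tensorCoact_eq {M N : YDDatum k H} {R : H ⊗[k] Module.End k M.carrier}
    {R' : H ⊗[k] Module.End k N.carrier} (hR : M.coact = coactOf R) (hR' : N.coact = coactOf R') :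
    tensorCoact M N = coactOf (tensorWord M.act R N.act R' iL
      (iR.comp (sL k M.carrier N.carrier)) (iR.comp (sR k M.carrier N.carrier))) := by
  refine LinearMap.ext fun v => ?_
  rw [tensorCoact, hR, hR']
  simp only [LinearMap.comp_apply, LinearEquiv.coe_coe]
  rw [← swap12_repT_sR, ← swap12_repT_word, ← repT_sL, ← repT_word, coactOf_apply, tensorWord,
    mul_assoc, mul_assoc, mul_assoc, map_mul, map_mul, map_mul, map_mul, map_mul, Module.End.mul_apply,
    Module.End.mul_apply, Module.End.mul_apply, Module.End.mul_apply, Module.End.mul_apply]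
  rfl

theorem YDDatum.IsYD.tensor {M N : YDDatum k H} [Module.Finite k M.carrier]
    [Module.Finite k N.carrier] (hM : M.IsYD) (hN : N.IsYD) : (M.tensor N).IsYD := by
  have : Module.Finite k (M.tensor N).carrier :=
    inferInstanceAs (Module.Finite k (M.carrier ⊗[k] N.carrier))
  have h := ((isYDElem hM).tensor (isYDElem hN)).map
    (Module.endTensorEndAlgHom (R := k) (S := k) (A := k) (M := M.carrier) (N := N.carrier))
  refine (isYD_iff (M.tensor N) (tensorCoact_eq M.coact_eq N.coact_eq)).2 ?_
  rw [comp_pr] at h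
  change IsYDElem (tensorAct M N) _
  rw [tensorAct_eq]
  convert h using 1
  · rfl
  · rw [tensorElem, ← pl_iL_iR (Algebra.TensorProduct.map _ _ _), pl_map, map_tensorWord]
    simp
    rfl

end Datum

/-! ### Colinearity of the constraints -/

section Words

variable {k : Type u} {H : Type v} [Field k] [Ring H] [Algebra k H] [QuasiBialgebra k H]
variable {E₁ E₂ E₃ A : Type*} [Semiring E₁] [Algebra k E₁] [Semiring E₂] [Algebra k E₂]
  [Semiring E₃] [Algebra k E₃] [Semiring A] [Algebra k A]
variable {ρ₁ : H →ₐ[k] E₁} {R₁ : H ⊗[k] E₁} {ρ₂ : H →ₐ[k] E₂} {R₂ : H ⊗[k] E₂}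
  {ρ₃ : H →ₐ[k] E₃} {R₃ : H ⊗[k] E₃}

/-- `Φ(m, n, p)` intertwines the words of the two iterated tensor products. Each step is a pentagon
or moves some `Rᵢ` past a reassociator. -/
theorem assoc_word (h₁ : IsYDElem ρ₁ R₁) (h₂ : IsYDElem ρ₂ R₂) (h₃ : IsYDElem ρ₃ R₃)
    (a : H →ₐ[k] A) (e₁ : E₁ →ₐ[k] A) (e₂ : E₂ →ₐ[k] A) (e₃ : E₃ →ₐ[k] A)
    [Comm a e₁] [Comm a e₂] [Comm a e₃] [Comm e₁ e₂] [Comm e₁ e₃] [Comm e₂ e₃] :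
    ph (e₁.comp ρ₁) (e₂.comp ρ₂) (e₃.comp ρ₃) *
      (ph a (e₁.comp ρ₁ ⋆ e₂.comp ρ₂) (e₃.comp ρ₃) * tensorWord ρ₁ R₁ ρ₂ R₂ a e₁ e₂ *
        ((ph (e₁.comp ρ₁ ⋆ e₂.comp ρ₂) a (e₃.comp ρ₃))⁻¹ : Aˣ) * pl a e₃ R₃ *
        ph (e₁.comp ρ₁ ⋆ e₂.comp ρ₂) (e₃.comp ρ₃) a) =
      ph a (e₁.comp ρ₁) (e₂.comp ρ₂ ⋆ e₃.comp ρ₃) * pl a e₁ R₁ *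
        ((ph (e₁.comp ρ₁) a (e₂.comp ρ₂ ⋆ e₃.comp ρ₃))⁻¹ : Aˣ) * tensorWord ρ₂ R₂ ρ₃ R₃ a e₂ e₃ *
        ph (e₁.comp ρ₁) (e₂.comp ρ₂ ⋆ e₃.comp ρ₃) a *
        ph (e₁.comp ρ₁) (e₂.comp ρ₂) (e₃.comp ρ₃) := by
  simp only [tensorWord, mul_assoc]
  rw [mul_mul_mul_of_eq (pentagon_val a (e₁.comp ρ₁) (e₂.comp ρ₂) (e₃.comp ρ₃))]
  simp only [mul_assoc]
  rw [mul_mul_of_eq (h₁.slide_fst a e₁ (e₂.comp ρ₂) (e₃.comp ρ₃)).symm]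
  simp only [mul_assoc]
  rw [mul_mul_of_eq (ph_mul_ph_inv (e₁.comp ρ₁) a (e₂.comp ρ₂) (e₃.comp ρ₃))]
  simp only [mul_assoc]
  rw [mul_mul_of_eq (h₂.slide_mid a e₂ (e₁.comp ρ₁) (e₃.comp ρ₃)).symm]
  simp only [mul_assoc]
  have e : (ph (e₁.comp ρ₁) (e₂.comp ρ₂ ⋆ a) (e₃.comp ρ₃) : A) *
      ph (e₁.comp ρ₁) (e₂.comp ρ₂) a *
      ((ph (e₁.comp ρ₁ ⋆ e₂.comp ρ₂) a (e₃.comp ρ₃))⁻¹ : Aˣ) =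
      ((ph (e₂.comp ρ₂) a (e₃.comp ρ₃))⁻¹ : Aˣ) *
        ph (e₁.comp ρ₁) (e₂.comp ρ₂) (a ⋆ e₃.comp ρ₃) :=
    (ph_inv_mul_ph (e₁.comp ρ₁) (e₂.comp ρ₂) a (e₃.comp ρ₃)).symm
  rw [mul_mul_mul_of_eq e]
  simp only [mul_assoc]
  rw [mul_mul_of_eq (h₃.slide_snd a e₃ (e₁.comp ρ₁) (e₂.comp ρ₂)).symm]
  simp only [mul_assoc]
  rw [← pentagon_val (e₁.comp ρ₁) (e₂.comp ρ₂) (e₃.comp ρ₃) a]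
  simp only [mul_assoc]

/-- The coaction of an iterated tensor product is compatible with the associator. -/
theorem tensorWord_assoc {E₁₂ E₂₃ : Type*} [Semiring E₁₂] [Algebra k E₁₂] [Semiring E₂₃]
    [Algebra k E₂₃] (h₁ : IsYDElem ρ₁ R₁) (h₂ : IsYDElem ρ₂ R₂) (h₃ : IsYDElem ρ₃ R₃)
    (a : H →ₐ[k] A) (e₁ : E₁ →ₐ[k] A) (e₂ : E₂ →ₐ[k] A) (e₃ : E₃ →ₐ[k] A)
    [Comm a e₁] [Comm a e₂] [Comm a e₃] [Comm e₁ e₂] [Comm e₁ e₃] [Comm e₂ e₃]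
    (s₁ : E₁ →ₐ[k] E₁₂) (s₂ : E₂ →ₐ[k] E₁₂) (t₂ : E₂ →ₐ[k] E₂₃) (t₃ : E₃ →ₐ[k] E₂₃)
    [Comm s₁ s₂] [Comm t₂ t₃] (e₁₂ : E₁₂ →ₐ[k] A) (e₂₃ : E₂₃ →ₐ[k] A) [Comm a e₁₂] [Comm a e₂₃]
    [Comm e₁ e₂₃] [Comm e₁₂ e₃] (hs₁ : e₁₂.comp s₁ = e₁) (hs₂ : e₁₂.comp s₂ = e₂)
    (ht₂ : e₂₃.comp t₂ = e₂) (ht₃ : e₂₃.comp t₃ = e₃) :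
    ph (e₁.comp ρ₁) (e₂.comp ρ₂) (e₃.comp ρ₃) *
      tensorWord (s₁.comp ρ₁ ⋆ s₂.comp ρ₂) (tensorWord ρ₁ R₁ ρ₂ R₂ iL (iR.comp s₁) (iR.comp s₂))
        ρ₃ R₃ a e₁₂ e₃ =
      tensorWord ρ₁ R₁ (t₂.comp ρ₂ ⋆ t₃.comp ρ₃)
        (tensorWord ρ₂ R₂ ρ₃ R₃ iL (iR.comp t₂) (iR.comp t₃)) a e₁ e₂₃ *
      ph (e₁.comp ρ₁) (e₂.comp ρ₂) (e₃.comp ρ₃) := by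
  have key := assoc_word h₁ h₂ h₃ a e₁ e₂ e₃
  rw [tensorWord.eq_1 (s₁.comp ρ₁ ⋆ s₂.comp ρ₂), tensorWord.eq_1 ρ₁ R₁ (t₂.comp ρ₂ ⋆ t₃.comp ρ₃),
    map_tensorWord, map_tensorWord]
  simp only [comp_pr, ← AlgHom.comp_assoc, pl_comp_iR, pl_comp_iL, hs₁, hs₂, ht₂, ht₃]
  exact key

theorem tensorWord_one_left {σ : H →ₐ[k] E₂} {R' : H ⊗[k] E₂} (a : H →ₐ[k] A) (e : E₁ →ₐ[k] A)
    (e' : E₂ →ₐ[k] A) [Comm a e] [Comm a e'] [Comm e e'] (he : e.comp ρ₁ = eta) :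
    tensorWord ρ₁ 1 σ R' a e e' = pl a e' R' := by
  simp [tensorWord, he]

theorem tensorWord_one_right {σ : H →ₐ[k] E₂} (a : H →ₐ[k] A) (e : E₁ →ₐ[k] A)
    (e' : E₂ →ₐ[k] A) [Comm a e] [Comm a e'] [Comm e e'] (he : e'.comp σ = eta) :
    tensorWord ρ₁ R₁ σ 1 a e e' = pl a e R₁ := by
  simp [tensorWord, he]

theorem isYDElem_eta : IsYDElem (eta : H →ₐ[k] A) (1 : H ⊗[k] A) where
  hex' := by
    rw [HexAt]
    simp
  compat' h := by simp
  counit' := by simp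

end Words

section Constraints

variable {k : Type u} {H : Type v} [Field k] [Ring H] [Algebra k H] [QuasiBialgebra k H]

namespace YDDatum

theorem unit_coact : TensorProduct.mk k H k 1 = coactOf (1 : H ⊗[k] Module.End k k) := by
  ext
  simp [coactOf_apply]

theorem unit_act : ((Algebra.lmul k k).comp (eps k H) : H →ₐ[k] Module.End k k) = eta := by
  ext h
  simp [eta_apply]

theorem isYD_unit : (unit k H).IsYD := by
  have : Module.Finite k (unit k H).carrier := inferInstanceAs (Module.Finite k k)
  refine (isYD_iff (unit k H) unit_coact).2 ?_
  change IsYDElem ((Algebra.lmul k k).comp (eps k H) : H →ₐ[k] Module.End k k) _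
  rw [unit_act]
  exact isYDElem_eta

section Assoc

variable (U V W : YDDatum k H)

/-- Conjugation by the canonical isomorphism `(U ⊗ V) ⊗ W ≃ U ⊗ (V ⊗ W)`. -/
abbrev assocConj (U V W : Type*) [AddCommGroup U] [Module k U] [AddCommGroup V] [Module k V]
    [AddCommGroup W] [Module k W] :
    Module.End k ((U ⊗[k] V) ⊗[k] W) →ₐ[k] Module.End k (U ⊗[k] (V ⊗[k] W)) :=
  ((TensorProduct.assoc k U V W).conjAlgEquiv k : _ →ₐ[k] _)

variable (X Y Z : Type*) [AddCommGroup X] [Module k X] [AddCommGroup Y] [Module k Y]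
    [AddCommGroup Z] [Module k Z]

theorem assocConj_sL_sL :
    ((assocConj X Y Z).comp (sL k (X ⊗[k] Y) Z)).comp (sL k X Y) = sL k X (Y ⊗[k] Z) := by
  ext; simp

theorem assocConj_sL_sR :
    ((assocConj X Y Z).comp (sL k (X ⊗[k] Y) Z)).comp (sR k X Y) =
      (sR k X (Y ⊗[k] Z)).comp (sL k Y Z) := by
  ext; simp

theorem assocConj_sR :
    (assocConj X Y Z).comp (sR k (X ⊗[k] Y) Z) = (sR k X (Y ⊗[k] Z)).comp (sR k Y Z) := by
  ext; simp

instance : Comm ((assocConj X Y Z).comp (sL k (X ⊗[k] Y) Z))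
    ((sR k X (Y ⊗[k] Z)).comp (sR k Y Z)) := by
  rw [← assocConj_sR]; infer_instance

variable {X Y Z}

theorem map_act3 {A : Type*} [Semiring A] [Algebra k A]
    (F : Module.End k (X ⊗[k] (Y ⊗[k] Z)) →ₐ[k] A) (ρ : H →ₐ[k] Module.End k X)
    (σ : H →ₐ[k] Module.End k Y) (τ : H →ₐ[k] Module.End k Z) (t : H ⊗[k] (H ⊗[k] H)) :
    F (act3 ρ σ τ t) =
    pl ((F.comp (sL k X (Y ⊗[k] Z))).comp ρ)
      (pl ((F.comp ((sR k X (Y ⊗[k] Z)).comp (sL k Y Z))).comp σ)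
        ((F.comp ((sR k X (Y ⊗[k] Z)).comp (sR k Y Z))).comp τ)) t := by
  induction t using tensor3_induction with
  | zero => simp only [map_zero]
  | add x y hx hy => simp only [map_add, hx, hy]
  | tmul x y z =>
    simp only [pl_tmul, AlgHom.comp_apply, ← map_mul]
    congr 1
    ext; simp

/-- The word identity behind the colinearity of the associator. -/
theorem tensorWord_assocConj {ρ₁ : H →ₐ[k] Module.End k X} {R₁ : H ⊗[k] Module.End k X}
    {ρ₂ : H →ₐ[k] Module.End k Y} {R₂ : H ⊗[k] Module.End k Y}
    {ρ₃ : H →ₐ[k] Module.End k Z} {R₃ : H ⊗[k] Module.End k Z}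
    (h₁ : IsYDElem ρ₁ R₁) (h₂ : IsYDElem ρ₂ R₂) (h₃ : IsYDElem ρ₃ R₃) :
    tensorWord ρ₁ R₁ ((sL k Y Z).comp ρ₂ ⋆ (sR k Y Z).comp ρ₃)
        (tensorWord ρ₂ R₂ ρ₃ R₃ iL (iR.comp (sL k Y Z)) (iR.comp (sR k Y Z)))
        iL (iR.comp (sL k X (Y ⊗[k] Z))) (iR.comp (sR k X (Y ⊗[k] Z))) *
      iR (act3 ρ₁ ρ₂ ρ₃ (Ph k H : H ⊗[k] (H ⊗[k] H))) =
    iR (act3 ρ₁ ρ₂ ρ₃ (Ph k H : H ⊗[k] (H ⊗[k] H))) *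
      pl iL (iR.comp (assocConj X Y Z))
        (tensorWord ((sL k X Y).comp ρ₁ ⋆ (sR k X Y).comp ρ₂)
          (tensorWord ρ₁ R₁ ρ₂ R₂ iL (iR.comp (sL k X Y)) (iR.comp (sR k X Y))) ρ₃ R₃
          iL (iR.comp (sL k (X ⊗[k] Y) Z)) (iR.comp (sR k (X ⊗[k] Y) Z))) := by
  have key := tensorWord_assoc h₁ h₂ h₃
    (iL : H →ₐ[k] H ⊗[k] Module.End k (X ⊗[k] (Y ⊗[k] Z)))
    (iR.comp (sL k X (Y ⊗[k] Z)))
    (iR.comp ((sR k X (Y ⊗[k] Z)).comp (sL k Y Z)))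
    (iR.comp ((sR k X (Y ⊗[k] Z)).comp (sR k Y Z)))
    (sL k X Y) (sR k X Y) (sL k Y Z) (sR k Y Z)
    (iR.comp ((assocConj X Y Z).comp (sL k (X ⊗[k] Y) Z)))
    (iR.comp (sR k X (Y ⊗[k] Z)))
    (by rw [AlgHom.comp_assoc, assocConj_sL_sL]) (by rw [AlgHom.comp_assoc, assocConj_sL_sR])
    (by rw [AlgHom.comp_assoc]) (by rw [AlgHom.comp_assoc])
  rw [map_act3]
  refine key.symm.trans ?_
  rw [map_tensorWord]
  congr 1
  simp only [← AlgHom.comp_assoc, pl_comp_iL, pl_comp_iR]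
  simp only [AlgHom.comp_assoc, assocConj_sR]

variable {U V W}

theorem tensorCoact_tensor_left {U V W : YDDatum k H} {R₁ : H ⊗[k] Module.End k U.carrier}
    {R₂ : H ⊗[k] Module.End k V.carrier} {R₃ : H ⊗[k] Module.End k W.carrier}
    (h₁ : U.coact = coactOf R₁) (h₂ : V.coact = coactOf R₂) (h₃ : W.coact = coactOf R₃) :
    tensorCoact (U.tensor V) W =
      coactOf (M := (U.carrier ⊗[k] V.carrier) ⊗[k] W.carrier)
        (tensorWord ((sL k U.carrier V.carrier).comp U.act ⋆ (sR k U.carrier V.carrier).comp V.act)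
          (tensorWord U.act R₁ V.act R₂ iL (iR.comp (sL k U.carrier V.carrier))
            (iR.comp (sR k U.carrier V.carrier))) W.act R₃
          iL (iR.comp (sL k (U.carrier ⊗[k] V.carrier) W.carrier))
          (iR.comp (sR k (U.carrier ⊗[k] V.carrier) W.carrier))) := by
  rw [← tensorAct_eq]
  exact tensorCoact_eq (M := U.tensor V) (tensorCoact_eq h₁ h₂) h₃

theorem tensorCoact_tensor_right {U V W : YDDatum k H} {R₁ : H ⊗[k] Module.End k U.carrier}
    {R₂ : H ⊗[k] Module.End k V.carrier} {R₃ : H ⊗[k] Module.End k W.carrier}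
    (h₁ : U.coact = coactOf R₁) (h₂ : V.coact = coactOf R₂) (h₃ : W.coact = coactOf R₃) :
    tensorCoact U (V.tensor W) =
      coactOf (M := U.carrier ⊗[k] (V.carrier ⊗[k] W.carrier))
        (tensorWord U.act R₁
          ((sL k V.carrier W.carrier).comp V.act ⋆ (sR k V.carrier W.carrier).comp W.act)
          (tensorWord V.act R₂ W.act R₃ iL (iR.comp (sL k V.carrier W.carrier))
            (iR.comp (sR k V.carrier W.carrier)))
          iL (iR.comp (sL k U.carrier (V.carrier ⊗[k] W.carrier)))
          (iR.comp (sR k U.carrier (V.carrier ⊗[k] W.carrier)))) := by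
  rw [← tensorAct_eq]
  exact tensorCoact_eq (N := V.tensor W) h₁ (tensorCoact_eq h₂ h₃)

theorem associator_colinear {U V W : YDDatum k H} [Module.Finite k U.carrier]
    [Module.Finite k V.carrier]
    [Module.Finite k W.carrier] (hU : U.IsYD) (hV : V.IsYD) (hW : W.IsYD)
    (x : (U.carrier ⊗[k] V.carrier) ⊗[k] W.carrier) :
    tensorCoact U (V.tensor W) (associator U V W x) =
      (associator U V W).toLinearMap.lTensor H (tensorCoact (U.tensor V) W x) := by
  rw [tensorCoact_tensor_left U.coact_eq V.coact_eq W.coact_eq,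
    tensorCoact_tensor_right U.coact_eq V.coact_eq W.coact_eq]
  exact colinear_of_word (TensorProduct.assoc k U.carrier V.carrier W.carrier)
    (act3 U.act V.act W.act (Ph k H : H ⊗[k] (H ⊗[k] H)))
    (tensorWord_assocConj (isYDElem hU) (isYDElem hV) (isYDElem hW)) x

theorem act2_comul_right (ρ : H →ₐ[k] Module.End k X) (σ : H →ₐ[k] Module.End k Y)
    (τ : H →ₐ[k] Module.End k Z) (t : H ⊗[k] H) :
    act2 ρ ((act2 σ τ).comp (Dl k H)) t =
      act3 ρ σ τ (Algebra.TensorProduct.map (AlgHom.id k H) (Dl k H) t) := by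
  induction t using TensorProduct.induction_on with
  | zero => simp only [map_zero]
  | add x y hx hy => simp only [map_add, hx, hy]
  | tmul x y => simp [act3, act2]

theorem assoc_act2_comul_left (ρ : H →ₐ[k] Module.End k X) (σ : H →ₐ[k] Module.End k Y)
    (τ : H →ₐ[k] Module.End k Z) (t : H ⊗[k] H) (x : (X ⊗[k] Y) ⊗[k] Z) :
    TensorProduct.assoc k X Y Z (act2 ((act2 ρ σ).comp (Dl k H)) τ t x) =
      act3 ρ σ τ (Algebra.TensorProduct.assoc k k k H H H
        (Algebra.TensorProduct.map (Dl k H) (AlgHom.id k H) t)) (TensorProduct.assoc k X Y Z x) := by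
  induction t using TensorProduct.induction_on with
  | zero => simp
  | add x y hx hy => simp only [map_add, LinearMap.add_apply, hx, hy]
  | tmul a c =>
    rw [Algebra.TensorProduct.map_tmul]
    induction x using TensorProduct.induction_on with
    | zero => simp
    | add x y hx hy => simp only [map_add, hx, hy]
    | tmul x z =>
      rw [act2_tmul, AlgHom.comp_apply]
      generalize Dl k H a = s
      induction s using TensorProduct.induction_on with
      | zero => simp
      | add x y hx hy =>
        simp only [map_add, LinearMap.add_apply, TensorProduct.add_tmul, hx, hy]
      | tmul a b =>
        induction x using TensorProduct.induction_on with
        | zero => simp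
        | add x y hx hy => simp only [map_add, TensorProduct.add_tmul, hx, hy]
        | tmul x y => simp

theorem associator_linear (U V W : YDDatum k H) (h : H)
    (x : (U.carrier ⊗[k] V.carrier) ⊗[k] W.carrier) :
    associator U V W (tensorAct (U.tensor V) W h x) =
      tensorAct U (V.tensor W) h (associator U V W x) := by
  change act3 U.act V.act W.act (Ph k H : H ⊗[k] (H ⊗[k] H))
      (TensorProduct.assoc k _ _ _ (act2 ((act2 U.act V.act).comp (Dl k H)) W.act (Dl k H h) x)) =
    act2 U.act ((act2 V.act W.act).comp (Dl k H)) (Dl k H h)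
      (act3 U.act V.act W.act (Ph k H : H ⊗[k] (H ⊗[k] H)) (TensorProduct.assoc k _ _ _ x))
  rw [assoc_act2_comul_left, act2_comul_right, ← Module.End.mul_apply, ← Module.End.mul_apply,
    ← map_mul, ← map_mul]
  rw [(Units.eq_mul_inv_iff_mul_eq _).1 (QuasiBialgebra.quasi_coassoc (k := k) h)]

end Assoc

section Unit

variable {M : YDDatum k H}

theorem leftUnitor_linear (h : H) (x : k ⊗[k] M.carrier) :
    TensorProduct.lid k M.carrier (tensorAct (unit k H) M h x) =
      M.act h (TensorProduct.lid k M.carrier x) := by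
  conv_rhs => rw [← QuasiBialgebra.counit_comul (k := k) h]
  change TensorProduct.lid k M.carrier
    (act2 ((Algebra.lmul k k).comp (eps k H)) M.act (Dl k H h) x) = _
  generalize Dl k H h = t
  induction x using TensorProduct.induction_on with
  | zero => simp
  | add x y hx hy => simp only [map_add, hx, hy]
  | tmul x y =>
    induction t using TensorProduct.induction_on with
    | zero => simp
    | add x y hx hy => simp only [map_add, LinearMap.add_apply, hx, hy]
    | tmul a b =>
      simp only [act2_tmul, Algebra.TensorProduct.map_tmul, TensorProduct.lid_tmul,
        AlgHom.comp_apply]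
      simp [mul_smul]
      exact smul_comm _ _ _

theorem rightUnitor_linear (h : H) (x : M.carrier ⊗[k] k) :
    TensorProduct.rid k M.carrier (tensorAct M (unit k H) h x) =
      M.act h (TensorProduct.rid k M.carrier x) := by
  conv_rhs => rw [← QuasiBialgebra.comul_counit (k := k) h]
  change TensorProduct.rid k M.carrier
    (act2 M.act ((Algebra.lmul k k).comp (eps k H)) (Dl k H h) x) = _
  generalize Dl k H h = t
  induction x using TensorProduct.induction_on with
  | zero => simp
  | add x y hx hy => simp only [map_add, hx, hy]
  | tmul x y =>
    induction t using TensorProduct.induction_on with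
    | zero => simp
    | add x y hx hy => simp only [map_add, LinearMap.add_apply, hx, hy]
    | tmul a b =>
      simp only [act2_tmul, Algebra.TensorProduct.map_tmul, TensorProduct.rid_tmul,
        AlgHom.comp_apply]
      simp [mul_smul]
      exact smul_comm _ _ _

theorem leftUnitor_colinear [Module.Finite k M.carrier] (x : k ⊗[k] M.carrier) :
    M.coact (TensorProduct.lid k M.carrier x) =
      (TensorProduct.lid k M.carrier).toLinearMap.lTensor H (tensorCoact (unit k H) M x) := by
  rw [tensorCoact_eq (M := unit k H) unit_coact M.coact_eq, M.coact_eq]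
  have e : ((sL k k M.carrier).comp ((Algebra.lmul k k).comp (eps k H)) : H →ₐ[k] _) = eta := by
    rw [unit_act, comp_eta]
  have key := colinear_of_word (TensorProduct.lid k M.carrier) 1 (R' := M.elem)
    (R := pl iL (iR.comp (sR k k M.carrier)) M.elem) ?_ x
  · refine key.trans ?_
    rw [← tensorWord_one_left (ρ₁ := ((Algebra.lmul k k).comp (eps k H) : H →ₐ[k] Module.End k k))
      (σ := M.act) (iL : H →ₐ[k] H ⊗[k] Module.End k (k ⊗[k] M.carrier))
      (iR.comp (sL k k M.carrier)) (iR.comp (sR k k M.carrier))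
      (by rw [AlgHom.comp_assoc, e, comp_eta])]
    rfl
  · have e' : (((TensorProduct.lid k M.carrier).conjAlgEquiv k : _ →ₐ[k] _)).comp
        (sR k k M.carrier) = AlgHom.id k _ := by
      ext; simp
    rw [map_one, one_mul, mul_one, map_pl]
    simp only [pl_comp_iL, pl_comp_iR_comp, AlgHom.comp_assoc, e', AlgHom.comp_id, pl_iL_iR]

theorem rightUnitor_colinear [Module.Finite k M.carrier] (x : M.carrier ⊗[k] k) :
    M.coact (TensorProduct.rid k M.carrier x) =
      (TensorProduct.rid k M.carrier).toLinearMap.lTensor H (tensorCoact M (unit k H) x) := by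
  rw [tensorCoact_eq (N := unit k H) M.coact_eq unit_coact, M.coact_eq]
  have e : ((sR k M.carrier k).comp ((Algebra.lmul k k).comp (eps k H)) : H →ₐ[k] _) = eta := by
    rw [unit_act, comp_eta]
  have key := colinear_of_word (TensorProduct.rid k M.carrier) 1 (R' := M.elem)
    (R := pl iL (iR.comp (sL k M.carrier k)) M.elem) ?_ x
  · refine key.trans ?_
    rw [← tensorWord_one_right (σ := ((Algebra.lmul k k).comp (eps k H) : H →ₐ[k] Module.End k k))
      (ρ₁ := M.act) (iL : H →ₐ[k] H ⊗[k] Module.End k (M.carrier ⊗[k] k))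
      (iR.comp (sL k M.carrier k)) (iR.comp (sR k M.carrier k))
      (by rw [AlgHom.comp_assoc, e, comp_eta])]
    rfl
  · have e' : (((TensorProduct.rid k M.carrier).conjAlgEquiv k : _ →ₐ[k] _)).comp
        (sL k M.carrier k) = AlgHom.id k _ := by
      ext; simp
    rw [map_one, one_mul, mul_one, map_pl]
    simp only [pl_comp_iL, pl_comp_iR_comp, AlgHom.comp_assoc, e', AlgHom.comp_id, pl_iL_iR]

end Unit

section Hom

variable {M M' N N' : YDDatum k H} {f : M.carrier →ₗ[k] M'.carrier} {g : N.carrier →ₗ[k] N'.carrier}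

theorem map_act2 {X X' Y Y' : Type*} [AddCommGroup X] [Module k X] [AddCommGroup X'] [Module k X']
    [AddCommGroup Y] [Module k Y] [AddCommGroup Y'] [Module k Y']
    {A B : Type*} [Ring A] [Algebra k A] [Ring B] [Algebra k B]
    {ρ : A →ₐ[k] Module.End k X} {ρ' : A →ₐ[k] Module.End k X'}
    {σ : B →ₐ[k] Module.End k Y} {σ' : B →ₐ[k] Module.End k Y'} {f : X →ₗ[k] X'} {g : Y →ₗ[k] Y'}
    (hf : ∀ h m, f (ρ h m) = ρ' h (f m)) (hg : ∀ h m, g (σ h m) = σ' h (g m)) (t : A ⊗[k] B)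
    (x : X ⊗[k] Y) :
    TensorProduct.map f g (act2 ρ σ t x) = act2 ρ' σ' t (TensorProduct.map f g x) := by
  induction t using TensorProduct.induction_on with
  | zero => simp
  | add x y hx hy => simp only [map_add, LinearMap.add_apply, hx, hy]
  | tmul a b =>
    induction x using TensorProduct.induction_on with
    | zero => simp
    | add x y hx hy => simp only [map_add, hx, hy]
    | tmul x y => simp [hf, hg]

theorem map_coact_tmul (hf : IsYDHom M M' f) (b h : H) (m : M.carrier) :
    coactTwist M'.act M'.coact (b ⊗ₜ h) (f m) =
      f.lTensor H (coactTwist M.act M.coact (b ⊗ₜ h) m) := by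
  rw [coactTwist_tmul, coactTwist_tmul, ← hf.map_act, hf.map_coact]
  generalize M.coact (M.act b m) = w
  rw [← LinearMap.comp_apply, ← LinearMap.comp_apply, LinearMap.rTensor_comp_lTensor,
    LinearMap.lTensor_comp_rTensor]

theorem map_tensorCoact (hf : IsYDHom M M' f) (hg : IsYDHom N N' g)
    (x : M.carrier ⊗[k] N.carrier) :
    tensorCoact M' N' (TensorProduct.map f g x) =
      TensorProduct.map LinearMap.id (TensorProduct.map f g) (tensorCoact M N x) := by
  have e1 : ∀ (z : H ⊗[k] (H ⊗[k] H)) (x : M.carrier ⊗[k] N.carrier),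
      TensorProduct.homTensorHomMap (RingHom.id k) M'.carrier N'.carrier M'.carrier
        (H ⊗[k] N'.carrier) (TensorProduct.map M'.act.toLinearMap (coactTwist N'.act N'.coact) z)
        (TensorProduct.map f g x) =
      TensorProduct.map f (TensorProduct.map LinearMap.id g)
        (TensorProduct.homTensorHomMap (RingHom.id k) M.carrier N.carrier M.carrier
        (H ⊗[k] N.carrier) (TensorProduct.map M.act.toLinearMap (coactTwist N.act N.coact) z) x) :=
    fun z x => by
    induction z using tensor3_induction with
    | zero => simp
    | add x y hx hy => simp only [map_add, LinearMap.add_apply, hx, hy]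
    | tmul a b c =>
      induction x using TensorProduct.induction_on with
      | zero => simp
      | add x y hx hy => simp only [map_add, hx, hy]
      | tmul x y =>
        simp only [TensorProduct.map_tmul, TensorProduct.homTensorHomMap_apply,
          map_coact_tmul hg, hf.map_act, AlgHom.toLinearMap_apply]
        rfl
  have e2 : ∀ y : M.carrier ⊗[k] (H ⊗[k] N.carrier),
      (braidLin M'.coact (reg k H)).rTensor N'.carrier
        ((TensorProduct.assoc k M'.carrier H N'.carrier).symm
          (TensorProduct.map f (TensorProduct.map LinearMap.id g) y)) =
      TensorProduct.map (TensorProduct.map LinearMap.id f) g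
        ((braidLin M.coact (reg k H)).rTensor N.carrier
        ((TensorProduct.assoc k M.carrier H N.carrier).symm y)) := fun y => by
    induction y using tensor3_induction with
    | zero => simp
    | add x y hx hy => simp only [map_add, hx, hy]
    | tmul a b c =>
      simp only [TensorProduct.map_tmul, TensorProduct.assoc_symm_tmul, LinearMap.rTensor_tmul,
        braidLin_tmul, hf.map_coact, LinearMap.id_apply]
      congr 1
      rw [← LinearMap.comp_apply, LinearMap.rTensor_comp_lTensor,
        ← LinearMap.lTensor_comp_rTensor]
      rfl
  have e3 : ∀ y : (H ⊗[k] M.carrier) ⊗[k] N.carrier,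
      TensorProduct.assoc k H M'.carrier N'.carrier
        (TensorProduct.map (TensorProduct.map LinearMap.id f) g y) =
      TensorProduct.map LinearMap.id (TensorProduct.map f g)
        (TensorProduct.assoc k H M.carrier N.carrier y) := fun y => by
    obtain ⟨y, rfl⟩ := (TensorProduct.assoc k H M.carrier N.carrier).symm.surjective y
    induction y using tensor3_induction with
    | zero => simp
    | add x y hx hy => simp only [map_add, hx, hy]
    | tmul a b c => simp
  simp only [tensorCoact, LinearMap.comp_apply, LinearEquiv.coe_coe]
  have i1 : ∀ h m : H, (LinearMap.id : H →ₗ[k] H) ((reg k H h) m) =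
      (reg k H h) ((LinearMap.id : H →ₗ[k] H) m) :=
    fun _ _ => rfl
  rw [e1, act3, act3, act3, act3,
    ← map_act2 hf.map_act (map_act2 i1 hg.map_act), e2, e3,
    ← map_act2 i1 (map_act2 hf.map_act hg.map_act)]

theorem IsYDHom.tensor (hf : IsYDHom M M' f) (hg : IsYDHom N N' g) :
    IsYDHom (M.tensor N) (M'.tensor N') (TensorProduct.map f g) where
  map_act h x := map_act2 hf.map_act hg.map_act (Dl k H h) x
  map_coact x := map_tensorCoact hf hg x

end Hom

end YDDatum

variable (k H) in
theorem tensorWellDefined : TensorWellDefined k H where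
  tensor M N := M.isYD.tensor N.isYD
  unit := YDDatum.isYD_unit
  tensorHom f g := f.isYDHom.tensor g.isYDHom
  associator U V W := ⟨YDDatum.associator_linear _ _ _,
    YDDatum.associator_colinear U.isYD V.isYD W.isYD⟩
  leftUnitor M := ⟨fun h x => YDDatum.leftUnitor_linear (M := M.datum) h x,
    fun x => YDDatum.leftUnitor_colinear (M := M.datum) x⟩
  rightUnitor M := ⟨fun h x => YDDatum.rightUnitor_linear (M := M.datum) h x,
    fun x => YDDatum.rightUnitor_colinear (M := M.datum) x⟩

end Constraints

/-! ### The monoidal category -/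

section Pentagon

variable {k : Type u} {H : Type v} [Field k] [Ring H] [Algebra k H]
variable {W X Y Z : Type*} [AddCommGroup W] [Module k W] [AddCommGroup X] [Module k X]
  [AddCommGroup Y] [Module k Y] [AddCommGroup Z] [Module k Z]
variable (ρ : H →ₐ[k] Module.End k W) (σ : H →ₐ[k] Module.End k X) (τ : H →ₐ[k] Module.End k Y)
  (υ : H →ₐ[k] Module.End k Z)

theorem lTensor_assoc_assoc_map_act3 (t : H ⊗[k] (H ⊗[k] H)) (v : ((W ⊗[k] X) ⊗[k] Y) ⊗[k] Z) :
    (TensorProduct.assoc k X Y Z).toLinearMap.lTensor W (TensorProduct.assoc k W (X ⊗[k] Y) Z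
      (TensorProduct.map (act3 ρ σ τ t ∘ₗ (TensorProduct.assoc k W X Y).toLinearMap) LinearMap.id
        v)) =
    act2 ρ (act3 σ τ υ) (tensorOne k H t)
      (TensorProduct.assoc k W X (Y ⊗[k] Z) (TensorProduct.assoc k (W ⊗[k] X) Y Z v)) := by
  induction t using tensor3_induction with
  | zero => simp
  | add x y hx hy =>
    simp only [map_add, LinearMap.add_apply, LinearMap.add_comp, TensorProduct.map_add_left, hx, hy]
  | tmul a b c =>
    rw [tensorOne, Algebra.TensorProduct.map_tmul, Algebra.TensorProduct.map_tmul]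
    induction v using TensorProduct.induction_on with
    | zero => simp
    | add x y hx hy => simp only [map_add, hx, hy]
    | tmul v z =>
      induction v using TensorProduct.induction_on with
      | zero => simp
      | add x y hx hy => simp only [map_add, TensorProduct.add_tmul, hx, hy]
      | tmul v y =>
        induction v using TensorProduct.induction_on with
        | zero => simp
        | add x y hx hy => simp only [map_add, TensorProduct.add_tmul, hx, hy]
        | tmul w x => simp

theorem lTensor_act3 (t : H ⊗[k] (H ⊗[k] H)) (v : W ⊗[k] (X ⊗[k] (Y ⊗[k] Z))) :
    (act3 σ τ υ t).lTensor W v = act2 ρ (act3 σ τ υ) (oneTensor k H t) v := by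
  induction v using TensorProduct.induction_on with
  | zero => simp
  | add x y hx hy => simp only [map_add, hx, hy]
  | tmul v z => simp [oneTensor]

theorem act2_tmul_eq_map {A B : Type*} [Ring A] [Algebra k A] [Ring B] [Algebra k B]
    (ρ : A →ₐ[k] Module.End k X) (σ : B →ₐ[k] Module.End k Y) (a : A) (b : B) :
    act2 ρ σ (a ⊗ₜ b) = TensorProduct.map (ρ a) (σ b) := by
  ext; simp

variable [QuasiBialgebra k H]

theorem lTensor_assoc_act3 (t : H ⊗[k] (H ⊗[k] H)) (v : W ⊗[k] ((X ⊗[k] Y) ⊗[k] Z)) :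
    (TensorProduct.assoc k X Y Z).toLinearMap.lTensor W
      (act3 ρ ((act2 σ τ).comp (Dl k H)) υ t v) =
    act2 ρ (act3 σ τ υ) (comulSnd (Dl k H) t)
      ((TensorProduct.assoc k X Y Z).toLinearMap.lTensor W v) := by
  induction t using TensorProduct.induction_on with
  | zero => simp
  | add x y hx hy => simp only [map_add, LinearMap.add_apply, hx, hy]
  | tmul a t =>
    induction v using TensorProduct.induction_on with
    | zero => simp
    | add x y hx hy => simp only [map_add, hx, hy]
    | tmul w v =>
      rw [act3, act2_tmul, LinearMap.lTensor_tmul, LinearEquiv.coe_coe, YDDatum.assoc_act2_comul_left]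
      simp [comulSnd]

theorem assoc_act3_comul_left (t : H ⊗[k] (H ⊗[k] H)) (v : (W ⊗[k] X) ⊗[k] (Y ⊗[k] Z)) :
    TensorProduct.assoc k W X (Y ⊗[k] Z) (act3 ((act2 ρ σ).comp (Dl k H)) τ υ t v) =
    act2 ρ (act3 σ τ υ) (comulFst (Dl k H) t) (TensorProduct.assoc k W X (Y ⊗[k] Z) v) := by
  induction t using TensorProduct.induction_on with
  | zero => simp
  | add x y hx hy => simp only [map_add, LinearMap.add_apply, hx, hy]
  | tmul a t =>
    induction v using TensorProduct.induction_on with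
    | zero => simp
    | add x y hx hy => simp only [map_add, hx, hy]
    | tmul v u =>
      rw [act3, act2_tmul, comulFst, AlgHom.comp_apply, AlgHom.comp_apply,
        Algebra.TensorProduct.map_tmul]
      generalize Dl k H a = s
      induction s using TensorProduct.induction_on with
      | zero => simp
      | add x y hx hy =>
        simp only [map_add, LinearMap.add_apply, TensorProduct.add_tmul, hx, hy]
      | tmul a b =>
        induction v using TensorProduct.induction_on with
        | zero => simp
        | add x y hx hy => simp only [map_add, TensorProduct.add_tmul, hx, hy]
        | tmul x y => simp [act3]

theorem act3_comul_right (t : H ⊗[k] (H ⊗[k] H)) :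
    act3 ρ σ ((act2 τ υ).comp (Dl k H)) t =
    act2 ρ (act3 σ τ υ) (comulThd (Dl k H) t) := by
  induction t using tensor3_induction with
  | zero => simp only [map_zero]
  | add x y hx hy => simp only [map_add, hx, hy]
  | tmul a b c =>
    rw [comulThd, Algebra.TensorProduct.map_tmul, Algebra.TensorProduct.map_tmul, act3, act3,
      act2_tmul_eq_map, act2_tmul_eq_map, act2_tmul_eq_map, act2_tmul_eq_map]
    rfl

theorem pentagon_act (v : ((W ⊗[k] X) ⊗[k] Y) ⊗[k] Z) :
    (act3 σ τ υ (Ph k H : H ⊗[k] (H ⊗[k] H)) ∘ₗ (TensorProduct.assoc k X Y Z).toLinearMap).lTensor W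
      (act3 ρ ((act2 σ τ).comp (Dl k H)) υ (Ph k H : H ⊗[k] (H ⊗[k] H))
        (TensorProduct.assoc k W (X ⊗[k] Y) Z
          (TensorProduct.map (act3 ρ σ τ (Ph k H : H ⊗[k] (H ⊗[k] H)) ∘ₗ
            (TensorProduct.assoc k W X Y).toLinearMap) LinearMap.id v))) =
    act3 ρ σ ((act2 τ υ).comp (Dl k H)) (Ph k H : H ⊗[k] (H ⊗[k] H))
      (TensorProduct.assoc k W X (Y ⊗[k] Z)
        (act3 ((act2 ρ σ).comp (Dl k H)) τ υ (Ph k H : H ⊗[k] (H ⊗[k] H))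
          (TensorProduct.assoc k (W ⊗[k] X) Y Z v))) := by
  rw [assoc_act3_comul_left, act3_comul_right, LinearMap.lTensor_comp_apply, lTensor_assoc_act3,
    lTensor_assoc_assoc_map_act3 ρ σ τ υ, lTensor_act3 ρ, ← Module.End.mul_apply,
    ← Module.End.mul_apply, ← Module.End.mul_apply, ← map_mul, ← map_mul, ← map_mul,
    ← QuasiBialgebra.cocycle, mul_assoc]

theorem triangle_act (v : (X ⊗[k] k) ⊗[k] Y) :
    (TensorProduct.lid k Y).toLinearMap.lTensor X
      (act3 σ ((Algebra.lmul k k).comp (eps k H)) τ (Ph k H : H ⊗[k] (H ⊗[k] H))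
        (TensorProduct.assoc k X k Y v)) =
    TensorProduct.map (TensorProduct.rid k X).toLinearMap LinearMap.id v := by
  have key : ∀ t : H ⊗[k] (H ⊗[k] H), (TensorProduct.lid k Y).toLinearMap.lTensor X
      (act3 σ ((Algebra.lmul k k).comp (eps k H)) τ t (TensorProduct.assoc k X k Y v)) =
      act2 σ τ (Algebra.TensorProduct.map (AlgHom.id k H)
      ((Algebra.TensorProduct.lid k H).toAlgHom.comp
        (Algebra.TensorProduct.map (eps k H) (AlgHom.id k H))) t)
        (TensorProduct.map (TensorProduct.rid k X).toLinearMap LinearMap.id v) := fun t => by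
    induction t using tensor3_induction with
    | zero => simp
    | add x y hx hy => simp only [map_add, LinearMap.add_apply, hx, hy]
    | tmul a b c =>
      induction v using TensorProduct.induction_on with
      | zero => simp
      | add x y hx hy => simp only [map_add, hx, hy]
      | tmul v y =>
        induction v using TensorProduct.induction_on with
        | zero => simp
        | add x y hx hy => simp only [map_add, TensorProduct.add_tmul, hx, hy]
        | tmul x t =>
          simp [TensorProduct.smul_tmul', mul_smul]
          rw [smul_comm]
  rw [key, QuasiBialgebra.normalized, map_one]
  rfl

end Pentagon

section Monoidal

variable {k : Type u} {H : Type v} [Field k] [Ring H] [Algebra k H] [QuasiBialgebra k H]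

theorem map_associator {U V W U' V' W' : YDDatum k H} {f : U.carrier →ₗ[k] U'.carrier}
    {g : V.carrier →ₗ[k] V'.carrier} {h : W.carrier →ₗ[k] W'.carrier}
    (hf : YDDatum.IsYDHom U U' f) (hg : YDDatum.IsYDHom V V' g) (hh : YDDatum.IsYDHom W W' h)
    (x : (U.carrier ⊗[k] V.carrier) ⊗[k] W.carrier) :
    YDDatum.associator U' V' W' (TensorProduct.map (TensorProduct.map f g) h x) =
      TensorProduct.map f (TensorProduct.map g h) (YDDatum.associator U V W x) := by
  change act3 U'.act V'.act W'.act (Ph k H : H ⊗[k] (H ⊗[k] H)) (TensorProduct.assoc k _ _ _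
    (TensorProduct.map (TensorProduct.map f g) h x)) = TensorProduct.map f (TensorProduct.map g h)
      (act3 U.act V.act W.act (Ph k H : H ⊗[k] (H ⊗[k] H)) (TensorProduct.assoc k _ _ _ x))
  rw [act3, act3, YDDatum.map_act2 hf.map_act (YDDatum.map_act2 hg.map_act hh.map_act)]
  congr 1
  induction x using TensorProduct.induction_on with
  | zero => simp
  | add x y hx hy => simp only [map_add, hx, hy]
  | tmul x z =>
    induction x using TensorProduct.induction_on with
    | zero => simp
    | add x y hx hy => simp only [map_add, TensorProduct.add_tmul, hx, hy]
    | tmul x y => simp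

theorem isMonoidal (hw : TensorWellDefined k H) : IsMonoidal (fdYDTensor hw) :=
  ⟨{ toMonoidalCategoryStruct := fdYDTensor hw
     tensorHom_def := fun f g => YDHom.ext <|
       TensorProduct.map_comp LinearMap.id g.toLin f.toLin LinearMap.id
     id_tensorHom_id := fun M N => YDHom.ext TensorProduct.map_id
     tensorHom_comp_tensorHom := fun f g f' g' => YDHom.ext <|
       (TensorProduct.map_comp f'.toLin g'.toLin f.toLin g.toLin).symm
     whiskerLeft_id := fun M N => YDHom.ext TensorProduct.map_id
     id_whiskerRight := fun M N => YDHom.ext TensorProduct.map_id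
     associator_naturality := fun f g h => YDHom.ext <| LinearMap.ext fun x =>
       map_associator f.isYDHom g.isYDHom h.isYDHom x
     leftUnitor_naturality := fun {M N} f => YDHom.ext <| by
       refine TensorProduct.ext' (M := k) (N := M.datum.carrier) fun x y => ?_
       change TensorProduct.lid k _ (TensorProduct.map LinearMap.id f.toLin (x ⊗ₜ y)) =
         f.toLin (TensorProduct.lid k _ (x ⊗ₜ y))
       simp
     rightUnitor_naturality := fun {M N} f => YDHom.ext <| by
       refine TensorProduct.ext' (M := M.datum.carrier) (N := k) fun x y => ?_
       change TensorProduct.rid k _ (TensorProduct.map f.toLin LinearMap.id (x ⊗ₜ y)) =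
         f.toLin (TensorProduct.rid k _ (x ⊗ₜ y))
       simp
     pentagon := fun W X Y Z => YDHom.ext <| LinearMap.ext fun v =>
       pentagon_act W.datum.act X.datum.act Y.datum.act Z.datum.act v
     triangle := fun X Y => YDHom.ext <| LinearMap.ext fun v =>
       triangle_act X.datum.act Y.datum.act v }, rfl⟩

end Monoidal

/-! ### Invertibility of the coaction element -/

section Inverse

variable {k : Type u} {H : Type v} [Field k] [Ring H] [Algebra k H]
variable {E A B X : Type*} [Semiring E] [Algebra k E] [Semiring A] [Algebra k A]
  [Semiring B] [Algebra k B] [AddCommMonoid X] [Module k X]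

/-- Sliding `R` on `x` next to `R` on `y` produces the hexagon and hence `R` on `x ⋆ y`, which is
absorbed. So the factors before `R` on `x` provide a left inverse of `R`. -/
theorem left_inverse_word [QuasiBialgebra k H] {ρ : H →ₐ[k] E} {R : H ⊗[k] E} (hR : IsYDElem ρ R)
    (x y z : H →ₐ[k] A) (e : E →ₐ[k] A) [Comm x y] [Comm x z] [Comm y z] [Comm x e] [Comm y e]
    [Comm z e] {Ψ : A →ₗ[k] X} (hL : AbsL Ψ (x ⋆ y)) (hr : AbsR Ψ (y ⋆ z)) :
    Ψ (((ph x y (e.comp ρ))⁻¹ : Aˣ) * pl y e R * ph x (e.comp ρ) y *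
      ((ph (x ⋆ e.comp ρ) y z)⁻¹ : Aˣ) * pl x e R) = Ψ ((ph x y z)⁻¹ : Aˣ) := by
  have e1 : (((ph x y (e.comp ρ))⁻¹ : Aˣ) * pl y e R * ph x (e.comp ρ) y *
      ((ph (x ⋆ e.comp ρ) y z)⁻¹ : Aˣ) * pl x e R : A) =
      1 * pl (x ⋆ y) e R * (ph (e.comp ρ) x y * ((ph (e.comp ρ ⋆ x) y z)⁻¹ : Aˣ)) := by
    simp only [mul_assoc]
    rw [← hR.slide_fst_inv x e y z, mul_mul_mul_of_eq (hR.hex x y e)]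
    simp [mul_assoc]
  have a1 : ∀ T, Abs Ψ (x ⋆ y) 1 T := fun T => hL.abs fun _ => Commute.one_left _
  have e2 := (a1 (ph (e.comp ρ) x y * ((ph (e.comp ρ ⋆ x) y z)⁻¹ : Aˣ))).ph_snd (a := e.comp ρ)
    (c := z)
  rw [e1, (a1 _).pl, hR.counit, mul_one, ← e2.1, one_mul, ← mul_assoc, ← ph_inv_mul_ph]
  have e3 := (hr.abs (L := (((ph x y z)⁻¹ : Aˣ) : A)) (T := 1) fun _ => Commute.one_left _).ph_thd
    (a := e.comp ρ) (b := x)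
  rw [mul_one, mul_one] at e3
  exact e3.1

theorem map_mul_pl {φ : B →ₗ[k] H} {x : H →ₐ[k] B} (hφ : ∀ b h, φ (b * x h) = φ b * h)
    (T : B ⊗[k] E) (R : H ⊗[k] E) :
    TensorProduct.map φ LinearMap.id (T * pl (iL.comp x) iR R) =
      TensorProduct.map φ LinearMap.id T * R := by
  induction T using TensorProduct.induction_on with
  | zero => simp
  | add x y hx hy => simp only [add_mul, map_add, hx, hy]
  | tmul b c =>
    induction R using TensorProduct.induction_on with
    | zero => simp
    | add x y hx hy => simp only [mul_add, map_add, hx, hy]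
    | tmul h e => simp [hφ]

/-- Over a quasi-Hopf algebra, the element of `H ⊗ E` describing a coaction has a left inverse. It is
read off from `left_inverse_word` for `S⁻¹` of the line `S(a) α b β S(c)`. -/
theorem IsYDElem.exists_left_inverse [QuasiHopfAlgebra k H] {ρ : H →ₐ[k] E} {R : H ⊗[k] E}
    (hR : IsYDElem ρ R) : ∃ R', R' * R = 1 := by
  let φ : H ⊗[k] (H ⊗[k] H) →ₗ[k] H := AnInv k H ∘ₗ lineAB k H
  have hL : AbsL φ (iL ⋆ iR.comp iL) := lineAB_absL.comp _
  have hr : AbsR φ (iR.comp iL ⋆ iR.comp iR) := fun h T => by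
    rw [LinearMap.comp_apply, lineAB_absR, map_smul]; rfl
  have h1 : ∀ b h, φ (b * iL h) = φ b * h := fun b h => by
    induction b using tensor3_induction with
    | zero => simp
    | add x y hx hy => rw [add_mul, map_add, map_add, add_mul, hx, hy]
    | tmul x y z =>
      change AnInv k H (lineAB k H ((x ⊗ₜ (y ⊗ₜ z)) * (h ⊗ₜ 1))) = _
      rw [Algebra.TensorProduct.tmul_mul_tmul, mul_one]
      change AnInv k H (An k H (x * h) * al k H * (y * be k H * An k H z)) =
        AnInv k H (An k H x * al k H * (y * be k H * An k H z)) * h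
      have : AnInv k H (An k H h) = h := LinearEquiv.symm_apply_apply _ _
      rw [An_mul, mul_assoc (An k H h), mul_assoc (An k H h), AnInv_mul, this]
  have key := left_inverse_word (Ψ := TensorProduct.map φ (LinearMap.id : E →ₗ[k] E)) hR
    (iL.comp iL) (iL.comp (iR.comp iL)) (iL.comp (iR.comp iR)) iR
    (by have := hL.map_fst (LinearMap.id : E →ₗ[k] E); rw [comp_pr] at this; exact this)
    (by have := hr.map_fst (LinearMap.id : E →ₗ[k] E); rw [comp_pr] at this; exact this)
  rw [map_mul_pl h1, ← map_ph_inv_val, IsAntipode.ph_std] at key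
  refine ⟨_, key.trans ?_⟩
  change φ _ ⊗ₜ[k] (1 : E) = 1
  rw [Algebra.TensorProduct.one_def]
  congr 1
  exact (congrArg (AnInv k H) (isAntipode_id k H).phi_inv).trans (AnInv_one k H)

end Inverse

/-! ### The braiding -/

section Braiding

variable {k : Type u} {H : Type v} [Field k] [Ring H] [Algebra k H]

section Words

variable {E E' A : Type*} [Semiring E] [Algebra k E] [Semiring E'] [Algebra k E']
  [Semiring A] [Algebra k A] [QuasiBialgebra k H]
variable {ρ : H →ₐ[k] E} {R : H ⊗[k] E} {σ : H →ₐ[k] E'} {R' : H ⊗[k] E'}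

/-- `R` on the strings `n` and `e` intertwines the coaction words of the two orders of tensor
factors. -/
theorem braid_word (hR : IsYDElem ρ R) (hR' : IsYDElem σ R') (a : H →ₐ[k] A) (e : E →ₐ[k] A)
    (e' : E' →ₐ[k] A) [Comm a e] [Comm a e'] [Comm e e'] :
    tensorWord σ R' ρ R a e' e * pl (e'.comp σ) e R =
      pl (e'.comp σ) e R * tensorWord ρ R σ R' a e e' := by
  simp only [tensorWord, mul_assoc]
  have h1 := hR.hex (e'.comp σ) a e
  rw [mul_assoc] at h1
  rw [h1, mul_mul_mul_of_eq (hR.hex a (e'.comp σ) e)]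
  simp only [mul_assoc, Units.inv_mul_cancel_left, Units.mul_inv_cancel_left]
  congr 1
  have h2 : pl a e' R' * pl (e'.comp σ ⋆ a) e R = pl (a ⋆ e'.comp σ) e R * pl a e' R' :=
    intertwine_pl (hR'.slide a e') (fun _ => Comm.comm (a := pl a e') (b := e) _ _) R
  rw [mul_mul_of_eq h2, mul_assoc]

end Words

section Maps

variable {X Y Z X' Y' : Type*} [AddCommGroup X] [Module k X] [AddCommGroup Y] [Module k Y]
  [AddCommGroup Z] [Module k Z] [AddCommGroup X'] [Module k X'] [AddCommGroup Y'] [Module k Y']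
variable {c : X →ₗ[k] H ⊗[k] X} {ρ : H →ₐ[k] Module.End k X} {σ : H →ₐ[k] Module.End k Y}
  {τ : H →ₐ[k] Module.End k Z}

theorem map_braidLin {c' : X' →ₗ[k] H ⊗[k] X'} {σ' : H →ₐ[k] Module.End k Y'} {f : X →ₗ[k] X'}
    {g : Y →ₗ[k] Y'} (hf : ∀ x, c' (f x) = f.lTensor H (c x)) (hg : ∀ h y, g (σ h y) = σ' h (g y))
    (v : X ⊗[k] Y) :
    braidLin c' σ' (TensorProduct.map f g v) = TensorProduct.map g f (braidLin c σ v) := by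
  induction v using TensorProduct.induction_on with
  | zero => simp
  | add x y hx hy => simp only [map_add, hx, hy]
  | tmul x y =>
    rw [TensorProduct.map_tmul, braidLin_tmul, braidLin_tmul, hf]
    generalize c x = w
    induction w using TensorProduct.induction_on with
    | zero => simp
    | add x y hx hy => simp only [map_add, hx, hy]
    | tmul h x => simp [hg]

theorem rTensor_flip_act2 (t : H ⊗[k] H) (w : H ⊗[k] X) (y : Y) :
    (σ.toLinearMap.flip y).rTensor X (act2 (reg k H) ρ t w) =
      act2 σ ρ t ((σ.toLinearMap.flip y).rTensor X w) := by
  induction t using TensorProduct.induction_on with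
  | zero => simp
  | add x y hx hy => simp only [map_add, LinearMap.add_apply, hx, hy]
  | tmul a b =>
    induction w using TensorProduct.induction_on with
    | zero => simp
    | add x y hx hy => simp only [map_add, hx, hy]
    | tmul h x => simp

theorem rTensor_flip_coactTwist (t : H ⊗[k] H) (x : X) (y : Y) :
    (σ.toLinearMap.flip y).rTensor X (coactTwist ρ c t x) =
      braidLin c σ (act2 ρ σ t (x ⊗ₜ y)) := by
  induction t using TensorProduct.induction_on with
  | zero => simp
  | add x y hx hy => simp only [map_add, LinearMap.add_apply, hx, hy]
  | tmul a b =>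
    rw [coactTwist_tmul, act2_tmul, braidLin_tmul]
    generalize c (ρ a x) = w
    induction w using TensorProduct.induction_on with
    | zero => simp
    | add x y hx hy => simp only [map_add, hx, hy]
    | tmul h x => simp

/-- The braiding is given by the action of an element of `End Y ⊗ End X`. -/
theorem braidLin_coactOf (R : H ⊗[k] Module.End k X) (v : X ⊗[k] Y) :
    braidLin (coactOf R) σ v =
      pl ((sL k Y X).comp σ) (sR k Y X) R (TensorProduct.comm k X Y v) := by
  induction v using TensorProduct.induction_on with
  | zero => simp
  | add x y hx hy => simp only [map_add, hx, hy]
  | tmul x y =>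
    induction R using TensorProduct.induction_on with
    | zero => simp
    | add R R' hx hy =>
      rw [map_add, LinearMap.add_apply, ← hx, ← hy]
      simp
    | tmul h f => simp

variable [QuasiBialgebra k H]

/-- `h ⊗ h' ⊗ x ↦ h · y ⊗ h' · z ⊗ x`. -/
abbrev evalPair (σ : H →ₐ[k] Module.End k Y) (τ : H →ₐ[k] Module.End k Z) (X : Type*)
    [AddCommGroup X] [Module k X] (y : Y) (z : Z) :
    H ⊗[k] (H ⊗[k] X) →ₗ[k] Y ⊗[k] (Z ⊗[k] X) :=
  TensorProduct.map (σ.toLinearMap.flip y) (TensorProduct.map (τ.toLinearMap.flip z) LinearMap.id)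

theorem evalPair_act3 (t : H ⊗[k] (H ⊗[k] H)) (w : H ⊗[k] (H ⊗[k] X)) (y : Y) (z : Z) :
    evalPair σ τ X y z (act3 (reg k H) (reg k H) ρ t w) = act3 σ τ ρ t (evalPair σ τ X y z w) := by
  induction t using tensor3_induction with
  | zero => simp
  | add x y hx hy => simp only [map_add, LinearMap.add_apply, hx, hy]
  | tmul a b c =>
    induction w using tensor3_induction with
    | zero => simp
    | add x y hx hy => simp only [map_add, hx, hy]
    | tmul h h' x => simp

theorem evalPair_coactTwist (t : H ⊗[k] (H ⊗[k] H)) (x : X) (y : Y) (z : Z) :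
    evalPair σ τ X y z (TensorProduct.assoc k H H X
      (coactTwist ρ ((Dl k H).toLinearMap.rTensor X ∘ₗ c) t x)) =
    TensorProduct.assoc k Y Z X
      (braidLin c ((act2 σ τ).comp (Dl k H)) (act3 ρ σ τ t (x ⊗ₜ (y ⊗ₜ z)))) := by
  induction t using tensor3_induction with
  | zero => simp
  | add x y hx hy => simp only [map_add, LinearMap.add_apply, hx, hy]
  | tmul a b d =>
    rw [coactTwist_tmul, act3_tmul, braidLin_tmul, LinearMap.comp_apply]
    generalize c (ρ a x) = w
    induction w using TensorProduct.induction_on with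
    | zero => simp
    | add x y hx hy => simp only [map_add, hx, hy]
    | tmul h x =>
      rw [LinearMap.rTensor_tmul, LinearMap.rTensor_tmul, LinearMap.rTensor_tmul,
        LinearMap.flip_apply, AlgHom.toLinearMap_apply, AlgHom.toLinearMap_apply,
        AlgHom.comp_apply]
      generalize Dl k H h = s
      induction s using TensorProduct.induction_on with
      | zero => simp
      | add x y hx hy => simp only [map_add, LinearMap.add_apply, TensorProduct.add_tmul, hx, hy]
      | tmul h h' => simp

theorem evalPair_hom (t : H ⊗[k] (H ⊗[k] H)) (w : H ⊗[k] X) (y : Y) (z : Z) :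
    evalPair σ τ X y z (TensorProduct.homTensorHomMap (RingHom.id k) H X H (H ⊗[k] X)
      (TensorProduct.map (reg k H).toLinearMap (coactTwist ρ c) t) w) =
    (braidLin c τ).lTensor Y (act3 σ ρ τ t (TensorProduct.assoc k Y X Z
      ((σ.toLinearMap.flip y).rTensor X w ⊗ₜ z))) := by
  induction w using TensorProduct.induction_on with
  | zero => simp
  | add x y hx hy => simp only [map_add, TensorProduct.add_tmul, hx, hy]
  | tmul h x =>
    induction t using tensor3_induction with
    | zero => simp
    | add x y hx hy => simp only [map_add, LinearMap.add_apply, hx, hy]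
    | tmul a b d =>
      rw [TensorProduct.map_tmul, TensorProduct.homTensorHomMap_apply, TensorProduct.map_tmul,
        coactTwist_tmul, LinearMap.rTensor_tmul, TensorProduct.assoc_tmul, act3_tmul,
        LinearMap.lTensor_tmul, braidLin_tmul, TensorProduct.map_tmul]
      congr 1
      · simp
      · generalize c (ρ b x) = w
        induction w using TensorProduct.induction_on with
        | zero => simp
        | add x y hx hy => simp only [map_add, hx, hy]
        | tmul h x => simp

/-- The first hexagon is the coassociativity of the coaction of the module which is moved. -/
theorem braidLin_hexagon
    (hc : ∀ x, TensorProduct.homTensorHomMap (RingHom.id k) H X H (H ⊗[k] X)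
        (TensorProduct.map (reg k H).toLinearMap (coactTwist ρ c) (Ph k H : H ⊗[k] (H ⊗[k] H)))
        (c x) =
      act3 (reg k H) (reg k H) ρ (Ph k H : H ⊗[k] (H ⊗[k] H)) (TensorProduct.assoc k H H X
        (coactTwist ρ ((Dl k H).toLinearMap.rTensor X ∘ₗ c) (Ph k H : H ⊗[k] (H ⊗[k] H)) x)))
    (v : (X ⊗[k] Y) ⊗[k] Z) :
    act3 σ τ ρ (Ph k H : H ⊗[k] (H ⊗[k] H)) (TensorProduct.assoc k Y Z X
      (braidLin c ((act2 σ τ).comp (Dl k H)) (act3 ρ σ τ (Ph k H : H ⊗[k] (H ⊗[k] H))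
        (TensorProduct.assoc k X Y Z v)))) =
      (braidLin c τ).lTensor Y (act3 σ ρ τ (Ph k H : H ⊗[k] (H ⊗[k] H))
        (TensorProduct.assoc k Y X Z ((braidLin c σ).rTensor Z v))) := by
  induction v using TensorProduct.induction_on with
  | zero => simp
  | add x y hx hy => simp only [map_add, hx, hy]
  | tmul v z =>
    induction v using TensorProduct.induction_on with
    | zero => simp
    | add x y hx hy => simp only [map_add, TensorProduct.add_tmul, hx, hy]
    | tmul x y =>
      have := congrArg (evalPair σ τ X y z) (hc x)
      rw [evalPair_act3, evalPair_coactTwist, evalPair_hom] at this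
      exact this.symm

section Reverse

variable {d : Y →ₗ[k] H ⊗[k] Y}

theorem rTensor_flip_act3 (t : H ⊗[k] (H ⊗[k] H)) (w : H ⊗[k] (X ⊗[k] Y)) (z : Z) :
    (τ.toLinearMap.flip z).rTensor (X ⊗[k] Y) (act3 (reg k H) ρ σ t w) =
      act3 τ ρ σ t ((τ.toLinearMap.flip z).rTensor (X ⊗[k] Y) w) := by
  induction t using tensor3_induction with
  | zero => simp
  | add x y hx hy => simp only [map_add, LinearMap.add_apply, hx, hy]
  | tmul a b c =>
    induction w using tensor3_induction with
    | zero => simp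
    | add x y hx hy => simp only [map_add, hx, hy]
    | tmul h h' x => simp

theorem rTensor_flip_assoc_braidLin (u : X ⊗[k] (H ⊗[k] Y)) (z : Z) :
    (τ.toLinearMap.flip z).rTensor (X ⊗[k] Y) (TensorProduct.assoc k H X Y
      ((braidLin c (reg k H)).rTensor Y ((TensorProduct.assoc k X H Y).symm u))) =
    TensorProduct.assoc k Z X Y ((braidLin c τ).rTensor Y ((TensorProduct.assoc k X Z Y).symm
      (((τ.toLinearMap.flip z).rTensor Y).lTensor X u))) := by
  induction u using tensor3_induction with
  | zero => simp
  | add x y hx hy => simp only [map_add, hx, hy]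
  | tmul x h y =>
    simp only [TensorProduct.assoc_symm_tmul, LinearMap.rTensor_tmul, braidLin_tmul,
      LinearMap.lTensor_tmul]
    generalize c x = w
    induction w using TensorProduct.induction_on with
    | zero => simp
    | add x y hx hy => simp only [map_add, TensorProduct.add_tmul, hx, hy]
    | tmul h x => simp

theorem lTensor_rTensor_flip_act3 (t : H ⊗[k] (H ⊗[k] H)) (w : X ⊗[k] (H ⊗[k] Y)) (z : Z) :
    ((τ.toLinearMap.flip z).rTensor Y).lTensor X (act3 ρ (reg k H) σ t w) =
      act3 ρ τ σ t (((τ.toLinearMap.flip z).rTensor Y).lTensor X w) := by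
  induction t using tensor3_induction with
  | zero => simp
  | add x y hx hy => simp only [map_add, LinearMap.add_apply, hx, hy]
  | tmul a b c =>
    induction w using tensor3_induction with
    | zero => simp
    | add x y hx hy => simp only [map_add, hx, hy]
    | tmul h h' x => simp

theorem lTensor_rTensor_flip_hom (t : H ⊗[k] (H ⊗[k] H)) (v : X ⊗[k] Y) (z : Z) :
    ((τ.toLinearMap.flip z).rTensor Y).lTensor X
      (TensorProduct.homTensorHomMap (RingHom.id k) X Y X (H ⊗[k] Y)
        (TensorProduct.map ρ.toLinearMap (coactTwist σ d) t) v) =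
      (braidLin d τ).lTensor X (act3 ρ σ τ t (TensorProduct.assoc k X Y Z (v ⊗ₜ z))) := by
  induction v using TensorProduct.induction_on with
  | zero => simp
  | add x y hx hy => simp only [map_add, TensorProduct.add_tmul, hx, hy]
  | tmul x y =>
    induction t using tensor3_induction with
    | zero => simp
    | add x y hx hy => simp only [map_add, LinearMap.add_apply, hx, hy]
    | tmul a b e =>
      rw [TensorProduct.map_tmul, TensorProduct.homTensorHomMap_apply, TensorProduct.map_tmul,
        coactTwist_tmul, TensorProduct.assoc_tmul, act3_tmul,
        LinearMap.lTensor_tmul, LinearMap.lTensor_tmul, braidLin_tmul]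
      congr 1
      generalize d (σ b y) = w
      induction w using TensorProduct.induction_on with
      | zero => simp
      | add x y hx hy => simp only [map_add, hx, hy]
      | tmul h x => simp

end Reverse

end Maps

namespace YDDatum

variable [QuasiBialgebra k H]

theorem braidLin_linear {M N : YDDatum k H} (hM : M.IsYD) (h : H) (v : M.carrier ⊗[k] N.carrier) :
    braidLin M.coact N.act (tensorAct M N h v) = tensorAct N M h (braidLin M.coact N.act v) := by
  induction v using TensorProduct.induction_on with
  | zero => simp
  | add x y hx hy => simp only [map_add, hx, hy]
  | tmul m n =>
    have := congrArg ((N.act.toLinearMap.flip n).rTensor M.carrier) (hM.compat h m)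
    rw [rTensor_flip_act2, rTensor_flip_coactTwist] at this
    exact this.symm

theorem comm_conj_sL (X Y : Type*) [AddCommGroup X] [Module k X] [AddCommGroup Y] [Module k Y] :
    ((TensorProduct.comm k X Y).conjAlgEquiv k : _ →ₐ[k] _).comp (sL k X Y) = sR k Y X := by
  ext; simp

theorem comm_conj_sR (X Y : Type*) [AddCommGroup X] [Module k X] [AddCommGroup Y] [Module k Y] :
    ((TensorProduct.comm k X Y).conjAlgEquiv k : _ →ₐ[k] _).comp (sR k X Y) = sL k Y X := by
  ext; simp

theorem braidLin_eq {M N : YDDatum k H} [Module.Finite k M.carrier] :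
    braidLin M.coact N.act = (pl ((sL k N.carrier M.carrier).comp N.act)
      (sR k N.carrier M.carrier) M.elem : Module.End k (N.carrier ⊗[k] M.carrier)) ∘ₗ
        (TensorProduct.comm k M.carrier N.carrier).toLinearMap := by
  refine LinearMap.ext fun v => ?_
  rw [M.coact_eq, braidLin_coactOf]
  rfl

theorem tensorWord_braid {X Y : Type*} [AddCommGroup X] [Module k X] [AddCommGroup Y] [Module k Y]
    {ρ : H →ₐ[k] Module.End k X} {R : H ⊗[k] Module.End k X} {σ : H →ₐ[k] Module.End k Y}
    {R' : H ⊗[k] Module.End k Y} (hR : IsYDElem ρ R) (hR' : IsYDElem σ R') :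
    tensorWord σ R' ρ R iL (iR.comp (sL k Y X)) (iR.comp (sR k Y X)) *
      iR (pl ((sL k Y X).comp σ) (sR k Y X) R) =
    iR (pl ((sL k Y X).comp σ) (sR k Y X) R) *
      pl iL (iR.comp ((TensorProduct.comm k X Y).conjAlgEquiv k : _ →ₐ[k] _))
        (tensorWord ρ R σ R' iL (iR.comp (sL k X Y)) (iR.comp (sR k X Y))) := by
  rw [map_tensorWord, map_pl]
  simp only [← AlgHom.comp_assoc, pl_comp_iL, pl_comp_iR]
  have := braid_word hR hR' (iL : H →ₐ[k] H ⊗[k] Module.End k (Y ⊗[k] X))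
    (iR.comp (sR k Y X)) (iR.comp (sL k Y X))
  simp only [AlgHom.comp_assoc, comm_conj_sL, comm_conj_sR] at this ⊢
  exact this

theorem isYDHom_braidLin {M N : YDDatum k H} [Module.Finite k M.carrier] [Module.Finite k N.carrier]
    (hM : M.IsYD) (hN : N.IsYD) :
    IsYDHom (M.tensor N) (N.tensor M) (braidLin M.coact N.act) where
  map_act h v := braidLin_linear hM h v
  map_coact v := by
    change tensorCoact N M _ = (braidLin M.coact N.act).lTensor H (tensorCoact M N v)
    rw [tensorCoact_eq M.coact_eq N.coact_eq, tensorCoact_eq N.coact_eq M.coact_eq, braidLin_eq]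
    exact colinear_of_word (TensorProduct.comm k M.carrier N.carrier) _
      (tensorWord_braid (isYDElem hM) (isYDElem hN)) v

/-- The second hexagon is the definition of the coaction on a tensor product. -/
theorem braidLin_tensorCoact (M N : YDDatum k H) {Z : Type*} [AddCommGroup Z] [Module k Z]
    (τ : H →ₐ[k] Module.End k Z) (v : (M.carrier ⊗[k] N.carrier) ⊗[k] Z) :
    braidLin (tensorCoact M N) τ v =
      act3 τ M.act N.act (Ph k H : H ⊗[k] (H ⊗[k] H)) (TensorProduct.assoc k Z M.carrier N.carrier
        ((braidLin M.coact τ).rTensor N.carrier ((TensorProduct.assoc k M.carrier Z N.carrier).symm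
          (act3 M.act τ N.act (((Ph k H)⁻¹ : (H ⊗[k] (H ⊗[k] H))ˣ) : H ⊗[k] (H ⊗[k] H))
            ((braidLin N.coact τ).lTensor M.carrier
              (act3 M.act N.act τ (Ph k H : H ⊗[k] (H ⊗[k] H))
                (TensorProduct.assoc k M.carrier N.carrier Z v))))))) := by
  induction v using TensorProduct.induction_on with
  | zero => simp
  | add x y hx hy => simp only [map_add, hx, hy]
  | tmul v z =>
    rw [braidLin_tmul, ← lTensor_rTensor_flip_hom, ← lTensor_rTensor_flip_act3,
      ← rTensor_flip_assoc_braidLin, ← rTensor_flip_act3]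
    rfl

end YDDatum

end Braiding

section Braided

variable {k : Type u} {H : Type v} [Field k] [Ring H] [Algebra k H]

theorem YDDatum.braidLin_bijective [QuasiHopfAlgebra k H] {M N : YDDatum k H}
    [Module.Finite k M.carrier] [Module.Finite k N.carrier] (hM : M.IsYD) :
    Function.Bijective (braidLin M.coact N.act) := by
  obtain ⟨R', hR'⟩ := (isYDElem hM).exists_left_inverse
  have h1 := congrArg (pl ((sL k N.carrier M.carrier).comp N.act) (sR k N.carrier M.carrier)) hR'
  rw [map_mul, map_one] at h1
  have h2 : Function.Injective (pl ((sL k N.carrier M.carrier).comp N.act)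
      (sR k N.carrier M.carrier) M.elem : Module.End k (N.carrier ⊗[k] M.carrier)) := fun x y h => by
    have := congrArg (pl ((sL k N.carrier M.carrier).comp N.act) (sR k N.carrier M.carrier) R') h
    rw [← Module.End.mul_apply, ← Module.End.mul_apply, h1] at this
    exact this
  have h3 : Function.Bijective (pl ((sL k N.carrier M.carrier).comp N.act)
      (sR k N.carrier M.carrier) M.elem : Module.End k (N.carrier ⊗[k] M.carrier)) :=
    ⟨h2, LinearMap.injective_iff_surjective.1 h2⟩
  rw [braidLin_eq]
  exact h3.comp (TensorProduct.comm k M.carrier N.carrier).bijective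

variable [QuasiHopfAlgebra k H]

/-- The braiding as an isomorphism of Yetter-Drinfeld modules. -/
def braidIso (hw : TensorWellDefined k H) (M N : FdYD k H) :
    (⟨M.datum.tensor N.datum, hw.tensor M N⟩ : FdYD k H) ≅
      ⟨N.datum.tensor M.datum, hw.tensor N M⟩ :=
  isoMk (LinearEquiv.ofBijective (braidLin M.datum.coact N.datum.act)
    (YDDatum.braidLin_bijective M.isYD)) (YDDatum.isYDHom_braidLin M.isYD N.isYD)

/-- The braiding on finite dimensional Yetter-Drinfeld modules. -/
@[reducible]
def fdYDBraided (hw : TensorWellDefined k H) (hm : IsMonoidal (fdYDTensor hw)) :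
    letI : MonoidalCategory (FdYD k H) := hm.monoidalCategory
    BraidedCategory (FdYD k H) :=
  letI : MonoidalCategory (FdYD k H) := hm.monoidalCategory
  { braiding := fun M N => braidIso hw M N
    braiding_naturality_right := fun X _ _ f => YDHom.ext <| LinearMap.ext fun v =>
      map_braidLin (f := LinearMap.id) (g := f.toLin) (fun x => by simp) f.isYDHom.map_act v
    braiding_naturality_left := fun f Z => YDHom.ext <| LinearMap.ext fun v =>
      map_braidLin (f := f.toLin) (g := LinearMap.id) f.isYDHom.map_coact (fun _ _ => rfl) v
    hexagon_forward := fun X Y Z => YDHom.ext <| LinearMap.ext fun v =>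
      braidLin_hexagon X.isYD.coassoc v
    hexagon_reverse := fun X Y Z => by
      rw [Iso.inv_comp_eq, Iso.comp_inv_eq]
      exact YDHom.ext <| LinearMap.ext fun v =>
        YDDatum.braidLin_tensorCoact X.datum Y.datum Z.datum.act v }

end Braided

/-! ### The dual Yetter-Drinfeld modules -/

section Elem

variable {k : Type u} {H : Type v} [Field k] [Ring H] [Algebra k H] [QuasiHopfAlgebra k H]
variable {E : Type*} [Semiring E] [Algebra k E]

/-- For a string `ρ : H → E`, the string `h ↦ ρ(S⁻¹(h))` of the opposite algebra. -/
def barInv (ρ : H →ₐ[k] E) : H →ₐ[k] Eᵐᵒᵖ :=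
  AlgHom.ofLinearMap
    ((MulOpposite.opLinearEquiv k).toLinearMap ∘ₗ ρ.toLinearMap ∘ₗ AnInv k H)
    (by
      change MulOpposite.op (ρ (AnInv k H 1)) = 1
      rw [AnInv_one, map_one]; rfl)
    (fun a b => by
      change MulOpposite.op (ρ (AnInv k H (a * b))) = _
      rw [AnInv_mul, map_mul]; rfl)

theorem barInv_apply (ρ : H →ₐ[k] E) (h : H) :
    barInv ρ h = MulOpposite.op (ρ (AnInv k H h)) := rfl

theorem bar_barInv (ρ : H →ₐ[k] E) :
    bar (barInv ρ) = (AlgEquiv.opOp k E : E →ₐ[k] Eᵐᵒᵖᵐᵒᵖ).comp ρ := by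
  ext h
  rw [bar_apply, barInv_apply]
  have : AnInv k H (An k H h) = h := LinearEquiv.symm_apply_apply _ _
  rw [this]
  rfl

/-- The element of `H ⊗ Eᵐᵒᵖ` describing the coaction of the right dual: `(S ⊗ op)` of the given
element, with the Drinfeld twist removed. -/
def rightDualElem (ρ : H →ₐ[k] E) (R : H ⊗[k] E) : H ⊗[k] Eᵐᵒᵖ :=
  ((tw iL (iR.comp (barInv ρ)))⁻¹ : (H ⊗[k] Eᵐᵒᵖ)ˣ) *
    TensorProduct.map (An k H) (MulOpposite.opLinearEquiv k).toLinearMap R *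
    tw (iR.comp (barInv ρ)) iL

/-- The left dual of the right dual is the original element. -/
theorem dualElem_rightDualElem (ρ : H →ₐ[k] E) (R : H ⊗[k] E) :
    dualElem (barInv ρ) (rightDualElem ρ R) =
      Algebra.TensorProduct.map (AlgHom.id k H) (AlgEquiv.opOp k E : E →ₐ[k] Eᵐᵒᵖᵐᵒᵖ) R := by
  have h : twElem (barInv ρ) (rightDualElem ρ R) iL iR =
      TensorProduct.map (An k H) (MulOpposite.opLinearEquiv k).toLinearMap R := by
    rw [twElem, pl_iL_iR, rightDualElem, ← mul_assoc, ← mul_assoc, Units.mul_inv, one_mul,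
      mul_assoc, Units.mul_inv, mul_one]
  rw [dualElem, h]
  clear h
  induction R using TensorProduct.induction_on with
  | zero => simp
  | add x y hx hy => simp only [map_add, hx, hy]
  | tmul x y =>
    have : AnInv k H (An k H x) = x := LinearEquiv.symm_apply_apply _ _
    rw [TensorProduct.map_tmul, TensorProduct.map_tmul, this]
    rfl

theorem IsYDElem.rightDual {ρ : H →ₐ[k] E} {R : H ⊗[k] E} (hR : IsYDElem ρ R) :
    IsYDElem (barInv ρ) (rightDualElem ρ R) := by
  rw [← isYDElem_dual_iff, bar_barInv, dualElem_rightDualElem]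
  exact hR.map _

end Elem

section Datum

variable {k : Type u} {H : Type v} [Field k] [Ring H] [Algebra k H]
variable {M : Type*} [AddCommGroup M] [Module k M]

variable (k M) in
/-- The transpose, as an algebra map from the opposite algebra of `End M` to `End M^*`. -/
def transp : (Module.End k M)ᵐᵒᵖ →ₐ[k] Module.End k (Module.Dual k M) :=
  AlgHom.ofLinearMap
    ((Module.Dual.transpose (R := k) (M := M) (M' := M)) ∘ₗ
      (MulOpposite.opLinearEquiv k).symm.toLinearMap)
    (by ext; rfl) (fun a b => by ext; rfl)

@[simp] theorem transp_apply (f : (Module.End k M)ᵐᵒᵖ) (φ : Module.Dual k M) (m : M) :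
    transp k M f φ m = φ (f.unop m) := rfl

theorem dualize_coactOf {n : ℕ} (b : Module.Basis (Fin n) k M)
    (T : H ⊗[k] (Module.End k M)ᵐᵒᵖ) :
    dualize b (coactOf (TensorProduct.map LinearMap.id
      (MulOpposite.opLinearEquiv k).symm.toLinearMap T)) =
    coactOf (Algebra.TensorProduct.map (AlgHom.id k H) (transp k M) T) := by
  refine LinearMap.ext fun φ => ?_
  change ∑ i, contract φ (coactOf _ (b i)) ⊗ₜ[k] b.coord i = _
  induction T using TensorProduct.induction_on with
  | zero => simp
  | add x y hx hy =>
    simp only [map_add, coactOf_add, LinearMap.add_apply, TensorProduct.add_tmul,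
      Finset.sum_add_distrib, hx, hy]
  | tmul h f =>
    have e : ∀ i, contract φ (coactOf (h ⊗ₜ[k] f.unop) (b i)) ⊗ₜ[k] b.coord i =
        h ⊗ₜ (φ (f.unop (b i)) • b.coord i) := fun i => by
      rw [coactOf_tmul, contract, LinearMap.comp_apply, LinearMap.lTensor_tmul]
      simp [TensorProduct.smul_tmul]
    rw [Algebra.TensorProduct.map_tmul, coactOf_tmul]
    refine (Finset.sum_congr rfl fun i _ => e i).trans ?_
    rw [← TensorProduct.tmul_sum]
    congr 1
    refine b.ext fun j => ?_
    rw [LinearMap.sum_apply, Finset.sum_eq_single j] <;>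
      simp +contextual [eq_comm]

variable [QuasiHopfAlgebra k H]

namespace YDDatum

variable {M : YDDatum k H} {R : H ⊗[k] Module.End k M.carrier} {n : ℕ}
  (b : Module.Basis (Fin n) k M.carrier)

theorem leftDual_coact (hR : M.coact = coactOf R) : (M.leftDual b).coact =
    coactOf (Algebra.TensorProduct.map (AlgHom.id k H) (transp k M.carrier)
      (dualElem M.act R)) := by
  rw [← dualize_coactOf b]
  change dualize b _ = _
  congr 1
  refine LinearMap.ext fun m => ?_
  rw [leftDualMap, hR, LinearMap.comp_apply, LinearMap.comp_apply, ← coactOf_mul_pl,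
    ← coactOf_pl_mul, dualElem]
  have e : (pl iL (iR.comp M.act) (drinfeldTwist k H) * (R *
      pl (iR.comp M.act) iL (drinfeldTwistInv k H)) : H ⊗[k] Module.End k M.carrier) =
      twElem M.act R iL iR := by
    rw [twElem, tw_val, tw_inv_val, pl_iL_iR, mul_assoc]
  rw [e]
  generalize twElem M.act R iL iR = T
  induction T using TensorProduct.induction_on with
  | zero => simp
  | add x y hx hy => simp only [map_add, coactOf_add, LinearMap.add_apply, hx, hy]
  | tmul h f => simp

theorem rightDualMapAux_eq (hR : M.coact = coactOf R) (T : H ⊗[k] H) :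
    M.rightDualMapAux T = coactOf (TensorProduct.map LinearMap.id
      (MulOpposite.opLinearEquiv k).symm.toLinearMap
        (pl iL (iR.comp (barInv M.act)) T *
          TensorProduct.map (An k H) (MulOpposite.opLinearEquiv k).toLinearMap R)) := by
  induction T using TensorProduct.induction_on with
  | zero => simp
  | add x y hx hy => simp only [map_add, add_mul, coactOf_add, hx, hy]
  | tmul a c =>
    refine LinearMap.ext fun m => ?_
    change (LinearMap.mulLeft k a ∘ₗ An k H).rTensor M.carrier
      (M.coact (M.act (AnInv k H c) m)) = _
    rw [hR, pl_tmul]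
    clear hR
    induction R using TensorProduct.induction_on with
    | zero => simp
    | add x y hx hy =>
      simp only [map_add, mul_add, coactOf_add, LinearMap.add_apply, hx, hy]
    | tmul h f => simp [barInv_apply, iL, iR]

theorem homTensorHomMap_comm_coactOf (T : H ⊗[k] H) (Y : H ⊗[k] (Module.End k M.carrier)ᵐᵒᵖ)
    (m : M.carrier) :
    TensorProduct.homTensorHomMap (RingHom.id k) H M.carrier H M.carrier
      (TensorProduct.map (LinearMap.mul k H).flip (M.act.toLinearMap ∘ₗ AnInv k H)
        (TensorProduct.comm k H H T))
      (coactOf (TensorProduct.map LinearMap.id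
        (MulOpposite.opLinearEquiv k).symm.toLinearMap Y) m) =
    coactOf (TensorProduct.map LinearMap.id
      (MulOpposite.opLinearEquiv k).symm.toLinearMap
        (Y * pl (iR.comp (barInv M.act)) iL T)) m := by
  induction T using TensorProduct.induction_on with
  | zero => simp
  | add x y hx hy =>
    simp only [map_add, mul_add, coactOf_add, LinearMap.add_apply, hx, hy]
  | tmul a c =>
    rw [pl_tmul]
    induction Y using TensorProduct.induction_on with
    | zero => simp
    | add x y hx hy =>
      simp only [map_add, add_mul, coactOf_add, LinearMap.add_apply, hx, hy]
    | tmul h f => simp [barInv_apply, iL, iR]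

theorem rightDual_coact (hR : M.coact = coactOf R) : (M.rightDual b).coact =
    coactOf (Algebra.TensorProduct.map (AlgHom.id k H) (transp k M.carrier)
      (rightDualElem M.act R)) := by
  rw [← dualize_coactOf b]
  change dualize b _ = _
  congr 1
  refine LinearMap.ext fun m => ?_
  rw [rightDualMap, LinearMap.comp_apply, rightDualMapAux_eq hR, homTensorHomMap_comm_coactOf,
    rightDualElem, tw_val, tw_inv_val]

theorem isYD_leftDual [Module.Finite k M.carrier] (hM : M.IsYD) : (M.leftDual b).IsYD := by
  have : Module.Finite k (M.leftDual b).carrier :=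
    inferInstanceAs (Module.Finite k (Module.Dual k M.carrier))
  have h := (isYDElem_dual_iff.2 (isYDElem hM)).map (transp k M.carrier)
  exact (isYD_iff (M.leftDual b) (leftDual_coact b M.coact_eq)).2 h

theorem isYD_rightDual [Module.Finite k M.carrier] (hM : M.IsYD) : (M.rightDual b).IsYD := by
  have : Module.Finite k (M.rightDual b).carrier :=
    inferInstanceAs (Module.Finite k (Module.Dual k M.carrier))
  have h := (isYDElem hM).rightDual.map (transp k M.carrier)
  exact (isYD_iff (M.rightDual b) (rightDual_coact b M.coact_eq)).2 h

end YDDatum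

end Datum

/-! ### The coaction on a module times its dual -/

section EvalWords

variable {k : Type u} {H : Type v} [Field k] [Ring H] [Algebra k H] [QuasiBialgebra k H]
variable {E A M : Type*} [Semiring E] [Algebra k E] [Semiring A] [Algebra k A] [AddCommMonoid M]
  [Module k M] {ρ : H →ₐ[k] E} {R : H ⊗[k] E}

/-- The hexagon and the pentagon turn the evaluation word into one in which `y ⋆ z` stands on the
left. -/
theorem eval_word_reduce (hR : IsYDElem ρ R) (x y z w : H →ₐ[k] A) (e : E →ₐ[k] A) [Comm x y]
    [Comm x z] [Comm x w] [Comm x e] [Comm y z] [Comm y w] [Comm y e] [Comm z w] [Comm z e]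
    [Comm w e] :
    (wA x y z (e.comp ρ) : A) * pl z e R * wA (x ⋆ y) (e.comp ρ) z w *
      (((ph x y (e.comp ρ))⁻¹ : Aˣ) * pl y e R * ph x (e.comp ρ) y) =
    ((ph x (y ⋆ z) (e.comp ρ))⁻¹ : Aˣ) * (pl (y ⋆ z) e R * (ph x (e.comp ρ) (y ⋆ z) *
      (ph (x ⋆ e.comp ρ) y z * ((ph ((x ⋆ e.comp ρ) ⋆ y) z w)⁻¹ : Aˣ)))) := by
  simp only [wA, Units.val_mul, mul_assoc]
  rw [mul_mul_of_eq (a := (((ph (x ⋆ y ⋆ e.comp ρ) z w)⁻¹ : Aˣ) : A))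
    (intertwine_ph_inv (fun h => (coassoc_inv x y (e.comp ρ) h).symm) (fun _ => commute_ph_inv _)
      (fun _ => commute_ph_inv _)).symm]
  simp only [mul_assoc]
  rw [mul_mul_of_eq (intertwine_ph_inv
    (intertwine_pr_right (a := x) (hR.slide y e) (fun _ => Comm.comm (a := pl y e) (b := x) _ _))
    (fun _ => Comm.comm (a := pl y e) (b := z) _ _)
    (fun _ => Comm.comm (a := pl y e) (b := w) _ _)).symm]
  simp only [mul_assoc]
  rw [← intertwine_ph_inv (fun h => (coassoc x (e.comp ρ) y h).symm) (fun _ => commute_ph _)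
      (fun _ => commute_ph _),
    mul_mul_of_eq (ph_mul_ph_inv x y (e.comp ρ) z)]
  simp only [mul_assoc]
  rw [mul_mul_of_eq (hR.slide_mid y e x z).symm]
  simp only [mul_assoc]
  rw [mul_mul_of_eq (hR.slide_snd_inv z e x y)]
  simp only [mul_assoc]
  rw [mul_mul_mul_of_eq (hR.hex y z e)]
  simp only [mul_assoc]
  rw [← mul_assoc (ph (e.comp ρ) y z : A), mul_mul_of_eq
    (show (ph (e.comp ρ) y z * ph x (e.comp ρ ⋆ y) z : A) * ph x (e.comp ρ) y = _ from
      pentagon_val x (e.comp ρ) y z)]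
  have h4 := ph_mul_ph_inv_mul_ph_inv_mul_ph x y z (e.comp ρ)
  simp only [mul_assoc] at h4 ⊢
  rw [← h4]
  simp only [mul_assoc]

/-- When the evaluation absorbs `y ⋆ z` and then `x ⋆ m`, only `Φ⁻¹` on one line is left. -/
theorem eval_word_absorb (hR : IsYDElem ρ R) {Ψ : A →ₗ[k] M} (x y z w : H →ₐ[k] A)
    (e : E →ₐ[k] A) [Comm x y]
    [Comm x z] [Comm x w] [Comm x e] [Comm y z] [Comm y w] [Comm y e] [Comm z w] [Comm z e]
    [Comm w e] (h1 : AbsL Ψ (y ⋆ z)) (h2 : AbsL Ψ (x ⋆ e.comp ρ)) :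
    Ψ ((wA x y z (e.comp ρ) : A) * pl z e R * wA (x ⋆ y) (e.comp ρ) z w *
      (((ph x y (e.comp ρ))⁻¹ : Aˣ) * pl y e R * ph x (e.comp ρ) y)) =
    Ψ ((ph y z w)⁻¹ : Aˣ) := by
  have a1 : ∀ T, Abs Ψ (y ⋆ z) 1 T := fun T => h1.abs fun _ => Commute.one_left _
  have a2 : ∀ T, Abs Ψ (x ⋆ e.comp ρ) 1 T := fun T => h2.abs fun _ => Commute.one_left _
  have b1 := fun T => ((a1 T).ph_snd (a := x) (c := e.comp ρ)).2
  have b2 := fun T => (a1 T).pl e R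
  have b3 := fun T => ((a1 T).ph_thd (a := x) (b := e.comp ρ)).1
  have b4 := fun T => ((a2 T).ph_fst (b := y) (c := z)).1
  have b5 := ((a2 1).ph_fst_left (a := y) (b := z) (c := w)).2
  simp only [one_mul, mul_one] at b1 b2 b3 b4 b5
  rw [eval_word_reduce hR, b1, b2, hR.counit, one_mul, b3, b4, b5]

/-- The hexagon and the pentagon turn the coevaluation word into one in which `y ⋆ z` stands on the
right. -/
theorem coeval_word_reduce (hR : IsYDElem ρ R) (x y z w : H →ₐ[k] A) (e : E →ₐ[k] A) [Comm x y]
    [Comm x z] [Comm x w] [Comm x e] [Comm y z] [Comm y w] [Comm y e] [Comm z w] [Comm z e]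
    [Comm w e] :
    (ph z (e.comp ρ) w * pl z e R * ((ph (e.comp ρ) z w)⁻¹ : Aˣ) : A) *
      ((((ph x y (e.comp ρ ⋆ (z ⋆ w)))⁻¹ : Aˣ) * ph y (e.comp ρ) (z ⋆ w)) * pl y e R *
        wB (e.comp ρ) y z w) =
    ((((ph x y (z ⋆ (e.comp ρ ⋆ w)))⁻¹ : Aˣ) * ph y z (e.comp ρ ⋆ w)) * ph (y ⋆ z) (e.comp ρ) w) *
      pl (y ⋆ z) e R := by
  simp only [wB, Units.val_mul, mul_assoc]
  rw [mul_mul_of_eq (a := (((ph (e.comp ρ) z w)⁻¹ : Aˣ) : A))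
    (intertwine_ph_inv (fun _ => commute_ph_inv _) (fun _ => commute_ph_inv _)
      (fun h => (coassoc_inv (e.comp ρ) z w h).symm))]
  simp only [mul_assoc]
  rw [mul_mul_of_eq (intertwine_ph_inv (fun _ => Comm.comm (a := pl z e) (b := x) _ _)
    (fun _ => Comm.comm (a := pl z e) (b := y) _ _)
    (intertwine_pr_left (a := w) (hR.slide z e) (fun _ => Comm.comm (a := pl z e) (b := w) _ _)))]
  simp only [mul_assoc]
  rw [mul_mul_of_eq
    (intertwine_ph_inv (fun _ => commute_ph _) (fun _ => commute_ph _)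
      (fun h => (coassoc z (e.comp ρ) w h).symm)),
    mul_mul_of_eq (ph_inv_mul_ph y (e.comp ρ) z w)]
  simp only [mul_assoc]
  rw [mul_mul_of_eq (hR.slide_fst_inv y e z w).symm]
  simp only [mul_assoc]
  rw [Units.inv_mul_cancel_left, mul_mul_of_eq (hR.slide_mid z e y w)]
  simp only [mul_assoc]
  rw [mul_mul_mul_of_eq (hR.hex y z e)]
  simp only [mul_assoc]
  rw [Units.mul_inv, mul_one, mul_mul_mul_of_eq (pentagon_val y z (e.comp ρ) w)]
  simp only [mul_assoc]

/-- When the coevaluation absorbs `y ⋆ z` and then `m ⋆ w`, only `Φ⁻¹` on one line is left. -/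
theorem coeval_word_absorb (hR : IsYDElem ρ R) {Ψ : A →ₗ[k] M} (x y z w : H →ₐ[k] A)
    (e : E →ₐ[k] A) [Comm x y]
    [Comm x z] [Comm x w] [Comm x e] [Comm y z] [Comm y w] [Comm y e] [Comm z w] [Comm z e]
    [Comm w e] (h1 : AbsR Ψ (y ⋆ z)) (h2 : AbsR Ψ (e.comp ρ ⋆ w)) :
    Ψ ((ph z (e.comp ρ) w * pl z e R * ((ph (e.comp ρ) z w)⁻¹ : Aˣ) : A) *
      ((((ph x y (e.comp ρ ⋆ (z ⋆ w)))⁻¹ : Aˣ) * ph y (e.comp ρ) (z ⋆ w)) * pl y e R *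
        wB (e.comp ρ) y z w)) =
    Ψ ((ph x y z)⁻¹ : Aˣ) := by
  have a1 : ∀ L, Abs Ψ (y ⋆ z) L 1 := fun T => h1.abs fun _ => Commute.one_left _
  have a2 : ∀ L, Abs Ψ (e.comp ρ ⋆ w) L 1 := fun T => h2.abs fun _ => Commute.one_left _
  have b1 := fun T => (a1 T).pl e R
  have b2 := fun T => ((a1 T).ph_fst (b := e.comp ρ) (c := w)).1
  have b3 := fun T => ((a2 T).ph_thd (a := y) (b := z)).1
  have b4 := ((a2 1).ph_thd_right (a := x) (b := y) (c := z)).2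
  simp only [one_mul, mul_one] at b1 b2 b3 b4
  rw [coeval_word_reduce hR, b1, hR.counit, mul_one, b2, b3, b4]

end EvalWords

/-! ### Lines for the evaluation and the coevaluation -/

section Multilinear

variable {k : Type*} [Field k] {X Y Z U V W E A B C : Type*} [AddCommMonoid X] [Module k X]
  [AddCommMonoid Y] [Module k Y] [AddCommMonoid Z] [Module k Z] [AddCommMonoid W] [Module k W]
  [AddCommMonoid U] [Module k U] [AddCommMonoid V] [Module k V] [AddCommMonoid E] [Module k E]
  [Semiring A] [Algebra k A] [Semiring B] [Algebra k B]

/-- Multilinear expressions agree if they agree on pure tensors, in the shape needed for evaluation. -/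
theorem eval_ext {Ψ : A →ₗ[k] B} {F : (X ⊗[k] Y) ⊗[k] (Z ⊗[k] W) →ₗ[k] A}
    {F' : (X ⊗[k] Y) ⊗[k] (Z ⊗[k] W) →ₗ[k] B} {G : U ⊗[k] E →ₗ[k] A} {G' : U ⊗[k] E →ₗ[k] B}
    {K : V ⊗[k] V →ₗ[k] A} {K' : V ⊗[k] V →ₗ[k] B} {c : A} {d : B}
    (key : ∀ x y z w u e v v', Ψ (F ((x ⊗ₜ y) ⊗ₜ (z ⊗ₜ w)) * G (u ⊗ₜ e) * (K (v ⊗ₜ v') * c)) =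
      K' (v ⊗ₜ v') * F' ((x ⊗ₜ y) ⊗ₜ (z ⊗ₜ w)) * G' (u ⊗ₜ e) * d)
    (S : (X ⊗[k] Y) ⊗[k] (Z ⊗[k] W)) (R : U ⊗[k] E) (t : V ⊗[k] V) :
    Ψ (F S * G R * (K t * c)) = K' t * F' S * G' R * d := by
  induction S using tensor22_induction with
  | zero => simp only [map_zero, zero_mul, mul_zero]
  | add x y hx hy => simp only [map_add, add_mul, mul_add, hx, hy]
  | tmul x y z w =>
  induction R using TensorProduct.induction_on with
  | zero => simp only [map_zero, zero_mul, mul_zero]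
  | add x y hx hy => simp only [map_add, add_mul, mul_add, hx, hy]
  | tmul u e =>
  induction t using TensorProduct.induction_on with
  | zero => simp only [map_zero, zero_mul, mul_zero]
  | add x y hx hy => simp only [map_add, add_mul, mul_add, hx, hy]
  | tmul v v' => exact key ..

/-- Multilinear expressions agree if they agree on pure tensors, in the shape needed for
coevaluation. -/
theorem coeval_ext {Ψ : A →ₗ[k] B} {F : (X ⊗[k] Y) ⊗[k] (Z ⊗[k] W) →ₗ[k] A}
    {F' : (X ⊗[k] Y) ⊗[k] (Z ⊗[k] W) →ₗ[k] B} {G : U ⊗[k] E →ₗ[k] A} {G' : U ⊗[k] E →ₗ[k] B}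
    {K : V ⊗[k] V →ₗ[k] A} {K' : V ⊗[k] V →ₗ[k] B} {c : A} {d : B}
    (key : ∀ x y z w u e v v', Ψ (c * K (v ⊗ₜ v') * G (u ⊗ₜ e) * F ((x ⊗ₜ y) ⊗ₜ (z ⊗ₜ w))) =
      d * G' (u ⊗ₜ e) * (F' ((x ⊗ₜ y) ⊗ₜ (z ⊗ₜ w)) * K' (v ⊗ₜ v')))
    (S : (X ⊗[k] Y) ⊗[k] (Z ⊗[k] W)) (R : U ⊗[k] E) (t : V ⊗[k] V) :
    Ψ (c * K t * G R * F S) = d * G' R * (F' S * K' t) := by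
  induction S using tensor22_induction with
  | zero => simp only [map_zero, zero_mul, mul_zero]
  | add x y hx hy => simp only [map_add, add_mul, mul_add, hx, hy]
  | tmul x y z w =>
  induction R using TensorProduct.induction_on with
  | zero => simp only [map_zero, zero_mul, mul_zero]
  | add x y hx hy => simp only [map_add, add_mul, mul_add, hx, hy]
  | tmul u e =>
  induction t using TensorProduct.induction_on with
  | zero => simp only [map_zero, zero_mul, mul_zero]
  | add x y hx hy => simp only [map_add, add_mul, mul_add, hx, hy]
  | tmul v v' => exact key ..

end Multilinear

section Lines

variable {k : Type u} {H : Type v} [Field k] [Ring H] [Algebra k H] [QuasiHopfAlgebra k H]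
variable {E A : Type*} [Semiring E] [Algebra k E] [Semiring A] [Algebra k A]

/-- `h ⊗ f ↦ ρ(S(h) α) f`. -/
def lineE (ρ : H →ₐ[k] E) : H ⊗[k] E →ₗ[k] E :=
  ln (rm (ρ.toLinearMap ∘ₗ An k H) (ρ (al k H))) LinearMap.id

@[simp] theorem lineE_tmul (ρ : H →ₐ[k] E) (h : H) (f : E) :
    lineE ρ (h ⊗ₜ f) = ρ (An k H h) * ρ (al k H) * f := rfl

/-- `f ⊗ h ↦ f ρ(β S(h))`. -/
def lineE' (ρ : H →ₐ[k] E) : E ⊗[k] H →ₗ[k] E :=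
  ln (rm LinearMap.id (ρ (be k H))) (ρ.toLinearMap ∘ₗ An k H)

@[simp] theorem lineE'_tmul (ρ : H →ₐ[k] E) (h : H) (f : E) :
    lineE' ρ (f ⊗ₜ h) = f * ρ (be k H) * ρ (An k H h) := rfl

theorem lineE_absL (ρ : H →ₐ[k] E) : AbsL (lineE ρ) (iL ⋆ iR.comp ρ) := fun h T => by
  rw [pr_apply]
  induction T using TensorProduct.induction_on with
  | zero => simp
  | add x y hx hy => simp only [mul_add, map_add, hx, hy, smul_add]
  | tmul x y =>
    have : ∀ t : H ⊗[k] H, lineE ρ (pl iL (iR.comp ρ) t * x ⊗ₜ y) =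
        ρ (An k H x) * ρ (lineA k H t) * y := fun t => by
      induction t using TensorProduct.induction_on with
      | zero => simp
      | add x y hx hy => simp only [add_mul, mul_add, map_add, hx, hy]
      | tmul z w => simp [QuasiHopfAlgebra.S_mul, mul_assoc]
    rw [this, (isAntipode_id k H).left]; simp

theorem lineE'_absR (ρ : H →ₐ[k] E) : AbsR (lineE' ρ) (iL.comp ρ ⋆ iR) := fun h T => by
  rw [pr_apply]
  induction T using TensorProduct.induction_on with
  | zero => simp
  | add x y hx hy => simp only [add_mul, map_add, hx, hy, smul_add]
  | tmul x y =>
    have : ∀ t : H ⊗[k] H, lineE' ρ (x ⊗ₜ y * pl (iL.comp ρ) iR t) =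
        x * ρ (lineB k H t) * ρ (An k H y) := fun t => by
      induction t using TensorProduct.induction_on with
      | zero => simp
      | add x y hx hy => simp only [add_mul, mul_add, map_add, hx, hy]
      | tmul z w => simp [QuasiHopfAlgebra.S_mul, mul_assoc]
    rw [this, (isAntipode_id k H).right]; simp

variable (k H E) in
/-- Three strings of `H` and a line of `H` and `E`. -/
abbrev Ev := (H ⊗[k] (H ⊗[k] H)) ⊗[k] (H ⊗[k] E)

variable (k H E) in
/-- Three strings of `H` and a line of `E` and `H`. -/
abbrev Ev' := (H ⊗[k] (H ⊗[k] H)) ⊗[k] (E ⊗[k] H)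

/-- `(a ⊗ b ⊗ c) ⊗ (h ⊗ f) ↦ S(a) α b β S(c) ⊗ ρ(S(h) α) f`. -/
def evLines (ρ : H →ₐ[k] E) : Ev k H E →ₗ[k] H ⊗[k] E := TensorProduct.map (lineAB k H) (lineE ρ)

/-- `(a ⊗ b ⊗ c) ⊗ (f ⊗ h) ↦ S(a) α b β S(c) ⊗ f ρ(β S(h))`. -/
def coevLines (ρ : H →ₐ[k] E) : Ev' k H E →ₗ[k] H ⊗[k] E :=
  TensorProduct.map (lineAB k H) (lineE' ρ)

theorem evLines_tmul (ρ : H →ₐ[k] E) (x : H ⊗[k] (H ⊗[k] H)) (y : H ⊗[k] E) :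
    evLines ρ (x ⊗ₜ y) = lineAB k H x ⊗ₜ lineE ρ y := rfl

theorem coevLines_tmul (ρ : H →ₐ[k] E) (x : H ⊗[k] (H ⊗[k] H)) (y : E ⊗[k] H) :
    coevLines ρ (x ⊗ₜ y) = lineAB k H x ⊗ₜ lineE' ρ y := rfl

section Strings

variable (k H E)

/-- The first bead of the line of `H` in `Ev`. -/
abbrev s2 : H →ₐ[k] Ev k H E := iL.comp iL
/-- The second bead of the line of `H` in `Ev`. -/
abbrev s8 : H →ₐ[k] Ev k H E := iL.comp (iR.comp iL)
/-- The third bead of the line of `H` in `Ev`. -/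
abbrev s9 : H →ₐ[k] Ev k H E := iL.comp (iR.comp iR)
/-- The bead of `H` on the line of `H` and `E` in `Ev`. -/
abbrev s1 : H →ₐ[k] Ev k H E := iR.comp iL
/-- The bead of `E` in `Ev`. -/
abbrev sE : E →ₐ[k] Ev k H E := iR.comp iR
/-- The first bead of the line of `H` in `Ev'`. -/
abbrev t1 : H →ₐ[k] Ev' k H E := iL.comp iL
/-- The second bead of the line of `H` in `Ev'`. -/
abbrev t2 : H →ₐ[k] Ev' k H E := iL.comp (iR.comp iL)
/-- The third bead of the line of `H` in `Ev'`. -/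
abbrev t5 : H →ₐ[k] Ev' k H E := iL.comp (iR.comp iR)
/-- The bead of `E` in `Ev'`. -/
abbrev tE : E →ₐ[k] Ev' k H E := iR.comp iL
/-- The bead of `H` on the line of `E` and `H` in `Ev'`. -/
abbrev t6 : H →ₐ[k] Ev' k H E := iR.comp iR

end Strings

theorem evLines_absL (ρ : H →ₐ[k] E) : AbsL (evLines ρ) (s2 k H E ⋆ s8 k H E) := by
  have h := (lineAB_absL (k := k) (H := H)).map_fst (lineE ρ)
  rw [comp_pr] at h; exact h

theorem evLines_absL' (ρ : H →ₐ[k] E) : AbsL (evLines ρ) (s1 k H E ⋆ (sE k H E).comp ρ) := by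
  have h := (lineE_absL ρ).map_snd (lineAB k H)
  rw [comp_pr] at h; exact h

theorem coevLines_absR (ρ : H →ₐ[k] E) : AbsR (coevLines ρ) (t2 k H E ⋆ t5 k H E) := by
  have h := (lineAB_absR (k := k) (H := H)).map_fst (lineE' ρ)
  rw [comp_pr] at h; exact h

theorem coevLines_absR' (ρ : H →ₐ[k] E) : AbsR (coevLines ρ) ((tE k H E).comp ρ ⋆ t6 k H E) := by
  have h := (lineE'_absR ρ).map_snd (lineAB k H)
  rw [comp_pr] at h; exact h

theorem evLines_word (ρ : H →ₐ[k] E) (W : (H ⊗[k] H) ⊗[k] (H ⊗[k] H)) (R : H ⊗[k] E)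
    (s : H ⊗[k] H) (x y z : H) :
    evLines ρ (pl (pl (s2 k H E) (s8 k H E)) (pl (s1 k H E) ((sE k H E).comp ρ)) W *
      pl (s8 k H E) (sE k H E) R *
      (pl (s1 k H E) (s2 k H E) s * ((sE k H E).comp ρ x * (s8 k H E y * s9 k H E z)))) =
    pl iL (iR.comp ρ) (flipS k H s) *
      pl iL (iR.comp ρ) (TensorProduct.map (lineA k H) (lineA k H) W) * R *
      (y * be k H * An k H z) ⊗ₜ ρ x := by
  refine eval_ext (A := Ev k H E) (B := H ⊗[k] E) (Ψ := evLines ρ)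
    (F := (pl (pl (s2 k H E) (s8 k H E)) (pl (s1 k H E) ((sE k H E).comp ρ))).toLinearMap)
    (F' := (pl iL (iR.comp ρ)).toLinearMap ∘ₗ TensorProduct.map (lineA k H) (lineA k H))
    (G := (pl (s8 k H E) (sE k H E)).toLinearMap) (G' := LinearMap.id)
    (K := (pl (s1 k H E) (s2 k H E)).toLinearMap)
    (K' := (pl iL (iR.comp ρ)).toLinearMap ∘ₗ flipS k H) ?_ W R s
  intros
  simp [evLines_tmul, QuasiHopfAlgebra.S_mul, mul_assoc]

theorem coevLines_word (ρ : H →ₐ[k] E) (W : (H ⊗[k] H) ⊗[k] (H ⊗[k] H)) (R : H ⊗[k] E)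
    (s : H ⊗[k] H) (x y z : H) :
    coevLines ρ (t1 k H E x * (t2 k H E y * (tE k H E).comp ρ z) *
      pl (t5 k H E) (t6 k H E) s * pl (t2 k H E) (tE k H E) R *
      pl (pl ((tE k H E).comp ρ) (t6 k H E)) (pl (t2 k H E) (t5 k H E)) W) =
    (An k H x * al k H * y) ⊗ₜ ρ z * R *
      (pl (iR.comp ρ) iL (TensorProduct.map (lineB k H) (lineB k H) W) *
        pl (iR.comp ρ) iL (flipS k H s)) := by
  refine coeval_ext (A := Ev' k H E) (B := H ⊗[k] E) (Ψ := coevLines ρ)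
    (F := (pl (pl ((tE k H E).comp ρ) (t6 k H E)) (pl (t2 k H E) (t5 k H E))).toLinearMap)
    (F' := (pl (iR.comp ρ) iL).toLinearMap ∘ₗ TensorProduct.map (lineB k H) (lineB k H))
    (G := (pl (t2 k H E) (tE k H E)).toLinearMap) (G' := LinearMap.id)
    (K := (pl (t5 k H E) (t6 k H E)).toLinearMap)
    (K' := (pl (iR.comp ρ) iL).toLinearMap ∘ₗ flipS k H) ?_ W R s
  intros
  simp [coevLines_tmul, QuasiHopfAlgebra.S_mul, mul_assoc]

theorem evLines_mul (ρ : H →ₐ[k] E) (w : Ev k H E) (x y : H) (f : E) :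
    evLines ρ (w * (s2 k H E x * (s1 k H E y * sE k H E f))) =
      An k H x ⊗ₜ ρ (An k H y) * evLines ρ w * (1 : H) ⊗ₜ f := by
  have key : ∀ a b c d g, evLines ρ ((a ⊗ₜ (b ⊗ₜ c)) ⊗ₜ (d ⊗ₜ g) *
      (s2 k H E x * (s1 k H E y * sE k H E f))) =
      An k H x ⊗ₜ ρ (An k H y) * evLines ρ ((a ⊗ₜ (b ⊗ₜ c)) ⊗ₜ (d ⊗ₜ g)) * (1 : H) ⊗ₜ f := by
    intros
    simp [evLines_tmul, QuasiHopfAlgebra.S_mul, mul_assoc]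
  generalize s2 k H E x * (s1 k H E y * sE k H E f) = X at key ⊢
  have : evLines ρ ∘ₗ LinearMap.mulRight k X = LinearMap.mulRight k ((1 : H) ⊗ₜ f) ∘ₗ
      LinearMap.mulLeft k (An k H x ⊗ₜ ρ (An k H y)) ∘ₗ evLines ρ := by
    ext a b c d g
    exact key a b c d g
  exact LinearMap.congr_fun this w

theorem coevLines_mul (ρ : H →ₐ[k] E) (w : Ev' k H E) (x y : H) (f : E) :
    coevLines ρ (t5 k H E x * (tE k H E f * t6 k H E y) * w) =
      (1 : H) ⊗ₜ f * coevLines ρ w * An k H x ⊗ₜ ρ (An k H y) := by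
  have key : ∀ a b c d g, coevLines ρ (t5 k H E x * (tE k H E f * t6 k H E y) *
      (a ⊗ₜ (b ⊗ₜ c)) ⊗ₜ (d ⊗ₜ g)) =
      (1 : H) ⊗ₜ f * coevLines ρ ((a ⊗ₜ (b ⊗ₜ c)) ⊗ₜ (d ⊗ₜ g)) * An k H x ⊗ₜ ρ (An k H y) := by
    intros
    simp [coevLines_tmul, QuasiHopfAlgebra.S_mul, mul_assoc]
  generalize t5 k H E x * (tE k H E f * t6 k H E y) = X at key ⊢
  have : coevLines ρ ∘ₗ LinearMap.mulLeft k X = LinearMap.mulRight k (An k H x ⊗ₜ ρ (An k H y)) ∘ₗ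
      LinearMap.mulLeft k ((1 : H) ⊗ₜ f) ∘ₗ coevLines ρ := by
    ext a b c d g
    exact key a b c d g
  exact LinearMap.congr_fun this w

end Lines

/-! ### The evaluation word -/

section Evaluation

variable {k : Type u} {H : Type v} [Field k] [Ring H] [Algebra k H] [QuasiHopfAlgebra k H]
variable {E A : Type*} [Semiring E] [Algebra k E] [Semiring A] [Algebra k A]
variable {ρ : H →ₐ[k] E} {R : H ⊗[k] E}

theorem pl_one {X Y : Type*} [Semiring X] [Algebra k X] [Semiring Y] [Algebra k Y]
    (a : X →ₐ[k] A) (b : Y →ₐ[k] A) [Comm a b] : pl a b 1 = 1 := map_one _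

theorem mul_mul_mul_mul_assoc {G : Type*} [Semigroup G] (a b c d e : G) :
    a * b * c * d * e = a * b * (c * d * e) := by
  simp only [mul_assoc]

theorem linear3_ext {X Y Z N : Type*} [AddCommMonoid X] [Module k X] [AddCommMonoid Y] [Module k Y]
    [AddCommMonoid Z] [Module k Z] [AddCommMonoid N] [Module k N] {f g : X ⊗[k] (Y ⊗[k] Z) →ₗ[k] N}
    (h : ∀ x y z, f (x ⊗ₜ (y ⊗ₜ z)) = g (x ⊗ₜ (y ⊗ₜ z))) (t : X ⊗[k] (Y ⊗[k] Z)) : f t = g t := by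
  induction t using tensor3_induction with
  | zero => rw [map_zero, map_zero]
  | add x y hx hy => rw [map_add, map_add, hx, hy]
  | tmul x y z => exact h x y z

theorem linear4_ext {X Y Z W N : Type*} [AddCommMonoid X] [Module k X] [AddCommMonoid Y]
    [Module k Y] [AddCommMonoid Z] [Module k Z] [AddCommMonoid W] [Module k W] [AddCommMonoid N]
    [Module k N] {f g : X ⊗[k] (Y ⊗[k] (Z ⊗[k] W)) →ₗ[k] N}
    (h : ∀ x y z w, f (x ⊗ₜ (y ⊗ₜ (z ⊗ₜ w))) = g (x ⊗ₜ (y ⊗ₜ (z ⊗ₜ w))))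
    (t : X ⊗[k] (Y ⊗[k] (Z ⊗[k] W))) : f t = g t := by
  induction t using tensor4_induction with
  | zero => rw [map_zero, map_zero]
  | add x y hx hy => rw [map_add, map_add, hx, hy]
  | tmul x y z w => exact h x y z w

theorem wA_val_eq (p q r s : H →ₐ[k] A) [Comm p q] [Comm p r] [Comm p s] [Comm q r]
    [Comm q s] [Comm r s] : (wA p q r s : A) = pl p (pl q (pl r s)) (elA k H) := by
  rw [elA, map_mul, pl_tensorOne, pl_comulFst]; rfl

theorem tw_inv_mul_SSop_gam (p q : H →ₐ[k] A) [Comm p q] (h : H) :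
    (((tw p q)⁻¹ : Aˣ) : A) * pl p q (SSop k H h * gam k H) = (p ⋆ q) (An k H h * al k H) := by
  have e : SSop k H h * gam k H = drinfeldTwist k H * Dl k H (An k H h * al k H) := by
    rw [map_mul, ← mul_assoc, drinfeldTwist_comul_S, mul_assoc, drinfeldTwist_comul_al]
  rw [e, map_mul, ← tw_val, Units.inv_mul_cancel_left, pr_apply]

theorem tw_mul_pr_S_al (p q : H →ₐ[k] A) [Comm p q] (h : H) :
    (tw p q : A) * (p ⋆ q) (An k H h * al k H) = pl p q (SSop k H h * gam k H) := by
  rw [← tw_inv_mul_SSop_gam, Units.mul_inv_cancel_left]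

/-- The factors `f` in the dual element are absorbed by `(S ⊗ S)(Δᵒᵖ(h)) γ = f Δ(S(h) α)`. -/
theorem twElem_mul_gam (hR : IsYDElem ρ R) (p : H →ₐ[k] A) (e : E →ₐ[k] A) [Comm p e] (h : H) :
    twElem ρ R p e * pl (e.comp ρ) p (SSop k H h * gam k H) =
      pl p (e.comp ρ) (SSop k H h * gam k H) * pl p e R := by
  rw [twElem, mul_assoc, tw_inv_mul_SSop_gam, mul_assoc, hR.slide, ← mul_assoc, tw_mul_pr_S_al]

theorem map_lineA_comm (W : (H ⊗[k] H) ⊗[k] (H ⊗[k] H)) :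
    TensorProduct.map (lineA k H) (lineA k H) (TensorProduct.comm k _ _ W) =
      TensorProduct.comm k H H (TensorProduct.map (lineA k H) (lineA k H) W) := by
  induction W using TensorProduct.induction_on with
  | zero => simp
  | add x y hx hy => simp only [map_add, hx, hy]
  | tmul x y => simp

theorem flipS_comm (W : H ⊗[k] H) :
    flipS k H (TensorProduct.comm k _ _ W) = TensorProduct.comm k H H (flipS k H W) := by
  induction W using TensorProduct.induction_on with
  | zero => simp
  | add x y hx hy => simp only [map_add, hx, hy]
  | tmul x y => simp

theorem comm_mul {X Y : Type*} [Semiring X] [Algebra k X] [Semiring Y] [Algebra k Y]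
    (x y : X ⊗[k] Y) : TensorProduct.comm k X Y (x * y) =
      TensorProduct.comm k X Y x * TensorProduct.comm k X Y y :=
  map_mul (Algebra.TensorProduct.comm k X Y) x y

theorem pl_iL_iR_comp_comm (ρ : H →ₐ[k] E) (W : H ⊗[k] H) :
    pl (iL : H →ₐ[k] H ⊗[k] E) (iR.comp ρ) (TensorProduct.comm k H H W) = pl (iR.comp ρ) iL W :=
  pl_comm _ _ W

theorem evLines_wA (x y z w : H) :
    evLines ρ (wA (s1 k H E) (s2 k H E) (s8 k H E) ((sE k H E).comp ρ) *
      pl (s8 k H E) (sE k H E) R * ((s1 k H E ⋆ s2 k H E) x *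
        ((sE k H E).comp ρ y * (s8 k H E z * s9 k H E w)))) =
    pl iL (iR.comp ρ) (SSop k H x * gam k H) * R * (z * be k H * An k H w) ⊗ₜ ρ y := by
  have h := evLines_word ρ
    (wA (iR.comp iL) (iL.comp iL) (iL.comp iR) (iR.comp iR) : ((H ⊗[k] H) ⊗[k] (H ⊗[k] H))ˣ) R
    (Dl k H x) y z w
  rw [← gam_eq, map_wA_val] at h
  simp only [pl_comp_iL_comp, pl_comp_iR_comp, pl_comp_iL, pl_comp_iR] at h
  rw [map_mul (pl iL (iR.comp ρ)), SSop_apply, pr_apply]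
  exact h

theorem evLines_wA_self (x y z w : H) :
    evLines (AlgHom.id k H) (wA (s2 k H H) (s1 k H H) (sE k H H) (s8 k H H) *
      ((s2 k H H ⋆ s1 k H H) x * (sE k H H y * (s8 k H H z * s9 k H H w)))) =
    TensorProduct.comm k H H (SSop k H x * gam k H) * (z * be k H * An k H w) ⊗ₜ y := by
  have h := evLines_word (AlgHom.id k H) (TensorProduct.comm k _ _
    (wA (iR.comp iL) (iL.comp iL) (iL.comp iR) (iR.comp iR) : ((H ⊗[k] H) ⊗[k] (H ⊗[k] H))ˣ)) 1
    (TensorProduct.comm k _ _ (Dl k H x)) y z w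
  rw [map_lineA_comm, flipS_comm, ← gam_eq, pl_comm, pl_comm, map_wA_val] at h
  simp only [pl_comp_iL_comp, pl_comp_iR_comp, pl_comp_iL, pl_comp_iR, AlgHom.comp_id, mul_one] at h
  rw [pl_one, mul_one] at h
  rw [comm_mul, SSop_apply, pr_apply]
  rw [pl_iL_iR, pl_iL_iR] at h
  exact h

/-- Multiplication by the twisted element inserts `R` between the two copies of `A`. -/
theorem twElem_mul_evLines (hR : IsYDElem ρ R) :
    twElem ρ R iL iR * pl iL (iR.comp ρ) (evLines (AlgHom.id k H)
      (wA (s2 k H H) (s1 k H H) (sE k H H) (s8 k H H) *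
        wA (s2 k H H ⋆ s1 k H H) (sE k H H) (s8 k H H) (s9 k H H))) =
    evLines ρ (wA (s1 k H E) (s2 k H E) (s8 k H E) ((sE k H E).comp ρ) *
      pl (s8 k H E) (sE k H E) R *
      wA (s1 k H E ⋆ s2 k H E) ((sE k H E).comp ρ) (s8 k H E) (s9 k H E)) := by
  rw [wA_val_eq (s2 k H H ⋆ s1 k H H), wA_val_eq (s1 k H E ⋆ s2 k H E)]
  refine linear4_ext (f := LinearMap.mulLeft k (twElem ρ R iL iR) ∘ₗ
    (pl iL (iR.comp ρ)).toLinearMap ∘ₗ evLines (AlgHom.id k H) ∘ₗ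
    LinearMap.mulLeft k (wA (s2 k H H) (s1 k H H) (sE k H H) (s8 k H H) : Ev k H H) ∘ₗ
    (pl (s2 k H H ⋆ s1 k H H) (pl (sE k H H) (pl (s8 k H H) (s9 k H H)))).toLinearMap)
    (g := evLines ρ ∘ₗ LinearMap.mulLeft k
      (wA (s1 k H E) (s2 k H E) (s8 k H E) ((sE k H E).comp ρ) * pl (s8 k H E) (sE k H E) R) ∘ₗ
    (pl (s1 k H E ⋆ s2 k H E) (pl ((sE k H E).comp ρ) (pl (s8 k H E) (s9 k H E)))).toLinearMap)
    (fun x y z w => ?_) (elA k H)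
  simp only [LinearMap.comp_apply, AlgHom.toLinearMap_apply, LinearMap.mulLeft_apply]
  rw [pl_tmul, pl_tmul, pl_tmul, evLines_wA_self, pl_tmul, pl_tmul, pl_tmul, evLines_wA,
    map_mul, pl_iL_iR_comp_comm, ← mul_assoc, twElem_mul_gam hR, pl_iL_iR, pl_tmul]
  congr 1
  simp

theorem evLines_ph_inv (ρ : H →ₐ[k] E) :
    evLines ρ ((ph (s2 k H E) (s8 k H E) (s9 k H E))⁻¹ : (Ev k H E)ˣ) = 1 ⊗ₜ ρ (al k H) := by
  have e2 : (((ph (s2 k H E) (s8 k H E) (s9 k H E))⁻¹ : (Ev k H E)ˣ) : Ev k H E) =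
      iL (((Ph k H)⁻¹ : (H ⊗[k] (H ⊗[k] H))ˣ) : H ⊗[k] (H ⊗[k] H)) := by
    rw [← IsAntipode.ph_std, map_ph_inv_val]
  rw [e2, Algebra.TensorProduct.includeLeft_apply, evLines_tmul]
  refine congrArg₂ _ (isAntipode_id k H).phi_inv ?_
  rw [Algebra.TensorProduct.one_def, lineE_tmul, An_one, map_one, one_mul, mul_one]

theorem wA_mul_wA_absorb {M : Type*} [AddCommMonoid M] [Module k M] {Ψ : A →ₗ[k] M}
    {p q r s t : H →ₐ[k] A} [Comm p q] [Comm p r] [Comm p s] [Comm p t] [Comm q r] [Comm q s]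
    [Comm q t] [Comm r s] [Comm r t] [Comm s t] (h : AbsL Ψ (q ⋆ r)) :
    Ψ (wA p q r s * wA (p ⋆ q) r s t) = Ψ (((ph p s t)⁻¹ : Aˣ) * ph p q r) := by
  have e1 : (wA p q r s * wA (p ⋆ q) r s t : A) =
      1 * ((ph (p ⋆ (q ⋆ r)) s t)⁻¹ : Aˣ) * ph p q r := by
    simp only [wA, Units.val_mul, mul_assoc, one_mul]
    rw [Units.inv_mul_cancel_left]
    exact intertwine_ph_inv (fun h => (coassoc p q r h).symm)
      (fun _ => commute_ph _) (fun _ => commute_ph _)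
  rw [e1, ((h.abs fun _ => Commute.one_left _).ph_fst_right (a := p) (b := s) (c := t)).2, one_mul]

/-- Two copies of `A` with their strings closed to lines give `S(X¹) ⊗ S(X²) α X³`: the factors
between the two copies are absorbed. -/
theorem evLines_wA_wA :
    evLines (AlgHom.id k H) (wA (s2 k H H) (s1 k H H) (sE k H H) (s8 k H H) *
        wA (s2 k H H ⋆ s1 k H H) (sE k H H) (s8 k H H) (s9 k H H)) =
      TensorProduct.map (An k H) (lineA k H) (Ph k H : H ⊗[k] (H ⊗[k] H)) := by
  have hA : AbsL (evLines (AlgHom.id k H)) (s1 k H H ⋆ sE k H H) := evLines_absL' (AlgHom.id k H)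
  rw [wA_mul_wA_absorb hA, ph_val]
  have h1 := evLines_ph_inv (AlgHom.id k H)
  refine linear3_ext (f := evLines (AlgHom.id k H) ∘ₗ LinearMap.mulLeft k
    (((ph (s2 k H H) (s8 k H H) (s9 k H H))⁻¹ : (Ev k H H)ˣ) : Ev k H H) ∘ₗ
    (pl (s2 k H H) (pl (s1 k H H) (sE k H H))).toLinearMap)
    (g := TensorProduct.map (An k H) (lineA k H)) (fun x y z => ?_) _
  simp only [LinearMap.comp_apply, AlgHom.toLinearMap_apply, LinearMap.mulLeft_apply]
  rw [pl_tmul, pl_tmul, evLines_mul, h1]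
  simp

/-- `op F ⊗ G ↦ F ρ(α) G`. -/
def evalOp (ρ : H →ₐ[k] E) : Eᵐᵒᵖ ⊗[k] E →ₗ[k] E :=
  ln (rm (MulOpposite.opLinearEquiv k).symm.toLinearMap (ρ (al k H))) LinearMap.id

@[simp] theorem evalOp_tmul (ρ : H →ₐ[k] E) (F : Eᵐᵒᵖ) (G : E) :
    evalOp ρ (F ⊗ₜ G) = F.unop * ρ (al k H) * G := rfl

theorem evalOp_dual_word (X : H ⊗[k] (H ⊗[k] H)) (Y : H ⊗[k] E) (h : H) (F : Eᵐᵒᵖ) (G : E) :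
    TensorProduct.map (An k H) (evalOp ρ)
      (pl iL (pl ((iR.comp iL).comp (bar ρ)) ((iR.comp iR).comp ρ)) X *
        pl iL (iR.comp iL) (TensorProduct.map (AnInv k H)
          (MulOpposite.opLinearEquiv k).toLinearMap Y) * h ⊗ₜ (F ⊗ₜ G)) =
    An k H h ⊗ₜ F.unop * (Y * pl iL (iR.comp ρ) (TensorProduct.map (An k H) (lineA k H) X)) *
      (1 : H) ⊗ₜ G := by
  induction X using tensor3_induction with
  | zero => simp only [map_zero, mul_zero, zero_mul]
  | add x y hx hy => simp only [map_add, mul_add, add_mul, hx, hy]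
  | tmul x y z =>
    induction Y using TensorProduct.induction_on with
    | zero => simp only [map_zero, mul_zero, zero_mul]
    | add x y hx hy => simp only [map_add, mul_add, add_mul, hx, hy]
    | tmul a b =>
      have e : An k H (AnInv k H a) = a := QuasiHopfAlgebra.S.apply_symm_apply a
      simp only [LinearEquiv.coe_coe] at e
      simp [QuasiHopfAlgebra.S_mul, mul_assoc, bar_apply, e]

/-- The coaction on the product of the left dual with the module becomes trivial under
evaluation. -/
theorem evalOp_tensorWord (hR : IsYDElem ρ R) :
    (evalOp ρ).lTensor H (tensorWord (bar ρ) (dualElem ρ R) ρ R iL (iR.comp iL) (iR.comp iR)) =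
      1 ⊗ₜ ρ (al k H) := by
  -- It suffices to compare after applying `S` to the factor `H`, which removes the `S⁻¹` of the dual.
  have inj : Function.Injective ((An k H).rTensor E) :=
    (LinearEquiv.rTensor E (QuasiHopfAlgebra.S (k := k) (H := H))).injective
  apply inj
  rw [LinearMap.rTensor_tmul, An_one, ← LinearMap.comp_apply, LinearMap.rTensor_comp_lTensor]
  -- The factor `Φ` closes to `S(X¹) ⊗ S(X²) α X³`, that is to two copies of `A`, and the twisted element
  -- inserts `R` between them.
  have key : ∀ T : H ⊗[k] (H ⊗[k] E), TensorProduct.map (An k H) (evalOp ρ)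
      (pl iL (pl ((iR.comp iL).comp (bar ρ)) ((iR.comp iR).comp ρ))
          (Ph k H : H ⊗[k] (H ⊗[k] H)) * pl iL (iR.comp iL) (dualElem ρ R) *
        pl iL (pl ((iR.comp iL).comp (bar ρ)) (iR.comp iR)) T) =
      evLines ρ (wA (s1 k H E) (s2 k H E) (s8 k H E) ((sE k H E).comp ρ) *
        pl (s8 k H E) (sE k H E) R *
        wA (s1 k H E ⋆ s2 k H E) ((sE k H E).comp ρ) (s8 k H E) (s9 k H E) *
        pl (s2 k H E) (pl (s1 k H E) (sE k H E)) T) := by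
    refine linear3_ext (f := TensorProduct.map (An k H) (evalOp ρ) ∘ₗ LinearMap.mulLeft k
      (pl iL (pl ((iR.comp iL).comp (bar ρ)) ((iR.comp iR).comp ρ))
          (Ph k H : H ⊗[k] (H ⊗[k] H)) * pl iL (iR.comp iL) (dualElem ρ R)) ∘ₗ
      (pl iL (pl ((iR.comp iL).comp (bar ρ)) (iR.comp iR))).toLinearMap)
      (g := evLines ρ ∘ₗ LinearMap.mulLeft k
      (wA (s1 k H E) (s2 k H E) (s8 k H E) ((sE k H E).comp ρ) * pl (s8 k H E) (sE k H E) R *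
        wA (s1 k H E ⋆ s2 k H E) ((sE k H E).comp ρ) (s8 k H E) (s9 k H E)) ∘ₗ
      (pl (s2 k H E) (pl (s1 k H E) (sE k H E))).toLinearMap) fun x y z => ?_
    simp only [LinearMap.comp_apply, AlgHom.toLinearMap_apply, LinearMap.mulLeft_apply]
    rw [pl_tmul (s2 k H E), pl_tmul (s1 k H E), evLines_mul, ← twElem_mul_evLines hR,
      evLines_wA_wA]
    have h := evalOp_dual_word (ρ := ρ) (Ph k H : H ⊗[k] (H ⊗[k] H)) (twElem ρ R iL iR) x
      (bar ρ y) z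
    have e : pl iL (pl ((iR.comp iL).comp (bar ρ)) (iR.comp iR)) (x ⊗ₜ (y ⊗ₜ z)) =
      (x ⊗ₜ (bar ρ y ⊗ₜ z) : H ⊗[k] (Eᵐᵒᵖ ⊗[k] E)) := by simp
    rw [e]
    exact h
  -- The remaining letters `T` are those of the coaction on the module.
  have h := key ((((ph (iR.comp iL) iL ((iR.comp iR).comp ρ))⁻¹ : (H ⊗[k] (H ⊗[k] E))ˣ) :
      H ⊗[k] (H ⊗[k] E)) *
    pl iL (iR.comp iR) R * ((ph (iR.comp iL) ((iR.comp iR).comp ρ) iL : (H ⊗[k] (H ⊗[k] E))ˣ) : H ⊗[k] (H ⊗[k] E)))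
  simp only [map_mul, map_ph_val, map_ph_inv_val, map_pl, pl_comp_iR_comp,
    pl_comp_iL, pl_comp_iR, AlgHom.comp_assoc] at h
  have h2 := eval_word_absorb hR (Ψ := evLines ρ) (s1 k H E) (s2 k H E) (s8 k H E) (s9 k H E)
    (sE k H E) (evLines_absL ρ) (evLines_absL' ρ)
  rw [evLines_ph_inv] at h2
  refine Eq.trans (congrArg _ ?_) (h.trans h2)
  rw [tensorWord, mul_mul_mul_mul_assoc]
  rfl

end Evaluation

/-! ### The coevaluation word -/

section Coevaluation

variable {k : Type u} {H : Type v} [Field k] [Ring H] [Algebra k H]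
variable {E A : Type*} [Semiring E] [Algebra k E] [Semiring A] [Algebra k A]

variable (k H) in
/-- `C = (id ⊗ id ⊗ Δ)(Φ⁻¹)(1 ⊗ Φ)`. -/
def elC [QuasiBialgebra k H] : H ⊗[k] (H ⊗[k] (H ⊗[k] H)) :=
  comulThd (Dl k H) (((Ph k H)⁻¹ : (H ⊗[k] (H ⊗[k] H))ˣ) : H ⊗[k] (H ⊗[k] H)) *
    oneTensor k H (Ph k H : H ⊗[k] (H ⊗[k] H))

theorem pl_elC [QuasiBialgebra k H] (p q r s : H →ₐ[k] A) [Comm p q] [Comm p r] [Comm p s]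
    [Comm q r] [Comm q s] [Comm r s] :
    pl p (pl q (pl r s)) (elC k H) = ((ph p q (r ⋆ s))⁻¹ : Aˣ) * ph q r s := by
  rw [elC, map_mul, pl_oneTensor, pl_comulThd]; rfl

theorem elC_mul_wB_absorb [QuasiBialgebra k H] {M : Type*} [AddCommMonoid M] [Module k M]
    {Ψ : A →ₗ[k] M} {p q r s t : H →ₐ[k] A} [Comm p q] [Comm p r] [Comm p s] [Comm p t] [Comm q r]
    [Comm q s] [Comm q t] [Comm r s] [Comm r t] [Comm s t] (h : AbsR Ψ (r ⋆ s)) :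
    Ψ (((ph p q (r ⋆ (s ⋆ t)))⁻¹ : Aˣ) * ph q r (s ⋆ t) * wB q r s t) =
      Ψ (ph r s t * ((ph p q t)⁻¹ : Aˣ)) := by
  have e1 : (((ph p q (r ⋆ (s ⋆ t)))⁻¹ : Aˣ) : A) * ph q r (s ⋆ t) * wB q r s t =
      ph r s t * ((ph p q (r ⋆ s ⋆ t))⁻¹ : Aˣ) * ph q (r ⋆ s) t * 1 := by
    simp only [wB, Units.val_mul, mul_assoc, mul_one]
    rw [mul_mul_of_eq (pentagon_val q r s t).symm]
    simp only [mul_assoc]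
    rw [Units.mul_inv, mul_one, mul_mul_of_eq (intertwine_ph_inv (fun _ => commute_ph _)
      (fun _ => commute_ph _) (fun h => (coassoc r s t h).symm))]
    simp only [mul_assoc]
  have a1 : ∀ L, Abs Ψ (r ⋆ s) L 1 := fun L => h.abs fun _ => Commute.one_left _
  rw [e1, ((a1 _).ph_snd (a := q) (c := t)).1, ((a1 _).ph_thd_left (a := p) (b := q) (c := t)).2,
    mul_one]

variable [QuasiHopfAlgebra k H]
variable {ρ : H →ₐ[k] E} {R : H ⊗[k] E}

theorem pr_be_S_mul_tw_inv (p q : H →ₐ[k] A) [Comm p q] (h : H) :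
    (p ⋆ q) (be k H * An k H h) * (((tw p q)⁻¹ : Aˣ) : A) = pl p q (del k H * SSop k H h) := by
  rw [Units.mul_inv_eq_iff_eq_mul, tw_val, pr_apply, ← map_mul, mul_assoc, ← drinfeldTwist_comul_S,
    ← comul_be_drinfeldTwistInv, mul_assoc, ← mul_assoc (drinfeldTwistInv k H),
    drinfeldTwistInv_mul, one_mul, map_mul]

theorem del_mul_tw (p q : H →ₐ[k] A) [Comm p q] (h : H) :
    pl p q (del k H * SSop k H h) * (tw p q : A) = (p ⋆ q) (be k H * An k H h) := by
  rw [← pr_be_S_mul_tw_inv, Units.inv_mul_cancel_right]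

/-- The factors `f⁻¹` in the dual element are absorbed by `δ (S ⊗ S)(Δᵒᵖ(h)) = Δ(β S(h)) f⁻¹`. -/
theorem del_mul_twElem (hR : IsYDElem ρ R) (p : H →ₐ[k] A) (e : E →ₐ[k] A) [Comm p e] (h : H) :
    pl p (e.comp ρ) (del k H * SSop k H h) * twElem ρ R p e =
      pl p e R * pl (e.comp ρ) p (del k H * SSop k H h) := by
  rw [twElem, ← mul_assoc, ← mul_assoc, del_mul_tw, ← hR.slide, mul_assoc, pr_be_S_mul_tw_inv]

theorem map_lineB_comm (W : (H ⊗[k] H) ⊗[k] (H ⊗[k] H)) :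
    TensorProduct.map (lineB k H) (lineB k H) (TensorProduct.comm k _ _ W) =
      TensorProduct.comm k H H (TensorProduct.map (lineB k H) (lineB k H) W) := by
  induction W using TensorProduct.induction_on with
  | zero => simp
  | add x y hx hy => simp only [map_add, hx, hy]
  | tmul x y => simp

theorem coevLines_wB (x y z w : H) :
    coevLines ρ (t1 k H E x * (t2 k H E y * (tE k H E).comp ρ z) * (t5 k H E ⋆ t6 k H E) w *
      pl (t2 k H E) (tE k H E) R *
      wB ((tE k H E).comp ρ) (t2 k H E) (t5 k H E) (t6 k H E)) =
    (An k H x * al k H * y) ⊗ₜ ρ z * R * pl (iR.comp ρ) iL (del k H * SSop k H w) := by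
  have h := coevLines_word ρ
    (wB (iL.comp iL) (iR.comp iL) (iR.comp iR) (iL.comp iR) : ((H ⊗[k] H) ⊗[k] (H ⊗[k] H))ˣ) R
    (Dl k H w) x y z
  rw [← del_eq, map_wB_val] at h
  simp only [pl_comp_iL_comp, pl_comp_iR_comp, pl_comp_iL, pl_comp_iR] at h
  rw [map_mul (pl (iR.comp ρ) iL), SSop_apply, pr_apply]
  exact h

theorem coevLines_wB_self (x y z w : H) :
    coevLines (AlgHom.id k H) (t1 k H H x * (t2 k H H y * tE k H H z) * (t6 k H H ⋆ t5 k H H) w *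
      wB (t2 k H H) (tE k H H) (t6 k H H) (t5 k H H)) =
    (An k H x * al k H * y) ⊗ₜ z * (del k H * SSop k H w) := by
  have h := coevLines_word (AlgHom.id k H) (TensorProduct.comm k _ _
    (wB (iL.comp iL) (iR.comp iL) (iR.comp iR) (iL.comp iR) : ((H ⊗[k] H) ⊗[k] (H ⊗[k] H))ˣ)) 1
    (TensorProduct.comm k _ _ (Dl k H w)) x y z
  rw [map_lineB_comm, flipS_comm, ← del_eq, pl_comm, pl_comm, map_wB_val, pl_comm, pl_comm] at h
  simp only [pl_comp_iL_comp, pl_comp_iR_comp, pl_comp_iL, pl_comp_iR, AlgHom.comp_id,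
    mul_one] at h
  rw [pl_one, mul_one, pl_iL_iR, pl_iL_iR] at h
  rw [SSop_apply, pr_apply]
  exact h

theorem mul_mul_mul_assoc' {G : Type*} [Semigroup G] (a b c d : G) :
    a * (b * (c * d)) = a * (b * c) * d := by
  simp only [mul_assoc]

/-- Multiplication by the twisted element inserts `R` between `elC` and `B`. -/
theorem coevLines_mul_twElem (hR : IsYDElem ρ R) :
    pl iL (iR.comp ρ) (coevLines (AlgHom.id k H)
      (pl (t1 k H H) (pl (t2 k H H) (pl (tE k H H) (t6 k H H ⋆ t5 k H H))) (elC k H) *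
        wB (t2 k H H) (tE k H H) (t6 k H H) (t5 k H H))) * twElem ρ R iL iR =
    coevLines ρ (pl (t1 k H E) (pl (t2 k H E) (pl ((tE k H E).comp ρ) (t5 k H E ⋆ t6 k H E)))
        (elC k H) * pl (t2 k H E) (tE k H E) R *
      wB ((tE k H E).comp ρ) (t2 k H E) (t5 k H E) (t6 k H E)) := by
  refine linear4_ext (f := LinearMap.mulRight k (twElem ρ R iL iR) ∘ₗ
    (pl iL (iR.comp ρ)).toLinearMap ∘ₗ coevLines (AlgHom.id k H) ∘ₗ
    LinearMap.mulRight k (wB (t2 k H H) (tE k H H) (t6 k H H) (t5 k H H) : Ev' k H H) ∘ₗ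
    (pl (t1 k H H) (pl (t2 k H H) (pl (tE k H H) (t6 k H H ⋆ t5 k H H)))).toLinearMap)
    (g := coevLines ρ ∘ₗ LinearMap.mulRight k
      (wB ((tE k H E).comp ρ) (t2 k H E) (t5 k H E) (t6 k H E) : Ev' k H E) ∘ₗ
      LinearMap.mulRight k (pl (t2 k H E) (tE k H E) R) ∘ₗ
      (pl (t1 k H E) (pl (t2 k H E)
        (pl ((tE k H E).comp ρ) (t5 k H E ⋆ t6 k H E)))).toLinearMap)
    (fun x y z w => ?_) (elC k H)
  simp only [LinearMap.comp_apply, AlgHom.toLinearMap_apply, LinearMap.mulRight_apply]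
  rw [pl_tmul, pl_tmul, pl_tmul, pl_tmul, pl_tmul, pl_tmul, mul_mul_mul_assoc', coevLines_wB_self,
    mul_mul_mul_assoc' (t1 k H E x),
    coevLines_wB, map_mul, mul_assoc, del_mul_twElem hR, pl_iL_iR, pl_tmul, ← mul_assoc]
  congr 2
  simp

theorem coevLines_ph_inv (ρ : H →ₐ[k] E) :
    coevLines ρ ((ph (t1 k H E) (t2 k H E) (t5 k H E))⁻¹ : (Ev' k H E)ˣ) = 1 ⊗ₜ ρ (be k H) := by
  have e2 : (((ph (t1 k H E) (t2 k H E) (t5 k H E))⁻¹ : (Ev' k H E)ˣ) : Ev' k H E) =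
      iL (((Ph k H)⁻¹ : (H ⊗[k] (H ⊗[k] H))ˣ) : H ⊗[k] (H ⊗[k] H)) := by
    rw [← IsAntipode.ph_std, map_ph_inv_val]
  rw [e2, Algebra.TensorProduct.includeLeft_apply, coevLines_tmul]
  refine congrArg₂ _ (isAntipode_id k H).phi_inv ?_
  rw [Algebra.TensorProduct.one_def, lineE'_tmul, An_one, map_one, one_mul, mul_one]

variable (k H) in
/-- `a ⊗ b ⊗ c ↦ S(c) ⊗ a β S(b)`. -/
def coevLine : H ⊗[k] (H ⊗[k] H) →ₗ[k] H ⊗[k] H :=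
  (TensorProduct.comm k H H).toLinearMap ∘ₗ TensorProduct.map (lineB k H) (An k H) ∘ₗ
    (TensorProduct.assoc k H H H).symm.toLinearMap

@[simp] theorem coevLine_tmul (x y z : H) :
    coevLine k H (x ⊗ₜ (y ⊗ₜ z)) = An k H z ⊗ₜ (x * be k H * An k H y) := rfl

/-- Counterpart of `evLines_wA_wA` for the lines of the coevaluation, which give
`S(X³) ⊗ X¹ β S(X²)`. -/
theorem coevLines_elC_wB :
    coevLines (AlgHom.id k H)
      (pl (t1 k H H) (pl (t2 k H H) (pl (tE k H H) (t6 k H H ⋆ t5 k H H))) (elC k H) *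
        wB (t2 k H H) (tE k H H) (t6 k H H) (t5 k H H)) =
      coevLine k H (Ph k H : H ⊗[k] (H ⊗[k] H)) := by
  have hA : AbsR (coevLines (AlgHom.id k H)) (tE k H H ⋆ t6 k H H) :=
    coevLines_absR' (AlgHom.id k H)
  rw [pl_elC, elC_mul_wB_absorb hA, ph_val]
  have h1 := coevLines_ph_inv (AlgHom.id k H)
  refine linear3_ext (f := coevLines (AlgHom.id k H) ∘ₗ LinearMap.mulRight k
    (((ph (t1 k H H) (t2 k H H) (t5 k H H))⁻¹ : (Ev' k H H)ˣ) : Ev' k H H) ∘ₗ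
    (pl (tE k H H) (pl (t6 k H H) (t5 k H H))).toLinearMap)
    (g := coevLine k H) (fun x y z => ?_) _
  simp only [LinearMap.comp_apply, AlgHom.toLinearMap_apply, LinearMap.mulRight_apply]
  have e : pl (tE k H H) (pl (t6 k H H) (t5 k H H)) (x ⊗ₜ (y ⊗ₜ z)) =
      t5 k H H z * (tE k H H x * t6 k H H y) := by simp
  rw [e, coevLines_mul, h1]
  simp

/-- `G ⊗ op F ↦ G ρ(β) F`. -/
def coevalOp (ρ : H →ₐ[k] E) : E ⊗[k] Eᵐᵒᵖ →ₗ[k] E :=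
  ln (rm LinearMap.id (ρ (be k H))) (MulOpposite.opLinearEquiv k).symm.toLinearMap

@[simp] theorem coevalOp_tmul (ρ : H →ₐ[k] E) (F : Eᵐᵒᵖ) (G : E) :
    coevalOp ρ (G ⊗ₜ F) = G * ρ (be k H) * F.unop := rfl

theorem linear2_ext {X Y N : Type*} [AddCommMonoid X] [Module k X] [AddCommMonoid Y] [Module k Y]
    [AddCommMonoid N] [Module k N] {f g : X ⊗[k] Y →ₗ[k] N}
    (h : ∀ x y, f (x ⊗ₜ y) = g (x ⊗ₜ y)) (t : X ⊗[k] Y) : f t = g t :=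
  LinearMap.congr_fun (TensorProduct.ext' h) t

theorem coevalOp_dual_word (X : H ⊗[k] (H ⊗[k] H)) (Y : H ⊗[k] E) (h : H) (F : Eᵐᵒᵖ) (G : E) :
    TensorProduct.map (An k H) (coevalOp ρ) (h ⊗ₜ (G ⊗ₜ F) *
      (pl iL (iR.comp iR) (TensorProduct.map (AnInv k H)
          (MulOpposite.opLinearEquiv k).toLinearMap Y) *
        pl ((iR.comp iL).comp ρ) (pl ((iR.comp iR).comp (bar ρ)) iL) X)) =
    (1 : H) ⊗ₜ G * (pl iL (iR.comp ρ) (coevLine k H X) * Y) * An k H h ⊗ₜ F.unop := by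
  refine linear3_ext (f := TensorProduct.map (An k H) (coevalOp ρ) ∘ₗ
    LinearMap.mulLeft k (h ⊗ₜ[k] (G ⊗ₜ[k] F)) ∘ₗ LinearMap.mulLeft k (pl iL (iR.comp iR)
      (TensorProduct.map (AnInv k H) (MulOpposite.opLinearEquiv k).toLinearMap Y)) ∘ₗ
    (pl ((iR.comp iL).comp ρ) (pl ((iR.comp iR).comp (bar ρ)) iL)).toLinearMap)
    (g := LinearMap.mulRight k (An k H h ⊗ₜ F.unop) ∘ₗ LinearMap.mulLeft k ((1 : H) ⊗ₜ G) ∘ₗ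
      LinearMap.mulRight k Y ∘ₗ (pl iL (iR.comp ρ)).toLinearMap ∘ₗ coevLine k H)
    (fun x y z => ?_) X
  simp only [LinearMap.comp_apply, AlgHom.toLinearMap_apply, LinearMap.mulLeft_apply,
    LinearMap.mulRight_apply]
  refine linear2_ext (f := TensorProduct.map (An k H) (coevalOp ρ) ∘ₗ
    LinearMap.mulLeft k (h ⊗ₜ[k] (G ⊗ₜ[k] F)) ∘ₗ LinearMap.mulRight k
      (pl ((iR.comp iL).comp ρ) (pl ((iR.comp iR).comp (bar ρ)) iL) (x ⊗ₜ (y ⊗ₜ z))) ∘ₗ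
    (pl iL (iR.comp iR)).toLinearMap ∘ₗ
      (TensorProduct.map (AnInv k H) (MulOpposite.opLinearEquiv k).toLinearMap))
    (g := LinearMap.mulRight k (An k H h ⊗ₜ F.unop) ∘ₗ LinearMap.mulLeft k ((1 : H) ⊗ₜ G) ∘ₗ
      LinearMap.mulLeft k (pl iL (iR.comp ρ) (coevLine k H (x ⊗ₜ (y ⊗ₜ z)))))
    (fun a b => ?_) Y
  have e : An k H (AnInv k H a) = a := QuasiHopfAlgebra.S.apply_symm_apply a
  simp only [LinearEquiv.coe_coe] at e
  simp [QuasiHopfAlgebra.S_mul, mul_assoc, bar_apply, e]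

/-- The coaction on the product of the module with its left dual becomes trivial under
coevaluation. -/
theorem coevalOp_tensorWord (hR : IsYDElem ρ R) :
    (coevalOp ρ).lTensor H (tensorWord ρ R (bar ρ) (dualElem ρ R) iL (iR.comp iL) (iR.comp iR)) =
      1 ⊗ₜ ρ (be k H) := by
  -- It suffices to compare after applying `S` to the factor `H`, which removes the `S⁻¹` of the dual.
  have inj : Function.Injective ((An k H).rTensor E) :=
    (LinearEquiv.rTensor E (QuasiHopfAlgebra.S (k := k) (H := H))).injective
  apply inj
  rw [LinearMap.rTensor_tmul, An_one, ← LinearMap.comp_apply, LinearMap.rTensor_comp_lTensor]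
  -- The factor `Φ` closes to `S(X³) ⊗ X¹ β S(X²)`, that is to `elC` and `B`, and the twisted element
  -- inserts `R` between them.
  have key : ∀ T : H ⊗[k] (E ⊗[k] H), TensorProduct.map (An k H) (coevalOp ρ)
      (pl iL (pl (iR.comp iL) ((iR.comp iR).comp (bar ρ))) T *
        (pl iL (iR.comp iR) (dualElem ρ R) *
          pl ((iR.comp iL).comp ρ) (pl ((iR.comp iR).comp (bar ρ)) iL)
            (Ph k H : H ⊗[k] (H ⊗[k] H)))) =
      coevLines ρ (pl (t5 k H E) (pl (tE k H E) (t6 k H E)) T *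
        (pl (t1 k H E) (pl (t2 k H E) (pl ((tE k H E).comp ρ) (t5 k H E ⋆ t6 k H E)))
          (elC k H) * pl (t2 k H E) (tE k H E) R *
        wB ((tE k H E).comp ρ) (t2 k H E) (t5 k H E) (t6 k H E))) := by
    refine linear3_ext (f := TensorProduct.map (An k H) (coevalOp ρ) ∘ₗ LinearMap.mulRight k
      (pl iL (iR.comp iR) (dualElem ρ R) *
          pl ((iR.comp iL).comp ρ) (pl ((iR.comp iR).comp (bar ρ)) iL)
            (Ph k H : H ⊗[k] (H ⊗[k] H))) ∘ₗ
      (pl iL (pl (iR.comp iL) ((iR.comp iR).comp (bar ρ)))).toLinearMap)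
      (g := coevLines ρ ∘ₗ LinearMap.mulRight k
      (pl (t1 k H E) (pl (t2 k H E) (pl ((tE k H E).comp ρ) (t5 k H E ⋆ t6 k H E)))
          (elC k H) * pl (t2 k H E) (tE k H E) R *
        wB ((tE k H E).comp ρ) (t2 k H E) (t5 k H E) (t6 k H E)) ∘ₗ
      (pl (t5 k H E) (pl (tE k H E) (t6 k H E))).toLinearMap) fun x y z => ?_
    simp only [LinearMap.comp_apply, AlgHom.toLinearMap_apply, LinearMap.mulRight_apply]
    rw [pl_tmul (t5 k H E), pl_tmul (tE k H E), coevLines_mul, ← coevLines_mul_twElem hR,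
      coevLines_elC_wB]
    have h := coevalOp_dual_word (ρ := ρ) (Ph k H : H ⊗[k] (H ⊗[k] H)) (twElem ρ R iL iR) x
      (bar ρ z) y
    have e : pl iL (pl (iR.comp iL) ((iR.comp iR).comp (bar ρ))) (x ⊗ₜ (y ⊗ₜ z)) =
      (x ⊗ₜ (y ⊗ₜ bar ρ z) : H ⊗[k] (E ⊗[k] Eᵐᵒᵖ)) := by simp
    rw [e]
    exact h
  -- The remaining letters `T` are those of the coaction on the module.
  have h := key (((ph iL ((iR.comp iL).comp ρ) (iR.comp iR) : (H ⊗[k] (E ⊗[k] H))ˣ) :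
      H ⊗[k] (E ⊗[k] H)) * pl iL (iR.comp iL) R *
    (((ph ((iR.comp iL).comp ρ) iL (iR.comp iR))⁻¹ : (H ⊗[k] (E ⊗[k] H))ˣ) : H ⊗[k] (E ⊗[k] H)))
  simp only [map_mul, map_ph_val, map_ph_inv_val, map_pl, pl_comp_iR_comp, pl_comp_iL_comp,
    pl_comp_iL, pl_comp_iR, AlgHom.comp_assoc] at h
  have h2 := coeval_word_absorb hR (Ψ := coevLines ρ) (t1 k H E) (t2 k H E) (t5 k H E) (t6 k H E)
    (tE k H E) (coevLines_absR ρ) (coevLines_absR' ρ)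
  rw [coevLines_ph_inv] at h2
  rw [pl_elC] at h
  refine Eq.trans (congrArg _ ?_) (h.trans h2)
  rw [tensorWord, mul_assoc _ (pl iL (iR.comp iR) (dualElem ρ R))]
  rfl

end Coevaluation

/-! ### Dual pairs of Yetter-Drinfeld modules -/

section Contraction

variable {k : Type u} [Field k] {N D : Type*} [AddCommGroup N] [Module k N] [AddCommGroup D]
  [Module k D]

/-- For a pairing `e : D ⊗ N → k` and `n ∈ N`, the map `n' ⊗ d ↦ e(d ⊗ n) n'`. -/
def contractSnd (e : D ⊗[k] N →ₗ[k] k) (n : N) : N ⊗[k] D →ₗ[k] N :=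
  (TensorProduct.rid k N).toLinearMap ∘ₗ (e ∘ₗ (TensorProduct.mk k D N).flip n).lTensor N

/-- For a pairing `e : D ⊗ N → k` and `d ∈ D`, the map `n ⊗ d' ↦ e(d ⊗ n) d'`. -/
def contractFst (e : D ⊗[k] N →ₗ[k] k) (d : D) : N ⊗[k] D →ₗ[k] D :=
  (TensorProduct.lid k D).toLinearMap ∘ₗ (e ∘ₗ TensorProduct.mk k D N d).rTensor D

@[simp] theorem contractSnd_tmul (e : D ⊗[k] N →ₗ[k] k) (n n' : N) (d : D) :
    contractSnd e n (n' ⊗ₜ d) = e (d ⊗ₜ n) • n' := rfl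

@[simp] theorem contractFst_tmul (e : D ⊗[k] N →ₗ[k] k) (d d' : D) (n : N) :
    contractFst e d (n ⊗ₜ d') = e (d ⊗ₜ n) • d' := rfl

end Contraction

section Dual

variable {k : Type u} {H : Type v} [Field k] [Ring H] [Algebra k H] [QuasiHopfAlgebra k H]
variable {E : Type*} [Semiring E] [Algebra k E]

/-- Yetter-Drinfeld data `N` and `D` in duality through a pairing `e : D ⊗ N → k` and a copairing
`c ∈ N ⊗ D` of vector spaces. The structure of `N` comes from a string `ρ : H → E` and an element
`R ∈ H ⊗ E` along a representation `θ` of `E`, and that of `D` from the dual string and the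
dual element along a representation `θ'` of the opposite algebra which is transpose to `θ`. -/
structure IsDualPair (ρ : H →ₐ[k] E) (R : H ⊗[k] E) (N D : YDDatum k H)
    (θ : E →ₐ[k] Module.End k N.carrier) (θ' : Eᵐᵒᵖ →ₐ[k] Module.End k D.carrier)
    (e : D.carrier ⊗[k] N.carrier →ₗ[k] k) (c : N.carrier ⊗[k] D.carrier) : Prop where
  isYDElem : IsYDElem ρ R
  act : N.act = θ.comp ρ
  coact : N.coact = coactOf (Algebra.TensorProduct.map (AlgHom.id k H) θ R)
  act_dual : D.act = θ'.comp (bar ρ)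
  coact_dual : D.coact = coactOf (Algebra.TensorProduct.map (AlgHom.id k H) θ' (dualElem ρ R))
  pairing : ∀ (f : Eᵐᵒᵖ) (d : D.carrier) (n : N.carrier),
    e (θ' f d ⊗ₜ n) = e (d ⊗ₜ θ f.unop n)
  copairing : ∀ f : Eᵐᵒᵖ,
    TensorProduct.map LinearMap.id (θ' f) c = TensorProduct.map (θ f.unop) LinearMap.id c
  contractSnd : ∀ n, contractSnd e n c = n
  contractFst : ∀ d, contractFst e d c = d

namespace IsDualPair

variable {ρ : H →ₐ[k] E} {R : H ⊗[k] E} {N D : YDDatum k H}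
  {θ : E →ₐ[k] Module.End k N.carrier} {θ' : Eᵐᵒᵖ →ₐ[k] Module.End k D.carrier}
  {e : D.carrier ⊗[k] N.carrier →ₗ[k] k} {c : N.carrier ⊗[k] D.carrier}

/-- The evaluation `d ⊗ n ↦ e(d ⊗ α · n)`. -/
def ev (_ : IsDualPair ρ R N D θ θ' e c) : D.carrier ⊗[k] N.carrier →ₗ[k] k :=
  e ∘ₗ TensorProduct.map LinearMap.id (θ (ρ (al k H)))

/-- The coevaluation `1 ↦ β · c₁ ⊗ c₂` for `c = c₁ ⊗ c₂`. -/
def coev (_ : IsDualPair ρ R N D θ θ' e c) : k →ₗ[k] N.carrier ⊗[k] D.carrier :=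
  LinearMap.toSpanSingleton k _ (TensorProduct.map (θ (ρ (be k H))) LinearMap.id c)

variable (p : IsDualPair ρ R N D θ θ' e c)

/-- `x ↦ e(d ⊗ x n)`, as a function of `x ∈ E` for fixed `d ⊗ n`. -/
def evAt (_ : IsDualPair ρ R N D θ θ' e c) (v : D.carrier ⊗[k] N.carrier) : E →ₗ[k] k :=
  e ∘ₗ LinearMap.applyₗ v ∘ₗ (sR k D.carrier N.carrier).toLinearMap ∘ₗ θ.toLinearMap

/-- `x ↦ x c₁ ⊗ c₂`. -/
def coevAt (_ : IsDualPair ρ R N D θ θ' e c) : E →ₗ[k] N.carrier ⊗[k] D.carrier :=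
  LinearMap.applyₗ c ∘ₗ (sL k N.carrier D.carrier).toLinearMap ∘ₗ θ.toLinearMap

theorem ev_eq (v : D.carrier ⊗[k] N.carrier) : p.ev v = p.evAt v (ρ (al k H)) := by
  induction v using TensorProduct.induction_on with
  | zero => simp [evAt]
  | add x y hx hy => simp only [map_add, hx, hy]; simp [evAt]
  | tmul x y => simp [ev, evAt]

theorem sL_eq_map (f : Module.End k N.carrier) (v : N.carrier ⊗[k] D.carrier) :
    sL k N.carrier D.carrier f v = TensorProduct.map f LinearMap.id v := by
  induction v using TensorProduct.induction_on with
  | zero => simp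
  | add x y hx hy => simp only [map_add, hx, hy]
  | tmul x y => simp

theorem sR_eq_map (f : Module.End k D.carrier) (v : N.carrier ⊗[k] D.carrier) :
    sR k N.carrier D.carrier f v = TensorProduct.map LinearMap.id f v := by
  induction v using TensorProduct.induction_on with
  | zero => simp
  | add x y hx hy => simp only [map_add, hx, hy]
  | tmul x y => simp

theorem coev_one : p.coev 1 = p.coevAt (ρ (be k H)) := by
  rw [coev, LinearMap.toSpanSingleton_apply, one_smul, ← sL_eq_map]; rfl

theorem ev_pl (T : Eᵐᵒᵖ ⊗[k] E) (v : D.carrier ⊗[k] N.carrier) :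
    p.ev (pl ((sL k D.carrier N.carrier).comp θ') ((sR k D.carrier N.carrier).comp θ) T v) =
      p.evAt v (evalOp ρ T) := by
  induction T using TensorProduct.induction_on with
  | zero => simp
  | add x y hx hy => simp only [map_add, LinearMap.add_apply, hx, hy]
  | tmul f g =>
    induction v using TensorProduct.induction_on with
    | zero => simp [evAt]
    | add x y hx hy => simp only [map_add, hx, hy]; simp [evAt]
    | tmul d n => simp [ev, evAt, p.pairing]

theorem pl_coev (T : E ⊗[k] Eᵐᵒᵖ) :
    pl ((sL k N.carrier D.carrier).comp θ) ((sR k N.carrier D.carrier).comp θ') T (p.coev 1) =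
      p.coevAt (coevalOp ρ T) := by
  rw [coev_one]
  induction T using TensorProduct.induction_on with
  | zero => simp
  | add x y hx hy => simp only [map_add, LinearMap.add_apply, hx, hy]
  | tmul g f =>
    have h1 : ∀ x, p.coevAt x = sL k N.carrier D.carrier (θ x) c := fun _ => rfl
    have h2 : sR k N.carrier D.carrier (θ' f) (sL k N.carrier D.carrier (θ (ρ (be k H))) c) =
        sL k N.carrier D.carrier (θ (ρ (be k H))) (sL k N.carrier D.carrier (θ f.unop) c) := by
      rw [sL_eq_map (θ f.unop), ← p.copairing, ← sR_eq_map, ← Module.End.mul_apply,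
        ← Module.End.mul_apply]
      exact LinearMap.congr_fun (Comm.comm (a := sL k N.carrier D.carrier)
        (b := sR k N.carrier D.carrier) _ _).symm c
    rw [pl_tmul, h1, Module.End.mul_apply, AlgHom.comp_apply, AlgHom.comp_apply, h2,
      coevalOp_tmul, h1, map_mul, map_mul, map_mul, map_mul, mul_assoc]
    rfl

theorem evalOp_map (t : H ⊗[k] H) :
    evalOp ρ (Algebra.TensorProduct.map (bar ρ) ρ t) = ρ (mulLeftS (An k H) (al k H) t) := by
  induction t using TensorProduct.induction_on with
  | zero => simp
  | add x y hx hy => simp only [map_add, hx, hy]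
  | tmul x y => simp [mulLeftS, bar_apply]

theorem coevalOp_map (t : H ⊗[k] H) :
    coevalOp ρ (Algebra.TensorProduct.map ρ (bar ρ) t) = ρ (mulRightS (An k H) (be k H) t) := by
  induction t using TensorProduct.induction_on with
  | zero => simp
  | add x y hx hy => simp only [map_add, hx, hy]
  | tmul x y => simp [mulRightS, bar_apply]

theorem coact_tensor_dual (p : IsDualPair ρ R N D θ θ' e c) : YDDatum.tensorCoact D N = coactOf (pl iL
    (iR.comp (pl ((sL k D.carrier N.carrier).comp θ') ((sR k D.carrier N.carrier).comp θ)))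
    (tensorWord (bar ρ) (dualElem ρ R) ρ R iL (iR.comp iL) (iR.comp iR))) := by
  rw [YDDatum.tensorCoact_eq p.coact_dual p.coact, map_tensorWord]
  simp only [tensorWord, pl_map, p.act, p.act_dual, AlgHom.comp_assoc, AlgHom.comp_id,
    pl_comp_iL, pl_comp_iR_comp, pl_comp_iR]

theorem coact_tensor (p : IsDualPair ρ R N D θ θ' e c) : YDDatum.tensorCoact N D = coactOf (pl iL
    (iR.comp (pl ((sL k N.carrier D.carrier).comp θ) ((sR k N.carrier D.carrier).comp θ')))
    (tensorWord ρ R (bar ρ) (dualElem ρ R) iL (iR.comp iL) (iR.comp iR))) := by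
  rw [YDDatum.tensorCoact_eq p.coact p.coact_dual, map_tensorWord]
  simp only [tensorWord, pl_map, p.act, p.act_dual, AlgHom.comp_assoc, AlgHom.comp_id,
    pl_comp_iL, pl_comp_iR_comp, pl_comp_iR]

theorem lTensor_ev (W : H ⊗[k] (Eᵐᵒᵖ ⊗[k] E)) (v : D.carrier ⊗[k] N.carrier) :
    p.ev.lTensor H (coactOf (pl iL (iR.comp (pl ((sL k D.carrier N.carrier).comp θ')
      ((sR k D.carrier N.carrier).comp θ))) W) v) =
      (p.evAt v).lTensor H ((evalOp ρ).lTensor H W) := by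
  induction W using TensorProduct.induction_on with
  | zero => simp
  | add x y hx hy => simp only [map_add, coactOf_add, LinearMap.add_apply, hx, hy]
  | tmul h T =>
    rw [LinearMap.lTensor_tmul, LinearMap.lTensor_tmul, ← ev_pl, pl_tmul]
    generalize (pl ((sL k D.carrier N.carrier).comp θ') ((sR k D.carrier N.carrier).comp θ)) = F
    simp [iL, iR]

theorem coact_coev (W : H ⊗[k] (E ⊗[k] Eᵐᵒᵖ)) :
    coactOf (pl iL (iR.comp (pl ((sL k N.carrier D.carrier).comp θ)
      ((sR k N.carrier D.carrier).comp θ'))) W) (p.coev 1) =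
      p.coevAt.lTensor H ((coevalOp ρ).lTensor H W) := by
  induction W using TensorProduct.induction_on with
  | zero => simp
  | add x y hx hy => simp only [map_add, coactOf_add, LinearMap.add_apply, hx, hy]
  | tmul h T =>
    rw [LinearMap.lTensor_tmul, LinearMap.lTensor_tmul, ← pl_coev, pl_tmul]
    generalize (pl ((sL k N.carrier D.carrier).comp θ) ((sR k N.carrier D.carrier).comp θ')) = F
    simp [iL, iR]

theorem ev_act (h : H) (v : D.carrier ⊗[k] N.carrier) :
    p.ev (YDDatum.tensorAct D N h v) = eps k H h * p.ev v := by
  have e1 : YDDatum.tensorAct D N h = pl ((sL k D.carrier N.carrier).comp θ')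
      ((sR k D.carrier N.carrier).comp θ) (Algebra.TensorProduct.map (bar ρ) ρ (Dl k H h)) := by
    rw [YDDatum.tensorAct_eq, p.act, p.act_dual, pl_map]; rfl
  rw [e1, ev_pl, evalOp_map, QuasiHopfAlgebra.S_alpha h, map_smul, map_smul, ev_eq]
  rfl

theorem coev_act (h : H) : YDDatum.tensorAct N D h (p.coev 1) = eps k H h • p.coev 1 := by
  have e1 : YDDatum.tensorAct N D h = pl ((sL k N.carrier D.carrier).comp θ)
      ((sR k N.carrier D.carrier).comp θ') (Algebra.TensorProduct.map ρ (bar ρ) (Dl k H h)) := by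
    rw [YDDatum.tensorAct_eq, p.act, p.act_dual, pl_map]; rfl
  rw [e1, pl_coev, coevalOp_map, QuasiHopfAlgebra.beta_S h, map_smul, map_smul, coev_one]

theorem coact_ev (v : D.carrier ⊗[k] N.carrier) :
    (1 : H) ⊗ₜ[k] p.ev v = p.ev.lTensor H (YDDatum.tensorCoact D N v) := by
  rw [coact_tensor_dual p, lTensor_ev, evalOp_tensorWord p.isYDElem, LinearMap.lTensor_tmul,
    ev_eq]

theorem isYDHom_ev : YDDatum.IsYDHom (D.tensor N) (YDDatum.unit k H) p.ev where
  map_act := p.ev_act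
  map_coact := p.coact_ev

theorem coev_apply (t : k) : p.coev t = t • p.coev 1 := by
  rw [← map_smul, smul_eq_mul, mul_one]

theorem coact_coev_apply (t : k) :
    YDDatum.tensorCoact N D (p.coev t) = p.coev.lTensor H ((1 : H) ⊗ₜ[k] t) := by
  rw [LinearMap.lTensor_tmul, coev_apply p t, map_smul, coact_tensor p, coact_coev,
    coevalOp_tensorWord p.isYDElem, LinearMap.lTensor_tmul, ← coev_one, TensorProduct.tmul_smul]

theorem coev_act_apply (h : H) (t : k) :
    p.coev (eps k H h * t) = YDDatum.tensorAct N D h (p.coev t) := by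
  rw [coev_apply, coev_apply p t, map_smul, coev_act, smul_smul, mul_comm]

theorem isYDHom_coev : YDDatum.IsYDHom (YDDatum.unit k H) (N.tensor D) p.coev where
  map_act := p.coev_act_apply
  map_coact := p.coact_coev_apply

theorem contract_coev_act (x y z : H) (n : N.carrier) (w : N.carrier ⊗[k] D.carrier) :
    TensorProduct.rid k N.carrier (p.ev.lTensor N.carrier
      (act3 N.act D.act N.act (x ⊗ₜ (y ⊗ₜ z)) (TensorProduct.assoc k _ _ _
        (TensorProduct.map (θ (ρ (be k H))) LinearMap.id w ⊗ₜ n)))) =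
    N.act x (θ (ρ (be k H)) (QuasiHopf.contractSnd e
      (N.act (mulLeftS (An k H) (al k H) (y ⊗ₜ z)) n) w)) := by
  induction w using TensorProduct.induction_on with
  | zero => simp
  | add x y hx hy => simp only [map_add, TensorProduct.add_tmul, hx, hy]
  | tmul a b => simp [ev, p.act, p.act_dual, p.pairing, bar_apply, mulLeftS, mul_assoc]

theorem contract_ev_act (x y z : H) (d : D.carrier) (w : N.carrier ⊗[k] D.carrier) :
    TensorProduct.lid k D.carrier (p.ev.rTensor D.carrier ((TensorProduct.assoc k _ _ _).symm
      (act3 D.act N.act D.act (x ⊗ₜ (y ⊗ₜ z))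
        (d ⊗ₜ TensorProduct.map (θ (ρ (be k H))) LinearMap.id w)))) =
    QuasiHopf.contractFst e d (TensorProduct.map (θ (ρ (An k H x * al k H * y * be k H)))
      LinearMap.id (TensorProduct.map LinearMap.id (θ' (bar ρ z)) w)) := by
  induction w using TensorProduct.induction_on with
  | zero => simp
  | add x y hx hy => simp only [map_add, TensorProduct.tmul_add, hx, hy]
  | tmul a b => simp [ev, p.act, p.act_dual, p.pairing, bar_apply, mul_assoc]

/-- The first zigzag identity is `X¹ β S(X²) α X³ = 1`. -/
theorem zigzag_snd (n : N.carrier) :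
    TensorProduct.rid k N.carrier (p.ev.lTensor N.carrier
      (act3 N.act D.act N.act (Ph k H : H ⊗[k] (H ⊗[k] H)) (TensorProduct.assoc k _ _ _
        (p.coev 1 ⊗ₜ n)))) = n := by
  have key : ∀ t : H ⊗[k] (H ⊗[k] H), TensorProduct.rid k N.carrier (p.ev.lTensor N.carrier
      (act3 N.act D.act N.act t (TensorProduct.assoc k _ _ _ (p.coev 1 ⊗ₜ n)))) =
      N.act (LinearMap.mul' k H (TensorProduct.map (LinearMap.mulRight k (be k H))
        (mulLeftS (An k H) (al k H)) t)) n := fun t => by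
    induction t using tensor3_induction with
    | zero => simp only [map_zero, LinearMap.zero_apply]
    | add x y hx hy => simp only [map_add, LinearMap.add_apply, hx, hy]
    | tmul x y z =>
      rw [coev, LinearMap.toSpanSingleton_apply, one_smul, contract_coev_act, p.contractSnd,
        TensorProduct.map_tmul]
      simp [p.act, mul_assoc]
  rw [key, QuasiHopfAlgebra.Phi_S, map_one, Module.End.one_apply]

/-- The second zigzag identity is `S(x¹) α x² β S(x³) = 1`. -/
theorem zigzag_fst (d : D.carrier) :
    TensorProduct.lid k D.carrier (p.ev.rTensor D.carrier ((TensorProduct.assoc k _ _ _).symm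
      (act3 D.act N.act D.act (((Ph k H)⁻¹ : (H ⊗[k] (H ⊗[k] H))ˣ) : H ⊗[k] (H ⊗[k] H))
        (d ⊗ₜ p.coev 1)))) = d := by
  have key : ∀ t : H ⊗[k] (H ⊗[k] H), TensorProduct.lid k D.carrier (p.ev.rTensor D.carrier
      ((TensorProduct.assoc k _ _ _).symm (act3 D.act N.act D.act t (d ⊗ₜ p.coev 1)))) =
      QuasiHopf.contractFst e d (TensorProduct.map (θ (ρ (LinearMap.mul' k H
        (TensorProduct.map (LinearMap.mulRight k (al k H) ∘ₗ An k H)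
          (mulRightS (An k H) (be k H)) t)))) LinearMap.id c) := fun t => by
    induction t using tensor3_induction with
    | zero => simp only [map_zero, LinearMap.zero_apply, TensorProduct.map_zero_left]
    | add x y hx hy =>
      simp only [map_add, LinearMap.add_apply, TensorProduct.map_add_left, hx, hy]
    | tmul x y z =>
      rw [coev, LinearMap.toSpanSingleton_apply, one_smul, contract_ev_act, p.copairing,
        ← LinearMap.comp_apply (TensorProduct.map _ _), ← TensorProduct.map_comp,
        TensorProduct.map_tmul]
      congr 3
      simp only [← Module.End.mul_eq_comp, bar_apply, MulOpposite.unop_op, ← map_mul]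
      congr 2
      simp [mulRightS, mul_assoc]
  rw [key, QuasiHopfAlgebra.PhiInv_S, map_one, map_one]
  change QuasiHopf.contractFst e d (TensorProduct.map LinearMap.id LinearMap.id c) = d
  rw [TensorProduct.map_id, LinearMap.id_apply, p.contractFst]

end IsDualPair

end Dual

/-! ### Rigidity -/

section DualBasis

variable {k : Type u} [Field k] {M : Type*} [AddCommGroup M] [Module k M] {n : ℕ}
  (b : Module.Basis (Fin n) k M)

/-- An endomorphism moves across the canonical element `Σᵢ mᵢ ⊗ mⁱ`. -/
theorem sum_basis_tmul_comp (f : Module.End k M) :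
    ∑ i, b i ⊗ₜ[k] (b.coord i ∘ₗ f) = ∑ i, f (b i) ⊗ₜ[k] b.coord i := by
  have h1 : ∀ i, b.coord i ∘ₗ f = ∑ j, b.coord i (f (b j)) • b.coord j := fun i => by
    exact (b.sum_dual_apply_smul_coord (b.coord i ∘ₗ f)).symm
  have h2 : ∀ j, f (b j) = ∑ i, b.coord i (f (b j)) • b i := fun j =>
    (b.sum_repr (f (b j))).symm
  calc ∑ i, b i ⊗ₜ[k] (b.coord i ∘ₗ f)
      = ∑ i, ∑ j, b.coord i (f (b j)) • (b i ⊗ₜ[k] b.coord j) := by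
        refine Finset.sum_congr rfl fun i _ => ?_
        rw [h1 i, TensorProduct.tmul_sum]
        simp only [TensorProduct.tmul_smul]
    _ = ∑ j, ∑ i, b.coord i (f (b j)) • (b i ⊗ₜ[k] b.coord j) := Finset.sum_comm
    _ = _ := by
        refine Finset.sum_congr rfl fun j _ => ?_
        conv_rhs => rw [h2 j]
        rw [TensorProduct.sum_tmul]
        simp only [TensorProduct.smul_tmul']

theorem sum_comp_tmul_basis (f : Module.End k M) :
    ∑ i, (b.coord i ∘ₗ f) ⊗ₜ[k] b i = ∑ i, b.coord i ⊗ₜ[k] f (b i) := by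
  have := congrArg (TensorProduct.comm k M (Module.Dual k M)) (sum_basis_tmul_comp b f)
  simpa using this

end DualBasis

section Rigid

variable {k : Type u} {H : Type v} [Field k] [Ring H] [Algebra k H] [QuasiHopfAlgebra k H]

/-- The left dual is dual to `M` through the usual pairing, with `End M` acting on `M` by itself and
on the dual by transposes. -/
theorem isDualPair_leftDual {M : YDDatum k H} [Module.Finite k M.carrier] (hM : M.IsYD) {n : ℕ}
    (b : Module.Basis (Fin n) k M.carrier) :
    IsDualPair M.act M.elem M (M.leftDual b) (AlgHom.id k _) (transp k M.carrier)
      (contractLeft k M.carrier) (∑ i, b i ⊗ₜ[k] b.coord i) where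
  isYDElem := YDDatum.isYDElem hM
  act := rfl
  coact := by
    rw [Algebra.TensorProduct.map_id]
    exact M.coact_eq
  act_dual := rfl
  coact_dual := YDDatum.leftDual_coact b M.coact_eq
  pairing _ _ _ := rfl
  copairing f := by
    rw [map_sum, map_sum]
    exact sum_basis_tmul_comp b f.unop
  contractSnd m := by
    rw [map_sum]
    exact b.sum_repr m
  contractFst φ := by
    rw [map_sum]
    exact b.sum_dual_apply_smul_coord φ

/-- `M` is a left dual of its right dual, because `dualElem` inverts `rightDualElem`. -/
theorem isDualPair_rightDual {M : YDDatum k H} [Module.Finite k M.carrier] (hM : M.IsYD) {n : ℕ}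
    (b : Module.Basis (Fin n) k M.carrier) :
    IsDualPair (barInv M.act) (rightDualElem M.act M.elem) (M.rightDual b) M (transp k M.carrier)
      ((AlgEquiv.opOp k (Module.End k M.carrier)).symm : _ →ₐ[k] Module.End k M.carrier)
      (contractLeft k M.carrier ∘ₗ
        (TensorProduct.comm k M.carrier (Module.Dual k M.carrier)).toLinearMap)
      (∑ i, b.coord i ⊗ₜ[k] b i) where
  isYDElem := (YDDatum.isYDElem hM).rightDual
  act := rfl
  coact := YDDatum.rightDual_coact b M.coact_eq
  act_dual := by
    rw [bar_barInv]
    rfl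
  coact_dual := by
    rw [dualElem_rightDualElem]
    refine M.coact_eq.trans (congrArg coactOf ?_)
    generalize M.elem = R
    induction R using TensorProduct.induction_on with
    | zero => simp only [map_zero]
    | add x y hx hy => rw [map_add, map_add, ← hx, ← hy]
    | tmul h f => rfl
  pairing _ _ _ := rfl
  copairing f := by
    rw [map_sum, map_sum]
    exact (sum_comp_tmul_basis b f.unop.unop).symm
  contractSnd φ := by
    rw [map_sum]
    exact b.sum_dual_apply_smul_coord φ
  contractFst m := by
    rw [map_sum]
    exact b.sum_repr m

variable {E : Type*} [Semiring E] [Algebra k E] {ρ : H →ₐ[k] E} {R : H ⊗[k] E}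

theorem IsDualPair.zigzag_fst_apply {N D : YDDatum k H} {θ : E →ₐ[k] Module.End k N.carrier}
    {θ' : Eᵐᵒᵖ →ₐ[k] Module.End k D.carrier} {e : D.carrier ⊗[k] N.carrier →ₗ[k] k}
    {c : N.carrier ⊗[k] D.carrier} (p : IsDualPair ρ R N D θ θ' e c) (v : D.carrier ⊗[k] k) :
    TensorProduct.lid k D.carrier (p.ev.rTensor D.carrier ((TensorProduct.assoc k _ _ _).symm
      (act3 D.act N.act D.act (((Ph k H)⁻¹ : (H ⊗[k] (H ⊗[k] H))ˣ) : H ⊗[k] (H ⊗[k] H))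
        (p.coev.lTensor D.carrier v)))) = TensorProduct.rid k D.carrier v := by
  refine linear2_ext (f := (TensorProduct.lid k D.carrier).toLinearMap ∘ₗ
    p.ev.rTensor D.carrier ∘ₗ (TensorProduct.assoc k _ _ _).symm.toLinearMap ∘ₗ
      act3 D.act N.act D.act (((Ph k H)⁻¹ : (H ⊗[k] (H ⊗[k] H))ˣ) : H ⊗[k] (H ⊗[k] H)) ∘ₗ
        p.coev.lTensor D.carrier) (g := (TensorProduct.rid k D.carrier).toLinearMap)
    (fun d t => ?_) v
  simp only [LinearMap.comp_apply, LinearEquiv.coe_coe]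
  rw [LinearMap.lTensor_tmul, p.coev_apply, TensorProduct.tmul_smul, TensorProduct.rid_tmul,
    map_smul, map_smul, map_smul, map_smul, p.zigzag_fst]

theorem IsDualPair.zigzag_snd_apply {N D : YDDatum k H} {θ : E →ₐ[k] Module.End k N.carrier}
    {θ' : Eᵐᵒᵖ →ₐ[k] Module.End k D.carrier} {e : D.carrier ⊗[k] N.carrier →ₗ[k] k}
    {c : N.carrier ⊗[k] D.carrier} (p : IsDualPair ρ R N D θ θ' e c) (v : k ⊗[k] N.carrier) :
    TensorProduct.rid k N.carrier (p.ev.lTensor N.carrier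
      (act3 N.act D.act N.act (Ph k H : H ⊗[k] (H ⊗[k] H)) (TensorProduct.assoc k _ _ _
        (p.coev.rTensor N.carrier v)))) = TensorProduct.lid k N.carrier v := by
  refine linear2_ext (f := (TensorProduct.rid k N.carrier).toLinearMap ∘ₗ
    p.ev.lTensor N.carrier ∘ₗ act3 N.act D.act N.act (Ph k H : H ⊗[k] (H ⊗[k] H)) ∘ₗ
      (TensorProduct.assoc k _ _ _).toLinearMap ∘ₗ p.coev.rTensor N.carrier)
    (g := (TensorProduct.lid k N.carrier).toLinearMap) (fun t n => ?_) v
  simp only [LinearMap.comp_apply, LinearEquiv.coe_coe]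
  rw [LinearMap.rTensor_tmul, p.coev_apply, ← TensorProduct.smul_tmul', TensorProduct.lid_tmul,
    map_smul, map_smul, map_smul, map_smul, p.zigzag_snd]

/-- A dual pair of Yetter-Drinfeld modules is an exact pairing. -/
@[reducible]
def IsDualPair.exactPairing {hw : TensorWellDefined k H} (hm : IsMonoidal (fdYDTensor hw))
    {N D : FdYD k H} {θ : E →ₐ[k] Module.End k N.datum.carrier}
    {θ' : Eᵐᵒᵖ →ₐ[k] Module.End k D.datum.carrier}
    {e : D.datum.carrier ⊗[k] N.datum.carrier →ₗ[k] k} {c : N.datum.carrier ⊗[k] D.datum.carrier}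
    (p : IsDualPair ρ R N.datum D.datum θ θ' e c) :
    letI : MonoidalCategory (FdYD k H) := hm.monoidalCategory
    ExactPairing N D :=
  letI : MonoidalCategory (FdYD k H) := hm.monoidalCategory
  { coevaluation' := ⟨p.coev, p.isYDHom_coev⟩
    evaluation' := ⟨p.ev, p.isYDHom_ev⟩
    coevaluation_evaluation' := by
      rw [← Category.assoc, Iso.eq_comp_inv]
      exact YDHom.ext <| LinearMap.ext fun v => p.zigzag_fst_apply v
    evaluation_coevaluation' := by
      rw [← Category.assoc, Iso.eq_comp_inv]
      exact YDHom.ext <| LinearMap.ext fun v => p.zigzag_snd_apply v }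

/-- Every finite dimensional Yetter-Drinfeld module has a left and a right dual. -/
@[reducible]
def fdYDRigid {hw : TensorWellDefined k H} (hm : IsMonoidal (fdYDTensor hw)) :
    letI : MonoidalCategory (FdYD k H) := hm.monoidalCategory
    RigidCategory (FdYD k H) :=
  letI : MonoidalCategory (FdYD k H) := hm.monoidalCategory
  { rightDual := fun M =>
      let b := Module.finBasis k M.datum.carrier
      { rightDual := ⟨M.datum.leftDual b, YDDatum.isYD_leftDual b M.isYD⟩
        exact := (isDualPair_leftDual M.isYD b).exactPairing
          (D := ⟨M.datum.leftDual b, YDDatum.isYD_leftDual b M.isYD⟩) hm }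
    leftDual := fun M =>
      let b := Module.finBasis k M.datum.carrier
      { leftDual := ⟨M.datum.rightDual b, YDDatum.isYD_rightDual b M.isYD⟩
        exact := (isDualPair_rightDual M.isYD b).exactPairing
          (N := ⟨M.datum.rightDual b, YDDatum.isYD_rightDual b M.isYD⟩) hm } }

theorem coev_leftDual_one {M : YDDatum k H} [Module.Finite k M.carrier] (hM : M.IsYD) {n : ℕ}
    (b : Module.Basis (Fin n) k M.carrier) : (isDualPair_leftDual hM b).coev 1 =
      ∑ i, M.act (be k H) (b i) ⊗ₜ[k] b.coord i :=
  (isDualPair_leftDual hM b).coev_one.trans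
    (map_sum (sL k M.carrier (Module.Dual k M.carrier) (M.act (be k H))) _ _)

theorem coev_rightDual_one {M : YDDatum k H} [Module.Finite k M.carrier] (hM : M.IsYD) {n : ℕ}
    (b : Module.Basis (Fin n) k M.carrier) : (isDualPair_rightDual hM b).coev 1 =
      ∑ i, b.coord i ⊗ₜ[k] M.act (AnInv k H (be k H)) (b i) :=
  ((isDualPair_rightDual hM b).coev_one.trans
    (map_sum (sL k (Module.Dual k M.carrier) M.carrier
      (transp k M.carrier (barInv M.act (be k H)))) _ _)).trans (sum_comp_tmul_basis b _)

end Rigid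

end QuasiHopf

end

theorem theorem3p2 {k : Type u} {H : Type v} [Field k] [Ring H] [Algebra k H]
    [QuasiHopf.QuasiHopfAlgebra k H] :
    (QuasiHopf.drinfeldTwist k H * QuasiHopf.drinfeldTwistInv k H = 1 ∧
      QuasiHopf.drinfeldTwistInv k H * QuasiHopf.drinfeldTwist k H = 1) ∧
    ∃ (hw : QuasiHopf.TensorWellDefined k H)
      (hm : QuasiHopf.IsMonoidal (QuasiHopf.fdYDTensor hw)),
      letI : MonoidalCategory (QuasiHopf.FdYD k H) := hm.monoidalCategory
      (∃ B : BraidedCategory (QuasiHopf.FdYD k H), ∀ M N : QuasiHopf.FdYD k H,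
        (B.braiding M N).hom.toLin = QuasiHopf.braidLin M.datum.coact N.datum.act) ∧
      Nonempty (RigidCategory (QuasiHopf.FdYD k H)) ∧
      ∀ (M : QuasiHopf.FdYD k H) (n : ℕ) (b : Module.Basis (Fin n) k M.datum.carrier),
        (∃ (hD : (M.datum.leftDual b).IsYD)
          (p : ExactPairing M (⟨M.datum.leftDual b, hD⟩ : QuasiHopf.FdYD k H)),
          (∀ (φ : Module.Dual k M.datum.carrier) (m : M.datum.carrier),
            p.evaluation'.toLin (φ ⊗ₜ[k] m) = φ (M.datum.act (QuasiHopf.al k H) m)) ∧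
          p.coevaluation'.toLin (1 : k) =
            ∑ i, M.datum.act (QuasiHopf.be k H) (b i) ⊗ₜ[k] b.coord i) ∧
        (∃ (hD : (M.datum.rightDual b).IsYD)
          (p : ExactPairing (⟨M.datum.rightDual b, hD⟩ : QuasiHopf.FdYD k H) M),
          (∀ (φ : Module.Dual k M.datum.carrier) (m : M.datum.carrier),
            p.evaluation'.toLin (m ⊗ₜ[k] φ) =
              φ (M.datum.act (QuasiHopf.AnInv k H (QuasiHopf.al k H)) m)) ∧
          p.coevaluation'.toLin (1 : k) =
            ∑ i, b.coord i ⊗ₜ[k]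
              M.datum.act (QuasiHopf.AnInv k H (QuasiHopf.be k H)) (b i)) :=
  ⟨⟨QuasiHopf.drinfeldTwist_mul_inv, QuasiHopf.drinfeldTwistInv_mul⟩,
    QuasiHopf.tensorWellDefined k H, QuasiHopf.isMonoidal _,
    ⟨QuasiHopf.fdYDBraided _ _, fun _ _ => rfl⟩, ⟨QuasiHopf.fdYDRigid _⟩, fun M _ b =>
    ⟨⟨QuasiHopf.YDDatum.isYD_leftDual b M.isYD,
        (QuasiHopf.isDualPair_leftDual M.isYD b).exactPairing
          (D := ⟨M.datum.leftDual b, QuasiHopf.YDDatum.isYD_leftDual b M.isYD⟩) _,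
        fun _ _ => rfl, QuasiHopf.coev_leftDual_one M.isYD b⟩,
      ⟨QuasiHopf.YDDatum.isYD_rightDual b M.isYD,
        (QuasiHopf.isDualPair_rightDual M.isYD b).exactPairing
          (N := ⟨M.datum.rightDual b, QuasiHopf.YDDatum.isYD_rightDual b M.isYD⟩) _,
        fun _ _ => rfl, QuasiHopf.coev_rightDual_one M.isYD b⟩⟩⟩
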